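/- **Setting.** Let $\tau>0$ and let $\mathbb{D}^3$ be either the torus $(\mathbb{R}/\ell\mathbb{Z})^3$ with $\ell>0$ (the standard choice is $\ell=2\pi$) or the whole space $\mathbb{R}^3$. Put $d\mu(\mathbf v)=(2\pi)^{-3/2}e^{-|\mathbf v|^2/2}\,d\mathbf v$ on $\mathbb{R}^3$, and $$e_0=1,\quad e_j=v_j\ (j=1,2,3),\quad e_4=\frac{|\mathbf v|^2-3}{\sqrt6},\qquad \mathbb{P}_5f=\sum_{j=0}^4\Big(\int f e_j\,d\mu\Big)e_j .$$ The linearized non-dimensional BGK operator is $$\mathcal{L}=-\mathbf v\cdot\nabla_{\mathbf x}-\frac1\tau+\frac1\tau\mathbb{P}_5\quad\text{on } L^2(\mathbb{D}^3\times\mathbb{R}^3,\,d\mathbf x\otimes d\mu),$$ with domain all $f$ such that the weak derivative $\mathbf v\cdot\nabla_{\mathbf x}f$ lies in $L^2$. At a wave vector $\mathbf k\in\mathbb{R}^3$, with wave number $k=|\mathbf k|$, it acts as $$\mathcal{L}_{\mathbf k}f=-\mathrm i(\mathbf v\cdot\mathbf k)f-\tfrac1\tau f+\tfrac1\tau\mathbb{P}_5f\quad\text{on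 } L^2(\mathbb{R}^3,d\mu),$$ with maximal domain. The wave vectors are $\mathbf k\in\frac{2\pi}{\ell}\mathbb{Z}^3$ on the torus and $\mathbf k\in\mathbb{R}^3$ on the whole space. The essential spectrum $\sigma_{\rm ess}(T)$ is the set of $\lambda$ for which $T-\lambda$ is not semi-Fredholm (semi-Fredholm: closed range, and finite-dimensional kernel or finite-codimensional range). The discrete spectrum $\sigma_{\rm disc}(T)$ is the set of eigenvalues with finite-dimensional eigenspace that are isolated points of $\sigma(T)$. For $\Im\zeta>0$ let $Z(\zeta)=\frac1{\sqrt{2\pi}}\int_{\mathbb{R}}\frac{e^{-v^2/2}}{v-\zeta}\,dv$, and for $\kappa>0$ let $$\Gamma_\kappa(\zeta)=\det\begin{pmatrix} Z-\mathrm i\kappa & 1+\zeta Z & \frac{\zeta+(\zeta^2-1)Z}{\sqrt6}\\ 1+\zeta Z & \zeta+\zeta^2Z-\mathrm i\kappa & \frac{\zeta^2+(\zeta^3-\zeta)Z}{\sqrt6}\\ \frac{\zeta+(\zeta^2-1)Z}{\sqrt6} & \frac{\zeta^2+(\zeta^3-\zeta)Z}{\sqrt6} & \frac{\zeta^3-\zeta+(\zeta^4-2\zeta^2+5)Z}{6}-\mathrm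 i\kappa\end{pmatrix},\qquad Z=Z(\zeta).$$ **Theorem.** There are numbers $\kappa_N>0$ and continuous functions $\Lambda_N:[0,\kappa_N)\to\{z\in\mathbb{C}:-1<\Re z\le0\}$ with $\Lambda_N(0)=0$, for $N\in\text{Modes}=\{\text{shear},\text{diff},\text{ac},\text{ac}*\}$, all independent of $\tau$ and of the domain, with the following properties. 1. *(The modes.)* $\Lambda_{\rm shear}$ and $\Lambda_{\rm diff}$ are real-valued, $\kappa_{\rm ac*}=\kappa_{\rm ac}$ and $\Lambda_{\rm ac*}=\overline{\Lambda_{\rm ac}}$. For $\kappa>0$ and $\Lambda\in\mathbb{C}$ with $\Re\Lambda>-1$, put $\zeta=\frac{-\Lambda-1}{\mathrm i\kappa}$. Then - $Z(\zeta)=\mathrm i\kappa$ if and only if $\kappa<\kappa_{\rm shear}$ and $\Lambda=\Lambda_{\rm shear}(\kappa)$; - $\Lambda\in\mathbb{R}$ and $\Gamma_\kappa(\zeta)=0$ if and only if $\kappa<\kappa_{\rm diff}$ and $\Lambda=\Lambda_{\rm diff}(\kappa)$; - $\Im\Lambda>0$ and $\Gamma_\kappa(\zeta)=0$ if and only if $\kappa<\kappa_{\rm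 ac}$ and $\Lambda=\Lambda_{\rm ac}(\kappa)$. For every $\tau>0$, set $\lambda_N(\tau k)=\frac1\tau\Lambda_N(\tau k)$ and $k_{{\rm crit},N}=\kappa_N/\tau$. So $\lambda_N$ exists exactly for wave numbers $k<k_{{\rm crit},N}$. 2. *(Each wave number.)* For every $\mathbf k\in\mathbb{R}^3$ one has $\sigma(\mathcal{L}_{\mathbf k})=\sigma_{\rm ess}(\mathcal{L}_{\mathbf k})\cup\sigma_{\rm disc}(\mathcal{L}_{\mathbf k})$, where $$\sigma_{\rm ess}(\mathcal{L}_{\mathbf k})=-\tfrac1\tau+\mathrm i\mathbb{R}\ \ (\mathbf k\neq0),\qquad \sigma_{\rm ess}(\mathcal{L}_{0})=\{-\tfrac1\tau\},\qquad \sigma_{\rm disc}(\mathcal{L}_{\mathbf k})=\{\lambda_N(\tau k): N\in\text{Modes},\ k<k_{{\rm crit},N}\}.$$ In particular the discrete spectrum at each wave number is finite. 3. *(The full operator.)* On the torus and on the whole space, $$\sigma(\mathcal{L})=\Big\{-\frac1\tau+\mathrm i\mathbb{R}\Big\}\cup\bigcup_{N\in\text{Modes}}\ \bigcup_{k<k_{{\rm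 crit},N}}\{\lambda_N(\tau k)\},$$ where $k$ runs through the wave numbers $|\mathbf k|$ of the respective domain. On the torus, moreover, $\sigma_{\rm ess}(\mathcal{L})=-\frac1\tau+\mathrm i\mathbb{R}$, and $\sigma_{\rm disc}(\mathcal{L})$ is the second set of the union. -/

import Mathlib

open MeasureTheory ProbabilityTheory Complex
open scoped Topology ENNReal ContDiff InnerProductSpace

namespace BGK

noncomputable section

/-! ### Spectral notions for unbounded operators on a Hilbert space -/

section Operators

variable {H : Type*} [NormedAddCommGroup H] [InnerProductSpace ℂ H]

/-- `z` is in the resolvent set of `T`: the map `T - z`, from the domain of `T` to `H`, is a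
bijection with a bounded inverse `R`. -/
def IsResolventPoint (T : H →ₗ.[ℂ] H) (z : ℂ) : Prop :=
  ∃ R : H →L[ℂ] H,
    (∀ h : H, ∃ hd : R h ∈ T.domain, T ⟨R h, hd⟩ - z • R h = h) ∧
    ∀ f : T.domain, R (T f - z • (f : H)) = f

/-- The spectrum `σ(T)`. -/
def opSpectrum (T : H →ₗ.[ℂ] H) : Set ℂ := {z | ¬ IsResolventPoint T z}

/-- The linear map `T - z` on the domain of `T`. -/
def shifted (T : H →ₗ.[ℂ] H) (z : ℂ) : T.domain →ₗ[ℂ] H :=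
  T.toFun - z • T.domain.subtype

/-- `T - z` is semi-Fredholm: closed range, and a kernel of finite dimension or a range of finite
codimension. -/
def IsSemiFredholmAt (T : H →ₗ.[ℂ] H) (z : ℂ) : Prop :=
  IsClosed (LinearMap.range (shifted T z) : Set H) ∧
    (FiniteDimensional ℂ (LinearMap.ker (shifted T z)) ∨
      FiniteDimensional ℂ (H ⧸ LinearMap.range (shifted T z)))

/-- The essential spectrum (in the sense of Kato): all `z` such that `T - z` is not
semi-Fredholm. -/
def essSpectrum (T : H →ₗ.[ℂ] H) : Set ℂ := {z | ¬ IsSemiFredholmAt T z}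

/-- The discrete spectrum: the eigenvalues of finite multiplicity that are isolated points of the
spectrum. -/
def discSpectrum (T : H →ₗ.[ℂ] H) : Set ℂ :=
  {z | LinearMap.ker (shifted T z) ≠ ⊥ ∧
    FiniteDimensional ℂ (LinearMap.ker (shifted T z)) ∧
    ∃ U ∈ 𝓝 z, U ∩ opSpectrum T = {z}}

end Operators

/-! ### The five hydrodynamic moments -/

/-- The three-dimensional Euclidean space (of positions, velocities or wave vectors). -/
abbrev E3 : Type := EuclideanSpace ℝ (Fin 3)

/-- The normalized global Maxwellian `(2π)^(-3/2) exp (-|v|² / 2) dv`. -/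
abbrev maxwellian : Measure E3 := stdGaussian E3

/-- The collision invariants `1, v₁, v₂, v₃, (|v|² - 3) / √6`, orthonormal in `L²(maxwellian)`. -/
def basis5 : Fin 5 → E3 → ℝ :=
  ![fun _ => 1, fun v => v 0, fun v => v 1, fun v => v 2, fun v => (‖v‖ ^ 2 - 3) / √6]

/-- The projection `ℙ₅ f = ∑ⱼ ⟨f, eⱼ⟩ eⱼ` onto the span of the collision invariants. -/
def proj5 (f : E3 → ℂ) (v : E3) : ℂ :=
  ∑ j, (∫ w, f w * (basis5 j w : ℂ) ∂maxwellian) * (basis5 j v : ℂ)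

lemma memLp_basis5 (j : Fin 5) : MemLp (fun v => (basis5 j v : ℂ)) 2 maxwellian := by
  have hc : ∀ i : Fin 3, MemLp (fun v : E3 => ((v i : ℝ) : ℂ)) 2 maxwellian := by
    intro i
    have h := IsGaussian.memLp_id maxwellian 2 (by norm_num)
    refine h.mono (by fun_prop) (Filter.Eventually.of_forall fun v => ?_)
    simpa using PiLp.norm_apply_le v i
  have h2 : MemLp (fun v : E3 => ((‖v‖ ^ 2 : ℝ) : ℂ)) 2 maxwellian := by
    have h := IsGaussian.memLp_id maxwellian 4 (by norm_num)
    have h' : MemLp (fun v : E3 => ‖v‖ * ‖v‖) 2 maxwellian := by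
      have : ENNReal.HolderTriple 4 4 2 := ⟨by
        rw [← two_mul, show (4 : ℝ≥0∞) = 2 * 2 by norm_num,
          ENNReal.mul_inv (by norm_num) (by norm_num), ← mul_assoc,
          ENNReal.mul_inv_cancel (by norm_num) (by norm_num), one_mul]⟩
      exact h.norm.mul' h.norm
    have h3 := h'.ofReal (K := ℂ)
    simpa [sq] using h3
  fin_cases j
  · simpa [basis5] using (memLp_const (1 : ℂ) : MemLp (fun _ : E3 => (1 : ℂ)) 2 maxwellian)
  · simpa [basis5] using hc 0
  · simpa [basis5] using hc 1
  · simpa [basis5] using hc 2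
  · have h4 := (h2.sub (memLp_const (3 : ℂ))).const_mul ((√6 : ℝ) : ℂ)⁻¹
    refine h4.ae_eq (Filter.Eventually.of_forall fun v => ?_)
    simp [basis5]
    ring

lemma integrable_mul_basis5 {f : E3 → ℂ} (hf : MemLp f 2 maxwellian) (j : Fin 5) :
    Integrable (fun w => f w * (basis5 j w : ℂ)) maxwellian :=
  hf.integrable_mul (memLp_basis5 j)

lemma proj5_congr {f g : E3 → ℂ} (h : f =ᵐ[maxwellian] g) (v : E3) : proj5 f v = proj5 g v := by
  unfold proj5
  refine Finset.sum_congr rfl fun j _ => ?_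
  congr 1
  refine integral_congr_ae ?_
  filter_upwards [h] with w hw
  rw [hw]

lemma proj5_add {f g : E3 → ℂ} (hf : MemLp f 2 maxwellian) (hg : MemLp g 2 maxwellian) (v : E3) :
    proj5 (fun w => f w + g w) v = proj5 f v + proj5 g v := by
  unfold proj5
  rw [← Finset.sum_add_distrib]
  refine Finset.sum_congr rfl fun j _ => ?_
  simp_rw [add_mul]
  rw [integral_add (integrable_mul_basis5 hf j) (integrable_mul_basis5 hg j), add_mul]

lemma proj5_smul (c : ℂ) (f : E3 → ℂ) (v : E3) :
    proj5 (fun w => c * f w) v = c * proj5 f v := by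
  unfold proj5
  rw [Finset.mul_sum]
  refine Finset.sum_congr rfl fun j _ => ?_
  simp_rw [mul_assoc]
  rw [integral_const_mul, mul_assoc]

/-! ### The operator at a fixed wave vector -/

/-- The velocity space `L²(ℝ³, maxwellian)`. -/
abbrev VelocityL2 : Type := Lp ℂ 2 maxwellian

/-- The graph of `f ↦ -i (v·k) f - f/τ + ℙ₅ f/τ`, on the maximal domain
`{f ∈ L² | (v·k) f ∈ L²}`. -/
def fibreGraph (τ : ℝ) (k : E3) : Submodule ℂ (VelocityL2 × VelocityL2) where
  carrier := {p | (p.2 : E3 → ℂ) =ᵐ[maxwellian] fun v =>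
    -I * ((⟪v, k⟫_ℝ : ℝ) : ℂ) * p.1 v - (1 / τ : ℂ) * p.1 v + (1 / τ : ℂ) * proj5 p.1 v}
  zero_mem' := by
    change ((0 : VelocityL2) : E3 → ℂ) =ᵐ[maxwellian] _
    have h0 := Lp.coeFn_zero ℂ 2 maxwellian
    filter_upwards [h0] with v hv
    have e : proj5 ((0 : VelocityL2) : E3 → ℂ) v = 0 := by
      rw [proj5_congr h0]; simp [proj5]
    simp only [Prod.fst_zero, e, hv, Pi.zero_apply]
    ring
  add_mem' := by
    intro p q hp hq
    simp only [Set.mem_ofPred_eq] at hp hq ⊢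
    have h1 := Lp.coeFn_add p.1 q.1
    have h2 := Lp.coeFn_add p.2 q.2
    filter_upwards [hp, hq, h1, h2] with v a b c d
    have e : proj5 ((p.1 + q.1 : VelocityL2) : E3 → ℂ) v = proj5 p.1 v + proj5 q.1 v := by
      rw [proj5_congr h1]; exact proj5_add (Lp.memLp p.1) (Lp.memLp q.1) v
    simp only [Prod.fst_add, Prod.snd_add, e, c, d, Pi.add_apply, a, b]
    ring
  smul_mem' := by
    intro c p hp
    simp only [Set.mem_ofPred_eq] at hp ⊢
    have h1 := Lp.coeFn_smul c p.1
    have h2 := Lp.coeFn_smul c p.2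
    filter_upwards [hp, h1, h2] with v a b d
    have e : proj5 ((c • p.1 : VelocityL2) : E3 → ℂ) v = c * proj5 p.1 v := by
      rw [proj5_congr h1]; exact proj5_smul c _ v
    simp only [Prod.smul_fst, Prod.smul_snd, e, b, d, Pi.smul_apply, a, smul_eq_mul]
    ring

/-- The operator `𝓛_k f = -i (v·k) f - f/τ + ℙ₅ f/τ` at the wave vector `k`. -/
def fibreOperator (τ : ℝ) (k : E3) : VelocityL2 →ₗ.[ℂ] VelocityL2 :=
  (fibreGraph τ k).toLinearPMap

/-! ### The full operator in position and velocity

The spatial domain `X` comes with a homomorphism `q : ℝ³ → X`, which is the identity for the whole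
space and the quotient map for the torus. -/

section PhaseSpace

variable {X : Type*} [AddCommGroup X] [TopologicalSpace X]

/-- Smooth, compactly supported functions on `X × ℝ³`; smoothness is that of the lift to
`ℝ³ × ℝ³`. -/
def IsTestFunction (q : E3 →+ X) (φ : X × E3 → ℂ) : Prop :=
  ContDiff ℝ ∞ (fun p : E3 × E3 => φ (q p.1, p.2)) ∧ HasCompactSupport φ

/-- The classical derivative `(v·∇ₓ) φ` at `(x, v)`. -/
def streamDeriv (q : E3 →+ X) (φ : X × E3 → ℂ) (p : X × E3) : ℂ :=
  deriv (fun t : ℝ => φ (p.1 + q (t • p.2), p.2)) 0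

end PhaseSpace

section FullOperator

variable {X : Type*} [AddCommGroup X] [TopologicalSpace X] [MeasureSpace X]

/-- The measure `dx ⊗ (2π)^(-3/2) exp (-|v|² / 2) dv` on the phase space `X × ℝ³`. -/
abbrev phaseMeasure (X : Type*) [MeasureSpace X] : Measure (X × E3) :=
  (volume : Measure X).prod maxwellian

/-- The phase space `L²(X × ℝ³, dx ⊗ maxwellian)`. -/
abbrev PhaseL2 (X : Type*) [MeasureSpace X] : Type _ := Lp ℂ 2 (phaseMeasure X)

/-- `g = (v·∇ₓ) f` in the weak sense. (The integrability clauses hold automatically on the torus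
and on the whole space; they only make sure that the integrals are meaningful.) -/
def IsWeakStream (q : E3 →+ X) (f g : PhaseL2 X) : Prop :=
  ∀ φ : X × E3 → ℂ, IsTestFunction q φ →
    Integrable (fun p => f p * streamDeriv q φ p) (phaseMeasure X) ∧
    Integrable (fun p => g p * φ p) (phaseMeasure X) ∧
    ∫ p, f p * streamDeriv q φ p ∂(phaseMeasure X) = -∫ p, g p * φ p ∂(phaseMeasure X)

lemma IsWeakStream.add {q : E3 →+ X} {f g f' g' : PhaseL2 X} (h : IsWeakStream q f g) (h' : IsWeakStream q f' g') :
    IsWeakStream q (f + f') (g + g') := by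
  intro φ hφ
  obtain ⟨i1, i2, i3⟩ := h φ hφ
  obtain ⟨j1, j2, j3⟩ := h' φ hφ
  have e1 : (fun p => (f + f' : PhaseL2 X) p * streamDeriv q φ p) =ᵐ[phaseMeasure X]
      fun p => f p * streamDeriv q φ p + f' p * streamDeriv q φ p := by
    filter_upwards [Lp.coeFn_add f f'] with p hp
    rw [hp, Pi.add_apply, add_mul]
  have e2 : (fun p => (g + g' : PhaseL2 X) p * φ p) =ᵐ[phaseMeasure X]
      fun p => g p * φ p + g' p * φ p := by
    filter_upwards [Lp.coeFn_add g g'] with p hp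
    rw [hp, Pi.add_apply, add_mul]
  refine ⟨(integrable_congr e1).2 (i1.add j1), (integrable_congr e2).2 (i2.add j2), ?_⟩
  rw [integral_congr_ae e1, integral_congr_ae e2, integral_add i1 j1, integral_add i2 j2, i3, j3]
  ring

lemma IsWeakStream.smul {q : E3 →+ X} {f g : PhaseL2 X} (c : ℂ) (h : IsWeakStream q f g) :
    IsWeakStream q (c • f) (c • g) := by
  intro φ hφ
  obtain ⟨i1, i2, i3⟩ := h φ hφ
  have e1 : (fun p => (c • f : PhaseL2 X) p * streamDeriv q φ p) =ᵐ[phaseMeasure X]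
      fun p => c * (f p * streamDeriv q φ p) := by
    filter_upwards [Lp.coeFn_smul c f] with p hp
    rw [hp, Pi.smul_apply, smul_eq_mul, mul_assoc]
  have e2 : (fun p => (c • g : PhaseL2 X) p * φ p) =ᵐ[phaseMeasure X]
      fun p => c * (g p * φ p) := by
    filter_upwards [Lp.coeFn_smul c g] with p hp
    rw [hp, Pi.smul_apply, smul_eq_mul, mul_assoc]
  refine ⟨(integrable_congr e1).2 (i1.const_mul c), (integrable_congr e2).2 (i2.const_mul c), ?_⟩
  rw [integral_congr_ae e1, integral_congr_ae e2, integral_const_mul, integral_const_mul, i3]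
  ring

lemma IsWeakStream.zero (q : E3 →+ X) : IsWeakStream q (0 : PhaseL2 X) 0 := by
  intro φ _
  have e : ∀ ψ : X × E3 → ℂ,
      (fun p => (0 : PhaseL2 X) p * ψ p) =ᵐ[phaseMeasure X] fun _ => (0 : ℂ) := by
    intro ψ
    filter_upwards [Lp.coeFn_zero ℂ 2 (phaseMeasure X)] with p hp
    rw [hp, Pi.zero_apply, zero_mul]
  refine ⟨(integrable_congr (e _)).2 (integrable_zero _ _ _),
    (integrable_congr (e _)).2 (integrable_zero _ _ _), ?_⟩
  rw [integral_congr_ae (e _), integral_congr_ae (e _)]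
  simp

end FullOperator

section Collision

variable {X : Type*} [MeasureSpace X]

/-- `ℙ₅` acting in the velocity variable of a function on the phase space. -/
def phaseProj5 (f : X × E3 → ℂ) (p : X × E3) : ℂ := proj5 (fun w => f (p.1, w)) p.2

lemma memLp_section [SFinite (volume : Measure X)] (f : PhaseL2 X) :
    ∀ᵐ p ∂(phaseMeasure X), MemLp (fun w => f (p.1, w)) 2 maxwellian := by
  have hm := Lp.memLp f
  have hs := hm.1.prodMk_left
  have hi := (hm.integrable_norm_pow (by norm_num)).prod_right_ae
  have h : ∀ᵐ x ∂(volume : Measure X), MemLp (fun w => f (x, w)) 2 maxwellian := by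
    filter_upwards [hs, hi] with x h1 h2
    rw [memLp_two_iff_integrable_sq_norm h1]
    simpa using h2
  exact Measure.quasiMeasurePreserving_fst.ae h

lemma phaseProj5_congr [SFinite (volume : Measure X)] {f g : X × E3 → ℂ}
    (h : f =ᵐ[phaseMeasure X] g) : phaseProj5 f =ᵐ[phaseMeasure X] phaseProj5 g := by
  have h1 := Measure.ae_ae_of_ae_prod h
  have h2 : ∀ᵐ p ∂(phaseMeasure X), ∀ᵐ w ∂maxwellian, f (p.1, w) = g (p.1, w) :=
    Measure.quasiMeasurePreserving_fst.ae h1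
  filter_upwards [h2] with p hp
  exact proj5_congr hp p.2

end Collision

section FullOperator

variable {X : Type*} [AddCommGroup X] [TopologicalSpace X] [MeasureSpace X]
  [SFinite (volume : Measure X)]

/-- The graph of `f ↦ -(v·∇ₓ) f - f/τ + ℙ₅ f/τ`, on the maximal domain
`{f ∈ L² | (v·∇ₓ) f ∈ L²}` with the weak derivative. (On the torus and on the whole space a weak
derivative is unique, so this is the graph of an operator.) -/
def bgkGraph (q : E3 →+ X) (τ : ℝ) : Submodule ℂ (PhaseL2 X × PhaseL2 X) where
  carrier := {p | ∃ g : PhaseL2 X, IsWeakStream q p.1 g ∧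
    (p.2 : X × E3 → ℂ) =ᵐ[phaseMeasure X] fun y =>
      -g y - (1 / τ : ℂ) * p.1 y + (1 / τ : ℂ) * phaseProj5 p.1 y}
  zero_mem' := by
    refine ⟨0, IsWeakStream.zero q, ?_⟩
    change ((0 : PhaseL2 X) : X × E3 → ℂ) =ᵐ[phaseMeasure X] _
    have h0 := Lp.coeFn_zero ℂ 2 (phaseMeasure X)
    filter_upwards [h0, phaseProj5_congr h0] with y hy e
    have e' : phaseProj5 (0 : X × E3 → ℂ) y = 0 := by simp [phaseProj5, proj5]
    simp only [Prod.fst_zero, e, e', hy, Pi.zero_apply]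
    ring
  add_mem' := by
    rintro p p' ⟨g, hg, hp⟩ ⟨g', hg', hp'⟩
    refine ⟨g + g', hg.add hg', ?_⟩
    have h1 := Lp.coeFn_add p.1 p'.1
    filter_upwards [hp, hp', h1, Lp.coeFn_add p.2 p'.2, Lp.coeFn_add g g', phaseProj5_congr h1,
      memLp_section p.1, memLp_section p'.1] with y a b c d d' e m m'
    have e' := e.trans (proj5_add m m' y.2)
    change _ = phaseProj5 p.1 y + phaseProj5 p'.1 y at e'
    simp only [Prod.fst_add, Prod.snd_add, e', c, d, d', Pi.add_apply, a, b]
    ring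
  smul_mem' := by
    rintro c p ⟨g, hg, hp⟩
    refine ⟨c • g, hg.smul c, ?_⟩
    have h1 := Lp.coeFn_smul c p.1
    filter_upwards [hp, h1, Lp.coeFn_smul c p.2, Lp.coeFn_smul c g, phaseProj5_congr h1]
      with y a b d d' e
    have e' : phaseProj5 (c • (p.1 : X × E3 → ℂ)) y = c * phaseProj5 p.1 y := proj5_smul c _ y.2
    simp only [Prod.smul_fst, Prod.smul_snd, e, e', b, d, d', Pi.smul_apply, a, smul_eq_mul]
    ring

/-- The linearized BGK operator `𝓛 = -v·∇ₓ - 1/τ + ℙ₅/τ` on `L²(X × ℝ³)`. -/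
def bgkOperator (q : E3 →+ X) (τ : ℝ) : PhaseL2 X →ₗ.[ℂ] PhaseL2 X :=
  (bgkGraph q τ).toLinearPMap

end FullOperator

/-- The flat torus `(ℝ / ℓℤ)³`. -/
abbrev Torus3 (ℓ : ℝ) : Type := Fin 3 → AddCircle ℓ

/-- The quotient map `ℝ³ → (ℝ / ℓℤ)³`. -/
def torusMk (ℓ : ℝ) : E3 →+ Torus3 ℓ where
  toFun x := fun i => (x i : AddCircle ℓ)
  map_zero' := by ext i; simp
  map_add' x y := by ext i; simp

/-- The linearized BGK operator on the torus `(ℝ / ℓℤ)³`. -/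
def bgkTorus (ℓ : ℝ) [Fact (0 < ℓ)] (τ : ℝ) : PhaseL2 (Torus3 ℓ) →ₗ.[ℂ] PhaseL2 (Torus3 ℓ) :=
  bgkOperator (torusMk ℓ) τ

/-- The linearized BGK operator on the whole space `ℝ³`. -/
def bgkSpace (τ : ℝ) : PhaseL2 E3 →ₗ.[ℂ] PhaseL2 E3 :=
  bgkOperator (AddMonoidHom.id E3) τ

/-- The wave vectors of the torus `(ℝ / ℓℤ)³`, indexed by `ℤ³`. -/
def torusWaveVector (ℓ : ℝ) (n : Fin 3 → ℤ) : E3 :=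
  WithLp.toLp 2 fun i => 2 * Real.pi / ℓ * (n i : ℝ)

/-! ### Spectral functions and modes -/

/-- The plasma dispersion function `Z(ζ) = (2π)^(-1/2) ∫ exp (-v² / 2) / (v - ζ) dv`
(used for `Im ζ > 0`). -/
def plasmaZ (ζ : ℂ) : ℂ :=
  (1 / (√(2 * Real.pi) : ℝ) : ℂ) * ∫ v : ℝ, (Real.exp (-v ^ 2 / 2) : ℂ) / ((v : ℂ) - ζ)

/-- The matrix `M(ζ)`. -/
def plasmaMatrix (ζ : ℂ) : Matrix (Fin 3) (Fin 3) ℂ :=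
  let Z := plasmaZ ζ
  let s : ℂ := ((√6 : ℝ) : ℂ)
  !![Z, 1 + ζ * Z, (ζ + (ζ ^ 2 - 1) * Z) / s;
     1 + ζ * Z, ζ + ζ ^ 2 * Z, (ζ ^ 2 + (ζ ^ 3 - ζ) * Z) / s;
     (ζ + (ζ ^ 2 - 1) * Z) / s, (ζ ^ 2 + (ζ ^ 3 - ζ) * Z) / s,
      (ζ ^ 3 - ζ + (ζ ^ 4 - 2 * ζ ^ 2 + 5) * Z) / 6]

/-- The spectral function `Γ_κ(ζ) = det (M(ζ) - i κ)`. -/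
def spectralGamma (κ : ℝ) (ζ : ℂ) : ℂ :=
  (plasmaMatrix ζ - (I * (κ : ℂ)) • (1 : Matrix (Fin 3) (Fin 3) ℂ)).det

/-- The variable `ζ = (-Λ - 1) / (i κ)` for `Λ = τ λ` and `κ = τ k`. -/
def zetaOf (κ : ℝ) (Λ : ℂ) : ℂ := (-Λ - 1) / (I * (κ : ℂ))

/-- The four families of modes. -/
inductive Mode
  | shear
  | diff
  | ac
  | acConj

/-- `Λ N κ = τ λ_N` is the rescaled eigenvalue of the mode `N` at the rescaled wave number
`κ = τ k`, and `κc N = τ k_crit,N` its rescaled critical wave number: the branches start at `0`, are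
continuous, stay to the right of the line `Re Λ = -1`, and the mode `N` exists exactly for
`κ < κc N`. The shear mode is the solution of `Z(ζ) = i κ` and is real; the other modes are the zeros
of `Γ_κ`: a real one (diffusion) and two complex conjugate non-real ones (acoustic). -/
structure IsModeFamily (Λ : Mode → ℝ → ℂ) (κc : Mode → ℝ) : Prop where
  crit_pos : ∀ N, 0 < κc N
  at_zero : ∀ N, Λ N 0 = 0
  continuousOn : ∀ N, ContinuousOn (Λ N) (Set.Ico 0 (κc N))
  above : ∀ N κ, 0 ≤ κ → κ < κc N → -1 < (Λ N κ).re ∧ (Λ N κ).re ≤ 0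
  shear_real : ∀ κ, 0 ≤ κ → κ < κc .shear → (Λ .shear κ).im = 0
  shear_iff : ∀ (κ : ℝ) (z : ℂ), 0 < κ →
    (-1 < z.re ∧ plasmaZ (zetaOf κ z) = I * (κ : ℂ) ↔ κ < κc .shear ∧ z = Λ .shear κ)
  diff_iff : ∀ (κ : ℝ) (z : ℂ), 0 < κ →
    (-1 < z.re ∧ z.im = 0 ∧ spectralGamma κ (zetaOf κ z) = 0 ↔ κ < κc .diff ∧ z = Λ .diff κ)
  ac_iff : ∀ (κ : ℝ) (z : ℂ), 0 < κ →
    (-1 < z.re ∧ 0 < z.im ∧ spectralGamma κ (zetaOf κ z) = 0 ↔ κ < κc .ac ∧ z = Λ .ac κ)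
  acConj_crit : κc .acConj = κc .ac
  acConj_eq : ∀ κ, 0 ≤ κ → κ < κc .ac → Λ .acConj κ = (starRingEnd ℂ) (Λ .ac κ)

/-- The line `Re λ = -1/τ`. -/
def essLine (τ : ℝ) : Set ℂ := {z | z.re = -(1 / τ)}

/-- The eigenvalues `λ_N = Λ N (τ k) / τ` at the wave number `k`, over all modes `N` with
`k < k_crit,N = κc N / τ`. -/
def modesAt (Λ : Mode → ℝ → ℂ) (κc : Mode → ℝ) (τ k : ℝ) : Set ℂ :=
  {z | ∃ N, k < κc N / τ ∧ z = Λ N (τ * k) / (τ : ℂ)}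

end

end BGK

namespace BGK
noncomputable section

open scoped ComplexConjugate
open Filter (Tendsto atTop)
open Set (mem_Ici Ioi Icc indicator_of_notMem indicator_of_mem mem_ofPred_eq)
open Finset (sum_congr mul_sum sum_mul)
open ContinuousLinearMap (adjoint_inner_right adjoint_inner_left)
open Real (norm_of_nonneg)

/-! ### The Mills function -/

/-- The moments `∫₀^∞ tⁿ exp (-s t - t² / 2) dt`. -/
def millsMoment (n : ℕ) (s : ℂ) : ℂ :=
  ∫ t in Ioi (0 : ℝ), (t : ℂ) ^ n * cexp (-s * t - (t : ℂ) ^ 2 / 2)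

/-- The Mills function `W(s) = ∫₀^∞ exp (-s t - t² / 2) dt`. -/
def mills (s : ℂ) : ℂ := millsMoment 0 s

lemma norm_mills_integrand (n : ℕ) (s : ℂ) {t : ℝ} (ht : 0 < t) :
    ‖(t : ℂ) ^ n * cexp (-s * t - (t : ℂ) ^ 2 / 2)‖ = t ^ n * Real.exp (-s.re * t - t ^ 2 / 2) := by
  rw [norm_mul, norm_pow, norm_real, norm_of_nonneg ht.le, Complex.norm_exp]
  congr 2
  have : -s * t - (t : ℂ) ^ 2 / 2 = -s * t - ((t ^ 2 / 2 : ℝ) : ℂ) := by push_cast; ring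
  rw [this]
  simp
  norm_cast

lemma mills_bound_aux (R t : ℝ) :
    R * t - t ^ 2 / 2 ≤ R ^ 2 + -(1 / 4) * t ^ 2 := by
  nlinarith [sq_nonneg (R - t / 2)]

lemma integrableOn_pow_mul_exp (n : ℕ) (R : ℝ) :
    IntegrableOn (fun t : ℝ => t ^ n * Real.exp (R * t - t ^ 2 / 2)) (Ioi 0) := by
  have h := (integrableOn_rpow_mul_exp_neg_mul_sq (b := 1 / 4) (by norm_num) (s := n)
    (by linarith [n.cast_nonneg (α := ℝ)])).const_mul (Real.exp (R ^ 2))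
  refine h.mono' (by fun_prop) ?_
  filter_upwards [self_mem_ae_restrict measurableSet_Ioi] with t ht
  have ht : 0 < t := ht
  rw [norm_of_nonneg (by positivity), Real.rpow_natCast]
  calc t ^ n * Real.exp (R * t - t ^ 2 / 2)
      ≤ t ^ n * Real.exp (R ^ 2 + -(1 / 4) * t ^ 2) := by gcongr; exact mills_bound_aux R t
    _ = _ := by rw [Real.exp_add]; ring

lemma integrableOn_mills (n : ℕ) (s : ℂ) :
    IntegrableOn (fun t : ℝ => (t : ℂ) ^ n * cexp (-s * t - (t : ℂ) ^ 2 / 2)) (Ioi 0) := by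
  refine (integrableOn_pow_mul_exp n (-s.re)).mono' (by fun_prop) ?_
  filter_upwards [self_mem_ae_restrict measurableSet_Ioi] with t ht
  rw [norm_mills_integrand n s ht]

lemma hasDerivAt_millsMoment (n : ℕ) (s : ℂ) :
    HasDerivAt (millsMoment n) (-millsMoment (n + 1) s) s := by
  have key := hasDerivAt_integral_of_dominated_loc_of_deriv_le
    (μ := volume.restrict (Ioi (0 : ℝ))) (s := Metric.ball s 1) (x₀ := s)
    (F := fun s (t : ℝ) => (t : ℂ) ^ n * cexp (-s * t - (t : ℂ) ^ 2 / 2))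
    (F' := fun s (t : ℝ) => -((t : ℂ) ^ (n + 1) * cexp (-s * t - (t : ℂ) ^ 2 / 2)))
    (bound := fun t : ℝ => t ^ (n + 1) * Real.exp ((-s.re + 1) * t - t ^ 2 / 2))
    (Metric.ball_mem_nhds _ one_pos)
    (.of_forall fun z => (integrableOn_mills n z).aestronglyMeasurable)
    (integrableOn_mills n s) (integrableOn_mills (n + 1) s).neg.aestronglyMeasurable
    ?_ (integrableOn_pow_mul_exp _ _) ?_
  · have h := key.2
    rw [integral_neg] at h
    exact h
  · filter_upwards [self_mem_ae_restrict measurableSet_Ioi] with t ht z hz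
    have ht : 0 < t := ht
    rw [norm_neg, norm_mills_integrand _ _ ht]
    gcongr
    have h1 : |(z - s).re| ≤ ‖z - s‖ := abs_re_le_norm _
    rw [Metric.mem_ball, dist_eq_norm] at hz
    have := (abs_le.1 h1).1
    simp only [sub_re] at this
    linarith
  · refine .of_forall fun t z _ => ?_
    have h1 : HasDerivAt (fun z : ℂ => -z * t - (t : ℂ) ^ 2 / 2) (-(t : ℂ)) z := by
      simpa using (((hasDerivAt_id z).neg.mul_const (t : ℂ)).sub_const ((t : ℂ) ^ 2 / 2))
    have h2 := (h1.cexp).const_mul ((t : ℂ) ^ n)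
    refine h2.congr_deriv ?_
    ring

lemma tendsto_mills_integrand (n : ℕ) (s : ℂ) :
    Tendsto (fun t : ℝ => (t : ℂ) ^ n * cexp (-s * t - (t : ℂ) ^ 2 / 2)) atTop
      (𝓝 0) := by
  rw [tendsto_zero_iff_norm_tendsto_zero]
  have h1 : Tendsto (fun t : ℝ => Real.exp ((-s.re + 1) ^ 2) * (t ^ n * Real.exp (-t)))
      atTop (𝓝 0) := by
    simpa using (Real.tendsto_pow_mul_exp_neg_atTop_nhds_zero n).const_mul
      (Real.exp ((-s.re + 1) ^ 2))
  refine squeeze_zero' (.of_forall fun _ => norm_nonneg _) ?_ h1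
  filter_upwards [Filter.eventually_gt_atTop 0] with t ht
  rw [norm_mills_integrand n s ht]
  calc t ^ n * Real.exp (-s.re * t - t ^ 2 / 2)
      ≤ t ^ n * Real.exp ((-s.re + 1) ^ 2 + -t) := by
        gcongr
        nlinarith [mills_bound_aux (-s.re + 1) t, sq_nonneg t]
    _ = _ := by rw [Real.exp_add]; ring

lemma hasDerivAt_mills_integrand (n : ℕ) (s : ℂ) (t : ℝ) :
    HasDerivAt (fun t : ℝ => (t : ℂ) ^ n * cexp (-s * t - (t : ℂ) ^ 2 / 2))
      ((n : ℂ) * ((t : ℂ) ^ (n - 1) * cexp (-s * t - (t : ℂ) ^ 2 / 2))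
        - s * ((t : ℂ) ^ n * cexp (-s * t - (t : ℂ) ^ 2 / 2))
        - (t : ℂ) ^ (n + 1) * cexp (-s * t - (t : ℂ) ^ 2 / 2)) t := by
  have h0 : HasDerivAt (fun t : ℝ => (t : ℂ)) 1 t := (hasDerivAt_id (t : ℂ)).comp_ofReal
  have h1 : HasDerivAt (fun t : ℝ => -s * t - (t : ℂ) ^ 2 / 2) (-s - t) t := by
    have := (h0.const_mul (-s)).sub ((h0.pow 2).div_const 2)
    refine this.congr_deriv ?_
    push_cast
    ring
  have h2 := (h0.pow n).mul h1.cexp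
  refine h2.congr_deriv ?_
  simp only [Pi.pow_apply]
  ring

lemma millsMoment_rec_aux (n : ℕ) (s : ℂ) :
    (n : ℂ) * millsMoment (n - 1) s - s * millsMoment n s - millsMoment (n + 1) s
      = -(0 : ℂ) ^ n := by
  have h := integral_Ioi_of_hasDerivAt_of_tendsto'
    (f := fun t : ℝ => (t : ℂ) ^ n * cexp (-s * t - (t : ℂ) ^ 2 / 2)) (a := 0)
    (fun t _ => hasDerivAt_mills_integrand n s t)
    ((((integrableOn_mills (n - 1) s).const_mul (n : ℂ)).sub
      ((integrableOn_mills n s).const_mul s)).sub (integrableOn_mills (n + 1) s))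
    (tendsto_mills_integrand n s)
  rw [integral_sub, integral_sub, integral_const_mul, integral_const_mul] at h
  · simpa [millsMoment] using h
  · exact (integrableOn_mills (n - 1) s).const_mul (n : ℂ)
  · exact (integrableOn_mills n s).const_mul s
  · exact ((integrableOn_mills (n - 1) s).const_mul (n : ℂ)).sub
      ((integrableOn_mills n s).const_mul s)
  · exact integrableOn_mills (n + 1) s

lemma millsMoment_one (s : ℂ) : millsMoment 1 s = 1 - s * mills s := by
  have := millsMoment_rec_aux 0 s
  simp at this
  rw [mills]
  linear_combination -this

lemma millsMoment_add_two (n : ℕ) (s : ℂ) :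
    millsMoment (n + 2) s = (n + 1) * millsMoment n s - s * millsMoment (n + 1) s := by
  have := millsMoment_rec_aux (n + 1) s
  simp at this
  linear_combination -this

lemma hasDerivAt_mills (s : ℂ) : HasDerivAt mills (s * mills s - 1) s := by
  have := hasDerivAt_millsMoment 0 s
  rw [zero_add, millsMoment_one, neg_sub] at this
  exact this

lemma differentiable_mills : Differentiable ℂ mills := fun s => (hasDerivAt_mills s).differentiableAt

lemma norm_millsMoment_le (n : ℕ) {s : ℂ} (hs : 0 ≤ s.re) :
    ‖millsMoment n s‖ ≤ ∫ t in Ioi (0 : ℝ), t ^ n * Real.exp (0 * t - t ^ 2 / 2) := by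
  refine norm_integral_le_of_norm_le (integrableOn_pow_mul_exp n 0) ?_
  filter_upwards [self_mem_ae_restrict measurableSet_Ioi] with t ht
  have ht : 0 < t := ht
  rw [norm_mills_integrand n s ht]
  gcongr
  linarith

lemma millsMoment_ofReal (n : ℕ) (s : ℝ) : millsMoment n s =
    ((∫ t in Ioi (0 : ℝ), t ^ n * Real.exp (-s * t - t ^ 2 / 2) : ℝ) : ℂ) := by
  rw [millsMoment, ← integral_complex_ofReal]
  congr 1
  ext t
  push_cast
  ring_nf

lemma millsMoment_ofReal_pos (n : ℕ) (s : ℝ) :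
    0 < ∫ t in Ioi (0 : ℝ), t ^ n * Real.exp (-s * t - t ^ 2 / 2) := by
  rw [setIntegral_pos_iff_support_of_nonneg_ae]
  · have : Function.support (fun t : ℝ => t ^ n * Real.exp (-s * t - t ^ 2 / 2)) ∩ Ioi 0
        = Ioi 0 := by
      ext t
      simp only [Set.mem_inter_iff, Function.mem_support, Set.mem_Ioi, and_iff_right_iff_imp]
      intro ht
      positivity
    rw [this]
    simp
  · filter_upwards [self_mem_ae_restrict measurableSet_Ioi] with t ht
    have ht : 0 < t := ht
    simp only [Pi.zero_apply]
    positivity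
  · simpa using integrableOn_pow_mul_exp n (-s)

/-- The Mills function on the real line. -/
def millsR (s : ℝ) : ℝ := ∫ t in Ioi (0 : ℝ), Real.exp (-s * t - t ^ 2 / 2)

lemma mills_ofReal (s : ℝ) : mills s = millsR s := by
  rw [mills, millsMoment_ofReal, millsR]
  simp

lemma mills_conj (s : ℂ) : mills (conj s) = conj (mills s) := by
  rw [mills, mills, millsMoment, millsMoment, ← integral_conj]
  congr 1
  ext t
  simp [← Complex.exp_conj, Complex.conj_ofNat]

lemma millsR_pos (s : ℝ) : 0 < millsR s := by
  simpa [millsR] using millsMoment_ofReal_pos 0 s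

lemma mul_millsR_lt_one (s : ℝ) : s * millsR s < 1 := by
  have h := millsMoment_ofReal_pos 1 s
  have h1 := millsMoment_one s
  rw [millsMoment_ofReal, mills_ofReal] at h1
  norm_cast at h1
  linarith

lemma millsR_upper (s : ℝ) : millsR s * (s * (s ^ 2 + 3)) ≤ s ^ 2 + 2 := by
  have h := millsMoment_ofReal_pos 3 s
  have h1 := millsMoment_one s
  have h2 := millsMoment_add_two 0 s
  have h3 := millsMoment_add_two 1 s
  have h4 : millsMoment 3 (s : ℂ) = s ^ 2 + 2 - mills s * (s * (s ^ 2 + 3)) := by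
    simp only [zero_add] at h2
    norm_num at h2 h3
    rw [h3, h2, h1, ← mills]
    ring
  rw [millsMoment_ofReal, mills_ofReal] at h4
  norm_cast at h4
  linarith

lemma hasDerivAt_millsR (s : ℝ) : HasDerivAt millsR (s * millsR s - 1) s := by
  have h := (hasDerivAt_mills (s : ℂ)).real_of_complex
  have e : (fun x : ℝ => (mills x).re) = millsR := by
    ext x; rw [mills_ofReal, ofReal_re]
  rw [e, mills_ofReal] at h
  refine h.congr_deriv ?_
  norm_cast

lemma millsR_strictAnti : StrictAnti millsR :=
  strictAnti_of_deriv_neg fun s => by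
    rw [(hasDerivAt_millsR s).deriv]; linarith [mul_millsR_lt_one s]

lemma millsR_zero : millsR 0 = √(Real.pi / 2) := by
  have h := integral_gaussian_Ioi (1 / 2)
  rw [millsR]
  convert h using 1
  · congr 1; ext t; ring_nf
  · rw [show Real.pi / (1 / 2) = (Real.pi / 2) * 2 ^ 2 by ring,
      Real.sqrt_mul (by positivity), Real.sqrt_sq (by norm_num)]
    ring

lemma continuous_millsR : Continuous millsR :=
  continuous_iff_continuousAt.2 fun s => (hasDerivAt_millsR s).continuousAt

/-! ### The dispersion polynomial -/

section DispersionPoly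

variable {R : Type*} [CommRing R]

/-- The polynomial in `s`, `κ` and `w` which at `w = W(s)` is the spectral function up to a constant
factor. -/
def dispersionPoly (s κ w : R) : R :=
  6 * κ ^ 3 + κ ^ 2 * (-w * s ^ 4 + 4 * w * s ^ 2 + s ^ 3 - 11 * w - 5 * s)
    + κ * (2 * w * s ^ 3 - 4 * w ^ 2 * s ^ 2 + 4 * w ^ 2 - 2 * s ^ 2 + 6)
    + (-w * s ^ 2 + 4 * w ^ 2 * s - 5 * w + s)

/-- The derivative of `dispersionPoly s κ w` along `w' = s w - 1`. -/
def dispersionPolyDeriv (s κ w : R) : R :=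
  κ ^ 2 * (-w * s ^ 5 + s ^ 4 - 3 * w * s - s ^ 2 + 6)
    + κ * (2 * w * s ^ 4 - 8 * w ^ 2 * s ^ 3 + 14 * w * s ^ 2 - 2 * s ^ 3 - 8 * w - 4 * s)
    + (-w * s ^ 3 + 8 * w ^ 2 * s ^ 2 - 15 * w * s + 4 * w ^ 2 + s ^ 2 + 6)

end DispersionPoly

lemma hasDerivAt_dispersionPoly {𝕜 : Type*} [NontriviallyNormedField 𝕜] {w : 𝕜 → 𝕜} {s : 𝕜}
    (hw : HasDerivAt w (s * w s - 1) s) (κ : 𝕜) :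
    HasDerivAt (fun z => dispersionPoly z κ (w z)) (dispersionPolyDeriv s κ (w s)) s := by
  have h1 := hasDerivAt_id' s
  unfold dispersionPoly
  have h2 := h1.fun_pow 2
  have h3 := h1.fun_pow 3
  have h4 := h1.fun_pow 4
  have hw2 := hw.fun_pow 2
  have A := ((((((hw.neg.fun_mul h4).fun_add ((hw.const_mul 4).fun_mul h2)).fun_add h3).fun_sub
    (hw.const_mul 11)).fun_sub (h1.const_mul 5)).const_mul (κ ^ 2)).const_add (6 * κ ^ 3)
  have B := ((((((hw.const_mul 2).fun_mul h3).fun_sub ((hw2.const_mul 4).fun_mul h2)).fun_add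
    (hw2.const_mul 4)).fun_sub (h2.const_mul 2)).add_const 6).const_mul κ
  have C := (((hw.neg.fun_mul h2).fun_add ((hw2.const_mul 4).fun_mul h1)).fun_sub
    (hw.const_mul 5)).fun_add h1
  refine ((A.fun_add B).fun_add C).congr_deriv ?_
  unfold dispersionPolyDeriv
  simp only [Pi.neg_apply]
  push_cast
  ring

/-- The dispersion function of the three longitudinal moments. -/
def dispersion (s κ : ℂ) : ℂ := dispersionPoly s κ (mills s)

/-- Its derivative in `s`. -/
def dispersionDeriv (s κ : ℂ) : ℂ := dispersionPolyDeriv s κ (mills s)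

lemma hasDerivAt_dispersion (s κ : ℂ) :
    HasDerivAt (fun z => dispersion z κ) (dispersionDeriv s κ) s :=
  hasDerivAt_dispersionPoly (hasDerivAt_mills s) κ

lemma continuous_mills : Continuous mills := differentiable_mills.continuous

lemma dispersion_conj (s : ℂ) (κ : ℝ) :
    dispersion (conj s) κ = conj (dispersion s κ) := by
  simp only [dispersion, dispersionPoly, mills_conj]
  simp only [map_add, map_mul, map_sub, map_neg, map_pow, conj_ofReal, Complex.conj_ofNat]

lemma dispersion_ofReal (s κ : ℝ) :
    dispersion s κ = (dispersionPoly s κ (millsR s) : ℝ) := by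
  simp only [dispersion, dispersionPoly, mills_ofReal]
  push_cast
  ring

lemma dispersionDeriv_ofReal (s κ : ℝ) :
    dispersionDeriv s κ = (dispersionPolyDeriv s κ (millsR s) : ℝ) := by
  simp only [dispersionDeriv, dispersionPolyDeriv, mills_ofReal]
  push_cast
  ring

/-! ### Real zeros -/

lemma dispersion_disc_neg {s w : ℝ} (hs : 0 ≤ s) (hw : 0 < w) (h : w * (s * (s ^ 2 + 3)) ≤ s ^ 2 + 2) :
    (2 * w * s ^ 4 - 8 * w ^ 2 * s ^ 3 + 14 * w * s ^ 2 - 2 * s ^ 3 - 8 * w - 4 * s) ^ 2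
      - 4 * (-w * s ^ 5 + s ^ 4 - 3 * w * s - s ^ 2 + 6)
        * (-w * s ^ 3 + 8 * w ^ 2 * s ^ 2 - 15 * w * s + 4 * w ^ 2 + s ^ 2 + 6) < 0 := by
  rcases hs.eq_or_lt with rfl | hs
  · nlinarith [sq_nonneg w]
  set q := s ^ 2 with hq
  have hq0 : 0 < q := by positivity
  set t := (q + 3) * (1 - s * w) - 1 with ht
  have ht0 : 0 ≤ t := by rw [ht]; nlinarith
  have ht1 : t ≤ q + 2 := by rw [ht]; nlinarith [mul_pos hs hw]
  set d := (2 * w * s ^ 4 - 8 * w ^ 2 * s ^ 3 + 14 * w * s ^ 2 - 2 * s ^ 3 - 8 * w - 4 * s) ^ 2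
      - 4 * (-w * s ^ 5 + s ^ 4 - 3 * w * s - s ^ 2 + 6)
        * (-w * s ^ 3 + 8 * w ^ 2 * s ^ 2 - 15 * w * s + 4 * w ^ 2 + s ^ 2 + 6) with hd
  have key : d * (q * (q + 3) ^ 4) = -192 * q - t * (64 * q ^ 3 + 384 * q ^ 2 + 1536 * q + 576)
      - t ^ 2 * (4 * q ^ 5 + 32 * q ^ 4 + 136 * q ^ 3 + 128 * q ^ 2 + 660 * q - 576)
      - t ^ 3 * (48 * q ^ 3 + 112 * q ^ 2 + 720 * q + 144) + 64 * q ^ 2 * t ^ 4 := by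
    rw [hd, ht, hq]; ring
  have e1 : 64 * q ^ 2 * t ^ 4 ≤ 64 * q ^ 2 * (t ^ 3 * (q + 2)) := by
    rw [pow_succ t 3]; gcongr
  have e2 : t ^ 3 * (16 * q ^ 3 + 16 * q ^ 2) ≤ t ^ 2 * (q + 2) * (16 * q ^ 3 + 16 * q ^ 2) := by
    rw [pow_succ t 2]; gcongr
  have e3 : 0 ≤ t * (t - 2) ^ 2 := by positivity
  have e4 : 0 ≤ t * (64 * q ^ 3 + 384 * q ^ 2 + 1536 * q) := by positivity
  have e5 : 0 ≤ t ^ 2 * (4 * q ^ 5 + 16 * q ^ 4 + 88 * q ^ 3 + 96 * q ^ 2 + 660 * q) := by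
    positivity
  have e6 : 0 ≤ t ^ 3 * (720 * q) := by positivity
  have neg : d * (q * (q + 3) ^ 4) < 0 := by rw [key]; linarith
  have : 0 < q * (q + 3) ^ 4 := by positivity
  by_contra hcon
  push Not at hcon
  exact absurd (mul_nonneg hcon this.le) (not_le.2 neg)

lemma dispersion_lead_pos {s w : ℝ} (h : w * (s * (s ^ 2 + 3)) ≤ s ^ 2 + 2) :
    0 < -w * s ^ 5 + s ^ 4 - 3 * w * s - s ^ 2 + 6 := by
  have h1 : 0 ≤ (s ^ 2 + 2 - w * (s * (s ^ 2 + 3))) * (s ^ 4 + 3) := by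
    have : 0 ≤ s ^ 2 + 2 - w * (s * (s ^ 2 + 3)) := by linarith
    positivity
  have h2 : 0 < (-w * s ^ 5 + s ^ 4 - 3 * w * s - s ^ 2 + 6) * (s ^ 2 + 3) := by nlinarith
  exact pos_of_mul_pos_left h2 (by positivity)

lemma dispersionPolyDeriv_pos {s : ℝ} (hs : 0 ≤ s) (κ : ℝ) :
    0 < dispersionPolyDeriv s κ (millsR s) := by
  have h1 := dispersion_disc_neg hs (millsR_pos s) (millsR_upper s)
  have h2 := dispersion_lead_pos (millsR_upper s)
  unfold dispersionPolyDeriv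
  set a := -millsR s * s ^ 5 + s ^ 4 - 3 * millsR s * s - s ^ 2 + 6
  set b := 2 * millsR s * s ^ 4 - 8 * millsR s ^ 2 * s ^ 3 + 14 * millsR s * s ^ 2 - 2 * s ^ 3
    - 8 * millsR s - 4 * s
  set c := -millsR s * s ^ 3 + 8 * millsR s ^ 2 * s ^ 2 - 15 * millsR s * s + 4 * millsR s ^ 2
    + s ^ 2 + 6
  have h3 : 0 < 4 * a * (κ ^ 2 * a + κ * b + c) := by nlinarith [sq_nonneg (2 * a * κ + b)]
  exact pos_of_mul_pos_right h3 (by positivity)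

lemma strictMonoOn_dispersion (κ : ℝ) :
    StrictMonoOn (fun s => dispersionPoly s κ (millsR s)) (Set.Ici 0) := by
  have hd : ∀ s, HasDerivAt (fun s => dispersionPoly s κ (millsR s))
    (dispersionPolyDeriv s κ (millsR s)) s := fun s =>
      hasDerivAt_dispersionPoly (hasDerivAt_millsR s) κ
  refine strictMonoOn_of_deriv_pos (convex_Ici 0)
    (fun s _ => (hd s).continuousAt.continuousWithinAt) fun s hs => ?_
  rw [interior_Ici] at hs
  rw [(hd s).deriv]
  exact dispersionPolyDeriv_pos (le_of_lt hs) κ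

/-! ### Large arguments -/

lemma dispersion_expansion {s w : ℂ} (hs : s ≠ 0) (m : ℂ) :
    s ^ 3 * dispersionPoly s (m / s) w - 6 * (m - 1) ^ 3
      = (m - 1) ^ 2 * (s ^ 2 * (s ^ 2 * (1 - s * w) - 1) + 3)
        + 4 * m * ((1 - s * w) ^ 2 - 2 * (1 - s * w)) + 11 * (1 - s * w) * m ^ 2
        + (s ^ 2 * (1 - s * w) - 1) * (-3 + 8 * m - 4 * m ^ 2)
        + 4 * (s ^ 2 * (1 - s * w)) * (1 - s * w) * (1 - m) := by
  unfold dispersionPoly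
  field_simp
  ring

lemma exists_mills_asymptotic : ∃ K : ℝ, 1 ≤ K ∧ ∀ s : ℂ, 0 ≤ s.re → 1 ≤ ‖s‖ →
    ‖1 - s * mills s‖ ≤ K / ‖s‖ ∧ ‖s ^ 2 * (1 - s * mills s) - 1‖ ≤ K / ‖s‖ ∧
    ‖s ^ 2 * (s ^ 2 * (1 - s * mills s) - 1) + 3‖ ≤ K / ‖s‖ := by
  set M : ℕ → ℝ := fun n => ∫ t in Ioi (0 : ℝ), t ^ n * Real.exp (0 * t - t ^ 2 / 2) with hM
  have hM0 : ∀ n, 0 ≤ M n := fun n => by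
    refine setIntegral_nonneg measurableSet_Ioi fun t ht => ?_
    have ht : 0 < t := ht
    positivity
  have h0 := hM0 0
  have h2 := hM0 2
  have h4 := hM0 4
  have h6 := hM0 6
  refine ⟨1 + 60 * (M 0 + M 2 + M 4 + M 6), by linarith, fun s hs hs1 => ?_⟩
  have hs0 : 0 < ‖s‖ := by linarith
  have B : ∀ n, ‖millsMoment n s‖ ≤ M n := fun n => norm_millsMoment_le n hs
  have r1 := millsMoment_one s
  have r0 : mills s = millsMoment 0 s := rfl
  have r2 := millsMoment_add_two 0 s
  have r3 := millsMoment_add_two 1 s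
  have r4 := millsMoment_add_two 2 s
  have r5 := millsMoment_add_two 3 s
  have r6 := millsMoment_add_two 4 s
  norm_num at r2 r3 r4 r5 r6
  have e1 : s * millsMoment 1 s = millsMoment 0 s - millsMoment 2 s := by rw [r2]; ring
  have e3 : s * millsMoment 3 s = 3 * millsMoment 2 s - millsMoment 4 s := by rw [r4]; ring
  have e5 : s * millsMoment 5 s = 5 * millsMoment 4 s - millsMoment 6 s := by rw [r6]; ring
  have n1 : ‖s * millsMoment 1 s‖ ≤ M 0 + M 2 := by
    rw [e1]; exact (norm_sub_le _ _).trans (add_le_add (B 0) (B 2))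
  have n3 : ‖s * millsMoment 3 s‖ ≤ 3 * M 2 + M 4 := by
    rw [e3]
    refine (norm_sub_le _ _).trans (add_le_add ?_ (B 4))
    rw [norm_mul, Complex.norm_ofNat]
    linarith [B 2]
  have n5 : ‖s * millsMoment 5 s‖ ≤ 5 * M 4 + M 6 := by
    rw [e5]
    refine (norm_sub_le _ _).trans (add_le_add ?_ (B 6))
    rw [norm_mul, Complex.norm_ofNat]
    linarith [B 4]
  have f2 : s ^ 2 * millsMoment 1 s = 1 - 3 * millsMoment 1 s + millsMoment 3 s := by
    have : s ^ 2 * millsMoment 1 s = s * mills s - s * millsMoment 2 s := by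
      rw [r0]; linear_combination s * e1
    rw [this, r3]
    linear_combination r1
  have f3 : s ^ 2 * (s ^ 2 * millsMoment 1 s - 1) + 3
      = 15 * millsMoment 1 s - 10 * millsMoment 3 s + millsMoment 5 s := by
    have : s ^ 2 * millsMoment 3 s = 6 * millsMoment 1 s - 7 * millsMoment 3 s
        + millsMoment 5 s := by
      linear_combination s * e3 + 3 * r3 - r5
    rw [f2]
    linear_combination -3 * f2 + this
  rw [← r1]
  refine ⟨?_, ?_, ?_⟩
  · rw [le_div_iff₀ hs0, ← norm_mul, mul_comm]; linarith
  · rw [le_div_iff₀ hs0, ← norm_mul, f2]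
    have : (1 - 3 * millsMoment 1 s + millsMoment 3 s - 1) * s
      = -(3 * (s * millsMoment 1 s)) + s * millsMoment 3 s := by ring
    rw [this]
    refine (norm_add_le _ _).trans ?_
    rw [norm_neg, norm_mul, Complex.norm_ofNat]
    linarith
  · rw [le_div_iff₀ hs0, ← norm_mul, f3]
    have : (15 * millsMoment 1 s - 10 * millsMoment 3 s + millsMoment 5 s) * s
      = 15 * (s * millsMoment 1 s) - 10 * (s * millsMoment 3 s) + s * millsMoment 5 s := by ring
    rw [this]
    refine (norm_add_le _ _).trans ((add_le_add_left (norm_sub_le _ _) _).trans ?_)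
    have c1 : ‖15 * (s * millsMoment 1 s)‖ = 15 * ‖s * millsMoment 1 s‖ := by
      rw [norm_mul, Complex.norm_ofNat]
    have c2 : ‖10 * (s * millsMoment 3 s)‖ = 10 * ‖s * millsMoment 3 s‖ := by
      rw [norm_mul, Complex.norm_ofNat]
    rw [c1, c2]
    linarith

/-- `s³ D(s, m / s)` is close to `6 (m - 1)³` for large `s` in the right half-plane. -/
lemma exists_dispersion_asymptotic : ∃ C : ℝ, 0 < C ∧ ∀ s : ℂ, 0 ≤ s.re → 1 ≤ ‖s‖ → ∀ m : ℂ,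
    ‖s ^ 3 * dispersion s (m / s) - 6 * (m - 1) ^ 3‖ ≤ C / ‖s‖ * (1 + ‖m‖) ^ 2 := by
  obtain ⟨K, hK, h⟩ := exists_mills_asymptotic
  refine ⟨K * (8 * K + 60), by positivity, fun s hs hs1 m => ?_⟩
  obtain ⟨h1, h2, h3⟩ := h s hs hs1
  have hs0 : 0 < ‖s‖ := by linarith
  rw [dispersion, dispersion_expansion (norm_pos_iff.1 hs0)]
  set u := 1 - s * mills s
  set a := s ^ 2 * u - 1 with ha
  set b := s ^ 2 * a + 3
  have ha' : s ^ 2 * u = a + 1 := by rw [ha]; ring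
  rw [ha']
  set ε := K / ‖s‖ with hε
  have hε0 : 0 ≤ ε := by positivity
  have hεK : ε ≤ K := div_le_self (by linarith) hs1
  have hm := norm_nonneg m
  have m1 : ‖m - 1‖ ≤ 1 + ‖m‖ := by
    refine (norm_sub_le _ _).trans ?_
    rw [norm_one]; linarith
  have m2 : ‖1 - m‖ ≤ 1 + ‖m‖ := by rwa [norm_sub_rev]
  have t1 : ‖(m - 1) ^ 2 * b‖ ≤ (1 + ‖m‖) ^ 2 * ε := by
    rw [norm_mul, norm_pow]; gcongr
  have t2 : ‖4 * m * (u ^ 2 - 2 * u)‖ ≤ 4 * ‖m‖ * (ε * (K + 2)) := by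
    rw [show u ^ 2 - 2 * u = u * (u - 2) by ring, norm_mul, norm_mul, norm_mul, Complex.norm_ofNat]
    gcongr
    refine (norm_sub_le _ _).trans ?_
    rw [Complex.norm_ofNat]; linarith
  have t3 : ‖11 * u * m ^ 2‖ ≤ 11 * ε * ‖m‖ ^ 2 := by
    rw [norm_mul, norm_mul, norm_pow, Complex.norm_ofNat]; gcongr
  have t4 : ‖a * (-3 + 8 * m - 4 * m ^ 2)‖ ≤ ε * (3 + 8 * ‖m‖ + 4 * ‖m‖ ^ 2) := by
    rw [norm_mul]
    gcongr
    refine (norm_sub_le _ _).trans (add_le_add ((norm_add_le _ _).trans (add_le_add ?_ ?_)) ?_) <;>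
    simp
  have t5 : ‖4 * (a + 1) * u * (1 - m)‖ ≤ 4 * (K + 1) * ε * (1 + ‖m‖) := by
    rw [norm_mul, norm_mul, norm_mul, Complex.norm_ofNat]
    gcongr
    refine (norm_add_le _ _).trans ?_
    rw [norm_one]; linarith
  refine (norm_add_le _ _).trans ?_
  have := norm_add_le ((m - 1) ^ 2 * b) (4 * m * (u ^ 2 - 2 * u))
  have := norm_add_le ((m - 1) ^ 2 * b + 4 * m * (u ^ 2 - 2 * u)) (11 * u * m ^ 2)
  have := norm_add_le ((m - 1) ^ 2 * b + 4 * m * (u ^ 2 - 2 * u) + 11 * u * m ^ 2)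
    (a * (-3 + 8 * m - 4 * m ^ 2))
  have e : K * (8 * K + 60) / ‖s‖ * (1 + ‖m‖) ^ 2 = ε * ((8 * K + 60) * (1 + ‖m‖) ^ 2) := by
    rw [hε]; ring
  rw [e]
  have key : (1 + ‖m‖) ^ 2 + 4 * ‖m‖ * (K + 2) + 11 * ‖m‖ ^ 2 + (3 + 8 * ‖m‖ + 4 * ‖m‖ ^ 2)
      + 4 * (K + 1) * (1 + ‖m‖) ≤ (8 * K + 60) * (1 + ‖m‖) ^ 2 := by
    nlinarith [mul_nonneg (by linarith : (0 : ℝ) ≤ K) hm, mul_nonneg (by linarith : (0 : ℝ) ≤ K) (sq_nonneg ‖m‖), sq_nonneg ‖m‖]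
  have := mul_le_mul_of_nonneg_left key hε0
  linarith

/-- Zeros of the dispersion function which are large lie near `κ s = 1`. -/
lemma exists_dispersion_zero_near {δ : ℝ} (hδ : 0 < δ) (hδ1 : δ ≤ 1) :
    ∃ R : ℝ, 1 ≤ R ∧ ∀ s κ : ℂ, 0 ≤ s.re → R ≤ ‖s‖ → dispersion s κ = 0 → ‖κ * s - 1‖ < δ := by
  obtain ⟨C, hC, h⟩ := exists_dispersion_asymptotic
  refine ⟨1 + 2 * C / δ ^ 3, by have : 0 ≤ 2 * C / δ ^ 3 := by positivity
                                linarith, fun s κ hs hR h0 => ?_⟩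
  have h2 : 0 < 2 * C / δ ^ 3 := by positivity
  have hs1 : 1 ≤ ‖s‖ := by linarith
  have hs0 : 0 < ‖s‖ := by linarith
  have h1 := h s hs hs1 (κ * s)
  rw [mul_div_cancel_right₀ _ (norm_pos_iff.1 hs0), h0, mul_zero, zero_sub, norm_neg, norm_mul,
    norm_pow, Complex.norm_ofNat] at h1
  by_contra hcon
  push Not at hcon
  set x := ‖κ * s - 1‖
  have hm : 1 + ‖κ * s‖ ≤ 3 * x / δ := by
    have : ‖κ * s‖ ≤ x + 1 := by
      have := norm_add_le (κ * s - 1) 1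
      rwa [sub_add_cancel, norm_one] at this
    rw [le_div_iff₀ hδ]
    nlinarith
  have hx : 0 < x := by linarith
  have h3 : 6 * x ^ 3 ≤ C / ‖s‖ * (3 * x / δ) ^ 2 := h1.trans (by gcongr)
  have h4 : 6 * x ^ 3 * (‖s‖ * δ ^ 2) ≤ 9 * C * x ^ 2 := by
    have : C / ‖s‖ * (3 * x / δ) ^ 2 * (‖s‖ * δ ^ 2) = 9 * C * x ^ 2 := by
      field_simp; norm_num
    rw [← this]; gcongr
  have h5 : 6 * x * (‖s‖ * δ ^ 2) ≤ 9 * C := by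
    have hx2 : 0 < x ^ 2 := by positivity
    nlinarith
  have h6 : 2 * C < ‖s‖ * δ ^ 3 := by
    have : 2 * C / δ ^ 3 < ‖s‖ := by linarith
    rwa [div_lt_iff₀ (by positivity)] at this
  have h7 : 6 * δ * (‖s‖ * δ ^ 2) ≤ 6 * x * (‖s‖ * δ ^ 2) := by gcongr
  nlinarith

/-! ### The Mills function on the imaginary axis -/

/-- The real part of `W(i y)`. -/
def gaussPart (y : ℝ) : ℝ := √(Real.pi / 2) * Real.exp (-(y ^ 2 / 2))

/-- Dawson's integral divided by its argument: `W(i y)` has imaginary part `-y δ(y)`. -/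
def dawsonRatio (y : ℝ) : ℝ := ∫ θ in (0 : ℝ)..1, Real.exp (-((1 - θ ^ 2) * (y ^ 2 / 2)))

lemma hasDerivAt_exp_sq_half (t : ℝ) :
    HasDerivAt (fun t : ℝ => Real.exp (t ^ 2 / 2)) (t * Real.exp (t ^ 2 / 2)) t := by
  have h := (((hasDerivAt_id' t).fun_pow 2).div_const 2).exp
  refine h.congr_deriv ?_
  push_cast
  ring

lemma dawson_eq (y : ℝ) :
    y * dawsonRatio y = Real.exp (-(y ^ 2 / 2)) * ∫ t in (0 : ℝ)..y, Real.exp (t ^ 2 / 2) := by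
  have h := intervalIntegral.mul_integral_comp_mul_left (a := 0) (b := 1) (c := y)
    (f := fun t : ℝ => Real.exp (t ^ 2 / 2))
  rw [mul_zero, mul_one] at h
  rw [← h, dawsonRatio, mul_left_comm]
  refine congrArg (y * ·) ?_
  rw [← intervalIntegral.integral_const_mul]
  refine intervalIntegral.integral_congr fun θ _ => ?_
  rw [← Real.exp_add]
  ring_nf

lemma mills_imag (y : ℝ) :
    mills (I * y) = (gaussPart y : ℂ) - I * ((y * dawsonRatio y : ℝ) : ℂ) := by
  have hc : Continuous fun t : ℝ => Real.exp (t ^ 2 / 2) := by fun_prop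
  have hd : ∀ t : ℝ, HasDerivAt (fun t : ℝ => ((Real.exp (t ^ 2 / 2) : ℝ) : ℂ) * mills (I * t)
      + I * ((∫ u in (0 : ℝ)..t, Real.exp (u ^ 2 / 2) : ℝ) : ℂ)) 0 t := by
    intro t
    have h1 := (hasDerivAt_exp_sq_half t).ofReal_comp
    have h2 : HasDerivAt (fun t : ℝ => I * (t : ℂ)) I t := by
      simpa using ((hasDerivAt_id (t : ℂ)).comp_ofReal).const_mul I
    have h3 := (hasDerivAt_mills (I * t)).comp t h2
    have h4 := (intervalIntegral.integral_hasDerivAt_right (hc.intervalIntegrable 0 t)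
      (hc.stronglyMeasurableAtFilter _ _) hc.continuousAt).ofReal_comp
    refine ((h1.fun_mul h3).fun_add (h4.const_mul I)).congr_deriv ?_
    simp only [Function.comp_apply]
    push_cast
    linear_combination (t : ℂ) * cexp (t ^ 2 / 2) * mills (I * t) * I_sq
  have hconst := is_const_of_deriv_eq_zero (fun t => (hd t).differentiableAt)
    (fun t => (hd t).deriv) y 0
  have h0 : mills 0 = (√(Real.pi / 2) : ℝ) := by
    have := mills_ofReal 0
    rwa [millsR_zero, ofReal_zero] at this
  rw [dawson_eq, gaussPart]
  generalize √(Real.pi / 2) = c at h0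
  simp [h0] at hconst
  have e1 : cexp (-((y : ℂ) ^ 2 / 2)) * cexp ((y : ℂ) ^ 2 / 2) = 1 := by
    rw [← Complex.exp_add]; simp
  push_cast
  linear_combination cexp (-((y : ℂ) ^ 2 / 2)) * hconst - mills (I * y) * e1

lemma gaussPart_pos (y : ℝ) : 0 < gaussPart y := by unfold gaussPart; positivity

lemma gaussPart_antitone {x y : ℝ} (hx : 0 ≤ x) (h : x ≤ y) : gaussPart y ≤ gaussPart x := by
  unfold gaussPart; gcongr

lemma dawsonRatio_nonneg (y : ℝ) : 0 ≤ dawsonRatio y :=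
  intervalIntegral.integral_nonneg (by norm_num) fun _ _ => (Real.exp_pos _).le

lemma dawsonRatio_antitone {x y : ℝ} (hx : 0 ≤ x) (h : x ≤ y) : dawsonRatio y ≤ dawsonRatio x := by
  refine intervalIntegral.integral_mono_on (by norm_num)
    (Continuous.intervalIntegrable (by fun_prop) _ _)
    (Continuous.intervalIntegrable (by fun_prop) _ _) fun θ hθ => ?_
  have : 0 ≤ 1 - θ ^ 2 := by nlinarith [hθ.1, hθ.2]
  gcongr

/-- The derivative of Dawson's integral. -/
lemma hasDerivAt_dawson (y : ℝ) :
    HasDerivAt (fun y => y * dawsonRatio y) (1 - y * (y * dawsonRatio y)) y := by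
  have hc : Continuous fun t : ℝ => Real.exp (t ^ 2 / 2) := by fun_prop
  have h4 := intervalIntegral.integral_hasDerivAt_right (hc.intervalIntegrable 0 y)
      (hc.stronglyMeasurableAtFilter _ _) hc.continuousAt
  have h1 : HasDerivAt (fun y : ℝ => Real.exp (-(y ^ 2 / 2))) (-y * Real.exp (-(y ^ 2 / 2))) y := by
    refine ((((hasDerivAt_id' y).fun_pow 2).div_const 2).fun_neg.exp).congr_deriv ?_
    push_cast
    ring
  have e : (fun y => y * dawsonRatio y)
      = fun y => Real.exp (-(y ^ 2 / 2)) * ∫ t in (0 : ℝ)..y, Real.exp (t ^ 2 / 2) :=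
    funext dawson_eq
  rw [dawson_eq, e]
  refine (h1.fun_mul h4).congr_deriv ?_
  have e1 : Real.exp (-(y ^ 2 / 2)) * Real.exp (y ^ 2 / 2) = 1 := by
    rw [← Real.exp_add]; simp
  linear_combination e1

/-- Comparison of Dawson's integral with a subsolution of its differential equation. -/
lemma le_dawson_of_subsolution {f f' : ℝ → ℝ} {a : ℝ}
    (hf : ∀ y, a ≤ y → HasDerivAt f (f' y) y) (hsub : ∀ y, a ≤ y → f' y + y * f y ≤ 1)
    (h0 : f a ≤ a * dawsonRatio a) {y : ℝ} (hy : a ≤ y) : f y ≤ y * dawsonRatio y := by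
  have hd : ∀ t, a ≤ t → HasDerivAt
      (fun t => Real.exp (t ^ 2 / 2) * (t * dawsonRatio t - f t))
      (Real.exp (t ^ 2 / 2) * (1 - (f' t + t * f t))) t := by
    intro t ht
    refine ((hasDerivAt_exp_sq_half t).fun_mul ((hasDerivAt_dawson t).fun_sub (hf t ht))).congr_deriv ?_
    ring
  have hmono : MonotoneOn (fun t => Real.exp (t ^ 2 / 2) * (t * dawsonRatio t - f t))
      (Set.Ici a) := by
    refine monotoneOn_of_deriv_nonneg (convex_Ici a)
      (fun t ht => (hd t ht).continuousAt.continuousWithinAt)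
      (fun t ht => ((hd t (interior_subset ht)).differentiableAt).differentiableWithinAt)
      fun t ht => ?_
    have ht := interior_subset ht
    rw [(hd t ht).deriv]
    exact mul_nonneg (Real.exp_pos _).le (by linarith [hsub t ht])
  have h1 := hmono (Set.mem_Ici.2 le_rfl) (Set.mem_Ici.2 hy) hy
  have h2 : 0 ≤ Real.exp (a ^ 2 / 2) * (a * dawsonRatio a - f a) :=
    mul_nonneg (Real.exp_pos _).le (by linarith)
  have h3 := h2.trans h1
  have h4 := nonneg_of_mul_nonneg_right h3 (Real.exp_pos _)
  linarith

/-- Comparison of Dawson's integral with a supersolution of its differential equation. -/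
lemma dawson_le_of_supersolution {f f' : ℝ → ℝ} {a : ℝ}
    (hf : ∀ y, a ≤ y → HasDerivAt f (f' y) y) (hsup : ∀ y, a ≤ y → 1 ≤ f' y + y * f y)
    (h0 : a * dawsonRatio a ≤ f a) {y : ℝ} (hy : a ≤ y) : y * dawsonRatio y ≤ f y := by
  have hd : ∀ t, a ≤ t → HasDerivAt
      (fun t => Real.exp (t ^ 2 / 2) * (f t - t * dawsonRatio t))
      (Real.exp (t ^ 2 / 2) * ((f' t + t * f t) - 1)) t := by
    intro t ht
    refine ((hasDerivAt_exp_sq_half t).fun_mul ((hf t ht).fun_sub (hasDerivAt_dawson t))).congr_deriv ?_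
    ring
  have hmono : MonotoneOn (fun t => Real.exp (t ^ 2 / 2) * (f t - t * dawsonRatio t))
      (Set.Ici a) := by
    refine monotoneOn_of_deriv_nonneg (convex_Ici a)
      (fun t ht => (hd t ht).continuousAt.continuousWithinAt)
      (fun t ht => ((hd t (interior_subset ht)).differentiableAt).differentiableWithinAt)
      fun t ht => ?_
    have ht := interior_subset ht
    rw [(hd t ht).deriv]
    exact mul_nonneg (Real.exp_pos _).le (by linarith [hsup t ht])
  have h1 := hmono (Set.mem_Ici.2 le_rfl) (Set.mem_Ici.2 hy) hy
  have h2 : 0 ≤ Real.exp (a ^ 2 / 2) * (f a - a * dawsonRatio a) :=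
    mul_nonneg (Real.exp_pos _).le (by linarith)
  have h4 := nonneg_of_mul_nonneg_right (h2.trans h1) (Real.exp_pos _)
  linarith

/-! ### Real and imaginary parts of the dispersion function on the imaginary axis -/

/-- Abbreviation for the powers of `s = i y` and the products with `w = g - i y δ`. -/
lemma imag_products (y g d : ℝ) :
    (I * y : ℂ) ^ 2 = -(y : ℂ) ^ 2 ∧
    (I * y : ℂ) * (g - I * ((y * d : ℝ) : ℂ)) = I * (y * g) + (y : ℂ) ^ 2 * d := by
  refine ⟨by rw [mul_pow, I_sq]; ring, ?_⟩
  push_cast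
  linear_combination (-(y : ℂ) ^ 2 * d) * I_sq

lemma dispersionPoly_imag (y κ g d : ℝ) :
    dispersionPoly (I * y : ℂ) κ (g - I * ((y * d : ℝ) : ℂ)) =
      ((6 * κ ^ 3 + κ ^ 2 * (-(g * (y ^ 4 + 4 * y ^ 2 + 11)))
        + κ * (2 * y ^ 2 * (1 - y ^ 2 * d) + 4 * (g ^ 2 - y ^ 2 * d ^ 2) * (1 + y ^ 2) + 6)
        + g * (y ^ 2 + 8 * y ^ 2 * d - 5) : ℝ) : ℂ)
      + I * ((y * (κ ^ 2 * (-(y ^ 2 * (1 - y ^ 2 * d)) + d * (4 * y ^ 2 + 11) - 5)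
        - κ * (2 * y ^ 2 * g + 8 * g * d * (1 + y ^ 2))
        + (1 - y ^ 2 * d + 4 * (g ^ 2 - y ^ 2 * d ^ 2) + 5 * d)) : ℝ) : ℂ) := by
  obtain ⟨h2, hsw⟩ := imag_products y g d
  set s : ℂ := I * y with hs
  set w : ℂ := g - I * ((y * d : ℝ) : ℂ) with hw
  have e : dispersionPoly s (κ : ℂ) w = 6 * κ ^ 3 + κ ^ 2 * (-w * (s ^ 2) ^ 2 + 4 * w * s ^ 2
      + s ^ 2 * s - 11 * w - 5 * s)
      + κ * (2 * (s ^ 2 * (s * w)) - 4 * (s * w) ^ 2 + 4 * w ^ 2 - 2 * s ^ 2 + 6)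
      + (-w * s ^ 2 + 4 * (s * w) * w - 5 * w + s) := by
    unfold dispersionPoly; ring
  rw [e, h2, hsw, hw, hs]
  push_cast
  linear_combination (κ * (-4 * y ^ 2 * g ^ 2 + 4 * y ^ 2 * d ^ 2) - 4 * g * y ^ 2 * d) * I_sq

lemma dispersionPolyDeriv_imag (y κ g d : ℝ) :
    dispersionPolyDeriv (I * y : ℂ) κ (g - I * ((y * d : ℝ) : ℂ)) =
      ((κ ^ 2 * (-(y ^ 6 * d) + y ^ 4 - 3 * y ^ 2 * d + y ^ 2 + 6)
        + κ * (2 * y ^ 4 * g + 16 * y ^ 4 * g * d - 14 * y ^ 2 * g - 8 * g)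
        + (y ^ 4 * d - 8 * y ^ 2 * g ^ 2 + 8 * y ^ 4 * d ^ 2 - 15 * y ^ 2 * d + 4 * g ^ 2
          - 4 * y ^ 2 * d ^ 2 - y ^ 2 + 6) : ℝ) : ℂ)
      + I * ((y * (κ ^ 2 * (-(y ^ 4 * g) - 3 * g)
        + κ * (-2 * y ^ 4 * d + 8 * y ^ 2 * g ^ 2 - 8 * y ^ 4 * d ^ 2 + 14 * y ^ 2 * d + 2 * y ^ 2
          + 8 * d - 4)
        + (y ^ 2 * g + 16 * y ^ 2 * g * d - 15 * g - 8 * g * d)) : ℝ) : ℂ) := by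
  obtain ⟨h2, hsw⟩ := imag_products y g d
  set s : ℂ := I * y with hs
  set w : ℂ := g - I * ((y * d : ℝ) : ℂ) with hw
  have e : dispersionPolyDeriv s (κ : ℂ) w = κ ^ 2 * (-((s ^ 2) ^ 2 * (s * w)) + (s ^ 2) ^ 2
      - 3 * (s * w) - s ^ 2 + 6)
      + κ * (2 * w * (s ^ 2) ^ 2 - 8 * ((s * w) ^ 2 * s) + 14 * w * s ^ 2 - 2 * (s ^ 2 * s)
        - 8 * w - 4 * s)
      + (-(s ^ 2 * (s * w)) + 8 * (s * w) ^ 2 - 15 * (s * w) + 4 * w ^ 2 + s ^ 2 + 6) := by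
    unfold dispersionPolyDeriv; ring
  rw [e, h2, hsw, hw, hs]
  push_cast
  linear_combination (κ * (-8 * (y ^ 3 * g ^ 2 * I + 2 * y ^ 4 * g * d)) + 8 * y ^ 2 * g ^ 2
    + 4 * y ^ 2 * d ^ 2) * I_sq

/-! ### Rational enclosures of the Mills function on the imaginary axis -/

lemma exp_sum_remainder {x : ℝ} (hx : 0 ≤ x) (N : ℕ) :
    Real.exp x * (1 - x ^ N / N.factorial) ≤ ∑ k ∈ Finset.range N, x ^ k / k.factorial := by
  have h : HasSum (fun k : ℕ => x ^ k / k.factorial) (Real.exp x) := by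
    rw [Real.exp_eq_exp_ℝ]; exact NormedSpace.expSeries_div_hasSum_exp x
  have h1 := h.summable.sum_add_tsum_nat_add N
  rw [h.tsum_eq] at h1
  have h2 : ∑' k, x ^ (k + N) / (k + N).factorial ≤ ∑' k, x ^ N / N.factorial * (x ^ k / k.factorial) := by
    refine Summable.tsum_le_tsum (fun k => ?_) ((summable_nat_add_iff N).2 h.summable)
      (h.summable.mul_left _)
    have e : ((N.factorial * k.factorial : ℕ) : ℝ) ≤ ((k + N).factorial : ℕ) := by
      rw [mul_comm]
      exact_mod_cast Nat.le_of_dvd (Nat.factorial_pos _) (Nat.factorial_mul_factorial_dvd_factorial_add k N)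
    rw [div_mul_div_comm, pow_add, mul_comm (x ^ N)]
    push_cast at e
    gcongr
  rw [tsum_mul_left, h.tsum_eq] at h2
  linarith

/-- `∫₀¹ exp (θ² x) dθ` is close to the integral of the exponential sum. -/
lemma integral_sum_sq (x : ℝ) (N : ℕ) :
    ∫ θ in (0 : ℝ)..1, ∑ k ∈ Finset.range N, (θ ^ 2 * x) ^ k / k.factorial
      = ∑ k ∈ Finset.range N, x ^ k / (k.factorial * (2 * k + 1)) := by
  rw [intervalIntegral.integral_finsetSum fun k _ =>
    Continuous.intervalIntegrable (by fun_prop) _ _]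
  refine sum_congr rfl fun k _ => ?_
  have : ∀ θ : ℝ, (θ ^ 2 * x) ^ k / k.factorial = x ^ k / k.factorial * θ ^ (2 * k) := by
    intro θ; rw [mul_pow, ← pow_mul]; ring
  simp_rw [this]
  rw [intervalIntegral.integral_const_mul, integral_pow]
  have : (2 * (k : ℝ) + 1) ≠ 0 := by positivity
  have : (k.factorial : ℝ) ≠ 0 := by positivity
  simp
  field_simp

lemma dawsonRatio_enclosure {x ε : ℝ} (hx : 0 ≤ x) {N : ℕ} (hN : x ^ N / N.factorial ≤ ε) {y : ℝ}
    (hy : y ^ 2 / 2 = x) :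
    (∑ k ∈ Finset.range N, x ^ k / (k.factorial * (2 * k + 1))) / Real.exp x ≤ dawsonRatio y ∧
    dawsonRatio y ≤ (∑ k ∈ Finset.range N, x ^ k / (k.factorial * (2 * k + 1))) / Real.exp x + ε := by
  have e : dawsonRatio y = (∫ θ in (0 : ℝ)..1, Real.exp (θ ^ 2 * x)) / Real.exp x := by
    rw [dawsonRatio, hy, ← intervalIntegral.integral_div]
    refine intervalIntegral.integral_congr fun θ _ => ?_
    rw [← Real.exp_sub]
    ring_nf
  have hx' := Real.exp_pos x
  rw [e, ← integral_sum_sq]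
  have c1 : IntervalIntegrable (fun θ : ℝ => ∑ k ∈ Finset.range N, (θ ^ 2 * x) ^ k / k.factorial)
    volume 0 1 := Continuous.intervalIntegrable (by fun_prop) _ _
  have c2 : IntervalIntegrable (fun θ : ℝ => Real.exp (θ ^ 2 * x)) volume 0 1 :=
    Continuous.intervalIntegrable (by fun_prop) _ _
  constructor
  · gcongr
    refine intervalIntegral.integral_mono_on (by norm_num) c1 c2 fun θ _ => ?_
    exact Real.sum_le_exp_of_nonneg (by positivity) _
  · rw [div_le_iff₀ hx', add_mul, div_mul_cancel₀ _ hx'.ne']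
    have : ∫ θ in (0 : ℝ)..1, Real.exp (θ ^ 2 * x) ≤ ∫ θ in (0 : ℝ)..1,
        ((∑ k ∈ Finset.range N, (θ ^ 2 * x) ^ k / k.factorial) + ε * Real.exp x) := by
      refine intervalIntegral.integral_mono_on (by norm_num) c2
        (c1.add (Continuous.intervalIntegrable (by fun_prop) _ _)) fun θ hθ => ?_
      have h1 : θ ^ 2 * x ≤ x := mul_le_of_le_one_left hx (by nlinarith [hθ.1, hθ.2])
      have h0 : 0 ≤ θ ^ 2 * x := by positivity
      have h2 := exp_sum_remainder h0 N
      have h3 : Real.exp (θ ^ 2 * x) * ((θ ^ 2 * x) ^ N / N.factorial) ≤ Real.exp x * ε := by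
        refine mul_le_mul (by gcongr) (le_trans (by gcongr) hN) (by positivity) (by positivity)
      linarith
    rwa [intervalIntegral.integral_add c1 (Continuous.intervalIntegrable (by fun_prop) _ _),
      intervalIntegral.integral_const, smul_eq_mul, sub_zero, one_mul] at this

/-- Numerators and denominators of the partial sums of `∑ xᵏ / k!` and `∑ xᵏ / (k! (2 k + 1))` at
`x = a / b`. -/
structure SeriesState where
  D : ℕ
  E : ℕ
  p : ℕ
  s : ℕ
  t : ℕ

def SeriesState.step (a b : ℕ) (n : ℕ) (σ : SeriesState) : SeriesState where
  D := σ.D * (b * (n + 1))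
  E := σ.E * (2 * n + 3)
  p := σ.p * a
  s := σ.s * (b * (n + 1)) + σ.p * a
  t := σ.t * (b * (n + 1) * (2 * n + 3)) + σ.p * a * σ.E

def seriesState (a b : ℕ) (n : ℕ) : SeriesState :=
  Nat.rec ⟨1, 1, 1, 1, 1⟩ (fun n σ => σ.step a b n) n

lemma seriesState_spec (a : ℕ) {b : ℕ} (hb : 0 < b) (n : ℕ) :
    0 < (seriesState a b n).D ∧ 0 < (seriesState a b n).E ∧
    ((seriesState a b n).p / (seriesState a b n).D : ℝ) = (a / b : ℝ) ^ n / n.factorial ∧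
    ((seriesState a b n).s / (seriesState a b n).D : ℝ)
      = ∑ k ∈ Finset.range (n + 1), (a / b : ℝ) ^ k / k.factorial ∧
    ((seriesState a b n).t / ((seriesState a b n).D * (seriesState a b n).E) : ℝ)
      = ∑ k ∈ Finset.range (n + 1), (a / b : ℝ) ^ k / (k.factorial * (2 * k + 1)) := by
  induction n with
  | zero => simp [seriesState]
  | succ n ih =>
    obtain ⟨h1, h2, h3, h4, h5⟩ := ih
    have e : seriesState a b (n + 1) = (seriesState a b n).step a b n := rfl
    rw [e]
    set σ := seriesState a b n
    have hD : (σ.D : ℝ) ≠ 0 := by positivity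
    have hE : (σ.E : ℝ) ≠ 0 := by positivity
    have hb' : (b : ℝ) ≠ 0 := by positivity
    have hn : (n : ℝ) + 1 ≠ 0 := by positivity
    have hn3 : 2 * (n : ℝ) + 3 ≠ 0 := by positivity
    have hn3' : 2 * ((n : ℝ) + 1) + 1 ≠ 0 := by positivity
    have hf : (n.factorial : ℝ) ≠ 0 := by positivity
    have hp : ((σ.p * a : ℕ) / (σ.D * (b * (n + 1)) : ℕ) : ℝ) = (a / b : ℝ) ^ (n + 1) / (n + 1).factorial := by
      rw [pow_succ, Nat.factorial_succ]
      push_cast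
      rw [mul_comm ((n : ℝ) + 1) (n.factorial : ℝ), mul_div_mul_comm, h3]
      field_simp
    refine ⟨by simp only [SeriesState.step]; positivity, by simp only [SeriesState.step]; positivity,
      hp, ?_, ?_⟩
    · rw [Finset.sum_range_succ, ← h4, ← hp]
      simp only [SeriesState.step]
      push_cast
      field_simp
    · have e2 : (a / b : ℝ) ^ (n + 1) / ((n + 1).factorial * (2 * (n + 1 : ℕ) + 1))
          = (a / b : ℝ) ^ (n + 1) / (n + 1).factorial / (2 * n + 3) := by
        rw [div_div]; push_cast; ring_nf
      rw [Finset.sum_range_succ, ← h5, e2, ← hp]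
      simp only [SeriesState.step]
      push_cast
      field_simp

/-- The partial sums of length `41` at `x = y² / 2`, `y = j / 1024`. -/
def gridSeries (j : ℕ) : SeriesState := seriesState (j * j) 2097152 40

/-- Lower and upper bounds for `2²⁰ √(π/2) exp (-y²/2)` and `2²⁰ δ(y)` at `y = j / 1024`. -/
def gaussLo (j : ℕ) : ℕ := 1253314 * 1048576 * (gridSeries j).D / (1000000 * (gridSeries j).s) - 1

def gaussHi (j : ℕ) : ℕ := 1253315 * 1048576 * (gridSeries j).D / (1000000 * (gridSeries j).s) + 1

def dawsonLo (j : ℕ) : ℕ := (gridSeries j).t * 1048576 / ((gridSeries j).s * (gridSeries j).E) - 1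

def dawsonHi (j : ℕ) : ℕ := (gridSeries j).t * 1048576 / ((gridSeries j).s * (gridSeries j).E) + 2

lemma gridSeries_spec (j : ℕ) :
    0 < (gridSeries j).D ∧ 0 < (gridSeries j).E ∧
    ((gridSeries j).s / (gridSeries j).D : ℝ)
      = ∑ k ∈ Finset.range 41, ((j : ℝ) ^ 2 / 2097152) ^ k / k.factorial ∧
    ((gridSeries j).t / ((gridSeries j).D * (gridSeries j).E) : ℝ)
      = ∑ k ∈ Finset.range 41, ((j : ℝ) ^ 2 / 2097152) ^ k / (k.factorial * (2 * k + 1)) := by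
  have h : ∀ b N : ℕ, 0 < b → 0 < (seriesState (j * j) b N).D ∧ 0 < (seriesState (j * j) b N).E ∧
    ((seriesState (j * j) b N).s / (seriesState (j * j) b N).D : ℝ)
      = ∑ k ∈ Finset.range (N + 1), ((j : ℝ) ^ 2 / b) ^ k / k.factorial ∧
    ((seriesState (j * j) b N).t / ((seriesState (j * j) b N).D * (seriesState (j * j) b N).E) : ℝ)
      = ∑ k ∈ Finset.range (N + 1), ((j : ℝ) ^ 2 / b) ^ k / (k.factorial * (2 * k + 1)) := by
    intro b N hb
    obtain ⟨h1, h2, -, h4, h5⟩ := seriesState_spec (j * j) hb N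
    have e : ((j * j : ℕ) : ℝ) = (j : ℝ) ^ 2 := by push_cast; ring
    rw [e] at h4 h5
    exact ⟨h1, h2, h4, h5⟩
  have h' := h 2097152 40 (by norm_num)
  rw [Nat.cast_ofNat] at h'
  exact h'

lemma sqrt_pi_half_bounds : 1253314 / 1000000 ≤ √(Real.pi / 2) ∧
    √(Real.pi / 2) ≤ 1253315 / 1000000 := by
  have h1 := Real.pi_gt_d6
  have h2 := Real.pi_lt_d6
  constructor
  · apply Real.le_sqrt_of_sq_le; norm_num; linarith
  · rw [Real.sqrt_le_left (by norm_num)]; norm_num; linarith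

lemma nat_sub_one_le_div {a b : ℕ} {r : ℝ} (hr0 : 0 ≤ r) (hr : (a / b : ℝ) - 1 ≤ r) :
    ((a / b - 1 : ℕ) : ℝ) ≤ r := by
  rcases Nat.eq_zero_or_pos (a / b) with h | h
  · rw [h]; simpa using hr0
  · rw [Nat.cast_sub h, Nat.cast_one]
    have : ((a / b : ℕ) : ℝ) ≤ a / b := Nat.cast_div_le
    linarith

lemma div_le_nat_add_one (a : ℕ) {b : ℕ} (hb : 0 < b) : (a / b : ℝ) ≤ ((a / b : ℕ) : ℝ) + 1 := by
  rw [div_le_iff₀ (by positivity)]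
  have := Nat.lt_div_mul_add hb (a := a)
  have h : (a : ℝ) < ((a / b * b + b : ℕ) : ℝ) := by exact_mod_cast this
  push_cast at h
  linarith

lemma grid_bounds {j : ℕ} (hj : j ≤ 4608) :
    (gaussLo j : ℝ) ≤ 1048576 * gaussPart (j / 1024) ∧
    1048576 * gaussPart (j / 1024) ≤ gaussHi j ∧
    (dawsonLo j : ℝ) ≤ 1048576 * dawsonRatio (j / 1024) ∧
    1048576 * dawsonRatio (j / 1024) ≤ dawsonHi j := by
  obtain ⟨hD, hE, h4, h5⟩ := gridSeries_spec j
  unfold gaussLo gaussHi dawsonLo dawsonHi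
  generalize gridSeries j = σ at *
  generalize hx : (j : ℝ) ^ 2 / 2097152 = x at *
  have hx0 : 0 ≤ x := by rw [← hx]; positivity
  have hxy : ((j : ℝ) / 1024) ^ 2 / 2 = x := by rw [← hx]; ring
  have hx1 : x ≤ 81 / 8 := by
    have : (j : ℝ) ≤ 4608 := by exact_mod_cast hj
    rw [← hxy]
    have : (j : ℝ) / 1024 ≤ 9 / 2 := by linarith
    have : ((j : ℝ) / 1024) ^ 2 ≤ (9 / 2) ^ 2 := by gcongr
    linarith
  have hε : x ^ 41 / (Nat.factorial 41 : ℝ) ≤ 1 / 10000000 := by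
    calc x ^ 41 / (Nat.factorial 41 : ℝ) ≤ (81 / 8) ^ 41 / (Nat.factorial 41 : ℝ) := by gcongr
      _ ≤ 1 / 10000000 := by norm_num [Nat.factorial]
  have r1 := Real.sum_le_exp_of_nonneg hx0 41
  have r2 := exp_sum_remainder hx0 41
  obtain ⟨r3, r4⟩ := dawsonRatio_enclosure hx0 hε hxy
  set A := ∑ k ∈ Finset.range 41, x ^ k / (k.factorial : ℝ) with hA
  set B := ∑ k ∈ Finset.range 41, x ^ k / ((k.factorial : ℝ) * (2 * k + 1)) with hB
  have hA' : (σ.s : ℝ) / σ.D = A := h4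
  have hB' : (σ.t : ℝ) / (σ.D * σ.E) = B := h5
  have hex := Real.exp_pos x
  have r2' : Real.exp x * (1 - 1 / 10000000) ≤ A := le_trans (by gcongr) r2
  have hA0 : 0 < A := lt_of_lt_of_le (by positivity) r2'
  have hs : 0 < σ.s := by
    rcases Nat.eq_zero_or_pos σ.s with h | h
    · rw [h] at hA'; simp at hA'; linarith
    · exact h
  have hBA : B ≤ A := by
    refine Finset.sum_le_sum fun k _ => ?_
    gcongr
    have : (0 : ℝ) ≤ k := by positivity
    exact le_mul_of_one_le_right (by positivity) (by linarith)
  have hB0 : 0 ≤ B := Finset.sum_nonneg fun k _ => by positivity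
  have hDr : (0 : ℝ) < σ.D := by positivity
  have hEr : (0 : ℝ) < σ.E := by positivity
  have hsr : (0 : ℝ) < σ.s := by positivity
  have inv1 : 1 / Real.exp x ≤ 1 / A := by gcongr
  have inv2 : 1 / A - 1 / 10000000 * (1 / A) ≤ 1 / Real.exp x := by
    rw [show 1 / A - 1 / 10000000 * (1 / A) = (1 - 1 / 10000000) / A by ring, div_le_div_iff₀ hA0 hex]
    linarith
  have hA1 : 1 ≤ A := by
    rw [hA, Finset.sum_range_succ']
    have : 0 ≤ ∑ k ∈ Finset.range 40, x ^ (k + 1) / ((k + 1).factorial : ℝ) :=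
      Finset.sum_nonneg fun k _ => by positivity
    simp; linarith
  have hA1' : 1 / A ≤ 1 := by rw [div_le_one hA0]; exact hA1
  have hg : gaussPart (j / 1024) = √(Real.pi / 2) * (1 / Real.exp x) := by
    rw [gaussPart, hxy, Real.exp_neg, one_div]
  obtain ⟨p1, p2⟩ := sqrt_pi_half_bounds
  have q1 : ((1253314 * 1048576 * σ.D : ℕ) : ℝ) / ((1000000 * σ.s : ℕ) : ℝ)
      = 1048576 * (1253314 / 1000000 * (1 / A)) := by
    rw [← hA']; push_cast; field_simp; norm_num
  have q2 : ((1253315 * 1048576 * σ.D : ℕ) : ℝ) / ((1000000 * σ.s : ℕ) : ℝ)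
      = 1048576 * (1253315 / 1000000 * (1 / A)) := by
    rw [← hA']; push_cast; field_simp; norm_num
  have q3 : ((σ.t * 1048576 : ℕ) : ℝ) / ((σ.s * σ.E : ℕ) : ℝ) = 1048576 * (B * (1 / A)) := by
    rw [← hA', ← hB']; push_cast; field_simp
  have hAi : 0 ≤ 1 / A := by positivity
  have hBi : B * (1 / A) ≤ 1 := by rw [mul_one_div, div_le_one hA0]; exact hBA
  refine ⟨?_, ?_, ?_, ?_⟩
  · refine nat_sub_one_le_div (by have := gaussPart_pos ((j : ℝ) / 1024); positivity) ?_
    rw [q1, hg]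
    have : 1253314 / 1000000 * (1 / A - 1 / 10000000 * (1 / A)) ≤ √(Real.pi / 2) * (1 / Real.exp x) := by
      gcongr
      linarith
    nlinarith
  · rw [hg]
    have h := div_le_nat_add_one (1253315 * 1048576 * σ.D) (b := 1000000 * σ.s) (by positivity)
    rw [q2] at h
    push_cast
    push_cast at h
    refine le_trans ?_ h
    gcongr
  · refine nat_sub_one_le_div (by have := dawsonRatio_nonneg ((j : ℝ) / 1024); positivity) ?_
    rw [q3]
    have : B * (1 / A - 1 / 10000000 * (1 / A)) ≤ dawsonRatio (j / 1024) := by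
      refine le_trans ?_ r3
      rw [div_eq_mul_one_div B]
      gcongr
    nlinarith
  · have h := div_le_nat_add_one (σ.t * 1048576) (b := σ.s * σ.E) (by positivity)
    rw [q3] at h
    push_cast
    have : dawsonRatio (j / 1024) ≤ B * (1 / A) + 1 / 10000000 := by
      refine r4.trans ?_
      rw [div_eq_mul_one_div B]
      gcongr
    linarith

/-! ### Sign tests on boxes

The positive and negative parts of the real and imaginary parts of the dispersion function at
`s = i y`, homogenised with `S = 2²⁰`. The same expressions are evaluated on naturals (by the kernel)
and on reals. -/

section SignPolys

variable {R : Type*} [Add R] [Mul R] [NatCast R]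

def gridScale (R : Type*) [NatCast R] : R := ((1048576 : ℕ) : R)

local notation "S" => gridScale R
local notation "c" => (Nat.cast : ℕ → R)

def reP (k q g d : R) : R :=
  k * (c 6 * (k * k) * (S * S) + (c 2 * q * S * S * S + c 6 * (S * S * S * S)
    + c 4 * (g * g) * (S + q) * S)) + g * q * (S * S) * (S + c 8 * d)

def reM (k q g d : R) : R :=
  k * (k * g * (q * (q + c 4 * S) + c 11 * (S * S)) + (c 2 * (q * q) * d * S
    + c 4 * q * (d * d) * (S + q))) + c 5 * g * (S * S * S * S)

def imP (k q g d : R) : R :=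
  k * k * (d * (q * (q + c 4 * S) + c 11 * (S * S))) + S * S * S * (S * S + c 4 * (g * g)
    + c 5 * d * S)

def imM (k q g d : R) : R :=
  k * (k * (q * (S * S) + c 5 * (S * S * S)) + (c 2 * q * g * (S * S) + c 8 * g * d * (S + q) * S))
    + q * d * (S * S) * (S + c 4 * d)

/-- The same for large `y`, in terms of `p = y² δ` and `e = p - 1`. -/
def rePFar (k q g p : R) : R :=
  k * (c 6 * (k * k) * (S * S) + (c 6 * (S * S * S * S) + c 4 * (g * g) * (S + q) * S))
    + g * (S * S * S) * (q + c 8 * p)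

def reMFar (k q g d p e : R) : R :=
  k * (k * g * (q * (q + c 4 * S) + c 11 * (S * S)) + (S * S) * (c 2 * q * e + c 4 * p * (d + p)))
    + c 5 * g * (S * S * S * S)

def imPFar (k q g d p e : R) : R :=
  k * k * (S * (q * e + S * (c 4 * p + c 11 * d))) + S * S * S * (c 4 * (g * g) + c 5 * d * S)

def imMFar (k q g d p e : R) : R :=
  k * (c 5 * k * (S * S * S) + g * (S * S) * (c 2 * q + c 8 * (d + p)))
    + S * S * S * (e * S + c 4 * p * d)

end SignPolys

/-- Bisection of an interval in `κ`. -/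
def checkInterval (T : ℕ → ℕ → Bool) (fuel : ℕ) : ℕ → ℕ → Bool :=
  Nat.rec T (fun _ ih a b => T a b || (ih a ((a + b) / 2) && ih ((a + b) / 2) b)) fuel

/-- Bisection of an interval in `y`. -/
def checkStrip (T : ℕ → ℕ → Bool) (fuel : ℕ) : ℕ → ℕ → Bool :=
  Nat.rec T (fun _ ih i j => T i j || (ih i ((i + j) / 2) && ih ((i + j) / 2) j)) fuel

lemma checkInterval_sound {T : ℕ → ℕ → Bool} {P : ℝ → Prop} {c : ℝ}
    (h : ∀ a b, T a b = true → ∀ x : ℝ, a ≤ c * x → c * x ≤ b → P x) {fuel a b : ℕ}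
    (hc : checkInterval T fuel a b = true) : ∀ x : ℝ, a ≤ c * x → c * x ≤ b → P x := by
  induction fuel generalizing a b with
  | zero => exact h a b hc
  | succ n ih =>
    change (T a b || (checkInterval T n a ((a + b) / 2) && checkInterval T n ((a + b) / 2) b)) = true at hc
    simp only [Bool.or_eq_true, Bool.and_eq_true] at hc
    rcases hc with hc | ⟨h1, h2⟩
    · exact h a b hc
    · intro x hx hx'
      rcases le_total (c * x) (((a + b) / 2 : ℕ) : ℝ) with h3 | h3
      · exact ih h1 x hx h3
      · exact ih h2 x h3 hx'

/-- Enclosures at the left and right ends of a strip. -/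
structure StripData where
  q0 : ℕ
  g0 : ℕ
  d0 : ℕ
  q1 : ℕ
  g1 : ℕ
  d1 : ℕ

def stripData (i j : ℕ) : StripData :=
  ⟨i * i, gaussLo j, dawsonLo j, j * j, gaussHi i, dawsonHi i⟩

def nearTest (σ : StripData) (a b : ℕ) : Bool :=
  Nat.blt (reM b σ.q1 σ.g1 σ.d1) (reP a σ.q0 σ.g0 σ.d0)
  || (Nat.blt (reP b σ.q1 σ.g1 σ.d1) (reM a σ.q0 σ.g0 σ.d0)
  || (Nat.blt (imM b σ.q1 σ.g1 σ.d1) (imP a σ.q0 σ.g0 σ.d0)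
  || Nat.blt (imP b σ.q1 σ.g1 σ.d1) (imM a σ.q0 σ.g0 σ.d0)))

def farTest (σ : StripData) (p0 p1 : ℕ) (a b : ℕ) : Bool :=
  Nat.blt (reMFar b σ.q1 σ.g1 σ.d1 p1 (p1 - 1048576)) (rePFar a σ.q0 σ.g0 p0)
  || (Nat.blt (rePFar b σ.q1 σ.g1 p1) (reMFar a σ.q0 σ.g0 σ.d0 p0 (p0 - 1048576))
  || (Nat.blt (imMFar b σ.q1 σ.g1 σ.d1 p1 (p1 - 1048576)) (imPFar a σ.q0 σ.g0 σ.d0 p0 (p0 - 1048576))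
  || Nat.blt (imPFar b σ.q1 σ.g1 σ.d1 p1 (p1 - 1048576)) (imMFar a σ.q0 σ.g0 σ.d0 p0 (p0 - 1048576))))

def nearStrip (fuel : ℕ) (a b : ℕ) (i j : ℕ) : Bool :=
  checkInterval (nearTest (stripData i j)) fuel a b

def farStrip (fuel : ℕ) (a b : ℕ) (i j : ℕ) : Bool :=
  Nat.ble 1048576 (j * j * dawsonLo j / 1048576) &&
  checkInterval (farTest (stripData i j) (j * j * dawsonLo j / 1048576)
    (i * i * dawsonHi i / 1048576 + 1)) fuel a b

set_option maxRecDepth 100000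

lemma check_near_left : checkStrip (nearStrip 9 0 3145728) 12 0 1344 = true := by decide +kernel

lemma check_near_middle :
    checkStrip (fun i j => nearStrip 9 0 1261568 i j && nearStrip 9 1474560 3145728 i j) 12 1344 1472
      = true := by decide +kernel

lemma check_near_right : checkStrip (nearStrip 9 0 3145728) 12 1472 2304 = true := by decide +kernel

lemma check_far : checkStrip (farStrip 9 0 3145728) 12 2304 4608 = true := by decide +kernel

/-- Real part of the dispersion function on the imaginary axis. -/
def imagAxisRe (y κ g d : ℝ) : ℝ :=
  6 * κ ^ 3 + κ ^ 2 * (-(g * (y ^ 4 + 4 * y ^ 2 + 11)))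
        + κ * (2 * y ^ 2 * (1 - y ^ 2 * d) + 4 * (g ^ 2 - y ^ 2 * d ^ 2) * (1 + y ^ 2) + 6)
        + g * (y ^ 2 + 8 * y ^ 2 * d - 5)

/-- Imaginary part of the dispersion function on the imaginary axis, divided by `y`. -/
def imagAxisIm (y κ g d : ℝ) : ℝ :=
  κ ^ 2 * (-(y ^ 2 * (1 - y ^ 2 * d)) + d * (4 * y ^ 2 + 11) - 5)
        - κ * (2 * y ^ 2 * g + 8 * g * d * (1 + y ^ 2))
        + (1 - y ^ 2 * d + 4 * (g ^ 2 - y ^ 2 * d ^ 2) + 5 * d)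

lemma dispersion_imag (y κ : ℝ) : dispersion (I * y) κ =
    (imagAxisRe y κ (gaussPart y) (dawsonRatio y) : ℂ)
      + I * ((y * imagAxisIm y κ (gaussPart y) (dawsonRatio y) : ℝ) : ℂ) := by
  rw [dispersion, mills_imag, dispersionPoly_imag]
  rfl

section Casts

lemma cast_reP (k q g d : ℕ) : ((reP k q g d : ℕ) : ℝ) = reP (k : ℝ) q g d := by
  simp only [reP, gridScale]; push_cast; ring
lemma cast_reM (k q g d : ℕ) : ((reM k q g d : ℕ) : ℝ) = reM (k : ℝ) q g d := by
  simp only [reM, gridScale]; push_cast; ring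
lemma cast_imP (k q g d : ℕ) : ((imP k q g d : ℕ) : ℝ) = imP (k : ℝ) q g d := by
  simp only [imP, gridScale]; push_cast; ring
lemma cast_imM (k q g d : ℕ) : ((imM k q g d : ℕ) : ℝ) = imM (k : ℝ) q g d := by
  simp only [imM, gridScale]; push_cast; ring
lemma cast_rePFar (k q g p : ℕ) : ((rePFar k q g p : ℕ) : ℝ) = rePFar (k : ℝ) q g p := by
  simp only [rePFar, gridScale]; push_cast; ring
lemma cast_reMFar (k q g d p e : ℕ) :
    ((reMFar k q g d p e : ℕ) : ℝ) = reMFar (k : ℝ) q g d p e := by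
  simp only [reMFar, gridScale]; push_cast; ring
lemma cast_imPFar (k q g d p e : ℕ) :
    ((imPFar k q g d p e : ℕ) : ℝ) = imPFar (k : ℝ) q g d p e := by
  simp only [imPFar, gridScale]; push_cast; ring
lemma cast_imMFar (k q g d p e : ℕ) :
    ((imMFar k q g d p e : ℕ) : ℝ) = imMFar (k : ℝ) q g d p e := by
  simp only [imMFar, gridScale]; push_cast; ring

variable {k q g d p e k' q' g' d' p' e' : ℝ} (k0 : 0 ≤ k) (q0 : 0 ≤ q) (g0 : 0 ≤ g) (d0 : 0 ≤ d)
  (p0 : 0 ≤ p) (e0 : 0 ≤ e) (hk : k ≤ k') (hq : q ≤ q') (hg : g ≤ g') (hd : d ≤ d') (hp : p ≤ p')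
  (he : e ≤ e')
include k0 q0 g0 hk hq hg

lemma rePFar_mono (p0 : 0 ≤ p) (hp : p ≤ p') : rePFar k q g p ≤ rePFar k' q' g' p' := by
  have := k0.trans hk; have := q0.trans hq; have := g0.trans hg; have := p0.trans hp
  unfold rePFar gridScale; push_cast; gcongr

include d0 hd

lemma imagPoly_mono : reP k q g d ≤ reP k' q' g' d' ∧
    reM k q g d ≤ reM k' q' g' d' ∧
    imP k q g d ≤ imP k' q' g' d' ∧
    imM k q g d ≤ imM k' q' g' d' := by
  have := k0.trans hk; have := q0.trans hq; have := g0.trans hg; have := d0.trans hd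
  unfold reP reM imP imM gridScale; push_cast
  refine ⟨?_, ?_, ?_, ?_⟩ <;> gcongr

include p0 e0 hp he

lemma imagPolyFar_mono : reMFar k q g d p e ≤ reMFar k' q' g' d' p' e' ∧
    imPFar k q g d p e ≤ imPFar k' q' g' d' p' e' ∧
    imMFar k q g d p e ≤ imMFar k' q' g' d' p' e' := by
  have := k0.trans hk; have := q0.trans hq; have := g0.trans hg; have := d0.trans hd
  have := p0.trans hp; have := e0.trans he
  unfold reMFar imPFar imMFar gridScale; push_cast
  refine ⟨?_, ?_, ?_⟩ <;> gcongr

end Casts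

section Values

variable (y κ g d : ℝ)

local notation "C" => (1048576 : ℝ)

lemma reP_sub_reM : reP (C * κ) (C * y ^ 2) (C * g) (C * d) - reM (C * κ) (C * y ^ 2) (C * g) (C * d)
    = C ^ 5 * imagAxisRe y κ g d := by
  unfold reP reM imagAxisRe gridScale; push_cast; ring

lemma imP_sub_imM : imP (C * κ) (C * y ^ 2) (C * g) (C * d) - imM (C * κ) (C * y ^ 2) (C * g) (C * d)
    = C ^ 5 * imagAxisIm y κ g d := by
  unfold imP imM imagAxisIm gridScale; push_cast; ring

lemma rePFar_sub_reMFar : rePFar (C * κ) (C * y ^ 2) (C * g) (C * (y ^ 2 * d))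
      - reMFar (C * κ) (C * y ^ 2) (C * g) (C * d) (C * (y ^ 2 * d)) (C * (y ^ 2 * d - 1))
    = C ^ 5 * imagAxisRe y κ g d := by
  unfold rePFar reMFar imagAxisRe gridScale; push_cast; ring

lemma imPFar_sub_imMFar :
    imPFar (C * κ) (C * y ^ 2) (C * g) (C * d) (C * (y ^ 2 * d)) (C * (y ^ 2 * d - 1))
      - imMFar (C * κ) (C * y ^ 2) (C * g) (C * d) (C * (y ^ 2 * d)) (C * (y ^ 2 * d - 1))
    = C ^ 5 * imagAxisIm y κ g d := by
  unfold imPFar imMFar imagAxisIm gridScale; push_cast; ring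

end Values

/-- The dispersion function has no zero at `(i y, κ)`. -/
def NoAxisZero (y κ : ℝ) : Prop :=
  imagAxisRe y κ (gaussPart y) (dawsonRatio y) ≠ 0 ∨ imagAxisIm y κ (gaussPart y) (dawsonRatio y) ≠ 0

lemma strip_bounds {i j : ℕ} (hj : j ≤ 4608) {y : ℝ} (hi : i ≤ 1024 * y) (hy : 1024 * y ≤ j) :
    ((stripData i j).q0 : ℝ) ≤ 1048576 * y ^ 2 ∧ 1048576 * y ^ 2 ≤ (stripData i j).q1 ∧
    ((stripData i j).g0 : ℝ) ≤ 1048576 * gaussPart y ∧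
    1048576 * gaussPart y ≤ (stripData i j).g1 ∧
    ((stripData i j).d0 : ℝ) ≤ 1048576 * dawsonRatio y ∧
    1048576 * dawsonRatio y ≤ (stripData i j).d1 := by
  have hi0 : (0 : ℝ) ≤ i := by positivity
  have hy0 : 0 ≤ y := by linarith
  have hij : i ≤ j := by exact_mod_cast hi.trans hy
  obtain ⟨a1, -, a3, -⟩ := grid_bounds hj
  obtain ⟨-, b2, -, b4⟩ := grid_bounds (hij.trans hj)
  have e1 : (i : ℝ) / 1024 ≤ y := by linarith
  have e2 : y ≤ (j : ℝ) / 1024 := by linarith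
  have c1 := gaussPart_antitone (by positivity) e1
  have c2 := gaussPart_antitone hy0 e2
  have c3 := dawsonRatio_antitone (by positivity) e1
  have c4 := dawsonRatio_antitone hy0 e2
  refine ⟨?_, ?_, by simp only [stripData]; linarith, by simp only [stripData]; linarith,
    by simp only [stripData]; linarith, by simp only [stripData]; linarith⟩
  · simp only [stripData]; push_cast; nlinarith
  · simp only [stripData]; push_cast; nlinarith

lemma blt_cast {a b : ℕ} (h : Nat.blt a b = true) : (a : ℝ) < b := by
  have : a < b := by simpa [Nat.blt_eq] using h
  exact_mod_cast this

lemma nearTest_sound {i j : ℕ} (hj : j ≤ 4608) {y : ℝ} (hi : i ≤ 1024 * y) (hy : 1024 * y ≤ j)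
    {a b : ℕ} (h : nearTest (stripData i j) a b = true) {κ : ℝ} (ha : a ≤ 1048576 * κ)
    (hb : 1048576 * κ ≤ b) : NoAxisZero y κ := by
  obtain ⟨h1, h2, h3, h4, h5, h6⟩ := strip_bounds hj hi hy
  set σ := stripData i j
  have g0 := gaussPart_pos y
  have d0 := dawsonRatio_nonneg y
  set g := gaussPart y
  set d := dawsonRatio y
  have e1 := reP_sub_reM y κ g d
  have e2 := imP_sub_imM y κ g d
  have k0 : 0 ≤ 1048576 * κ := le_trans (Nat.cast_nonneg _) ha
  have q0 : 0 ≤ 1048576 * y ^ 2 := by positivity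
  have n : ∀ m : ℕ, (0 : ℝ) ≤ m := fun m => Nat.cast_nonneg m
  have G0 : 0 ≤ 1048576 * g := by positivity
  have D0 : 0 ≤ 1048576 * d := by positivity
  obtain ⟨l1, l2, l3, l4⟩ := imagPoly_mono k0 q0 G0 D0 hb h2 h4 h6
  obtain ⟨m1, m2, m3, m4⟩ := imagPoly_mono (n a) (n σ.q0) (n σ.g0) (n σ.d0) ha h1 h3 h5
  simp only [nearTest, Bool.or_eq_true] at h
  rcases h with h | h | h | h
  · left
    have := blt_cast h
    rw [cast_reP, cast_reM] at this
    intro h0; rw [show imagAxisRe y κ g d = 0 from h0] at e1; linarith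
  · left
    have := blt_cast h
    rw [cast_reP, cast_reM] at this
    intro h0; rw [show imagAxisRe y κ g d = 0 from h0] at e1; linarith
  · right
    have := blt_cast h
    rw [cast_imP, cast_imM] at this
    intro h0; rw [show imagAxisIm y κ g d = 0 from h0] at e2; linarith
  · right
    have := blt_cast h
    rw [cast_imP, cast_imM] at this
    intro h0; rw [show imagAxisIm y κ g d = 0 from h0] at e2; linarith

lemma nearStrip_sound {i j : ℕ} (hj : j ≤ 4608) {y : ℝ} (hi : i ≤ 1024 * y) (hy : 1024 * y ≤ j)
    {fuel a b : ℕ} (h : nearStrip fuel a b i j = true) {κ : ℝ} (ha : a ≤ 1048576 * κ)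
    (hb : 1048576 * κ ≤ b) : NoAxisZero y κ :=
  checkInterval_sound (P := fun κ => NoAxisZero y κ)
    (fun _ _ h _ ha hb => nearTest_sound hj hi hy h ha hb) h κ ha hb

lemma checkStrip_sound_of_le {T : ℕ → ℕ → Bool} {P : ℝ → Prop} {c : ℝ} {I J : ℕ}
    (h : ∀ a b, I ≤ a → b ≤ J → T a b = true → ∀ x : ℝ, a ≤ c * x → c * x ≤ b → P x)
    {fuel a b : ℕ} (ha : I ≤ a) (hb : b ≤ J) (hab : a ≤ b)
    (hc : checkStrip T fuel a b = true) : ∀ x : ℝ, a ≤ c * x → c * x ≤ b → P x := by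
  induction fuel generalizing a b with
  | zero => exact h a b ha hb hc
  | succ n ih =>
    change (T a b || (checkStrip T n a ((a + b) / 2) && checkStrip T n ((a + b) / 2) b)) = true at hc
    simp only [Bool.or_eq_true, Bool.and_eq_true] at hc
    rcases hc with hc | ⟨h1, h2⟩
    · exact h a b ha hb hc
    · intro x hx hx'
      rcases le_total (c * x) (((a + b) / 2 : ℕ) : ℝ) with h3 | h3
      · exact ih ha (by omega) (by omega) h1 x hx h3
      · exact ih (by omega) hb (by omega) h2 x h3 hx'

lemma checkStrip_sound {T : ℕ → ℕ → Bool} {P : ℝ → Prop} {c : ℝ} {J : ℕ}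
    (h : ∀ a b, b ≤ J → T a b = true → ∀ x : ℝ, a ≤ c * x → c * x ≤ b → P x) {fuel a b : ℕ}
    (hb : b ≤ J) (hab : a ≤ b)
    (hc : checkStrip T fuel a b = true) : ∀ x : ℝ, a ≤ c * x → c * x ≤ b → P x :=
  checkStrip_sound_of_le (I := 0) (fun a b _ => h a b) (Nat.zero_le a) hb hab hc

/-- Beyond `y = 9/4` the function `y² δ(y)` decreases. -/
lemma le_dawson_mid {y : ℝ} (hy : 9 / 4 ≤ y) : y / (y ^ 2 - 1) ≤ y * dawsonRatio y := by
  refine le_dawson_of_subsolution (a := 9 / 4) (f := fun y => y / (y ^ 2 - 1))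
    (f' := fun y => (1 * (y ^ 2 - 1) - y * (2 * y)) / (y ^ 2 - 1) ^ 2) ?_ ?_ ?_ hy
  · intro t ht
    have : t ^ 2 - 1 ≠ 0 := by nlinarith
    refine ((hasDerivAt_id' t).fun_div (((hasDerivAt_id' t).fun_pow 2).sub_const 1) this).congr_deriv ?_
    push_cast; ring
  · intro t ht
    have h : 0 < t ^ 2 - 1 := by nlinarith
    have : (1 * (t ^ 2 - 1) - t * (2 * t)) / (t ^ 2 - 1) ^ 2 + t * (t / (t ^ 2 - 1))
      = (t ^ 4 - 2 * t ^ 2 - 1) / (t ^ 2 - 1) ^ 2 := by field_simp; ring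
    rw [this, div_le_one (by positivity)]
    nlinarith
  · have h := (grid_bounds (j := 2304) (by norm_num)).2.2.1
    have h' : 260000 ≤ dawsonLo 2304 := by decide +kernel
    have h'' : (260000 : ℝ) ≤ dawsonLo 2304 := by exact_mod_cast h'
    norm_num at h ⊢
    linarith

lemma sq_dawsonRatio_antitoneOn :
    AntitoneOn (fun y => y * (y * dawsonRatio y)) (Set.Ici (9 / 4)) := by
  have hd : ∀ t : ℝ, HasDerivAt (fun y => y * (y * dawsonRatio y))
      (1 * (t * dawsonRatio t) + t * (1 - t * (t * dawsonRatio t))) t := fun t =>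
    (hasDerivAt_id' t).fun_mul (hasDerivAt_dawson t)
  refine antitoneOn_of_deriv_nonpos (convex_Ici _)
    (fun t _ => (hd t).continuousAt.continuousWithinAt)
    (fun t _ => (hd t).differentiableAt.differentiableWithinAt) fun t ht => ?_
  rw [(hd t).deriv]
  have ht' : (9 / 4 : ℝ) ≤ t := interior_subset ht
  have h := le_dawson_mid ht'
  have h0 : 0 < t ^ 2 - 1 := by nlinarith
  rw [div_le_iff₀ h0] at h
  nlinarith

lemma far_bounds {i j : ℕ} (hj : j ≤ 4608) (hi' : 2304 ≤ i) {y : ℝ} (hi : i ≤ 1024 * y)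
    (hy : 1024 * y ≤ j) (hp : 1048576 ≤ j * j * dawsonLo j / 1048576) :
    ((j * j * dawsonLo j / 1048576 : ℕ) : ℝ) ≤ 1048576 * (y ^ 2 * dawsonRatio y) ∧
    1048576 * (y ^ 2 * dawsonRatio y) ≤ ((i * i * dawsonHi i / 1048576 + 1 : ℕ) : ℝ) ∧
    ((j * j * dawsonLo j / 1048576 - 1048576 : ℕ) : ℝ) ≤ 1048576 * (y ^ 2 * dawsonRatio y - 1) ∧
    1048576 * (y ^ 2 * dawsonRatio y - 1)
      ≤ ((i * i * dawsonHi i / 1048576 + 1 - 1048576 : ℕ) : ℝ) := by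
  have hij : i ≤ j := by exact_mod_cast hi.trans hy
  have hir : (2304 : ℝ) ≤ i := by exact_mod_cast hi'
  obtain ⟨-, -, a3, -⟩ := grid_bounds hj
  obtain ⟨-, -, -, b4⟩ := grid_bounds (hij.trans hj)
  have f1 : (1024 * y) * (1024 * y * dawsonRatio y) ≤ i * i * dawsonRatio (i / 1024) := by
    have := sq_dawsonRatio_antitoneOn (a := (i : ℝ) / 1024) (b := y)
      (by rw [mem_Ici]; linarith) (by rw [mem_Ici]; linarith) (by linarith)
    simp only at this
    linarith
  have f2 : j * j * dawsonRatio (j / 1024) ≤ (1024 * y) * (1024 * y * dawsonRatio y) := by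
    have := sq_dawsonRatio_antitoneOn (a := y) (b := (j : ℝ) / 1024)
      (by rw [mem_Ici]; linarith) (by rw [mem_Ici]; linarith) (by linarith)
    simp only at this
    linarith
  have P0 : ((j * j * dawsonLo j / 1048576 : ℕ) : ℝ) ≤ 1048576 * (y ^ 2 * dawsonRatio y) := by
    have : ((j * j * dawsonLo j / 1048576 : ℕ) : ℝ) ≤ (j * j * dawsonLo j : ℕ) / (1048576 : ℕ) :=
      Nat.cast_div_le
    push_cast at this
    have h3 : (j : ℝ) * j * dawsonLo j ≤ j * j * (1048576 * dawsonRatio (j / 1024)) := by gcongr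
    linarith
  have P1 : 1048576 * (y ^ 2 * dawsonRatio y) ≤ ((i * i * dawsonHi i / 1048576 + 1 : ℕ) : ℝ) := by
    have := div_le_nat_add_one (i * i * dawsonHi i) (b := 1048576) (by norm_num)
    push_cast at this ⊢
    have h3 : (i : ℝ) * i * (1048576 * dawsonRatio (i / 1024)) ≤ i * i * dawsonHi i := by gcongr
    linarith
  refine ⟨P0, P1, ?_⟩
  generalize j * j * dawsonLo j / 1048576 = p0 at *
  generalize i * i * dawsonHi i / 1048576 + 1 = p1 at *
  have E0 : ((p0 - 1048576 : ℕ) : ℝ) ≤ 1048576 * (y ^ 2 * dawsonRatio y - 1) := by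
    rw [Nat.cast_sub hp]; push_cast; linarith
  have p01 : 1048576 ≤ p1 := by
    have : (1048576 : ℝ) ≤ p0 := by exact_mod_cast hp
    have : (1048576 : ℝ) ≤ p1 := by linarith
    exact_mod_cast this
  have E1 : 1048576 * (y ^ 2 * dawsonRatio y - 1) ≤ ((p1 - 1048576 : ℕ) : ℝ) := by
    rw [Nat.cast_sub p01]; push_cast; linarith
  exact ⟨E0, E1⟩

lemma farStrip_sound {i j : ℕ} (hj : j ≤ 4608) (hi' : 2304 ≤ i) {y : ℝ} (hi : i ≤ 1024 * y)
    (hy : 1024 * y ≤ j) {fuel a b : ℕ} (h : farStrip fuel a b i j = true) {κ : ℝ}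
    (ha : a ≤ 1048576 * κ) (hb : 1048576 * κ ≤ b) : NoAxisZero y κ := by
  simp only [farStrip, Bool.and_eq_true] at h
  obtain ⟨hp, h⟩ := h
  have hp := Nat.le_of_ble_eq_true hp
  obtain ⟨P0, P1, E0, E1⟩ := far_bounds hj hi' hi hy hp
  refine checkInterval_sound (P := fun κ => NoAxisZero y κ) (fun a b h κ ha hb => ?_) h κ ha hb
  obtain ⟨h1, h2, h3, h4, h5, h6⟩ := strip_bounds hj hi hy
  set σ := stripData i j
  generalize j * j * dawsonLo j / 1048576 = p0 at *
  generalize i * i * dawsonHi i / 1048576 + 1 = p1 at *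
  have g0 := gaussPart_pos y
  have d0 := dawsonRatio_nonneg y
  set g := gaussPart y
  set d := dawsonRatio y
  have e1 := rePFar_sub_reMFar y κ g d
  have e2 := imPFar_sub_imMFar y κ g d
  have k0 : 0 ≤ 1048576 * κ := le_trans (Nat.cast_nonneg _) ha
  have q0 : 0 ≤ 1048576 * y ^ 2 := by positivity
  have n : ∀ m : ℕ, (0 : ℝ) ≤ m := fun m => Nat.cast_nonneg m
  have G0 : 0 ≤ 1048576 * g := by positivity
  have D0 : 0 ≤ 1048576 * d := by positivity
  have PP0 : 0 ≤ 1048576 * (y ^ 2 * d) := by positivity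
  have EE0 : 0 ≤ 1048576 * (y ^ 2 * d - 1) := le_trans (n _) E0
  obtain ⟨l1, l2, l3⟩ := imagPolyFar_mono k0 q0 G0 D0 PP0 EE0 hb h2 h4 h6 P1 E1
  obtain ⟨m1, m2, m3⟩ := imagPolyFar_mono (n a) (n σ.q0) (n σ.g0) (n σ.d0) (n p0) (n _) ha h1 h3 h5
    P0 E0
  have l4 := rePFar_mono k0 q0 G0 hb h2 h4 PP0 P1
  have m4 := rePFar_mono (n a) (n σ.q0) (n σ.g0) ha h1 h3 (n p0) P0
  simp only [farTest, Bool.or_eq_true] at h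
  rcases h with h | h | h | h
  · left
    have := blt_cast h
    rw [cast_rePFar, cast_reMFar] at this
    intro h0; rw [show imagAxisRe y κ g d = 0 from h0] at e1; linarith
  · left
    have := blt_cast h
    rw [cast_rePFar, cast_reMFar] at this
    intro h0; rw [show imagAxisRe y κ g d = 0 from h0] at e1; linarith
  · right
    have := blt_cast h
    rw [cast_imPFar, cast_imMFar] at this
    intro h0; rw [show imagAxisIm y κ g d = 0 from h0] at e2; linarith
  · right
    have := blt_cast h
    rw [cast_imPFar, cast_imMFar] at this
    intro h0; rw [show imagAxisIm y κ g d = 0 from h0] at e2; linarith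

/-! ### Large `κ` on the imaginary axis -/

section LeadPolys

variable {R : Type*} [Add R] [Mul R] [NatCast R]

local notation "S" => gridScale R
local notation "c" => (Nat.cast : ℕ → R)

/-- The part of `imP` quadratic in `κ`. -/
def imLead (k q d : R) : R := k * k * (d * (q * (q + c 4 * S) + c 11 * (S * S)))

/-- The part of `imPFar` quadratic in `κ`. -/
def imLeadFar (k q d p e : R) : R := k * k * (S * (q * e + S * (c 4 * p + c 11 * d)))

end LeadPolys

def nearLeadTest (i j : ℕ) : Bool :=
  Nat.blt (imM 3145728 (stripData i j).q1 (stripData i j).g1 (stripData i j).d1)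
    (imLead 3145728 (stripData i j).q0 (stripData i j).d0)

def farLeadTest (i j : ℕ) : Bool :=
  Nat.ble 1048576 (j * j * dawsonLo j / 1048576) &&
  Nat.blt (imMFar 3145728 (stripData i j).q1 (stripData i j).g1 (stripData i j).d1
      (i * i * dawsonHi i / 1048576 + 1) (i * i * dawsonHi i / 1048576 + 1 - 1048576))
    (imLeadFar 3145728 (stripData i j).q0 (stripData i j).d0 (j * j * dawsonLo j / 1048576)
      (j * j * dawsonLo j / 1048576 - 1048576))

set_option maxRecDepth 100000

lemma check_near_lead : checkStrip nearLeadTest 12 0 2304 = true := by decide +kernel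

lemma check_far_lead : checkStrip farLeadTest 12 2304 4608 = true := by decide +kernel

lemma cast_imLead (k q d : ℕ) : ((imLead k q d : ℕ) : ℝ) = imLead (k : ℝ) q d := by
  simp only [imLead, gridScale]; push_cast; ring

lemma cast_imLeadFar (k q d p e : ℕ) :
    ((imLeadFar k q d p e : ℕ) : ℝ) = imLeadFar (k : ℝ) q d p e := by
  simp only [imLeadFar, gridScale]; push_cast; ring

lemma imLead_mono {k q d k' q' d' : ℝ} (k0 : 0 ≤ k) (q0 : 0 ≤ q) (d0 : 0 ≤ d) (hk : k ≤ k')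
    (hq : q ≤ q') (hd : d ≤ d') : imLead k q d ≤ imLead k' q' d' := by
  have := k0.trans hk; have := q0.trans hq; have := d0.trans hd
  unfold imLead gridScale; push_cast; gcongr

lemma imLeadFar_mono {k q d p e k' q' d' p' e' : ℝ} (k0 : 0 ≤ k) (q0 : 0 ≤ q) (d0 : 0 ≤ d)
    (p0 : 0 ≤ p) (e0 : 0 ≤ e) (hk : k ≤ k') (hq : q ≤ q') (hd : d ≤ d') (hp : p ≤ p')
    (he : e ≤ e') : imLeadFar k q d p e ≤ imLeadFar k' q' d' p' e' := by
  have := k0.trans hk; have := q0.trans hq; have := d0.trans hd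
  have := p0.trans hp; have := e0.trans he
  unfold imLeadFar gridScale; push_cast; gcongr

/-- `Im D / y` at `κ ≥ 3` is controlled by its value at `κ = 3` without the constant term. -/
lemma imagAxisIm_pos {y κ g d : ℝ} (hκ : 3 ≤ κ) (hg : 0 ≤ g) (hd : 0 ≤ d)
    (h : 3 * (2 * y ^ 2 * g + 8 * g * d * (1 + y ^ 2)) + (y ^ 2 * d + 4 * y ^ 2 * d ^ 2)
      < 9 * (-(y ^ 2 * (1 - y ^ 2 * d)) + d * (4 * y ^ 2 + 11) - 5)) :
    0 < imagAxisIm y κ g d := by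
  unfold imagAxisIm
  set A := -(y ^ 2 * (1 - y ^ 2 * d)) + d * (4 * y ^ 2 + 11) - 5
  set B := 2 * y ^ 2 * g + 8 * g * d * (1 + y ^ 2)
  have hB : 0 ≤ B := by positivity
  have hC : 0 ≤ y ^ 2 * d + 4 * y ^ 2 * d ^ 2 := by positivity
  have hA : 0 < A := by linarith
  have h1 : κ ^ 2 * A ≥ κ * 3 * A := by
    nlinarith [mul_nonneg (mul_nonneg (by linarith : 0 ≤ κ) (by linarith : 0 ≤ κ - 3)) hA.le]
  have h2 : κ * (3 * A - B) ≥ 3 * (3 * A - B) := by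
    have : 0 ≤ 3 * A - B := by linarith
    nlinarith
  have : 0 ≤ 4 * g ^ 2 + 5 * d := by positivity
  nlinarith

/-- The same with the constant term in terms of `p = y² δ`. -/
lemma imagAxisIm_pos_far {y κ g d : ℝ} (hκ : 3 ≤ κ) (hg : 0 ≤ g) (hd : 0 ≤ d)
    (hp : 1 ≤ y ^ 2 * d)
    (h : 3 * (2 * y ^ 2 * g + 8 * g * d * (1 + y ^ 2)) + (y ^ 2 * d - 1 + 4 * y ^ 2 * d ^ 2)
      < 9 * (-(y ^ 2 * (1 - y ^ 2 * d)) + d * (4 * y ^ 2 + 11) - 5)) :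
    0 < imagAxisIm y κ g d := by
  unfold imagAxisIm
  set A := -(y ^ 2 * (1 - y ^ 2 * d)) + d * (4 * y ^ 2 + 11) - 5
  set B := 2 * y ^ 2 * g + 8 * g * d * (1 + y ^ 2)
  have hB : 0 ≤ B := by positivity
  have hC : 0 ≤ 4 * y ^ 2 * d ^ 2 := by positivity
  have hA : 0 < A := by linarith
  have h1 : κ ^ 2 * A ≥ κ * 3 * A := by
    nlinarith [mul_nonneg (mul_nonneg (by linarith : 0 ≤ κ) (by linarith : 0 ≤ κ - 3)) hA.le]
  have h2 : κ * (3 * A - B) ≥ 3 * (3 * A - B) := by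
    have : 0 ≤ 3 * A - B := by linarith
    nlinarith
  have : 0 ≤ 4 * g ^ 2 + 5 * d := by positivity
  nlinarith

lemma nearLeadTest_sound {i j : ℕ} (hj : j ≤ 4608) (h : nearLeadTest i j = true) {y : ℝ}
    (hi : i ≤ 1024 * y) (hy : 1024 * y ≤ j) {κ : ℝ} (hκ : 3 ≤ κ) : NoAxisZero y κ := by
  obtain ⟨h1, h2, h3, h4, h5, h6⟩ := strip_bounds hj hi hy
  have h := blt_cast h
  rw [cast_imM, cast_imLead] at h
  have g0 := gaussPart_pos y
  have d0 := dawsonRatio_nonneg y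
  right
  refine (imagAxisIm_pos hκ g0.le d0 ?_).ne'
  have ⟨_, _, _, m1⟩ := imagPoly_mono (k := 3145728) (k' := (3145728 : ℕ)) (by norm_num) (by positivity)
    (by positivity) (by positivity) (by norm_num) h2 h4 h6
  have m2 := imLead_mono (k := (3145728 : ℕ)) (k' := 3145728) (by positivity) (Nat.cast_nonneg _)
    (Nat.cast_nonneg _) (by norm_num) h1 h5
  have h' := m1.trans_lt (h.trans_le m2)
  unfold imLead imM gridScale at h'
  push_cast at h'
  nlinarith

lemma farLeadTest_sound {i j : ℕ} (hj : j ≤ 4608) (hi' : 2304 ≤ i) (h : farLeadTest i j = true)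
    {y : ℝ} (hi : i ≤ 1024 * y) (hy : 1024 * y ≤ j) {κ : ℝ} (hκ : 3 ≤ κ) : NoAxisZero y κ := by
  simp only [farLeadTest, Bool.and_eq_true] at h
  obtain ⟨hp, h⟩ := h
  have hp := Nat.le_of_ble_eq_true hp
  obtain ⟨h1, h2, h3, h4, h5, h6⟩ := strip_bounds hj hi hy
  obtain ⟨P0, P1, E0, E1⟩ := far_bounds hj hi' hi hy hp
  have h := blt_cast h
  rw [cast_imMFar, cast_imLeadFar] at h
  have g0 := gaussPart_pos y
  have d0 := dawsonRatio_nonneg y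
  have hp1 : 1 ≤ y ^ 2 * dawsonRatio y := by
    have := (Nat.cast_nonneg _).trans E0
    linarith
  have hp0 : 0 ≤ y ^ 2 * dawsonRatio y - 1 := by linarith
  right
  refine (imagAxisIm_pos_far hκ g0.le d0 hp1 ?_).ne'
  have ⟨_, _, m1⟩ := imagPolyFar_mono (k := 3145728) (k' := (3145728 : ℕ)) (by norm_num) (by positivity)
    (by positivity) (by positivity) (by positivity) (by positivity) (by norm_num) h2 h4 h6 P1 E1
  have m2 := imLeadFar_mono (k := (3145728 : ℕ)) (k' := 3145728) (Nat.cast_nonneg _)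
    (Nat.cast_nonneg _) (Nat.cast_nonneg _) (Nat.cast_nonneg _) (Nat.cast_nonneg _) (by norm_num)
    h1 h5 P0 E0
  have h' := m1.trans_lt (h.trans_le m2)
  unfold imLeadFar imMFar gridScale at h'
  push_cast at h'
  nlinarith

/-! ### Large `y` -/

lemma dawson_far_bounds {y : ℝ} (hy : 9 / 2 ≤ y) :
    1 / y + 1 / y ^ 3 + 3 / 2 * (1 / y ^ 5) ≤ y * dawsonRatio y ∧
    y * dawsonRatio y ≤ 1 / y + 1 / y ^ 3 + 9 / 2 * (1 / y ^ 5) := by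
  have hd : ∀ c t : ℝ, 9 / 2 ≤ t → HasDerivAt (fun y : ℝ => 1 / y + 1 / y ^ 3 + c * (1 / y ^ 5))
      (-(1 / t ^ 2) + -(3 / t ^ 4) + c * -(5 / t ^ 6)) t := by
    intro c t ht
    have ht0 : t ≠ 0 := by linarith
    have h1 : ∀ n : ℕ, HasDerivAt (fun y : ℝ => 1 / y ^ (n + 1)) (-((n + 1) / t ^ (n + 2))) t := by
      intro n
      have := ((hasDerivAt_id' t).fun_pow (n + 1)).fun_inv (pow_ne_zero _ ht0)
      simp_rw [one_div]
      refine this.congr_deriv ?_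
      push_cast
      field_simp
      ring
    have a := h1 0
    have b := h1 2
    have d := h1 4
    norm_num at a b d
    simp_rw [one_div]
    exact (a.fun_add b).fun_add (d.const_mul c)
  constructor
  · refine le_dawson_of_subsolution (a := 9 / 2) (hd (3 / 2)) (fun t ht => ?_) ?_ hy
    · have ht0 : 0 < t := by linarith
      have : -(1 / t ^ 2) + -(3 / t ^ 4) + 3 / 2 * -(5 / t ^ 6)
          + t * (1 / t + 1 / t ^ 3 + 3 / 2 * (1 / t ^ 5))
          = 1 - (3 / 2 * (1 / t ^ 4) + 3 / 2 * (5 / t ^ 6)) := by field_simp; ring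
      rw [this]
      have : 0 ≤ 3 / 2 * (1 / t ^ 4) + 3 / 2 * (5 / t ^ 6) := by positivity
      linarith
    · have h := (grid_bounds (j := 4608) (by norm_num)).2.2.1
      have h' : 54800 ≤ dawsonLo 4608 := by decide +kernel
      have h'' : (54800 : ℝ) ≤ dawsonLo 4608 := by exact_mod_cast h'
      norm_num at h ⊢
      linarith
  · refine dawson_le_of_supersolution (a := 9 / 2) (hd (9 / 2)) (fun t ht => ?_) ?_ hy
    · have ht0 : 0 < t := by linarith
      have : -(1 / t ^ 2) + -(3 / t ^ 4) + 9 / 2 * -(5 / t ^ 6)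
          + t * (1 / t + 1 / t ^ 3 + 9 / 2 * (1 / t ^ 5))
          = 1 + 3 / 2 / t ^ 6 * (t ^ 2 - 15) := by field_simp; ring
      rw [this]
      have : 0 ≤ t ^ 2 - 15 := by nlinarith
      have : 0 ≤ 3 / 2 / t ^ 6 * (t ^ 2 - 15) := by positivity
      linarith
    · have h := (grid_bounds (j := 4608) (by norm_num)).2.2.2
      have h' : dawsonHi 4608 ≤ 54890 := by decide +kernel
      have h'' : (dawsonHi 4608 : ℝ) ≤ 54890 := by exact_mod_cast h'
      norm_num at h ⊢
      linarith

lemma gauss_far_bound {y : ℝ} (hy : 9 / 2 ≤ y) : y ^ 5 * gaussPart y ≤ 1 / 10 := by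
  have hd : ∀ t : ℝ, HasDerivAt (fun t => t ^ 5 * gaussPart t)
      (t ^ 4 * gaussPart t * (5 - t ^ 2)) t := by
    intro t
    have h := ((((hasDerivAt_id' t).fun_pow 2).div_const 2).fun_neg.exp).const_mul √(Real.pi / 2)
    refine (((hasDerivAt_id' t).fun_pow 5).fun_mul h).congr_deriv ?_
    unfold gaussPart
    push_cast
    ring
  have hmono : AntitoneOn (fun t => t ^ 5 * gaussPart t) (Set.Ici (9 / 2)) := by
    refine antitoneOn_of_deriv_nonpos (convex_Ici _)
      (fun t _ => (hd t).continuousAt.continuousWithinAt)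
      (fun t _ => (hd t).differentiableAt.differentiableWithinAt) fun t ht => ?_
    have ht' : (9 / 2 : ℝ) ≤ t := interior_subset ht
    rw [(hd t).deriv]
    have := gaussPart_pos t
    exact mul_nonpos_of_nonneg_of_nonpos (by positivity) (by nlinarith)
  refine (hmono (Set.mem_Ici.2 le_rfl) (Set.mem_Ici.2 hy) hy).trans ?_
  have h := (grid_bounds (j := 4608) (by norm_num)).2.1
  have h' : gaussHi 4608 ≤ 54 := by decide +kernel
  have h'' : (gaussHi 4608 : ℝ) ≤ 54 := by exact_mod_cast h'
  norm_num at h ⊢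
  linarith

lemma norm_le_of_sq {z : ℂ} {r : ℝ} (hr : 0 ≤ r) (h : z.re ^ 2 + z.im ^ 2 ≤ r ^ 2) : ‖z‖ ≤ r := by
  rw [← abs_of_nonneg (norm_nonneg z), ← abs_of_nonneg hr]
  refine sq_le_sq.1 ?_
  rw [Complex.sq_norm, normSq_apply]
  linarith

lemma cubic_dominates {u A B : ℂ} {x : ℝ} (hx0 : 0 ≤ x) (nu : ‖u‖ ≤ 2 / 25) (nA : ‖A‖ ≤ 3 / 10)
    (nB : ‖B‖ ≤ 17 / 10) : -(6 * (I * (x : ℂ) - 1) ^ 3) ≠ (I * (x : ℂ) - 1) ^ 2 * B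
      + 4 * (I * (x : ℂ)) * (u ^ 2 - 2 * u) + 11 * u * (I * (x : ℂ)) ^ 2
      + A * (-3 + 8 * (I * (x : ℂ)) - 4 * (I * (x : ℂ)) ^ 2)
      + 4 * (A + 1) * u * (1 - I * (x : ℂ)) := by
  intro key
  set m : ℂ := I * (x : ℂ) with hm'
  have nm : ‖m‖ = x := by rw [hm', norm_mul, norm_I, one_mul, norm_real, norm_of_nonneg hx0]
  have M2 : ‖m - 1‖ ^ 2 = 1 + x ^ 2 := by
    rw [Complex.sq_norm, normSq_apply]; simp [hm']; ring
  set M := ‖m - 1‖ with hM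
  have hM0 : 0 ≤ M := norm_nonneg _
  have hM1 : 1 ≤ M := by nlinarith
  have hxM : x ≤ M := by nlinarith
  have nq : ‖-3 + 8 * m - 4 * m ^ 2‖ ≤ 4 * x ^ 2 + 5 := by
    refine norm_le_of_sq (by positivity) ?_
    have e : -3 + 8 * m - 4 * m ^ 2 = ((4 * x ^ 2 - 3 : ℝ) : ℂ) + I * ((8 * x : ℝ) : ℂ) := by
      rw [hm', mul_pow, I_sq]; push_cast; ring
    rw [e]
    simp only [add_re, add_im, ofReal_re, ofReal_im, mul_re, mul_im, I_re, I_im]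
    nlinarith
  have n0 : ‖-(6 * (m - 1) ^ 3)‖ = 6 * M ^ 3 := by
    rw [norm_neg, norm_mul, norm_pow, Complex.norm_ofNat]
  have t1 : ‖(m - 1) ^ 2 * B‖ ≤ M ^ 2 * (17 / 10) := by
    rw [norm_mul, norm_pow]; gcongr
  have t2 : ‖4 * m * (u ^ 2 - 2 * u)‖ ≤ 4 * x * (2 / 25 * (2 / 25 + 2)) := by
    rw [show u ^ 2 - 2 * u = u * (u - 2) by ring, norm_mul, norm_mul 4 m, norm_mul u, Complex.norm_ofNat, nm]
    gcongr
    refine (norm_sub_le _ _).trans ?_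
    rw [Complex.norm_ofNat]; linarith
  have t3 : ‖11 * u * m ^ 2‖ ≤ 11 * (2 / 25) * x ^ 2 := by
    rw [norm_mul, norm_mul, norm_pow, Complex.norm_ofNat, nm]; gcongr
  have t4 : ‖A * (-3 + 8 * m - 4 * m ^ 2)‖ ≤ 3 / 10 * (4 * x ^ 2 + 5) := by
    rw [norm_mul]; gcongr
  have t5 : ‖4 * (A + 1) * u * (1 - m)‖ ≤ 4 * (3 / 10 + 1) * (2 / 25) * M := by
    rw [norm_mul, norm_mul, norm_mul, Complex.norm_ofNat, norm_sub_rev, ← hM]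
    gcongr
    refine (norm_add_le _ _).trans ?_
    rw [norm_one]; linarith
  have s1 := norm_add_le ((m - 1) ^ 2 * B) (4 * m * (u ^ 2 - 2 * u))
  have s2 := norm_add_le ((m - 1) ^ 2 * B + 4 * m * (u ^ 2 - 2 * u)) (11 * u * m ^ 2)
  have s3 := norm_add_le ((m - 1) ^ 2 * B + 4 * m * (u ^ 2 - 2 * u) + 11 * u * m ^ 2)
    (A * (-3 + 8 * m - 4 * m ^ 2))
  have s4 := norm_add_le ((m - 1) ^ 2 * B + 4 * m * (u ^ 2 - 2 * u) + 11 * u * m ^ 2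
    + A * (-3 + 8 * m - 4 * m ^ 2)) (4 * (A + 1) * u * (1 - m))
  rw [← key, n0] at s4
  have q1 : M ≤ M ^ 3 := by nlinarith
  have q2 : M ^ 2 ≤ M ^ 3 := by nlinarith
  nlinarith

lemma dispersion_imag_far {y κ : ℝ} (hy : 9 / 2 ≤ y) (hκ : 0 ≤ κ) : dispersion (I * y) κ ≠ 0 := by
  have hy0 : 0 < y := by linarith
  obtain ⟨l1, l2⟩ := dawson_far_bounds hy
  have l3 := gauss_far_bound hy
  have g0 := gaussPart_pos y
  set g := gaussPart y
  set F := y * dawsonRatio y with hF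
  set x := κ * y with hx
  have hx0 : 0 ≤ x := by positivity
  have hs : I * (y : ℂ) ≠ 0 := mul_ne_zero I_ne_zero (by exact_mod_cast hy0.ne')
  have hm : (κ : ℂ) = (I * (x : ℂ)) / (I * y) := by
    rw [eq_div_iff hs, hx]; push_cast; ring
  have key := dispersion_expansion (w := mills (I * y)) hs (I * (x : ℂ))
  rw [← hm] at key
  change (I * (y : ℂ)) ^ 3 * dispersion (I * y) κ - _ = _ at key
  intro h0
  rw [h0, mul_zero, zero_sub] at key
  -- the small quantities `u = 1 - s W`, `A = s² u - 1`, `B = s² A + 3`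
  have hu : 1 - I * (y : ℂ) * mills (I * y) = ((1 - y * F : ℝ) : ℂ) - I * ((y * g : ℝ) : ℂ) := by
    rw [mills_imag, ← hF]
    push_cast
    linear_combination ((y : ℂ) * F) * I_sq
  have y2 : (81 / 4 : ℝ) ≤ y ^ 2 := by nlinarith
  have iy2 : 1 / y ^ 2 ≤ 4 / 81 := by
    rw [div_le_div_iff₀ (by positivity) (by norm_num)]; linarith
  have iy0 : 0 < 1 / y ^ 2 := by positivity
  have p1 : 1 + 1 / y ^ 2 + 3 / 2 * (1 / y ^ 2) ^ 2 ≤ y * F := by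
    have := mul_le_mul_of_nonneg_left l1 hy0.le
    refine le_trans (le_of_eq ?_) this
    field_simp
  have p2 : y * F ≤ 1 + 1 / y ^ 2 + 9 / 2 * (1 / y ^ 2) ^ 2 := by
    have := mul_le_mul_of_nonneg_left l2 hy0.le
    refine this.trans (le_of_eq ?_)
    field_simp
  set r := 1 / y ^ 2 with hr
  have hyr : y ^ 2 * r = 1 := by rw [hr]; field_simp
  set p := y * F
  set γ := y ^ 5 * g with hγ
  have hγ0 : 0 ≤ γ := by positivity
  have g1 : y * g = γ * r ^ 2 := by rw [hγ, hr]; field_simp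
  set u : ℂ := 1 - I * (y : ℂ) * mills (I * y) with hu'
  set A : ℂ := (I * (y : ℂ)) ^ 2 * u - 1 with hA'
  set B : ℂ := (I * (y : ℂ)) ^ 2 * A + 3 with hB'
  have hs2 : (I * (y : ℂ)) ^ 2 = -((y ^ 2 : ℝ) : ℂ) := by
    rw [mul_pow, I_sq]; push_cast; ring
  have hA : A = ((y ^ 2 * (p - 1) - 1 : ℝ) : ℂ) + I * ((y ^ 2 * (y * g) : ℝ) : ℂ) := by
    rw [hA', hs2, hu]; push_cast; ring
  have hB : B = ((3 - y ^ 2 * (y ^ 2 * (p - 1) - 1) : ℝ) : ℂ)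
      + I * ((-(y ^ 2 * (y ^ 2 * (y * g))) : ℝ) : ℂ) := by
    rw [hB', hs2, hA]; push_cast; ring
  have a1 : y ^ 2 * (p - 1) - 1 ≤ 9 / 2 * r := by nlinarith
  have a2 : 3 / 2 * r ≤ y ^ 2 * (p - 1) - 1 := by nlinarith
  have b1 : y ^ 2 * (y ^ 2 * (p - 1) - 1) ≤ 9 / 2 := by nlinarith
  have b2 : 3 / 2 ≤ y ^ 2 * (y ^ 2 * (p - 1) - 1) := by nlinarith
  have g2 : y ^ 2 * (y * g) = γ * r := by rw [g1]; linear_combination (γ * r) * hyr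
  have g3 : y ^ 2 * (y ^ 2 * (y * g)) = γ := by rw [g2]; linear_combination γ * hyr
  have r2 : r ^ 2 ≤ (4 / 81) ^ 2 := by gcongr
  have nu : ‖u‖ ≤ 2 / 25 := by
    rw [hu]
    refine norm_le_of_sq (by norm_num) ?_
    simp only [sub_re, sub_im, ofReal_re, ofReal_im, mul_re, mul_im, I_re, I_im]
    rw [g1]
    have e1 : (p - 1) ^ 2 ≤ (31 / 500) ^ 2 := by
      have : p - 1 ≤ 31 / 500 := by nlinarith
      have : 0 ≤ p - 1 := by nlinarith
      gcongr
    have e2 : (γ * r ^ 2) ^ 2 ≤ (1 / 10 * (4 / 81) ^ 2) ^ 2 := by gcongr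
    linarith
  have nA : ‖A‖ ≤ 3 / 10 := by
    rw [hA]
    refine norm_le_of_sq (by norm_num) ?_
    simp only [add_re, add_im, ofReal_re, ofReal_im, mul_re, mul_im, I_re, I_im]
    rw [g2]
    have e1 : (y ^ 2 * (p - 1) - 1) ^ 2 ≤ (9 / 2 * (4 / 81)) ^ 2 := by
      have : 0 ≤ y ^ 2 * (p - 1) - 1 := by nlinarith
      have : y ^ 2 * (p - 1) - 1 ≤ 9 / 2 * (4 / 81) := by linarith
      gcongr
    have e2 : (γ * r) ^ 2 ≤ (1 / 10 * (4 / 81)) ^ 2 := by gcongr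
    linarith
  have nB : ‖B‖ ≤ 17 / 10 := by
    rw [hB]
    refine norm_le_of_sq (by norm_num) ?_
    simp only [add_re, add_im, ofReal_re, ofReal_im, mul_re, mul_im, I_re, I_im]
    rw [g3]
    have e1 : (3 - y ^ 2 * (y ^ 2 * (p - 1) - 1)) ^ 2 ≤ (3 / 2) ^ 2 :=
      sq_le_sq' (by linarith) (by linarith)
    have e2 : γ ^ 2 ≤ (1 / 10) ^ 2 := by gcongr
    linarith
  have hA1 : (I * (y : ℂ)) ^ 2 * u = A + 1 := by rw [hA']; ring
  rw [hA1] at key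
  exact cubic_dominates hx0 nu nA nB key

/-- On the positive imaginary axis, zeros of the dispersion function lie in a small box. -/
lemma dispersion_imag_ne_zero {y κ : ℝ} (hy : 0 < y) (hκ : 0 ≤ κ)
    (hbox : ¬ (y ∈ Icc (21 / 16) (23 / 16) ∧ κ ∈ Icc (77 / 64) (45 / 32))) :
    dispersion (I * y) κ ≠ 0 := by
  rcases le_total (9 / 2) y with h | h
  · exact dispersion_imag_far h hκ
  have main : NoAxisZero y κ := by
    have c0 : ((0 : ℕ) : ℝ) ≤ 1024 * y := by push_cast; positivity
    have k0 : ((0 : ℕ) : ℝ) ≤ 1048576 * κ := by push_cast; positivity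
    have cJ : 1024 * y ≤ (4608 : ℕ) := by push_cast; linarith
    rcases le_total 3 κ with h3 | h3
    · rcases le_total (1024 * y) (2304 : ℕ) with hm | hm
      · exact checkStrip_sound (J := 4608) (P := fun y => NoAxisZero y κ)
          (fun a b hb h y hi hj => nearLeadTest_sound hb h hi hj h3) (by norm_num) (by norm_num)
          check_near_lead y c0 hm
      · refine checkStrip_sound_of_le (J := 4608) (I := 2304) (P := fun y => NoAxisZero y κ)
          (fun a b ha hb h y hi hj => farLeadTest_sound hb ha h hi hj h3) (by norm_num) (by norm_num)
          (by norm_num) check_far_lead y hm cJ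
    · have kJ : 1048576 * κ ≤ (3145728 : ℕ) := by push_cast; linarith
      rcases le_total (1024 * y) (2304 : ℕ) with hm | hm
      · rcases le_total (1024 * y) (1344 : ℕ) with hA | hA
        · exact checkStrip_sound (J := 4608) (P := fun y => NoAxisZero y κ)
            (fun a b hb h y hi hj => nearStrip_sound hb hi hj h k0 kJ) (by norm_num) (by norm_num)
            check_near_left y c0 hA
        rcases le_total (1024 * y) (1472 : ℕ) with hB | hB
        · refine checkStrip_sound (J := 4608) (P := fun y => NoAxisZero y κ)
            (fun a b hb h y hi hj => ?_) (by norm_num) (by norm_num) check_near_middle y hA hB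
          simp only [Bool.and_eq_true] at h
          push_cast at hA hB
          by_cases hκ1 : κ < 77 / 64
          · exact nearStrip_sound hb hi hj h.1 k0 (by push_cast; linarith)
          · have : 45 / 32 < κ := by
              by_contra hc
              exact hbox ⟨⟨by linarith, by linarith⟩, by linarith, by linarith⟩
            exact nearStrip_sound hb hi hj h.2 (by push_cast; linarith) kJ
        · exact checkStrip_sound (J := 4608) (P := fun y => NoAxisZero y κ)
            (fun a b hb h y hi hj => nearStrip_sound hb hi hj h k0 kJ) (by norm_num) (by norm_num)
            check_near_right y hB hm
      · exact checkStrip_sound_of_le (J := 4608) (I := 2304) (P := fun y => NoAxisZero y κ)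
          (fun a b ha hb h y hi hj => farStrip_sound hb ha hi hj h k0 kJ) (by norm_num) (by norm_num)
          (by norm_num) check_far y hm cJ
  rw [dispersion_imag]
  intro h0
  have h1 := congrArg Complex.re h0
  have h2 := congrArg Complex.im h0
  simp at h1 h2
  rcases main with hm | hm
  · exact hm h1
  · rcases h2 with h2 | h2
    · exact hy.ne' h2
    · exact hm h2

/-! ### Signs of the derivatives near the crossing of the imaginary axis -/

/-- The derivative of `dispersionPoly` in `κ`. -/
def dispersionPolyKappa {R : Type*} [CommRing R] (s κ w : R) : R :=
  18 * κ ^ 2 + 2 * κ * (-w * s ^ 4 + 4 * w * s ^ 2 + s ^ 3 - 11 * w - 5 * s)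
    + (2 * w * s ^ 3 - 4 * w ^ 2 * s ^ 2 + 4 * w ^ 2 - 2 * s ^ 2 + 6)

lemma dispersionPolyKappa_imag (y κ g d : ℝ) :
    dispersionPolyKappa (I * y : ℂ) κ (g - I * ((y * d : ℝ) : ℂ)) =
      ((18 * κ ^ 2 + 2 * κ * (-(g * (y ^ 4 + 4 * y ^ 2 + 11)))
        + (2 * y ^ 2 * (1 - y ^ 2 * d) + 4 * (g ^ 2 - y ^ 2 * d ^ 2) * (1 + y ^ 2) + 6) : ℝ) : ℂ)
      + I * ((y * (2 * κ * (-(y ^ 2 * (1 - y ^ 2 * d)) + d * (4 * y ^ 2 + 11) - 5)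
        - (2 * y ^ 2 * g + 8 * g * d * (1 + y ^ 2))) : ℝ) : ℂ) := by
  obtain ⟨h2, hsw⟩ := imag_products y g d
  set s : ℂ := I * y with hs
  set w : ℂ := g - I * ((y * d : ℝ) : ℂ) with hw
  have e : dispersionPolyKappa s (κ : ℂ) w = 18 * κ ^ 2 + 2 * κ * (-w * (s ^ 2) ^ 2 + 4 * w * s ^ 2
      + s ^ 2 * s - 11 * w - 5 * s)
      + (2 * (s ^ 2 * (s * w)) - 4 * (s * w) ^ 2 + 4 * w ^ 2 - 2 * s ^ 2 + 6) := by
    unfold dispersionPolyKappa; ring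
  rw [e, h2, hsw, hw, hs]
  push_cast
  linear_combination (-4 * y ^ 2 * g ^ 2 + 4 * y ^ 2 * d ^ 2) * I_sq

section SignPolys

variable {R : Type*} [Add R] [Mul R] [NatCast R]

local notation "S" => gridScale R
local notation "c" => (Nat.cast : ℕ → R)

def dsReP (k q g d : R) : R :=
  k * (k * (S * S * (q * q + S * (q + c 6 * S))) + S * g * (q * q) * (c 2 * S + c 16 * d))
    + S * S * (q * q * d * (S + c 8 * d) + S * S * (c 4 * (g * g) + c 6 * (S * S)))

def dsReM (k q g d : R) : R :=
  k * (k * (q * d * (q * q + c 3 * (S * S))) + S * S * S * g * (c 14 * q + c 8 * S))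
    + q * (S * S * S) * (c 8 * (g * g) + c 15 * d * S + c 4 * (d * d) + S * S)

def dsImP (k q g d : R) : R :=
  k * S * (q * (c 8 * (g * g) + c 14 * d * S + c 2 * (S * S)) + c 8 * d * (S * S))
    + q * g * (S * S) * (S + c 16 * d)

def dsImM (k q g d : R) : R :=
  k * (k * (g * (q * q + c 3 * (S * S))) + (q * q * d * (c 2 * S + c 8 * d)
    + c 4 * (S * S * S * S))) + g * (S * S * S) * (c 15 * S + c 8 * d)

def dkReP (k q g d : R) : R :=
  c 18 * (k * k) * (S * S) + S * (S * S * (c 2 * q + c 6 * S) + c 4 * (g * g) * (S + q)) + d * c 0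

def dkReM (k q g d : R) : R :=
  c 2 * k * g * (q * (q + c 4 * S) + c 11 * (S * S)) + q * d * (c 2 * q * S + c 4 * d * (S + q))

def dkImP (k q g d : R) : R := c 2 * k * d * (q * (q + c 4 * S) + c 11 * (S * S)) + g * c 0

def dkImM (k q g d : R) : R :=
  c 2 * k * (S * S) * (q + c 5 * S) + S * g * (c 2 * q * S + c 8 * d * (S + q))

end SignPolys

def boxTest (σ : StripData) (a b : ℕ) : Bool :=
  Nat.blt (dsReM b σ.q1 σ.g1 σ.d1) (dsReP a σ.q0 σ.g0 σ.d0)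
  && (Nat.blt (dsImM b σ.q1 σ.g1 σ.d1) (dsImP a σ.q0 σ.g0 σ.d0)
  && (Nat.blt (dkReM b σ.q1 σ.g1 σ.d1) (dkReP a σ.q0 σ.g0 σ.d0)
  && Nat.blt (dkImM b σ.q1 σ.g1 σ.d1) (dkImP a σ.q0 σ.g0 σ.d0)))

set_option maxRecDepth 100000

lemma check_box : checkStrip (fun i j => checkInterval (boxTest (stripData i j)) 6 1261568 1474560) 6
    1344 1472 = true := by decide +kernel

lemma check_corners :
    Nat.blt (reM 1261568 (stripData 1344 1344).q1 (stripData 1344 1344).g1 (stripData 1344 1344).d1)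
      (reP 1261568 (stripData 1344 1344).q0 (stripData 1344 1344).g0 (stripData 1344 1344).d0) ∧
    Nat.blt (reP 1474560 (stripData 1472 1472).q1 (stripData 1472 1472).g1 (stripData 1472 1472).d1)
      (reM 1474560 (stripData 1472 1472).q0 (stripData 1472 1472).g0 (stripData 1472 1472).d0) ∧
    Nat.blt (imP 1261568 (stripData 1472 1472).q1 (stripData 1472 1472).g1 (stripData 1472 1472).d1)
      (imM 1261568 (stripData 1472 1472).q0 (stripData 1472 1472).g0 (stripData 1472 1472).d0) ∧
    Nat.blt (imM 1474560 (stripData 1344 1344).q1 (stripData 1344 1344).g1 (stripData 1344 1344).d1)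
      (imP 1474560 (stripData 1344 1344).q0 (stripData 1344 1344).g0 (stripData 1344 1344).d0) := by
  decide +kernel

section Mono

lemma cast_dsReP (k q g d : ℕ) : ((dsReP k q g d : ℕ) : ℝ) = dsReP (k : ℝ) q g d := by
  simp only [dsReP, gridScale]; push_cast; ring
lemma cast_dsReM (k q g d : ℕ) : ((dsReM k q g d : ℕ) : ℝ) = dsReM (k : ℝ) q g d := by
  simp only [dsReM, gridScale]; push_cast; ring
lemma cast_dsImP (k q g d : ℕ) : ((dsImP k q g d : ℕ) : ℝ) = dsImP (k : ℝ) q g d := by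
  simp only [dsImP, gridScale]; push_cast; ring
lemma cast_dsImM (k q g d : ℕ) : ((dsImM k q g d : ℕ) : ℝ) = dsImM (k : ℝ) q g d := by
  simp only [dsImM, gridScale]; push_cast; ring
lemma cast_dkReP (k q g d : ℕ) : ((dkReP k q g d : ℕ) : ℝ) = dkReP (k : ℝ) q g d := by
  simp only [dkReP, gridScale]; push_cast; ring
lemma cast_dkReM (k q g d : ℕ) : ((dkReM k q g d : ℕ) : ℝ) = dkReM (k : ℝ) q g d := by
  simp only [dkReM, gridScale]; push_cast; ring
lemma cast_dkImP (k q g d : ℕ) : ((dkImP k q g d : ℕ) : ℝ) = dkImP (k : ℝ) q g d := by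
  simp only [dkImP, gridScale]; push_cast; ring
lemma cast_dkImM (k q g d : ℕ) : ((dkImM k q g d : ℕ) : ℝ) = dkImM (k : ℝ) q g d := by
  simp only [dkImM, gridScale]; push_cast; ring

variable {k q g d k' q' g' d' : ℝ} (k0 : 0 ≤ k) (q0 : 0 ≤ q) (g0 : 0 ≤ g) (d0 : 0 ≤ d)
  (hk : k ≤ k') (hq : q ≤ q') (hg : g ≤ g') (hd : d ≤ d')
include k0 q0 g0 hk hq hg d0 hd

lemma boxPoly_mono : dsReP k q g d ≤ dsReP k' q' g' d' ∧
    dsReM k q g d ≤ dsReM k' q' g' d' ∧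
    dsImP k q g d ≤ dsImP k' q' g' d' ∧
    dsImM k q g d ≤ dsImM k' q' g' d' ∧
    dkReP k q g d ≤ dkReP k' q' g' d' ∧
    dkReM k q g d ≤ dkReM k' q' g' d' ∧
    dkImP k q g d ≤ dkImP k' q' g' d' ∧
    dkImM k q g d ≤ dkImM k' q' g' d' := by
  have := k0.trans hk; have := q0.trans hq; have := g0.trans hg; have := d0.trans hd
  unfold dsReP dsReM dsImP dsImM dkReP dkReM dkImP dkImM gridScale; push_cast
  refine ⟨?_, ?_, ?_, ?_, ?_, ?_, ?_, ?_⟩ <;> gcongr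

end Mono

/-- The box on the imaginary axis which contains the acoustic crossing. -/
def crossingBox : Set (ℝ × ℝ) := Icc (21 / 16) (23 / 16) ×ˢ Icc (77 / 64) (45 / 32)

lemma box_derivatives_pos {y κ : ℝ} (h : (y, κ) ∈ crossingBox) :
    0 < (dispersionDeriv (I * y) κ).re ∧ 0 < (dispersionDeriv (I * y) κ).im ∧
    0 < (dispersionPolyKappa (I * y) κ (mills (I * y))).re ∧
    0 < (dispersionPolyKappa (I * y) κ (mills (I * y))).im := by
  obtain ⟨⟨hy1, hy2⟩, hk1, hk2⟩ := h
  have hy0 : 0 < y := by linarith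
  refine checkStrip_sound (J := 4608) (c := 1024) (P := fun y => 0 < y →
      0 < (dispersionDeriv (I * y) κ).re ∧ 0 < (dispersionDeriv (I * y) κ).im ∧
      0 < (dispersionPolyKappa (I * y) κ (mills (I * y))).re ∧
      0 < (dispersionPolyKappa (I * y) κ (mills (I * y))).im)
    (fun i j hj h y hi hy hy0 => ?_) (by norm_num) (by norm_num) check_box y
    (by push_cast; linarith) (by push_cast; linarith) hy0
  refine checkInterval_sound (c := 1048576) (P := fun κ : ℝ =>
      0 < (dispersionDeriv (I * y) κ).re ∧ 0 < (dispersionDeriv (I * y) κ).im ∧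
      0 < (dispersionPolyKappa (I * y) κ (mills (I * y))).re ∧
      0 < (dispersionPolyKappa (I * y) κ (mills (I * y))).im)
    (fun a b h κ ha hb => ?_) h κ (by push_cast; linarith) (by push_cast; linarith)
  obtain ⟨h1, h2, h3, h4, h5, h6⟩ := strip_bounds hj hi hy
  set σ := stripData i j
  simp only [boxTest, Bool.and_eq_true] at h
  obtain ⟨t1, t2, t3, t4⟩ := h
  have t1 := blt_cast t1
  have t2 := blt_cast t2
  have t3 := blt_cast t3
  have t4 := blt_cast t4
  rw [cast_dsReP, cast_dsReM] at t1
  rw [cast_dsImP, cast_dsImM] at t2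
  rw [cast_dkReP, cast_dkReM] at t3
  rw [cast_dkImP, cast_dkImM] at t4
  have k0 : 0 ≤ 1048576 * κ := le_trans (Nat.cast_nonneg _) ha
  have q0 : 0 ≤ 1048576 * y ^ 2 := by positivity
  have n : ∀ m : ℕ, (0 : ℝ) ≤ m := fun m => Nat.cast_nonneg m
  have g0 := gaussPart_pos y
  have d0 := dawsonRatio_nonneg y
  rw [dispersionDeriv, mills_imag, dispersionPolyDeriv_imag, dispersionPolyKappa_imag]
  set g := gaussPart y
  set d := dawsonRatio y
  have G0 : 0 ≤ 1048576 * g := by positivity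
  have D0 : 0 ≤ 1048576 * d := by positivity
  obtain ⟨_, u1, _, u2, _, u3, _, u4⟩ := boxPoly_mono k0 q0 G0 D0 hb h2 h4 h6
  obtain ⟨v1, _, v2, _, v3, _, v4, _⟩ :=
    boxPoly_mono (n a) (n σ.q0) (n σ.g0) (n σ.d0) ha h1 h3 h5
  have l1 := u1.trans_lt (t1.trans_le v1)
  have l2 := u2.trans_lt (t2.trans_le v2)
  have l3 := u3.trans_lt (t3.trans_le v3)
  have l4 := u4.trans_lt (t4.trans_le v4)
  simp only [add_re, add_im, ofReal_re, ofReal_im, mul_re, mul_im, I_re, I_im, zero_mul, one_mul,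
    zero_add, mul_zero, sub_zero, add_zero]
  unfold dsReM dsReP gridScale at l1
  unfold dsImM dsImP gridScale at l2
  unfold dkReM dkReP gridScale at l3
  unfold dkImM dkImP gridScale at l4
  push_cast at l1 l2 l3 l4
  refine ⟨by linarith, mul_pos hy0 (by linarith), by linarith, mul_pos hy0 (by linarith)⟩

lemma hasDerivAt_dispersion_kappa (s κ : ℂ) :
    HasDerivAt (fun κ => dispersion s κ) (dispersionPolyKappa s κ (mills s)) κ := by
  unfold dispersion dispersionPoly dispersionPolyKappa
  have h := hasDerivAt_id' κ
  refine ((((h.fun_pow 3).const_mul 6).fun_add ((h.fun_pow 2).mul_const _)).fun_add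
    (h.mul_const _)).add_const _ |>.congr_deriv ?_
  push_cast
  ring

lemma hasDerivAt_re_dispersion_y (y κ : ℝ) :
    HasDerivAt (fun y : ℝ => (dispersion (I * y) κ).re) (-(dispersionDeriv (I * y) κ).im) y ∧
    HasDerivAt (fun y : ℝ => (dispersion (I * y) κ).im) ((dispersionDeriv (I * y) κ).re) y := by
  have h2 : HasDerivAt (fun t : ℝ => I * (t : ℂ)) I y := by
    simpa using ((hasDerivAt_id (y : ℂ)).comp_ofReal).const_mul I
  have h := (hasDerivAt_dispersion (I * y) κ).comp y h2
  constructor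
  · refine (reCLM.hasFDerivAt.comp_hasDerivAt y h).congr_deriv ?_
    simp
  · refine (imCLM.hasFDerivAt.comp_hasDerivAt y h).congr_deriv ?_
    simp

lemma hasDerivAt_re_dispersion_kappa (y κ : ℝ) :
    HasDerivAt (fun κ : ℝ => (dispersion (I * y) κ).re)
      ((dispersionPolyKappa (I * y) κ (mills (I * y))).re) κ ∧
    HasDerivAt (fun κ : ℝ => (dispersion (I * y) κ).im)
      ((dispersionPolyKappa (I * y) κ (mills (I * y))).im) κ := by
  have h := (hasDerivAt_dispersion_kappa (I * y) κ).comp_ofReal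
  exact ⟨reCLM.hasFDerivAt.comp_hasDerivAt κ h, imCLM.hasFDerivAt.comp_hasDerivAt κ h⟩

section Monotone

variable {y κ : ℝ}

lemma strictAntiOn_re_y (hκ : κ ∈ Icc (77 / 64) (45 / 32)) :
    StrictAntiOn (fun y : ℝ => (dispersion (I * y) κ).re) (Icc (21 / 16) (23 / 16)) := by
  refine strictAntiOn_of_deriv_neg (convex_Icc _ _)
    (fun y _ => (hasDerivAt_re_dispersion_y y κ).1.continuousAt.continuousWithinAt) fun y hy => ?_
  rw [(hasDerivAt_re_dispersion_y y κ).1.deriv]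
  exact neg_neg_of_pos (box_derivatives_pos ⟨interior_subset hy, hκ⟩).2.1

lemma strictMonoOn_im_y (hκ : κ ∈ Icc (77 / 64) (45 / 32)) :
    StrictMonoOn (fun y : ℝ => (dispersion (I * y) κ).im) (Icc (21 / 16) (23 / 16)) := by
  refine strictMonoOn_of_deriv_pos (convex_Icc _ _)
    (fun y _ => (hasDerivAt_re_dispersion_y y κ).2.continuousAt.continuousWithinAt) fun y hy => ?_
  rw [(hasDerivAt_re_dispersion_y y κ).2.deriv]
  exact (box_derivatives_pos ⟨interior_subset hy, hκ⟩).1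

lemma strictMonoOn_re_kappa (hy : y ∈ Icc (21 / 16) (23 / 16)) :
    StrictMonoOn (fun κ : ℝ => (dispersion (I * y) κ).re) (Icc (77 / 64) (45 / 32)) := by
  refine strictMonoOn_of_deriv_pos (convex_Icc _ _)
    (fun κ _ => (hasDerivAt_re_dispersion_kappa y κ).1.continuousAt.continuousWithinAt)
    fun κ hκ => ?_
  rw [(hasDerivAt_re_dispersion_kappa y κ).1.deriv]
  exact (box_derivatives_pos ⟨hy, interior_subset hκ⟩).2.2.1

lemma strictMonoOn_im_kappa (hy : y ∈ Icc (21 / 16) (23 / 16)) :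
    StrictMonoOn (fun κ : ℝ => (dispersion (I * y) κ).im) (Icc (77 / 64) (45 / 32)) := by
  refine strictMonoOn_of_deriv_pos (convex_Icc _ _)
    (fun κ _ => (hasDerivAt_re_dispersion_kappa y κ).2.continuousAt.continuousWithinAt)
    fun κ hκ => ?_
  rw [(hasDerivAt_re_dispersion_kappa y κ).2.deriv]
  exact (box_derivatives_pos ⟨hy, interior_subset hκ⟩).2.2.2

end Monotone

lemma corner_signs :
    0 < (dispersion (I * (21 / 16 : ℝ)) (77 / 64 : ℝ)).re ∧
    (dispersion (I * (23 / 16 : ℝ)) (45 / 32 : ℝ)).re < 0 ∧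
    (dispersion (I * (23 / 16 : ℝ)) (77 / 64 : ℝ)).im < 0 ∧
    0 < (dispersion (I * (21 / 16 : ℝ)) (45 / 32 : ℝ)).im := by
  have n : ∀ m : ℕ, (0 : ℝ) ≤ m := fun m => Nat.cast_nonneg m
  obtain ⟨t1, t2, t3, t4⟩ := check_corners
  have t1 := blt_cast t1
  have t2 := blt_cast t2
  have t3 := blt_cast t3
  have t4 := blt_cast t4
  rw [cast_reP, cast_reM] at t1 t2
  rw [cast_imP, cast_imM] at t3 t4
  have key : ∀ (j : ℕ) (y : ℝ), j ≤ 4608 → 1024 * y = j → 0 < y → ∀ (a : ℕ) (κ : ℝ),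
      1048576 * κ = a →
      (reM (a : ℝ) (stripData j j).q1 (stripData j j).g1 (stripData j j).d1
        < (reP (a : ℝ) (stripData j j).q0 (stripData j j).g0 (stripData j j).d0 : ℝ) →
        0 < (dispersion (I * y) κ).re) ∧
      (reP (a : ℝ) (stripData j j).q1 (stripData j j).g1 (stripData j j).d1
        < (reM (a : ℝ) (stripData j j).q0 (stripData j j).g0 (stripData j j).d0 : ℝ) →
        (dispersion (I * y) κ).re < 0) ∧
      (imM (a : ℝ) (stripData j j).q1 (stripData j j).g1 (stripData j j).d1
        < (imP (a : ℝ) (stripData j j).q0 (stripData j j).g0 (stripData j j).d0 : ℝ) →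
        0 < (dispersion (I * y) κ).im) ∧
      (imP (a : ℝ) (stripData j j).q1 (stripData j j).g1 (stripData j j).d1
        < (imM (a : ℝ) (stripData j j).q0 (stripData j j).g0 (stripData j j).d0 : ℝ) →
        (dispersion (I * y) κ).im < 0) := by
    intro j y hj hy hy0 a κ ha
    obtain ⟨h1, h2, h3, h4, h5, h6⟩ := strip_bounds hj hy.ge hy.le
    set σ := stripData j j
    have k0 : 0 ≤ 1048576 * κ := ha ▸ n a
    have q0 : 0 ≤ 1048576 * y ^ 2 := by positivity
    have g0 := gaussPart_pos y
    have d0 := dawsonRatio_nonneg y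
    rw [dispersion_imag]
    simp only [add_re, add_im, ofReal_re, ofReal_im, mul_re, mul_im, I_re, I_im, zero_mul, one_mul,
      zero_add, mul_zero, sub_zero, add_zero]
    set g := gaussPart y
    set d := dawsonRatio y
    have e1 := reP_sub_reM y κ g d
    have e2 := imP_sub_imM y κ g d
    have G0 : 0 ≤ 1048576 * g := by positivity
    have D0 : 0 ≤ 1048576 * d := by positivity
    obtain ⟨l1, l2, l3, l4⟩ := imagPoly_mono k0 q0 G0 D0 ha.le h2 h4 h6
    obtain ⟨m1, m2, m3, m4⟩ := imagPoly_mono (n a) (n σ.q0) (n σ.g0) (n σ.d0) ha.ge h1 h3 h5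
    exact ⟨fun t => by linarith, fun t => by linarith, fun t => mul_pos hy0 (by linarith),
      fun t => mul_neg_of_pos_of_neg hy0 (by linarith)⟩
  have r1 := (key 1344 (21 / 16) (by norm_num) (by norm_num) (by norm_num) 1261568 (77 / 64)
    (by norm_num)).1
  have r2 := (key 1472 (23 / 16) (by norm_num) (by norm_num) (by norm_num) 1474560 (45 / 32)
    (by norm_num)).2.1
  have r3 := (key 1472 (23 / 16) (by norm_num) (by norm_num) (by norm_num) 1261568 (77 / 64)
    (by norm_num)).2.2.2
  have r4 := (key 1344 (21 / 16) (by norm_num) (by norm_num) (by norm_num) 1474560 (45 / 32)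
    (by norm_num)).2.2.1
  clear key
  generalize stripData 1344 1344 = σ at *
  generalize stripData 1472 1472 = σ' at *
  exact ⟨r1 t1, r2 t2, r3 t3, r4 t4⟩

lemma continuous_dispersion_imag :
    Continuous fun p : ℝ × ℝ => dispersion (I * (p.1 : ℂ)) (p.2 : ℂ) := by
  have := continuous_mills
  unfold dispersion dispersionPoly
  fun_prop

/-- The dispersion function has exactly one zero on the positive imaginary axis. -/
lemma exists_crossing : ∃ y κ : ℝ, (y, κ) ∈ crossingBox ∧ dispersion (I * y) κ = 0 ∧
    ∀ y' κ' : ℝ, 0 < y' → 0 ≤ κ' → dispersion (I * y') κ' = 0 → y' = y ∧ κ' = κ := by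
  obtain ⟨c1, c2, c3, c4⟩ := corner_signs
  set Y : Set ℝ := Icc (21 / 16) (23 / 16) with hY
  set K : Set ℝ := Icc (77 / 64) (45 / 32) with hK
  have y0 : (21 / 16 : ℝ) ∈ Y := by constructor <;> norm_num
  have y1 : (23 / 16 : ℝ) ∈ Y := by constructor <;> norm_num
  have k0 : (77 / 64 : ℝ) ∈ K := by constructor <;> norm_num
  have k1 : (45 / 32 : ℝ) ∈ K := by constructor <;> norm_num
  have hre : Continuous fun p : ℝ × ℝ => (dispersion (I * (p.1 : ℂ)) (p.2 : ℂ)).re :=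
    continuous_re.comp continuous_dispersion_imag
  have him : Continuous fun p : ℝ × ℝ => (dispersion (I * (p.1 : ℂ)) (p.2 : ℂ)).im :=
    continuous_im.comp continuous_dispersion_imag
  -- along each horizontal line the imaginary part vanishes once
  have ex : ∀ y ∈ Y, ∃ κ ∈ K, (dispersion (I * y) κ).im = 0 := by
    intro y hy
    have a : (dispersion (I * y) (77 / 64 : ℝ)).im ≤ 0 :=
      ((strictMonoOn_im_y k0).monotoneOn hy y1 hy.2).trans c3.le
    have b : 0 ≤ (dispersion (I * y) (45 / 32 : ℝ)).im :=
      c4.le.trans ((strictMonoOn_im_y k1).monotoneOn y0 hy hy.1)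
    have hcont : ContinuousOn (fun κ : ℝ => (dispersion (I * y) κ).im) K :=
      (him.comp (by fun_prop : Continuous fun κ : ℝ => (y, κ))).continuousOn
    obtain ⟨κ, hκ, h⟩ := intermediate_value_Icc (by norm_num) hcont ⟨a, b⟩
    exact ⟨κ, hκ, h⟩
  set A : Set ℝ := Prod.fst '' ((Y ×ˢ K) ∩ {p : ℝ × ℝ | (dispersion (I * p.1) p.2).im = 0 ∧
    0 ≤ (dispersion (I * p.1) p.2).re}) with hA
  set B : Set ℝ := Prod.fst '' ((Y ×ˢ K) ∩ {p : ℝ × ℝ | (dispersion (I * p.1) p.2).im = 0 ∧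
    (dispersion (I * p.1) p.2).re ≤ 0}) with hB
  have cA : IsClosed A := by
    refine (((isCompact_Icc.prod isCompact_Icc).inter_right ?_).image continuous_fst).isClosed
    exact (isClosed_eq him continuous_const).inter (isClosed_le continuous_const hre)
  have cB : IsClosed B := by
    refine (((isCompact_Icc.prod isCompact_Icc).inter_right ?_).image continuous_fst).isClosed
    exact (isClosed_eq him continuous_const).inter (isClosed_le hre continuous_const)
  have cover : Y ⊆ A ∪ B := by
    intro y hy
    obtain ⟨κ, hκ, h⟩ := ex y hy
    rcases le_total 0 (dispersion (I * y) κ).re with h' | h'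
    · exact Or.inl ⟨(y, κ), ⟨⟨hy, hκ⟩, h, h'⟩, rfl⟩
    · exact Or.inr ⟨(y, κ), ⟨⟨hy, hκ⟩, h, h'⟩, rfl⟩
  have nA : (Y ∩ A).Nonempty := by
    obtain ⟨κ, hκ, h⟩ := ex _ y0
    refine ⟨21 / 16, y0, (21 / 16, κ), ⟨⟨y0, hκ⟩, h, ?_⟩, rfl⟩
    exact c1.le.trans ((strictMonoOn_re_kappa y0).monotoneOn k0 hκ hκ.1)
  have nB : (Y ∩ B).Nonempty := by
    obtain ⟨κ, hκ, h⟩ := ex _ y1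
    refine ⟨23 / 16, y1, (23 / 16, κ), ⟨⟨y1, hκ⟩, h, ?_⟩, rfl⟩
    exact ((strictMonoOn_re_kappa y1).monotoneOn hκ k1 hκ.2).trans c2.le
  obtain ⟨y, hy, ⟨⟨y₁, κ⟩, ⟨⟨-, hκ⟩, h1, h2⟩, e1⟩, ⟨⟨y₂, κ'⟩, ⟨⟨-, hκ'⟩, h1', h2'⟩, e2⟩⟩ :=
    isPreconnected_closed_iff.1 isPreconnected_Icc A B cA cB cover nA nB
  change y₁ = y at e1
  change y₂ = y at e2
  subst y₁ y₂
  have e : κ = κ' := (strictMonoOn_im_kappa hy).injOn hκ hκ' (h1.trans h1'.symm)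
  subst e
  have hz : dispersion (I * y) κ = 0 := Complex.ext (le_antisymm h2' h2) h1
  refine ⟨y, κ, ⟨hy, hκ⟩, hz, fun y' κ' hy' hκ' hz' => ?_⟩
  have hbox : y' ∈ Y ∧ κ' ∈ K := by
    by_contra hcon
    exact dispersion_imag_ne_zero hy' hκ' hcon hz'
  have key : ∀ y κ y' κ' : ℝ, y ∈ Y → κ ∈ K → y' ∈ Y → κ' ∈ K → dispersion (I * y) κ = 0 →
      dispersion (I * y') κ' = 0 → ¬ y < y' := by
    intro y κ y' κ' hy hκ hy' hκ' hz hz' hlt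
    rcases le_or_gt κ κ' with hle | hgt
    · have a := strictMonoOn_im_y hκ hy hy' hlt
      have b := (strictMonoOn_im_kappa hy').monotoneOn hκ hκ' hle
      simp only [hz, hz', zero_im] at a b
      linarith
    · have a := strictAntiOn_re_y hκ hy hy' hlt
      have b := strictMonoOn_re_kappa hy' hκ' hκ hgt
      simp only [hz, hz', zero_re] at a b
      linarith
  have ey : y' = y := by
    rcases lt_trichotomy y' y with h | h | h
    · exact absurd h (key _ _ _ _ hbox.1 hbox.2 hy hκ hz' hz)
    · exact h
    · exact absurd h (key _ _ _ _ hy hκ hbox.1 hbox.2 hz hz')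
  refine ⟨ey, ?_⟩
  subst ey
  exact (strictMonoOn_im_kappa hy).injOn hbox.2 hκ (by simp only [hz, hz'])

open Filter Set in
/-- Zeros of a holomorphic function persist under continuous perturbations (Hurwitz). -/
lemma eventually_exists_zero {P : Type*} [TopologicalSpace P] {G : ℂ → P → ℂ}
    (hc : Continuous fun x : ℂ × P => G x.1 x.2) (hd : ∀ p, Differentiable ℂ fun s => G s p)
    {s₀ : ℂ} {p₀ : P} (h0 : G s₀ p₀ = 0) (hne : ∃ s, G s p₀ ≠ 0) {U : Set ℂ} (hU : U ∈ 𝓝 s₀) :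
    ∀ᶠ p in 𝓝 p₀, ∃ s ∈ U, G s p = 0 := by
  have han : ∀ p, AnalyticOnNhd ℂ (fun s => G s p) univ := fun p s _ => (hd p).analyticAt s
  have hev : ∀ᶠ z in 𝓝[≠] s₀, G z p₀ ≠ 0 := by
    rcases (han p₀ s₀ trivial).eventually_eq_zero_or_eventually_ne_zero with h | h
    · obtain ⟨s, hs⟩ := hne
      exact absurd ((han p₀).eqOn_zero_of_preconnected_of_eventuallyEq_zero isPreconnected_univ
        (mem_univ s₀) h (mem_univ s)) hs
    · exact h
  rw [eventually_nhdsWithin_iff] at hev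
  obtain ⟨r, hr, hball⟩ := Metric.nhds_basis_closedBall.mem_iff.1 (inter_mem hU hev)
  obtain ⟨z₁, hz₁, hmin⟩ := (isCompact_sphere s₀ r).exists_isMinOn
    (NormedSpace.sphere_nonempty.2 hr.le)
    ((hd p₀).continuous.norm.continuousOn (s := Metric.sphere s₀ r))
  set m := ‖G z₁ p₀‖ with hm
  have hm0 : 0 < m := by
    rw [hm, norm_pos_iff]
    refine (hball (Metric.sphere_subset_closedBall hz₁)).2 ?_
    rintro rfl
    rw [Metric.mem_sphere, dist_self] at hz₁
    exact hr.ne hz₁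
  have hunif : ∀ᶠ p in 𝓝 p₀, ∀ z ∈ Metric.closedBall s₀ r, ‖G z p - G z p₀‖ < m / 4 := by
    refine (isCompact_closedBall s₀ r).eventually_forall_of_forall_eventually fun z _ => ?_
    have hcont : Continuous fun x : P × ℂ => ‖G x.2 x.1 - G x.2 p₀‖ := by
      have h1 : Continuous fun x : P × ℂ => G x.2 x.1 := hc.comp (continuous_snd.prodMk continuous_fst)
      have h2 : Continuous fun x : P × ℂ => G x.2 p₀ := (hd p₀).continuous.comp continuous_snd
      exact (h1.sub h2).norm
    have := hcont.tendsto (p₀, z)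
    simp only [sub_self, norm_zero] at this
    exact this.eventually (gt_mem_nhds (by positivity))
  filter_upwards [hunif] with p hp
  have hsph : ∀ z ∈ Metric.sphere s₀ r, m / 2 ≤ ‖G z p - G s₀ p‖ := by
    intro z hz
    have a1 := hp z (Metric.sphere_subset_closedBall hz)
    have a2 := hp s₀ (Metric.mem_closedBall_self hr.le)
    have a3 : m ≤ ‖G z p₀‖ := hmin hz
    rw [h0, sub_zero] at a2
    have e : G z p₀ = (G z p - G s₀ p) - (G z p - G z p₀) + G s₀ p := by ring
    have a4 : ‖G z p₀‖ ≤ ‖G z p - G s₀ p‖ + ‖G z p - G z p₀‖ + ‖G s₀ p‖ := by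
      conv_lhs => rw [e]
      exact (norm_add_le _ _).trans (add_le_add_left (norm_sub_le _ _) _)
    linarith
  have hfreq : ∃ᶠ z in 𝓝 s₀, G z p ≠ G s₀ p := by
    intro hcon
    have heq : EqOn (fun z => G z p) (fun _ => G s₀ p) univ :=
      (han p).eqOn_of_preconnected_of_eventuallyEq (fun _ _ => analyticAt_const) isPreconnected_univ
        (mem_univ s₀) (by filter_upwards [hcon] with z hz using not_not.1 hz)
    have h1 := hsph z₁ hz₁
    have h2 : G z₁ p = G s₀ p := heq (mem_univ z₁)
    rw [h2, sub_self, norm_zero] at h1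
    linarith
  have himg := ((hd p).diffContOnCl (s := Metric.ball s₀ r)).ball_subset_image_closedBall hr hsph hfreq
  have h0mem : (0 : ℂ) ∈ Metric.ball (G s₀ p) (m / 2 / 2) := by
    have a2 := hp s₀ (Metric.mem_closedBall_self hr.le)
    rw [h0, sub_zero] at a2
    rw [Metric.mem_ball, dist_zero_left]
    linarith
  obtain ⟨s, hs, hs0⟩ := himg h0mem
  exact ⟨s, (hball hs).1, hs0⟩

/-! ### Zeros of the dispersion function in the open first quadrant -/

/-- The divided difference of the dispersion function. -/
def dispersionDiff (s a κ : ℂ) : ℂ := ∫ t in (0 : ℝ)..1, dispersionDeriv (a + t * (s - a)) κ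

lemma dispersionDiff_mul (s a κ : ℂ) :
    (s - a) * dispersionDiff s a κ = dispersion s κ - dispersion a κ := by
  have hline : ∀ t : ℝ, HasDerivAt (fun t : ℝ => a + t * (s - a)) (s - a) t := by
    intro t
    simpa using (((hasDerivAt_id (t : ℂ)).comp_ofReal).mul_const (s - a)).const_add a
  have hd : ∀ t ∈ Set.uIcc (0 : ℝ) 1, HasDerivAt (fun t : ℝ => dispersion (a + t * (s - a)) κ)
      (dispersionDeriv (a + t * (s - a)) κ * (s - a)) t := fun t _ =>
    (hasDerivAt_dispersion _ κ).comp t (hline t)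
  have hcont : Continuous fun t : ℝ => dispersionDeriv (a + t * (s - a)) κ * (s - a) := by
    have := continuous_mills
    unfold dispersionDeriv dispersionPolyDeriv
    fun_prop
  have := intervalIntegral.integral_eq_sub_of_hasDerivAt hd (hcont.intervalIntegrable _ _)
  rw [intervalIntegral.integral_mul_const] at this
  simp only [ofReal_one, ofReal_zero, one_mul, zero_mul, add_zero, add_sub_cancel] at this
  rw [dispersionDiff, mul_comm, this]

lemma dispersionDiff_self (a κ : ℂ) : dispersionDiff a a κ = dispersionDeriv a κ := by
  simp [dispersionDiff]

lemma _root_.Continuous.dispersionDiff {X : Type*} [TopologicalSpace X] {f g h : X → ℂ}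
    (hf : Continuous f) (hg : Continuous g) (hh : Continuous h) :
    Continuous fun x => dispersionDiff (f x) (g x) (h x) := by
  have := continuous_mills
  unfold BGK.dispersionDiff
  refine intervalIntegral.continuous_parametric_intervalIntegral_of_continuous' ?_ 0 1
  unfold Function.uncurry dispersionDeriv dispersionPolyDeriv
  fun_prop

attribute [irreducible] dispersionDiff

lemma differentiable_dispersion (κ : ℂ) : Differentiable ℂ fun s => dispersion s κ :=
  fun s => (hasDerivAt_dispersion s κ).differentiableAt

lemma differentiable_dispersionDiff (a κ : ℂ) : Differentiable ℂ fun s => dispersionDiff s a κ := by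
  have e : (fun s => dispersionDiff s a κ) = dslope (fun s => dispersion s κ) a := by
    funext s
    rcases eq_or_ne s a with rfl | h
    · rw [dslope_same, dispersionDiff_self, (hasDerivAt_dispersion s κ).deriv]
    · rw [dslope_of_ne _ h, slope_def_field, eq_div_iff (sub_ne_zero.2 h), mul_comm,
        dispersionDiff_mul]
  rw [e, ← differentiableOn_univ, Complex.differentiableOn_dslope Filter.univ_mem]
  exact (differentiable_dispersion κ).differentiableOn

/-- The open first quadrant. -/
def quadrant : Set ℂ := {s | 0 < s.re ∧ 0 < s.im}

lemma isOpen_quadrant : IsOpen quadrant :=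
  (isOpen_lt continuous_const continuous_re).inter (isOpen_lt continuous_const continuous_im)

lemma exists_dispersion_ne_zero (κ : ℝ) : ∃ r : ℝ, dispersion r κ ≠ 0 := by
  by_contra hcon
  push Not at hcon
  have h0 := hcon 0
  have h1 := hcon 1
  rw [dispersion_ofReal] at h0 h1
  have := strictMonoOn_dispersion κ (Set.mem_Ici.2 le_rfl) (Set.mem_Ici.2 zero_le_one) zero_lt_one
  simp only at this
  rw [ofReal_eq_zero.1 h0, ofReal_eq_zero.1 h1] at this
  exact lt_irrefl _ this

lemma dispersion_zero_persists {s₀ : ℂ} {κ₀ : ℝ} (h : dispersion s₀ κ₀ = 0) {U : Set ℂ}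
    (hU : U ∈ 𝓝 s₀) : ∀ᶠ κ : ℝ in 𝓝 κ₀, ∃ s ∈ U, dispersion s κ = 0 := by
  obtain ⟨r, hr⟩ := exists_dispersion_ne_zero κ₀
  refine eventually_exists_zero (G := fun s (κ : ℝ) => dispersion s κ) ?_
    (fun κ => differentiable_dispersion κ) h ⟨r, hr⟩ hU
  have := continuous_mills
  unfold dispersion dispersionPoly
  fun_prop

lemma dispersionDiff_ne_near {s₀ : ℂ} {κ₀ : ℝ} (h : dispersionDeriv s₀ κ₀ ≠ 0) :
    ∃ V : Set ℂ, IsOpen V ∧ s₀ ∈ V ∧ ∃ W ∈ 𝓝 κ₀, ∀ s ∈ V, ∀ a ∈ V, ∀ κ ∈ W,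
      dispersionDiff s a (κ : ℝ) ≠ 0 := by
  have hc : Continuous fun p : (ℂ × ℂ) × ℝ => dispersionDiff p.1.1 p.1.2 p.2 :=
    Continuous.dispersionDiff (by fun_prop) (by fun_prop) (by fun_prop)
  have hmem : ∀ᶠ p in 𝓝 ((s₀, s₀), κ₀), dispersionDiff p.1.1 p.1.2 (p.2 : ℝ) ≠ 0 := by
    refine hc.continuousAt.eventually_ne ?_
    simp only [dispersionDiff_self]
    exact h
  obtain ⟨U, hU, W, hW, hUW⟩ := mem_nhds_prod_iff.1 hmem
  obtain ⟨A, hA, B, hB, hAB⟩ := mem_nhds_prod_iff.1 hU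
  obtain ⟨V, hV, hVo, hsV⟩ := mem_nhds_iff.1 (Filter.inter_mem hA hB)
  refine ⟨V, hVo, hsV, W, hW, fun s hs a ha κ hκ => ?_⟩
  have hm : ((s, a), κ) ∈ U ×ˢ W := ⟨hAB ⟨(hV hs).1, (hV ha).2⟩, hκ⟩
  exact hUW hm

lemma dispersion_injective_near {s₀ : ℂ} {κ₀ : ℝ} (h : dispersionDeriv s₀ κ₀ ≠ 0) :
    ∃ V : Set ℂ, IsOpen V ∧ s₀ ∈ V ∧ ∀ᶠ κ : ℝ in 𝓝 κ₀, ∀ s ∈ V, ∀ a ∈ V,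
      (dispersion s κ = 0 → dispersion a κ = 0 → s = a) ∧ dispersionDeriv s κ ≠ 0 := by
  obtain ⟨V, hVo, hsV, W, hW, key⟩ := dispersionDiff_ne_near h
  refine ⟨V, hVo, hsV, ?_⟩
  filter_upwards [hW] with κ hκ s hs a haV
  refine ⟨fun h1 h2 => ?_, ?_⟩
  · have := dispersionDiff_mul s a κ
    rw [h1, h2, sub_self] at this
    exact sub_eq_zero.1 ((mul_eq_zero.1 this).resolve_right (key s hs a haV κ hκ))
  · rw [← dispersionDiff_self]; exact key s hs s hs κ hκ

lemma dispersion_zeros_bounded {κ₀ : ℝ} (hκ₀ : 0 < κ₀) :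
    ∃ R : ℝ, ∀ᶠ κ : ℝ in 𝓝 κ₀, ∀ s : ℂ, 0 ≤ s.re → dispersion s κ = 0 → ‖s‖ ≤ R := by
  obtain ⟨R, hR1, hR⟩ := exists_dispersion_zero_near zero_lt_one le_rfl
  refine ⟨max R (4 / κ₀), ?_⟩
  filter_upwards [lt_mem_nhds (half_lt_self hκ₀)] with κ hκ s hs h0
  by_contra hcon
  push Not at hcon
  obtain ⟨h1, h2⟩ := max_lt_iff.1 hcon
  have h3 := hR s κ hs h1.le h0
  have h4 : ‖(κ : ℂ) * s‖ < 2 := by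
    have := norm_add_le ((κ : ℂ) * s - 1) 1
    rw [sub_add_cancel, norm_one] at this
    linarith
  rw [norm_mul, norm_real, norm_of_nonneg (by linarith)] at h4
  rw [div_lt_iff₀ hκ₀] at h2
  nlinarith [norm_nonneg s]

lemma dispersionDeriv_real_ne_zero {r : ℝ} (hr : 0 ≤ r) (κ : ℝ) : dispersionDeriv r κ ≠ 0 := by
  rw [dispersionDeriv_ofReal, ofReal_ne_zero]
  exact (dispersionPolyDeriv_pos hr κ).ne'

/-- Zeros in the quadrant can only emerge from zeros in the quadrant or on the positive imaginary
axis. -/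
lemma quadrant_zeros_eventually_mem {κ₀ : ℝ} (hκ₀ : 0 < κ₀) {V : Set ℂ} (hV : IsOpen V)
    (h : ∀ s : ℂ, 0 ≤ s.re → 0 < s.im → dispersion s κ₀ = 0 → s ∈ V) :
    ∀ᶠ κ : ℝ in 𝓝 κ₀, ∀ s ∈ quadrant, dispersion s κ = 0 → s ∈ V := by
  obtain ⟨R, hR⟩ := dispersion_zeros_bounded hκ₀
  set F : Set ℂ := Metric.closedBall 0 R ∩ ({s | 0 ≤ s.re} ∩ {s | 0 ≤ s.im}) ∩ Vᶜ with hF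
  have hFc : IsCompact F := by
    refine ((isCompact_closedBall (0 : ℂ) R).inter_right ?_).inter_right hV.isClosed_compl
    exact (isClosed_le continuous_const continuous_re).inter (isClosed_le continuous_const continuous_im)
  have hev : ∀ᶠ κ : ℝ in 𝓝 κ₀, ∀ s ∈ F, s ∈ quadrant → dispersion s κ ≠ 0 := by
    refine hFc.eventually_forall_of_forall_eventually fun s₀ hs₀ => ?_
    obtain ⟨⟨-, hre, him⟩, hnV⟩ := hs₀
    by_cases h0 : dispersion s₀ κ₀ = 0
    · have him0 : s₀.im = 0 := by
        by_contra hne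
        exact hnV (h s₀ hre (lt_of_le_of_ne him (Ne.symm hne)) h0)
      have hs : s₀ = (s₀.re : ℂ) := Complex.ext rfl (by simpa using him0)
      have hd : dispersionDeriv s₀ κ₀ ≠ 0 := by
        rw [hs]; exact dispersionDeriv_real_ne_zero hre κ₀
      obtain ⟨V', hVo', hsV', W, hW, key⟩ := dispersionDiff_ne_near hd
      have hconj : conj s₀ = s₀ := by rw [hs, conj_ofReal]
      have hV'' : {s : ℂ | conj s ∈ V'} ∈ 𝓝 s₀ :=
        (hVo'.preimage continuous_conj).mem_nhds (by rw [Set.mem_preimage, hconj]; exact hsV')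
      filter_upwards [prod_mem_nhds hW (Filter.inter_mem (hVo'.mem_nhds hsV') hV'')]
        with p ⟨hp1, hp2, hp3⟩ hq hz
      have hp := key p.2 hp2 _ hp3 p.1 hp1
      have hz' := dispersion_conj p.2 p.1
      rw [hz, map_zero] at hz'
      have := dispersionDiff_mul p.2 (conj p.2) p.1
      rw [hz, hz', sub_self] at this
      have h3 := sub_eq_zero.1 ((mul_eq_zero.1 this).resolve_right hp)
      have h4 := conj_eq_iff_im.1 h3.symm
      exact hq.2.ne' h4
    · have hc : Continuous fun p : ℝ × ℂ => dispersion p.2 p.1 := by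
        have := continuous_mills
        unfold dispersion dispersionPoly
        fun_prop
      have := (hc.continuousAt (x := (κ₀, s₀))).eventually_ne h0
      filter_upwards [this] with p hp _ using hp
  filter_upwards [hev, hR] with κ h1 h2 s hs hz
  by_contra hnV
  exact h1 s ⟨⟨by simpa using h2 s hs.1.le hz, hs.1.le, hs.2.le⟩, hnV⟩ hs hz

/-- The height of the acoustic crossing of the imaginary axis. -/
def crossHeight : ℝ := exists_crossing.choose

/-- The critical wave number of the acoustic modes. -/
def crossKappa : ℝ := exists_crossing.choose_spec.choose

lemma cross_mem : (crossHeight, crossKappa) ∈ crossingBox :=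
  exists_crossing.choose_spec.choose_spec.1

lemma cross_zero : dispersion (I * crossHeight) crossKappa = 0 :=
  exists_crossing.choose_spec.choose_spec.2.1

lemma cross_unique {y κ : ℝ} (hy : 0 < y) (hκ : 0 ≤ κ) (h : dispersion (I * y) κ = 0) :
    y = crossHeight ∧ κ = crossKappa :=
  exists_crossing.choose_spec.choose_spec.2.2 y κ hy hκ h

lemma crossHeight_pos : 0 < crossHeight := by have := cross_mem.1.1; linarith

lemma crossKappa_pos : 0 < crossKappa := by have := cross_mem.2.1; linarith

lemma cross_unique' {s : ℂ} {κ : ℝ} (hs : s.re = 0) (hs' : 0 < s.im) (hκ : 0 ≤ κ)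
    (h : dispersion s κ = 0) : s = I * crossHeight ∧ κ = crossKappa := by
  have e : s = I * (s.im : ℂ) := Complex.ext (by simpa using hs) (by simp)
  rw [e] at h
  obtain ⟨h1, h2⟩ := cross_unique hs' hκ h
  exact ⟨by rw [e, h1], h2⟩

/-- No acoustic zero. -/
def NoAcoustic (κ : ℝ) : Prop := ∀ s ∈ quadrant, dispersion s κ ≠ 0

/-- Exactly one acoustic zero, and it is simple. -/
def OneAcoustic (κ : ℝ) : Prop := ∃ s ∈ quadrant, dispersion s κ = 0 ∧ dispersionDeriv s κ ≠ 0 ∧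
  ∀ s' ∈ quadrant, dispersion s' κ = 0 → s' = s

lemma NoAcoustic.eventually {κ₀ : ℝ} (hκ₀ : 0 < κ₀) (hne : κ₀ ≠ crossKappa) (h : NoAcoustic κ₀) :
    ∀ᶠ κ in 𝓝 κ₀, NoAcoustic κ := by
  refine (quadrant_zeros_eventually_mem hκ₀ isOpen_empty fun s h1 h2 h3 => ?_).mono
    fun κ hκ s hs h0 => hκ s hs h0
  rcases h1.eq_or_lt with h1 | h1
  · exact absurd (cross_unique' h1.symm h2 hκ₀.le h3).2 hne
  · exact absurd h3 (h s ⟨h1, h2⟩)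

lemma not_noAcoustic_eventually {κ₀ : ℝ} (h : ¬ NoAcoustic κ₀) : ∀ᶠ κ in 𝓝 κ₀, ¬ NoAcoustic κ := by
  unfold NoAcoustic at h
  push Not at h
  obtain ⟨s, hs, h0⟩ := h
  filter_upwards [dispersion_zero_persists h0 (isOpen_quadrant.mem_nhds hs)] with κ hκ hcon
  obtain ⟨s, hs, h0⟩ := hκ
  exact hcon s hs h0

lemma exists_noAcoustic : ∃ K : ℝ, ∀ κ, K ≤ κ → NoAcoustic κ := by
  obtain ⟨R, hR1, hR⟩ := exists_dispersion_zero_near zero_lt_one le_rfl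
  have hc : Continuous fun s : ℂ => ‖-mills s * s ^ 4 + 4 * mills s * s ^ 2 + s ^ 3 - 11 * mills s - 5 * s‖
      + ‖2 * mills s * s ^ 3 - 4 * mills s ^ 2 * s ^ 2 + 4 * mills s ^ 2 - 2 * s ^ 2 + 6‖
      + ‖-mills s * s ^ 2 + 4 * mills s ^ 2 * s - 5 * mills s + s‖ := by
    have := continuous_mills
    fun_prop
  obtain ⟨M, hM⟩ := (isCompact_closedBall (0 : ℂ) R).bddAbove_image hc.continuousOn
  refine ⟨max 2 (max M 0 + 1), fun κ hκ s hs h0 => ?_⟩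
  obtain ⟨h2, hκM⟩ := max_le_iff.1 hκ
  have hM1 := le_max_left M 0
  have hM2 := le_max_right M 0
  have hκ0 : 0 < κ := by linarith
  rcases le_or_gt R ‖s‖ with h | h
  · have h3 := hR s κ hs.1.le h h0
    have h4 : ‖(κ : ℂ) * s‖ < 2 := by
      have := norm_add_le ((κ : ℂ) * s - 1) 1
      rw [sub_add_cancel, norm_one] at this
      linarith
    rw [norm_mul, norm_real, norm_of_nonneg hκ0.le] at h4
    nlinarith [norm_nonneg s]
  · have hb := hM ⟨s, by simpa using h.le, rfl⟩
    simp only at hb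
    set a := -mills s * s ^ 4 + 4 * mills s * s ^ 2 + s ^ 3 - 11 * mills s - 5 * s
    set b := 2 * mills s * s ^ 3 - 4 * mills s ^ 2 * s ^ 2 + 4 * mills s ^ 2 - 2 * s ^ 2 + 6
    set c := -mills s * s ^ 2 + 4 * mills s ^ 2 * s - 5 * mills s + s
    have e : (6 * (κ : ℂ) ^ 3) = -((κ : ℂ) ^ 2 * a + κ * b + c) := by
      have : 6 * (κ : ℂ) ^ 3 + (κ : ℂ) ^ 2 * a + κ * b + c = 0 := h0
      linear_combination this
    have n : 6 * κ ^ 3 ≤ κ ^ 2 * ‖a‖ + κ * ‖b‖ + ‖c‖ := by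
      have h1 : ‖6 * (κ : ℂ) ^ 3‖ = 6 * κ ^ 3 := by
        rw [norm_mul, norm_pow, norm_real, norm_of_nonneg hκ0.le, Complex.norm_ofNat]
      rw [← h1, e, norm_neg]
      refine (norm_add_le _ _).trans (add_le_add_left ((norm_add_le _ _).trans ?_) _)
      rw [norm_mul, norm_mul, norm_pow, norm_real, norm_of_nonneg hκ0.le]
    have na := norm_nonneg a
    have nb := norm_nonneg b
    have nc := norm_nonneg c
    have hk2 : κ ≤ κ ^ 2 := by nlinarith
    have k1 : κ * ‖b‖ ≤ κ ^ 2 * ‖b‖ := by gcongr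
    have k2 : ‖c‖ ≤ κ ^ 2 * ‖c‖ := le_mul_of_one_le_left nc (by nlinarith)
    have k3 : κ ^ 2 * (‖a‖ + ‖b‖ + ‖c‖) ≤ κ ^ 2 * κ := by
      gcongr
      linarith
    have : 0 < κ ^ 3 := by positivity
    nlinarith

open Filter in
/-- A property which is locally constant on a preconnected set and holds somewhere holds everywhere. -/
lemma forall_of_locally_constant {S : Set ℝ} (hS : IsPreconnected S) {p : ℝ → Prop}
    (h1 : ∀ x ∈ S, p x → ∀ᶠ y in 𝓝 x, p y) (h2 : ∀ x ∈ S, ¬ p x → ∀ᶠ y in 𝓝 x, ¬ p y)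
    {x₀ : ℝ} (hx₀ : x₀ ∈ S) (hp : p x₀) : ∀ x ∈ S, p x := by
  have ho : ∀ q : ℝ → Prop, IsOpen {x | ∀ᶠ y in 𝓝 x, q y} := fun q =>
    isOpen_iff_mem_nhds.2 fun x hx => eventually_eventually_nhds.2 hx
  have := hS.subset_left_of_subset_union (ho p) (ho fun y => ¬ p y)
    (Set.disjoint_left.2 fun x hx hx' => by
      have := (hx.and hx').self_of_nhds
      exact this.2 this.1)
    (fun x hx => (em (p x)).imp (h1 x hx) (h2 x hx)) ⟨x₀, hx₀, h1 x₀ hx₀ hp⟩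
  exact fun x hx => (this hx).self_of_nhds

lemma noAcoustic_of_gt {κ : ℝ} (hκ : crossKappa < κ) : NoAcoustic κ := by
  obtain ⟨K, hK⟩ := exists_noAcoustic
  refine forall_of_locally_constant (S := Ioi crossKappa) isPreconnected_Ioi
    (fun x hx h => h.eventually (crossKappa_pos.trans hx) (ne_of_gt hx))
    (fun x _ h => not_noAcoustic_eventually h)
    (x₀ := max K (crossKappa + 1)) ?_ (hK _ (le_max_left _ _)) κ hκ
  exact lt_of_lt_of_le (lt_add_one crossKappa) (le_max_right K (crossKappa + 1))

lemma noAcoustic_crossKappa : NoAcoustic crossKappa := by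
  by_contra hcon
  have h1 := (not_noAcoustic_eventually hcon).filter_mono (nhdsWithin_le_nhds (s := Ioi crossKappa))
  have h2 : ∀ᶠ κ in 𝓝[>] crossKappa, NoAcoustic κ := by
    filter_upwards [self_mem_nhdsWithin] with κ hκ using noAcoustic_of_gt hκ
  obtain ⟨κ, a, b⟩ := (h1.and h2).exists
  exact a b

lemma OneAcoustic.eventually {κ₀ : ℝ} (hκ₀ : 0 < κ₀) (hne : κ₀ ≠ crossKappa) (h : OneAcoustic κ₀) :
    ∀ᶠ κ in 𝓝 κ₀, OneAcoustic κ := by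
  obtain ⟨s, hs, h0, hd, hu⟩ := h
  obtain ⟨V, hVo, hsV, hV⟩ := dispersion_injective_near hd
  have hloc := quadrant_zeros_eventually_mem hκ₀ hVo fun s' h1 h2 h3 => by
    rcases h1.eq_or_lt with h1 | h1
    · exact absurd (cross_unique' h1.symm h2 hκ₀.le h3).2 hne
    · rwa [hu s' ⟨h1, h2⟩ h3]
  filter_upwards [hV, hloc, dispersion_zero_persists h0
    ((isOpen_quadrant.inter hVo).mem_nhds ⟨hs, hsV⟩)] with κ h1 h2 ⟨a, ⟨ha, haV⟩, ha0⟩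
  exact ⟨a, ha, ha0, (h1 a haV a haV).2, fun s' hs' h' => (h1 s' (h2 s' hs' h') a haV).1 h' ha0⟩

lemma not_oneAcoustic_eventually {κ₀ : ℝ} (hκ₀ : 0 < κ₀) (hne : κ₀ ≠ crossKappa)
    (h : ¬ OneAcoustic κ₀) : ∀ᶠ κ in 𝓝 κ₀, ¬ OneAcoustic κ := by
  by_cases hE : NoAcoustic κ₀
  · filter_upwards [hE.eventually hκ₀ hne] with κ hκ
    rintro ⟨s, hs, h0, -⟩
    exact hκ s hs h0
  unfold NoAcoustic at hE
  push Not at hE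
  obtain ⟨s₀, hs₀, h0⟩ := hE
  by_cases hu : ∀ s' ∈ quadrant, dispersion s' κ₀ = 0 → s' = s₀
  · -- a double zero
    have hd : dispersionDeriv s₀ κ₀ = 0 := by
      by_contra hd
      exact h ⟨s₀, hs₀, h0, hd, hu⟩
    have hG : ∀ᶠ p : ℂ × ℝ in 𝓝 (s₀, κ₀), ∃ s ∈ quadrant, dispersionDiff s p.1 p.2 = 0 := by
      refine eventually_exists_zero (G := fun s (p : ℂ × ℝ) => dispersionDiff s p.1 p.2) ?_
        (fun p => differentiable_dispersionDiff _ _) ?_ ?_ (isOpen_quadrant.mem_nhds hs₀)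
      · exact Continuous.dispersionDiff (by fun_prop) (by fun_prop) (by fun_prop)
      · simp only [dispersionDiff_self, hd]
      · obtain ⟨r, hr⟩ := exists_dispersion_ne_zero κ₀
        refine ⟨r, fun hcon => hr ?_⟩
        have := dispersionDiff_mul r s₀ κ₀
        simp only at hcon
        rw [hcon, mul_zero, h0, sub_zero] at this
        exact this.symm
    rw [nhds_prod_eq, Filter.eventually_prod_iff] at hG
    obtain ⟨pa, ha, pb, hb, hab⟩ := hG
    filter_upwards [hb, dispersion_zero_persists h0
      (Filter.inter_mem ha (isOpen_quadrant.mem_nhds hs₀))] with κ hκ ⟨a, ⟨hpa, haq⟩, ha0⟩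
    rintro ⟨s, hs, hs0, hsd, hsu⟩
    obtain ⟨z, hz, hz0⟩ := hab hpa hκ
    simp only at hz0
    have h1 := dispersionDiff_mul z a κ
    rw [hz0, mul_zero, ha0, sub_zero] at h1
    have e1 := hsu a haq ha0
    have e2 := hsu z hz h1.symm
    rw [e1, e2, dispersionDiff_self] at hz0
    exact hsd hz0
  · push Not at hu
    obtain ⟨s₁, hs₁, h1, hne'⟩ := hu
    obtain ⟨U, V, hU, hV, hsU, hsV, hdis⟩ := t2_separation hne'
    filter_upwards [dispersion_zero_persists h1 ((hU.inter isOpen_quadrant).mem_nhds ⟨hsU, hs₁⟩),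
      dispersion_zero_persists h0 ((hV.inter isOpen_quadrant).mem_nhds ⟨hsV, hs₀⟩)]
      with κ ⟨a, ⟨haU, haq⟩, ha0⟩ ⟨b, ⟨hbV, hbq⟩, hb0⟩
    rintro ⟨s, hs, hs0, hsd, hsu⟩
    rw [hsu a haq ha0] at haU
    rw [hsu b hbq hb0] at hbV
    exact Set.disjoint_left.1 hdis haU hbV

/-- Just below the critical wave number the zero lies in the open quadrant. -/
lemma oneAcoustic_eventually_left : ∀ᶠ κ in 𝓝[<] crossKappa, OneAcoustic κ := by
  obtain ⟨p1, p2, p3, p4⟩ := box_derivatives_pos cross_mem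
  set sc : ℂ := I * crossHeight with hsc
  have hd : dispersionDeriv sc crossKappa ≠ 0 := fun h => by rw [h] at p1; simp at p1
  obtain ⟨V, hVo, hsV, hV⟩ := dispersion_injective_near hd
  have hloc := quadrant_zeros_eventually_mem crossKappa_pos hVo fun s' h1 h2 h3 => by
    rcases h1.eq_or_lt with h1 | h1
    · rw [(cross_unique' h1.symm h2 crossKappa_pos.le h3).1]; exact hsV
    · exact absurd h3 (noAcoustic_crossKappa s' ⟨h1, h2⟩)
  -- the slope of the zero
  set A := -mills sc * sc ^ 4 + 4 * mills sc * sc ^ 2 + sc ^ 3 - 11 * mills sc - 5 * sc with hA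
  set B := 2 * mills sc * sc ^ 3 - 4 * mills sc ^ 2 * sc ^ 2 + 4 * mills sc ^ 2 - 2 * sc ^ 2 + 6 with hB
  set KK : ℝ → ℂ := fun κ => 6 * ((κ : ℂ) ^ 2 + κ * crossKappa + (crossKappa : ℂ) ^ 2)
    + A * (κ + crossKappa) + B with hKK
  have hKc : KK crossKappa = dispersionPolyKappa sc crossKappa (mills sc) := by
    rw [hKK, hA, hB]; simp only [dispersionPolyKappa]; ring
  have hKd : ∀ κ : ℝ, dispersion sc κ - dispersion sc crossKappa = (κ - crossKappa) * KK κ := by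
    intro κ; rw [hKK, hA, hB]; simp only [dispersion, dispersionPoly]; ring
  have hpos : ∀ᶠ p : ℂ × ℝ in 𝓝 (sc, crossKappa), 0 < (KK p.2 / dispersionDiff p.1 sc p.2).re := by
    have c1 : ContinuousAt (fun p : ℂ × ℝ => dispersionDiff p.1 sc p.2) (sc, crossKappa) :=
      (Continuous.dispersionDiff (by fun_prop) (by fun_prop) (by fun_prop)).continuousAt
    have c2 : ContinuousAt (fun p : ℂ × ℝ => KK p.2) (sc, crossKappa) := by
      rw [hKK]; fun_prop
    have c3 : ContinuousAt (fun p : ℂ × ℝ => (KK p.2 / dispersionDiff p.1 sc p.2).re) (sc, crossKappa) :=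
      continuous_re.continuousAt.comp (c2.div c1 (by simpa only [dispersionDiff_self] using hd))
    refine c3.eventually (lt_mem_nhds ?_)
    simp only [dispersionDiff_self, hKc]
    rw [div_re]
    have : 0 < normSq (dispersionDeriv sc crossKappa) := normSq_pos.2 hd
    positivity
  rw [nhds_prod_eq, Filter.eventually_prod_iff] at hpos
  obtain ⟨pa, ha, pb, hb, hab⟩ := hpos
  have him : {s : ℂ | 0 < s.im} ∈ 𝓝 sc :=
    (isOpen_lt continuous_const continuous_im).mem_nhds (by simpa [hsc] using crossHeight_pos)
  have hex := dispersion_zero_persists cross_zero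
    (Filter.inter_mem (Filter.inter_mem ha him) (hVo.mem_nhds hsV))
  filter_upwards [self_mem_nhdsWithin, nhdsWithin_le_nhds hV, nhdsWithin_le_nhds hloc,
    nhdsWithin_le_nhds hex, nhdsWithin_le_nhds hb] with κ hκ h1 h2 ⟨s, ⟨⟨hs1, hs2⟩, hs3⟩, hs0⟩ h4
  have hr := hab hs1 h4
  simp only at hr
  have hDD : dispersionDiff s sc κ ≠ 0 := by
    intro h; rw [h, div_zero] at hr; simp at hr
  have key := dispersionDiff_mul s sc κ
  have key2 := hKd κ
  rw [cross_zero, sub_zero] at key2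
  rw [hs0, key2, zero_sub] at key
  have e : s - sc = ((crossKappa - κ : ℝ) : ℂ) * (KK κ / dispersionDiff s sc κ) := by
    field_simp
    rw [key]; push_cast; ring
  have hre : 0 < s.re := by
    have h5 := congrArg Complex.re e
    rw [re_ofReal_mul, sub_re] at h5
    have h6 : sc.re = 0 := by simp [hsc]
    rw [h6, sub_zero] at h5
    rw [h5]
    exact mul_pos (sub_pos.2 hκ) hr
  exact ⟨s, ⟨hre, hs2⟩, hs0, (h1 s hs3 s hs3).2,
    fun s' hs' h' => (h1 s' (h2 s' hs' h') s hs3).1 h' hs0⟩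

lemma oneAcoustic_of_lt {κ : ℝ} (h0 : 0 < κ) (h1 : κ < crossKappa) : OneAcoustic κ := by
  have hmem : Set.Ioo 0 crossKappa ∈ 𝓝[<] crossKappa := Ioo_mem_nhdsLT crossKappa_pos
  obtain ⟨x, hx, hx'⟩ := (oneAcoustic_eventually_left.and hmem).exists
  exact forall_of_locally_constant (S := Set.Ioo 0 crossKappa) isPreconnected_Ioo
    (fun x hx h => h.eventually hx.1 hx.2.ne) (fun x hx h => not_oneAcoustic_eventually hx.1 hx.2.ne h)
    hx' hx κ ⟨h0, h1⟩

open Classical in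
/-- The acoustic zero in the first quadrant. -/
def acousticRoot (κ : ℝ) : ℂ :=
  if h : 0 < κ ∧ κ < crossKappa then (oneAcoustic_of_lt h.1 h.2).choose else 0

lemma acousticRoot_spec {κ : ℝ} (h0 : 0 < κ) (h1 : κ < crossKappa) :
    acousticRoot κ ∈ quadrant ∧ dispersion (acousticRoot κ) κ = 0 ∧
    ∀ s ∈ quadrant, dispersion s κ = 0 → s = acousticRoot κ := by
  have h := (oneAcoustic_of_lt h0 h1).choose_spec
  rw [acousticRoot, dif_pos ⟨h0, h1⟩]
  exact ⟨h.1, h.2.1, h.2.2.2⟩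

lemma quadrant_zero_iff {κ : ℝ} (h0 : 0 < κ) (s : ℂ) :
    s ∈ quadrant ∧ dispersion s κ = 0 ↔ κ < crossKappa ∧ s = acousticRoot κ := by
  constructor
  · rintro ⟨hs, hz⟩
    rcases lt_trichotomy κ crossKappa with h | h | h
    · exact ⟨h, (acousticRoot_spec h0 h).2.2 s hs hz⟩
    · rw [h] at hz; exact absurd hz (noAcoustic_crossKappa s hs)
    · exact absurd hz (noAcoustic_of_gt h s hs)
  · rintro ⟨h, rfl⟩
    exact ⟨(acousticRoot_spec h0 h).1, (acousticRoot_spec h0 h).2.1⟩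

lemma continuousAt_acousticRoot {κ : ℝ} (h0 : 0 < κ) (h1 : κ < crossKappa) :
    ContinuousAt acousticRoot κ := by
  obtain ⟨a, b, -⟩ := acousticRoot_spec h0 h1
  intro U hU
  rw [Filter.mem_map]
  filter_upwards [dispersion_zero_persists b (Filter.inter_mem hU (isOpen_quadrant.mem_nhds a)),
    Ioo_mem_nhds h0 h1] with κ' ⟨s, ⟨hsU, hsq⟩, hs⟩ hκ'
  rw [Set.mem_preimage, ← (acousticRoot_spec hκ'.1 hκ'.2).2.2 s hsq hs]
  exact hsU

/-- As `κ → 0`, all zeros in the right half-plane satisfy `κ s → 1`. -/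
lemma eventually_zero_near_one (hz : ∀ s : ℂ, 0 ≤ s.re → dispersion s 0 ≠ 0) {δ : ℝ} (hδ : 0 < δ) :
    ∀ᶠ κ : ℝ in 𝓝 0, ∀ s : ℂ, 0 ≤ s.re → dispersion s κ = 0 → ‖κ * s - 1‖ < δ := by
  obtain ⟨R, hR1, hR⟩ := exists_dispersion_zero_near (lt_min hδ zero_lt_one) (min_le_right _ _)
  have hF : IsCompact (Metric.closedBall (0 : ℂ) R ∩ {s | 0 ≤ s.re}) :=
    (isCompact_closedBall (0 : ℂ) R).inter_right (isClosed_le continuous_const continuous_re)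
  have hev : ∀ᶠ κ : ℝ in 𝓝 0, ∀ s ∈ Metric.closedBall (0 : ℂ) R ∩ {s | 0 ≤ s.re},
      dispersion s κ ≠ 0 := by
    refine hF.eventually_forall_of_forall_eventually fun s₀ hs₀ => ?_
    have hc : Continuous fun p : ℝ × ℂ => dispersion p.2 p.1 := by
      have := continuous_mills
      unfold dispersion dispersionPoly
      fun_prop
    refine (hc.continuousAt (x := ((0 : ℝ), s₀))).eventually_ne ?_
    simpa using hz s₀ hs₀.2
  filter_upwards [hev] with κ hκ s hs h0
  rcases le_total R ‖s‖ with h | h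
  · exact (hR s κ hs h h0).trans_le (min_le_left _ _)
  · exact absurd h0 (hκ s ⟨by simpa using h, hs⟩)

/-! ### One-dimensional Gaussian moments -/

/-- The standard Gaussian measure on the line. -/
abbrev gauss1 : Measure ℝ := gaussianReal 0 1

lemma integrable_pow_gauss1 (n : ℕ) : Integrable (fun t : ℝ => t ^ n) gauss1 := by
  have h := (memLp_id_gaussianReal (μ := 0) (v := 1) n).integrable_norm_pow'
  refine h.mono' (by fun_prop) (.of_forall fun t => ?_)
  simp

lemma gaussianPDFReal_std (t : ℝ) :
    gaussianPDFReal 0 1 t = (√(2 * Real.pi))⁻¹ * Real.exp (-t ^ 2 / 2) := by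
  simp [gaussianPDFReal]

lemma hasDerivAt_gaussianPDFReal_std (t : ℝ) :
    HasDerivAt (gaussianPDFReal 0 1) (-t * gaussianPDFReal 0 1 t) t := by
  have h : gaussianPDFReal 0 1 = fun t => (√(2 * Real.pi))⁻¹ * Real.exp (-t ^ 2 / 2) :=
    funext gaussianPDFReal_std
  rw [h]
  have h1 : HasDerivAt (fun t : ℝ => -t ^ 2 / 2) (-t) t := by
    refine (((hasDerivAt_id t).fun_pow 2).fun_neg.div_const 2).congr_deriv ?_
    simp; ring
  refine (h1.exp.const_mul _).congr_deriv ?_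
  ring

lemma integral_gauss1_eq (f : ℝ → ℝ) :
    ∫ t, f t ∂gauss1 = ∫ t, f t * gaussianPDFReal 0 1 t := by
  rw [integral_gaussianReal_eq_integral_smul (by norm_num)]
  simp [mul_comm]

lemma integrable_pow_mul_gaussianPDFReal (n : ℕ) :
    Integrable (fun t : ℝ => t ^ n * gaussianPDFReal 0 1 t) := by
  have h := integrable_pow_gauss1 n
  rw [gauss1, gaussianReal_of_var_ne_zero _ (by norm_num),
    integrable_withDensity_iff_integrable_smul₀' (measurable_gaussianPDF 0 1).aemeasurable
      (.of_forall fun x => gaussianPDF_lt_top)] at h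
  refine h.congr (.of_forall fun t => ?_)
  simp [toReal_gaussianPDF, mul_comm]

lemma integral_pow_add_two_gauss1 (n : ℕ) :
    ∫ t, t ^ (n + 2) ∂gauss1 = (n + 1) * ∫ t, t ^ n ∂gauss1 := by
  have hd : ∀ t : ℝ, HasDerivAt (fun t => t ^ (n + 1) * gaussianPDFReal 0 1 t)
      ((n + 1) * (t ^ n * gaussianPDFReal 0 1 t) - t ^ (n + 2) * gaussianPDFReal 0 1 t) t := by
    intro t
    refine ((hasDerivAt_pow (n + 1) t).fun_mul (hasDerivAt_gaussianPDFReal_std t)).congr_deriv ?_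
    push_cast
    ring
  have i0 := (integrable_pow_mul_gaussianPDFReal n).const_mul ((n : ℝ) + 1)
  have h := integral_eq_zero_of_hasDerivAt_of_integrable hd
    (i0.sub (integrable_pow_mul_gaussianPDFReal (n + 2)))
    (integrable_pow_mul_gaussianPDFReal (n + 1))
  rw [integral_sub i0 (integrable_pow_mul_gaussianPDFReal (n + 2)), integral_const_mul] at h
  rw [integral_gauss1_eq, integral_gauss1_eq]
  linarith

lemma integral_pow_zero_gauss1 : ∫ t, t ^ 0 ∂gauss1 = 1 := by simp

lemma integral_pow_one_gauss1 : ∫ t, t ^ 1 ∂gauss1 = 0 := by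
  simp

lemma integral_pow_two_gauss1 : ∫ t, t ^ 2 ∂gauss1 = 1 := by
  have := integral_pow_add_two_gauss1 0
  simpa using this

lemma integral_pow_three_gauss1 : ∫ t, t ^ 3 ∂gauss1 = 0 := by
  have := integral_pow_add_two_gauss1 1
  simpa using this

lemma integral_pow_four_gauss1 : ∫ t, t ^ 4 ∂gauss1 = 3 := by
  have := integral_pow_add_two_gauss1 2
  rw [integral_pow_two_gauss1] at this
  rw [this]; norm_num

/-- The weighted moments `∫ h(t) tⁿ dγ(t)`. -/
def wMoment (h : ℝ → ℂ) (n : ℕ) : ℂ := ∫ t, h t * (t : ℂ) ^ n ∂gauss1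

lemma integrable_wMoment {h : ℝ → ℂ} (hm : Measurable h) {C : ℝ} (hb : ∀ t, ‖h t‖ ≤ C) (n : ℕ) :
    Integrable (fun t : ℝ => h t * (t : ℂ) ^ n) gauss1 := by
  have h1 : Integrable (fun t : ℝ => (t : ℂ) ^ n) gauss1 := by
    have := (integrable_pow_gauss1 n).ofReal (𝕜 := ℂ)
    refine this.congr (.of_forall fun t => by simp)
  exact h1.bdd_mul (c := C) hm.aestronglyMeasurable (.of_forall hb)

lemma wMoment_one (n : ℕ) : wMoment (fun _ => 1) n = ((∫ t, t ^ n ∂gauss1 : ℝ) : ℂ) := by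
  unfold wMoment
  rw [← integral_complex_ofReal]
  simp

/-- The moments `∫ tⁿ / (s + i t) dγ(t)`. -/
def resMoment (s : ℂ) (n : ℕ) : ℂ := wMoment (fun t => (s + I * t)⁻¹) n

lemma norm_inv_add_I_mul_le {s : ℂ} (hs : s.re ≠ 0) (t : ℝ) : ‖(s + I * t)⁻¹‖ ≤ |s.re|⁻¹ := by
  rw [norm_inv]
  have h0 : 0 < |s.re| := abs_pos.2 hs
  gcongr
  have := abs_re_le_norm (s + I * t)
  simpa using this

lemma add_I_mul_ne_zero {s : ℂ} (hs : s.re ≠ 0) (t : ℝ) : s + I * t ≠ 0 := by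
  intro h
  apply hs
  have := congrArg Complex.re h
  simpa using this

lemma integrable_resMoment {s : ℂ} (hs : s.re ≠ 0) (n : ℕ) :
    Integrable (fun t : ℝ => (s + I * t)⁻¹ * (t : ℂ) ^ n) gauss1 :=
  integrable_wMoment (by fun_prop) (norm_inv_add_I_mul_le hs) n

lemma resMoment_succ {s : ℂ} (hs : s.re ≠ 0) (n : ℕ) :
    resMoment s (n + 1) = -I * (((∫ t, t ^ n ∂gauss1 : ℝ) : ℂ) - s * resMoment s n) := by
  have e : ∀ t : ℝ, (s + I * t)⁻¹ * (t : ℂ) ^ (n + 1) =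
      -I * ((t : ℂ) ^ n - s * ((s + I * t)⁻¹ * (t : ℂ) ^ n)) := by
    intro t
    have h := add_I_mul_ne_zero hs t
    have hI : I ^ 2 = -1 := I_sq
    field_simp
    linear_combination (t : ℂ) ^ (n + 1) * hI
  unfold resMoment wMoment
  simp_rw [e]
  have h1 : Integrable (fun t : ℝ => (t : ℂ) ^ n) gauss1 := by
    have := (integrable_pow_gauss1 n).ofReal (𝕜 := ℂ)
    refine this.congr (.of_forall fun t => by simp)
  rw [integral_const_mul, integral_sub h1 ((integrable_resMoment hs n).const_mul s),
    integral_const_mul, ← integral_complex_ofReal]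
  simp

lemma resMoment_zero {s : ℂ} (hs : 0 < s.re) : resMoment s 0 = mills s := by
  have e : ∀ t : ℝ, (s + I * t)⁻¹ * (t : ℂ) ^ 0 =
      ∫ x in Ioi (0 : ℝ), cexp (-(s + I * t) * x) := by
    intro t
    rw [integral_exp_mul_complex_Ioi (by simpa using hs)]
    have := add_I_mul_ne_zero hs.ne' t
    rw [div_neg, neg_div, neg_neg]
    simp
  have hint : Integrable (Function.uncurry fun t x : ℝ => cexp (-(s + I * t) * x))
      (gauss1.prod (volume.restrict (Ioi 0))) := by
    have h1 : Integrable (fun x : ℝ => Real.exp (-s.re * x)) (volume.restrict (Ioi 0)) :=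
      exp_neg_integrableOn_Ioi 0 hs
    have h2 := (integrable_const (1 : ℝ) : Integrable _ gauss1).mul_prod h1
    refine h2.mono' (Continuous.aestronglyMeasurable (by fun_prop))
      (.of_forall fun p => ?_)
    simp [Function.uncurry, Complex.norm_exp]
  unfold resMoment wMoment
  simp_rw [e]
  rw [integral_integral_swap hint]
  unfold mills millsMoment
  refine integral_congr_ae (.of_forall fun x => ?_)
  have h := charFun_gaussianReal (μ := 0) (v := 1) (-x)
  rw [charFun_apply_real] at h
  have e2 : ∀ t : ℝ, cexp (-(s + I * t) * x) = cexp (-s * x) * cexp ((-x : ℝ) * t * I) := by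
    intro t
    rw [← Complex.exp_add]; congr 1; push_cast; ring
  simp only [e2]
  rw [integral_const_mul, h, pow_zero, one_mul, ← Complex.exp_add]
  congr 1
  push_cast
  ring

lemma resMoment_values {s : ℂ} (hs : 0 < s.re) :
    resMoment s 0 = mills s ∧ resMoment s 1 = -I * (1 - s * mills s) ∧
    resMoment s 2 = s * (1 - s * mills s) ∧
    resMoment s 3 = -I * (1 - s ^ 2 * (1 - s * mills s)) ∧
    resMoment s 4 = s * (1 - s ^ 2 * (1 - s * mills s)) := by
  have h0 := resMoment_zero hs
  have h1 := resMoment_succ hs.ne' 0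
  have h2 := resMoment_succ hs.ne' 1
  have h3 := resMoment_succ hs.ne' 2
  have h4 := resMoment_succ hs.ne' 3
  have hI : I ^ 2 = -1 := I_sq
  rw [integral_pow_zero_gauss1, h0] at h1
  rw [integral_pow_one_gauss1, h1] at h2
  rw [integral_pow_two_gauss1, h2] at h3
  have h3' : resMoment s 3 = -I * (1 - s ^ 2 * (1 - s * mills s)) := by
    rw [h3]; push_cast; linear_combination (I * (s * mills s * s ^ 2 - s ^ 2)) * hI
  rw [integral_pow_three_gauss1, h3'] at h4
  refine ⟨h0, by simpa using h1, ?_, h3', ?_⟩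
  · rw [h2]; push_cast; linear_combination (s * mills s * s - s) * hI
  · rw [h4]; push_cast; linear_combination (-s * (1 - s ^ 2 * (1 - s * mills s))) * hI

/-! ### Three-dimensional Gaussian integrals -/

lemma maxwellian_eq_map_pi :
    maxwellian = (Measure.pi (fun _ : Fin 3 => gauss1)).map (WithLp.toLp 2) :=
  map_pi_eq_stdGaussian.symm

/-- The monomial `h(v₀) v₀^{n₀} v₁^{n₁} v₂^{n₂}`. -/
def wMonomial (h : ℝ → ℂ) (n : Fin 3 → ℕ) (v : E3) : ℂ :=
  h (v 0) * (v 0 : ℂ) ^ n 0 * (v 1 : ℂ) ^ n 1 * (v 2 : ℂ) ^ n 2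

lemma integral_wMonomial (h : ℝ → ℂ) (hm : Measurable h) (n : Fin 3 → ℕ) :
    ∫ v, wMonomial h n v ∂maxwellian = wMoment h (n 0) * ((∫ t, t ^ n 1 ∂gauss1 : ℝ) : ℂ) *
      ((∫ t, t ^ n 2 ∂gauss1 : ℝ) : ℂ) := by
  rw [maxwellian_eq_map_pi, integral_map (by fun_prop)
    (Measurable.aestronglyMeasurable (by unfold wMonomial; fun_prop))]
  have e := integral_fintype_prod_eq_prod (𝕜 := ℂ) (μ := fun _ : Fin 3 => gauss1)
    ![fun t : ℝ => h t * (t : ℂ) ^ n 0, fun t => (t : ℂ) ^ n 1, fun t => (t : ℂ) ^ n 2]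
  simp only [Fin.prod_univ_three] at e
  simp only [Matrix.cons_val_zero, Matrix.cons_val_one, Matrix.cons_val_two] at e
  rw [← integral_complex_ofReal, ← integral_complex_ofReal]
  simpa [wMonomial, wMoment] using e

lemma integrable_wMonomial {h : ℝ → ℂ} (hm : Measurable h) {C : ℝ} (hb : ∀ t, ‖h t‖ ≤ C)
    (n : Fin 3 → ℕ) : Integrable (wMonomial h n) maxwellian := by
  rw [maxwellian_eq_map_pi, integrable_map_measure
    (Measurable.aestronglyMeasurable (by unfold wMonomial; fun_prop)) (by fun_prop)]
  have h1 : ∀ k : ℕ, Integrable (fun t : ℝ => (t : ℂ) ^ k) gauss1 := fun k => by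
    have := (integrable_pow_gauss1 k).ofReal (𝕜 := ℂ)
    refine this.congr (.of_forall fun t => by simp)
  have e := Integrable.fintype_prod (𝕜 := ℂ) (μ := fun _ : Fin 3 => gauss1)
    (f := ![fun t : ℝ => h t * (t : ℂ) ^ n 0, fun t => (t : ℂ) ^ n 1, fun t => (t : ℂ) ^ n 2])
    (by
      intro i
      fin_cases i
      · exact integrable_wMoment hm hb (n 0)
      · exact h1 _
      · exact h1 _)
  refine e.congr (.of_forall fun x => ?_)
  simp [Fin.prod_univ_three, wMonomial]

lemma integral_sum_wMonomial {h : ℝ → ℂ} (hm : Measurable h) {C : ℝ} (hb : ∀ t, ‖h t‖ ≤ C)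
    {N : ℕ} (c : Fin N → ℂ) (n : Fin N → Fin 3 → ℕ) :
    ∫ v, ∑ i, c i * wMonomial h (n i) v ∂maxwellian = ∑ i, c i * (wMoment h (n i 0) *
      ((∫ t, t ^ n i 1 ∂gauss1 : ℝ) : ℂ) * ((∫ t, t ^ n i 2 ∂gauss1 : ℝ) : ℂ)) := by
  rw [integral_finsetSum _ fun i _ => (integrable_wMonomial hm hb (n i)).const_mul (c i)]
  refine sum_congr rfl fun i _ => ?_
  rw [integral_const_mul, integral_wMonomial h hm]

/-- The matrix `∫ h(v₀) e_i e_j dμ`. -/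
def weightMatrix (h : ℝ → ℂ) : Matrix (Fin 5) (Fin 5) ℂ :=
  fun i j => ∫ v, h (v 0) * ((basis5 i v : ℂ) * (basis5 j v : ℂ)) ∂maxwellian

lemma basis5_four (v : E3) : basis5 4 v = (v 0 ^ 2 + v 1 ^ 2 + v 2 ^ 2 - 3) / √6 := by
  simp [basis5, EuclideanSpace.norm_sq_eq, Fin.sum_univ_three]

lemma weightMatrix_symm (h : ℝ → ℂ) (i j : Fin 5) : weightMatrix h i j = weightMatrix h j i := by
  unfold weightMatrix
  simp_rw [mul_comm (basis5 i _ : ℂ)]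

lemma sqrt_six_mul : ((√6 : ℝ) : ℂ) * ((√6 : ℝ) : ℂ) = 6 := by
  rw [← ofReal_mul, Real.mul_self_sqrt (by norm_num)]; norm_num

lemma sqrt_six_ne : ((√6 : ℝ) : ℂ) ≠ 0 := by
  intro h
  have := sqrt_six_mul
  rw [h] at this
  norm_num at this

lemma weightMatrix_eq {h : ℝ → ℂ} (hm : Measurable h) {C : ℝ} (hb : ∀ t, ‖h t‖ ≤ C) :
    weightMatrix h = 
      !![wMoment h 0, wMoment h 1, 0, 0, (wMoment h 2 - wMoment h 0) / (√6 : ℝ);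
         wMoment h 1, wMoment h 2, 0, 0, (wMoment h 3 - wMoment h 1) / (√6 : ℝ);
         0, 0, wMoment h 0, 0, 0;
         0, 0, 0, wMoment h 0, 0;
         (wMoment h 2 - wMoment h 0) / (√6 : ℝ), (wMoment h 3 - wMoment h 1) / (√6 : ℝ), 0, 0,
          (wMoment h 4 - 2 * wMoment h 2 + 5 * wMoment h 0) / 6] := by
  have key : ∀ (i j : Fin 5) (N : ℕ) (c : Fin N → ℂ) (n : Fin N → Fin 3 → ℕ),
      (∀ v : E3, h (v 0) * ((basis5 i v : ℂ) * (basis5 j v : ℂ)) =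
        ∑ l, c l * wMonomial h (n l) v) →
      weightMatrix h i j = ∑ l, c l * (wMoment h (n l 0) *
        ((∫ t, t ^ n l 1 ∂gauss1 : ℝ) : ℂ) * ((∫ t, t ^ n l 2 ∂gauss1 : ℝ) : ℂ)) := by
    intro i j N c n e
    unfold weightMatrix
    simp_rw [e]
    exact integral_sum_wMonomial hm hb c n
  have p0 := integral_pow_zero_gauss1
  have p1 := integral_pow_one_gauss1
  have p2 := integral_pow_two_gauss1
  have p3 := integral_pow_three_gauss1
  have p4 := integral_pow_four_gauss1
  have b0 : ∀ v, basis5 0 v = 1 := fun v => rfl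
  have b1 : ∀ v, basis5 1 v = v 0 := fun v => rfl
  have b2 : ∀ v, basis5 2 v = v 1 := fun v => rfl
  have b3 : ∀ v, basis5 3 v = v 2 := fun v => rfl
  have s0 := sqrt_six_ne
  have ss := sqrt_six_mul
  have e00 : weightMatrix h 0 0 = wMoment h 0 := by
    rw [key 0 0 1 ![1] ![![0, 0, 0]] (fun v => by simp [b0, wMonomial])]
    simp
  have e01 : weightMatrix h 0 1 = wMoment h 1 := by
    rw [key 0 1 1 ![1] ![![1, 0, 0]] (fun v => by simp [b0, b1, wMonomial])]
    simp
  have e02 : weightMatrix h 0 2 = 0 := by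
    rw [key 0 2 1 ![1] ![![0, 1, 0]] (fun v => by simp [b0, b2, wMonomial])]
    simp
  have e03 : weightMatrix h 0 3 = 0 := by
    rw [key 0 3 1 ![1] ![![0, 0, 1]] (fun v => by simp [b0, b3, wMonomial])]
    simp
  have e11 : weightMatrix h 1 1 = wMoment h 2 := by
    rw [key 1 1 1 ![1] ![![2, 0, 0]] (fun v => by simp [b1, wMonomial, sq, mul_assoc])]
    simp
  have e12 : weightMatrix h 1 2 = 0 := by
    rw [key 1 2 1 ![1] ![![1, 1, 0]] (fun v => by simp [b1, b2, wMonomial, sq, mul_assoc])]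
    simp
  have e13 : weightMatrix h 1 3 = 0 := by
    rw [key 1 3 1 ![1] ![![1, 0, 1]] (fun v => by simp [b1, b3, wMonomial, sq, mul_assoc])]
    simp
  have e22 : weightMatrix h 2 2 = wMoment h 0 := by
    rw [key 2 2 1 ![1] ![![0, 2, 0]] (fun v => by simp [b2, wMonomial, sq, mul_assoc])]
    simp [p2]
  have e23 : weightMatrix h 2 3 = 0 := by
    rw [key 2 3 1 ![1] ![![0, 1, 1]] (fun v => by simp [b2, b3, wMonomial, sq, mul_assoc])]
    simp
  have e33 : weightMatrix h 3 3 = wMoment h 0 := by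
    rw [key 3 3 1 ![1] ![![0, 0, 2]] (fun v => by simp [b3, wMonomial, sq, mul_assoc])]
    simp [p2]
  have q4 : ∀ (i : Fin 5) (m : Fin 3 → ℕ), (∀ v : E3, (basis5 i v : ℂ) =
      (v 0 : ℂ) ^ m 0 * (v 1 : ℂ) ^ m 1 * (v 2 : ℂ) ^ m 2) → ∀ v : E3,
      h (v 0) * ((basis5 i v : ℂ) * (basis5 4 v : ℂ)) =
        ∑ l, (fun _ : Fin 4 => ((√6 : ℝ) : ℂ)⁻¹ * (![1, 1, 1, -3] : Fin 4 → ℂ) l) l *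
          wMonomial h (![![m 0 + 2, m 1, m 2], ![m 0, m 1 + 2, m 2], ![m 0, m 1, m 2 + 2],
            ![m 0, m 1, m 2]] l) v := by
    intro i m e v
    rw [e, basis5_four]
    simp [wMonomial, Fin.sum_univ_four]
    field_simp
    ring
  have k4 : ∀ (i : Fin 5) (m : Fin 3 → ℕ), (∀ v : E3, (basis5 i v : ℂ) =
      (v 0 : ℂ) ^ m 0 * (v 1 : ℂ) ^ m 1 * (v 2 : ℂ) ^ m 2) → weightMatrix h i 4 = _ :=
    fun i m e => key i 4 4 _ _ (q4 i m e)
  have e04 : weightMatrix h 0 4 = (wMoment h 2 - wMoment h 0) / (√6 : ℝ) := by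
    rw [k4 0 ![0, 0, 0] (fun v => by simp [b0])]
    simp [Fin.sum_univ_four, p2]
    ring
  have e14 : weightMatrix h 1 4 = (wMoment h 3 - wMoment h 1) / (√6 : ℝ) := by
    rw [k4 1 ![1, 0, 0] (fun v => by simp [b1])]
    simp [Fin.sum_univ_four, p2]
    ring
  have e24 : weightMatrix h 2 4 = 0 := by
    rw [k4 2 ![0, 1, 0] (fun v => by simp [b2])]
    simp [Fin.sum_univ_four, p3]
  have e34 : weightMatrix h 3 4 = 0 := by
    rw [k4 3 ![0, 0, 1] (fun v => by simp [b3])]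
    simp [Fin.sum_univ_four, p3]
  have e44 : weightMatrix h 4 4 = (wMoment h 4 - 2 * wMoment h 2 + 5 * wMoment h 0) / 6 := by
    rw [key 4 4 10 (fun l => (6 : ℂ)⁻¹ * (![1, 1, 1, 9, 2, 2, 2, -6, -6, -6] : Fin 10 → ℂ) l)
      ![![4, 0, 0], ![0, 4, 0], ![0, 0, 4], ![0, 0, 0], ![2, 2, 0], ![2, 0, 2], ![0, 2, 2],
        ![2, 0, 0], ![0, 2, 0], ![0, 0, 2]] (fun v => by
          rw [basis5_four]
          push_cast
          rw [div_mul_div_comm, ss]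
          simp [wMonomial, Fin.sum_univ_succ]
          ring)]
    simp [Fin.sum_univ_succ, p2, p4]
    ring
  have sy := weightMatrix_symm h
  ext i j
  fin_cases i <;> fin_cases j <;> simp only [Fin.zero_eta, Fin.mk_one, Fin.reduceFinMk] <;>
    first
    | (simp [e00, e01, e02, e03, e04, e11, e12, e13, e14, e22, e23, e24, e33, e34, e44]; done)
    | (rw [sy]
       simp [e00, e01, e02, e03, e04, e11, e12, e13, e14, e22, e23, e24, e33, e34, e44])

/-- The collision invariants are orthonormal. -/
lemma basis5_orthonormal (i j : Fin 5) :
    ∫ v, (basis5 i v : ℂ) * (basis5 j v : ℂ) ∂maxwellian = if i = j then 1 else 0 := by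
  have h := weightMatrix_eq (h := fun _ => 1) measurable_const (C := 1) (fun t => by simp)
  have h' : weightMatrix (fun _ => 1) = 1 := by
    rw [h]
    simp only [wMoment_one, integral_pow_zero_gauss1, integral_pow_one_gauss1,
      integral_pow_two_gauss1, integral_pow_three_gauss1, integral_pow_four_gauss1]
    ext i j
    fin_cases i <;> fin_cases j <;> simp <;> norm_num
  have h2 := congrFun (congrFun h' i) j
  rw [Matrix.one_apply] at h2
  rw [← h2]
  simp [weightMatrix]

/-! ### The matrix of a multiplication operator in the collision invariants -/

/-- The matrix `∫ φ e_i e_j dμ`. -/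
def mulMatrix (φ : E3 → ℂ) : Matrix (Fin 5) (Fin 5) ℂ :=
  fun i j => ∫ v, φ v * ((basis5 i v : ℂ) * (basis5 j v : ℂ)) ∂maxwellian

lemma measurable_basis5 (j : Fin 5) : Measurable (basis5 j) := by
  fin_cases j <;> simp [basis5] <;> fun_prop

lemma integrable_basis5_mul (i j : Fin 5) :
    Integrable (fun v => (basis5 i v : ℂ) * (basis5 j v : ℂ)) maxwellian :=
  integrable_mul_basis5 (memLp_basis5 i) j

lemma integrable_mulMatrix {φ : E3 → ℂ} (hm : AEStronglyMeasurable φ maxwellian) {C : ℝ}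
    (hb : ∀ v, ‖φ v‖ ≤ C) (i j : Fin 5) :
    Integrable (fun v => φ v * ((basis5 i v : ℂ) * (basis5 j v : ℂ))) maxwellian :=
  (integrable_basis5_mul i j).bdd_mul (c := C) hm (.of_forall hb)

lemma mulMatrix_const (c : ℂ) : mulMatrix (fun _ => c) = c • (1 : Matrix (Fin 5) (Fin 5) ℂ) := by
  ext i j
  rw [mulMatrix, integral_const_mul, basis5_orthonormal]
  simp [Matrix.one_apply]

lemma basis5_comp_isometry (O : E3 ≃ₗᵢ[ℝ] E3) :
    ∃ L : Matrix (Fin 5) (Fin 5) ℂ, ∀ j v, (basis5 j (O v) : ℂ) = ∑ l, L j l * (basis5 l v : ℂ) := by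
  have hO : ∀ v i, (O v) i = ∑ l : Fin 3, v l * (O (EuclideanSpace.single l 1)) i := by
    intro v i
    have hv : v = ∑ l : Fin 3, v l • EuclideanSpace.single l (1 : ℝ) := by
      ext m
      simp [Finset.sum_apply, Pi.single_apply]
    conv_lhs => rw [hv]
    rw [map_sum]
    simp
  set o : Fin 3 → Fin 3 → ℂ := fun i l => ((O (EuclideanSpace.single l 1)) i : ℝ) with ho
  refine ⟨!![1, 0, 0, 0, 0; 0, o 0 0, o 0 1, o 0 2, 0; 0, o 1 0, o 1 1, o 1 2, 0;
    0, o 2 0, o 2 1, o 2 2, 0; 0, 0, 0, 0, 1], fun j v => ?_⟩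
  have b1 : ∀ v, basis5 1 v = v 0 := fun v => rfl
  have b2 : ∀ v, basis5 2 v = v 1 := fun v => rfl
  have b3 : ∀ v, basis5 3 v = v 2 := fun v => rfl
  fin_cases j
  · simp [Fin.sum_univ_succ, basis5]
  · simp [Fin.sum_univ_five, b1, b2, b3, hO v 0, Fin.sum_univ_three, ho]; ring
  · simp [Fin.sum_univ_five, b1, b2, b3, hO v 1, Fin.sum_univ_three, ho]; ring
  · simp [Fin.sum_univ_five, b1, b2, b3, hO v 2, Fin.sum_univ_three, ho]; ring
  · simp [Fin.sum_univ_five, basis5]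

lemma integral_comp_isometry (O : E3 ≃ₗᵢ[ℝ] E3) (f : E3 → ℂ) :
    ∫ v, f (O v) ∂maxwellian = ∫ v, f v ∂maxwellian := by
  have h : maxwellian.map O = maxwellian := stdGaussian_map O
  conv_rhs => rw [← h]
  exact (integral_map_equiv O.toMeasurableEquiv f).symm

lemma mulMatrix_comp_isometry (O : E3 ≃ₗᵢ[ℝ] E3) : ∃ L : Matrix (Fin 5) (Fin 5) ℂ,
    L * L.transpose = 1 ∧ ∀ φ : E3 → ℂ, Measurable φ → ∀ C : ℝ, (∀ v, ‖φ v‖ ≤ C) →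
      mulMatrix φ = L * mulMatrix (fun v => φ (O v)) * L.transpose := by
  obtain ⟨L, hL⟩ := basis5_comp_isometry O
  have key : ∀ φ : E3 → ℂ, Measurable φ → ∀ C : ℝ, (∀ v, ‖φ v‖ ≤ C) →
      mulMatrix φ = L * mulMatrix (fun v => φ (O v)) * L.transpose := by
    intro φ hm C hb
    ext i j
    have e : ∀ v, φ (O v) * ((basis5 i (O v) : ℂ) * (basis5 j (O v) : ℂ)) =
        ∑ m, (∑ l, L i l * (φ (O v) * ((basis5 l v : ℂ) * (basis5 m v : ℂ)))) * L j m := by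
      intro v
      rw [hL, hL, Finset.sum_mul_sum, Finset.sum_comm, mul_sum]
      refine sum_congr rfl fun m _ => ?_
      rw [mul_sum, sum_mul]
      refine sum_congr rfl fun l _ => ?_
      ring
    have hi : ∀ l m, Integrable (fun v => φ (O v) * ((basis5 l v : ℂ) * (basis5 m v : ℂ)))
        maxwellian := fun l m => integrable_mulMatrix
          (hm.comp O.continuous.measurable).aestronglyMeasurable (fun v => hb (O v)) l m
    rw [mulMatrix, ← integral_comp_isometry O]
    simp_rw [e]
    rw [integral_finsetSum _ fun m _ =>
      (integrable_finsetSum _ fun l _ => (hi l m).const_mul (L i l)).mul_const _]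
    rw [Matrix.mul_apply]
    refine sum_congr rfl fun m _ => ?_
    rw [integral_mul_const, integral_finsetSum _ fun l _ => (hi l m).const_mul (L i l),
      Matrix.mul_apply, Matrix.transpose_apply]
    congr 1
    refine sum_congr rfl fun l _ => ?_
    rw [integral_const_mul]
    rfl
  refine ⟨L, ?_, key⟩
  have h := key (fun _ => 1) measurable_const 1 (by simp)
  simp only [mulMatrix_const, one_smul, mul_one] at h
  exact h.symm

lemma det_one_sub_conj {L B : Matrix (Fin 5) (Fin 5) ℂ} (hL : L * L.transpose = 1) (c : ℂ) :
    (1 - c • (L * B * L.transpose)).det = (1 - c • B).det := by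
  have : 1 - c • (L * B * L.transpose) = L * (1 - c • B) * L.transpose := by
    rw [mul_sub, sub_mul, mul_one, hL]
    simp
  rw [this, Matrix.det_mul, Matrix.det_mul, mul_right_comm, ← Matrix.det_mul, hL, Matrix.det_one,
    one_mul]

/-! ### The symbol `z + i v·q` -/

/-- The symbol `z + i v·q`. -/
def velSymbol (z : ℂ) (q v : E3) : ℂ := z + I * ((⟪v, q⟫_ℝ : ℝ) : ℂ)

lemma velSymbol_re (z : ℂ) (q v : E3) : (velSymbol z q v).re = z.re := by
  simp [velSymbol]

lemma continuous_velSymbol (z : ℂ) : Continuous fun p : E3 × E3 => velSymbol z p.1 p.2 := by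
  unfold velSymbol
  fun_prop

lemma velSymbol_ne_zero {z : ℂ} (hz : z.re ≠ 0) (q v : E3) : velSymbol z q v ≠ 0 := by
  intro h
  apply hz
  rw [← velSymbol_re z q v, h]
  simp

lemma norm_velSymbol_ge (z : ℂ) (q v : E3) : |z.re| ≤ ‖velSymbol z q v‖ := by
  rw [← velSymbol_re z q v]
  exact abs_re_le_norm _

lemma norm_inv_velSymbol_le {z : ℂ} (hz : z.re ≠ 0) (q v : E3) :
    ‖(velSymbol z q v)⁻¹‖ ≤ |z.re|⁻¹ := by
  rw [norm_inv]
  have h0 : 0 < |z.re| := abs_pos.2 hz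
  gcongr
  exact norm_velSymbol_ge z q v

lemma measurable_velSymbol (z : ℂ) (q : E3) : Measurable (velSymbol z q) := by
  unfold velSymbol; fun_prop

/-- The matrix `∫ e_i e_j / (z + i v·q) dμ`. -/
def momentMatrix (z : ℂ) (q : E3) : Matrix (Fin 5) (Fin 5) ℂ :=
  mulMatrix fun v => (velSymbol z q v)⁻¹

/-- `det (1 - B(z, q) / τ)`. -/
def fibreDet (τ : ℝ) (z : ℂ) (q : E3) : ℂ := (1 - (1 / τ : ℂ) • momentMatrix z q).det

/-- The first coordinate vector. -/
abbrev axis0 : E3 := EuclideanSpace.single 0 (1 : ℝ)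

lemma inner_axis0 (v : E3) (k : ℝ) : ⟪v, k • axis0⟫_ℝ = k * v 0 := by
  rw [real_inner_smul_right]
  simp [axis0, EuclideanSpace.inner_single_right]

lemma exists_isometry_eq {p q : E3} (h : ‖p‖ = ‖q‖) : ∃ O : E3 ≃ₗᵢ[ℝ] E3, O p = q :=
  ⟨(ℝ ∙ (p - q))ᗮ.reflection, Submodule.reflection_sub h⟩

lemma fibreDet_eq_of_norm_eq (τ : ℝ) {z : ℂ} (hz : z.re ≠ 0) {p q : E3} (h : ‖p‖ = ‖q‖) :
    fibreDet τ z p = fibreDet τ z q := by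
  obtain ⟨O, rfl⟩ := exists_isometry_eq h
  obtain ⟨L, hL, hO⟩ := mulMatrix_comp_isometry O
  have e := hO (fun v => (velSymbol z (O p) v)⁻¹) (measurable_velSymbol z _).inv _
    (norm_inv_velSymbol_le hz _)
  have e2 : ∀ v, velSymbol z (O p) (O v) = velSymbol z p v := by
    intro v
    simp only [velSymbol, O.inner_map_map]
  simp only [e2] at e
  unfold fibreDet momentMatrix
  rw [e, det_one_sub_conj hL]

lemma fibreDet_eq_axis (τ : ℝ) {z : ℂ} (hz : z.re ≠ 0) (q : E3) :
    fibreDet τ z q = fibreDet τ z (‖q‖ • axis0) :=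
  fibreDet_eq_of_norm_eq τ hz (by simp [norm_smul, axis0])

lemma det_block_five (x a b d e f g : ℂ) :
    (x • 1 - !![a, b, 0, 0, d; b, e, 0, 0, f; 0, 0, a, 0, 0; 0, 0, 0, a, 0; d, f, 0, 0, g] :
      Matrix (Fin 5) (Fin 5) ℂ).det = (x - a) ^ 2 * ((x - a) * (x - e) * (x - g)
        - 2 * (b * f * d) - d ^ 2 * (x - e) - f ^ 2 * (x - a) - b ^ 2 * (x - g)) := by
  have h : (x • 1 - !![a, b, 0, 0, d; b, e, 0, 0, f; 0, 0, a, 0, 0; 0, 0, 0, a, 0; d, f, 0, 0, g] :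
      Matrix (Fin 5) (Fin 5) ℂ) = !![x - a, -b, 0, 0, -d; -b, x - e, 0, 0, -f; 0, 0, x - a, 0, 0;
        0, 0, 0, x - a, 0; -d, -f, 0, 0, x - g] := by
    ext i j
    fin_cases i <;> fin_cases j <;> simp
  rw [h]
  simp [Matrix.det_succ_row_zero, Fin.sum_univ_succ, Fin.succAbove]
  ring

lemma det_smul_one_sub_momentMatrix {k : ℝ} (hk : 0 < k) {z : ℂ} (hz : 0 < z.re) (x : ℂ) :
    (x • 1 - momentMatrix z (k • axis0)).det =
      (k * x - mills (z / k)) ^ 2 * dispersion (z / k) (k * x) / (6 * k ^ 5) := by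
  have hk0 : (k : ℂ) ≠ 0 := by exact_mod_cast hk.ne'
  set s : ℂ := z / k with hs
  have hsre : 0 < s.re := by
    rw [hs, div_ofReal_re]; positivity
  have hw : ∀ n, wMoment (fun t => (z + I * (k * t : ℝ))⁻¹) n = (k : ℂ)⁻¹ * resMoment s n := by
    intro n
    unfold resMoment wMoment
    rw [← integral_const_mul]
    refine integral_congr_ae (.of_forall fun t => ?_)
    have h : z + I * (k * t : ℝ) = k * (s + I * t) := by
      rw [hs]; push_cast; field_simp
    simp only [h, mul_inv]
    ring
  have e : momentMatrix z (k • axis0) = weightMatrix (fun t => (z + I * (k * t : ℝ))⁻¹) := by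
    unfold momentMatrix mulMatrix weightMatrix velSymbol
    simp only [inner_axis0]
    rfl
  have e2 := weightMatrix_eq (h := fun t => (z + I * (k * t : ℝ))⁻¹) (by fun_prop) (C := |z.re|⁻¹)
    (fun t => norm_inv_add_I_mul_le hz.ne' _)
  simp only [hw] at e2
  obtain ⟨h0, h1, h2, h3, h4⟩ := resMoment_values hsre
  unfold dispersion dispersionPoly
  rw [e, e2, h0, h1, h2, h3, h4]
  generalize mills s = W
  have s0 := sqrt_six_ne
  have ss : ((√6 : ℝ) : ℂ) ^ 2 = 6 := by rw [sq]; exact sqrt_six_mul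
  have hI : I ^ 2 = -1 := I_sq
  rw [det_block_five]
  generalize ((√6 : ℝ) : ℂ) = r at *
  set y : ℂ := (k : ℂ)⁻¹ with hy
  have q1 : (y * (-I * (1 - s * W))) ^ 2 = -(y * (1 - s * W)) ^ 2 := by
    linear_combination (y * (1 - s * W)) ^ 2 * hI
  have q2 : ((y * (s * (1 - s * W)) - y * W) / r) ^ 2 = (y * (s * (1 - s * W)) - y * W) ^ 2 / 6 := by
    rw [div_pow, ss]
  have q3 : ((y * (-I * (1 - s ^ 2 * (1 - s * W))) - y * (-I * (1 - s * W))) / r) ^ 2 =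
      -(y * (1 - s ^ 2 * (1 - s * W)) - y * (1 - s * W)) ^ 2 / 6 := by
    rw [div_pow, ss]
    linear_combination ((y * (1 - s ^ 2 * (1 - s * W)) - y * (1 - s * W)) ^ 2 / 6) * hI
  have q4 : y * (-I * (1 - s * W)) *
      ((y * (-I * (1 - s ^ 2 * (1 - s * W))) - y * (-I * (1 - s * W))) / r) *
      ((y * (s * (1 - s * W)) - y * W) / r) = -(y * (1 - s * W) *
      (y * (1 - s ^ 2 * (1 - s * W)) - y * (1 - s * W)) * (y * (s * (1 - s * W)) - y * W)) / 6 := by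
    have aux : ∀ x p u : ℂ, x * (p / r) * (u / r) = x * p * u / 6 := fun x p u => by
      rw [show x * (p / r) * (u / r) = x * p * u / r ^ 2 by field_simp, ss]
    rw [aux]
    linear_combination ((y * (1 - s * W) *
      (y * (1 - s ^ 2 * (1 - s * W)) - y * (1 - s * W)) * (y * (s * (1 - s * W)) - y * W)) / 6) * hI
  rw [q1, q2, q3, q4]
  clear q1 q2 q3 q4
  rw [hy]
  clear_value s
  field_simp
  ring

lemma fibreDet_axis {τ k : ℝ} (hτ : 0 < τ) (hk : 0 < k) {z : ℂ} (hz : 0 < z.re) :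
    fibreDet τ z (k • axis0) = (1 - mills (z / k) / (τ * k : ℝ)) ^ 2 *
      (dispersion (z / k) (τ * k : ℝ) / (6 * (τ * k : ℝ) ^ 3)) := by
  have hk0 : (k : ℂ) ≠ 0 := by exact_mod_cast hk.ne'
  have ht0 : (τ : ℂ) ≠ 0 := by exact_mod_cast hτ.ne'
  have e : 1 - (1 / τ : ℂ) • momentMatrix z (k • axis0) =
      (1 / τ : ℂ) • ((τ : ℂ) • 1 - momentMatrix z (k • axis0)) := by
    rw [smul_sub, smul_smul, one_div_mul_cancel ht0, one_smul]
  unfold fibreDet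
  rw [e, Matrix.det_smul, det_smul_one_sub_momentMatrix hk hz, mul_comm (k : ℂ)]
  push_cast
  simp only [Fintype.card_fin]
  field_simp

lemma fibreDet_zero {τ : ℝ} {z : ℂ} : fibreDet τ z 0 = (1 - (1 / τ : ℂ) * z⁻¹) ^ 5 := by
  unfold fibreDet momentMatrix
  have : (fun v => (velSymbol z 0 v)⁻¹) = fun _ => z⁻¹ := by
    funext v; simp [velSymbol]
  rw [this, mulMatrix_const]
  have h : (1 - (1 / τ : ℂ) • z⁻¹ • (1 : Matrix (Fin 5) (Fin 5) ℂ)) =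
      (1 - (1 / τ : ℂ) * z⁻¹) • 1 := by
    rw [smul_smul, sub_smul, one_smul]
  rw [h, Matrix.det_smul]
  simp

/-! ### Accretivity -/

/-- The combination `∑ cⱼ eⱼ`. -/
def basisComb (c : Fin 5 → ℂ) (v : E3) : ℂ := ∑ j, c j * (basis5 j v : ℂ)

lemma memLp_basisComb (c : Fin 5 → ℂ) : MemLp (basisComb c) 2 maxwellian := by
  have : basisComb c = ∑ j, fun v => c j * (basis5 j v : ℂ) := by
    funext v; simp [basisComb]
  rw [this]
  exact memLp_finsetSum' _ fun j _ => (memLp_basis5 j).const_mul (c j)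

lemma integral_conj_basisComb_mul (c : Fin 5 → ℂ) {f : E3 → ℂ} (hf : MemLp f 2 maxwellian) :
    ∫ v, conj (basisComb c v) * f v ∂maxwellian =
      ∑ j, conj (c j) * ∫ v, f v * (basis5 j v : ℂ) ∂maxwellian := by
  have e : ∀ v, conj (basisComb c v) * f v =
      ∑ j, conj (c j) * (f v * (basis5 j v : ℂ)) := by
    intro v
    simp only [basisComb, map_sum, map_mul, conj_ofReal, sum_mul]
    exact sum_congr rfl fun j _ => by ring
  simp_rw [e]
  rw [integral_finsetSum _ fun j _ => (integrable_mul_basis5 hf j).const_mul _]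
  simp_rw [integral_const_mul]

lemma integral_basisComb_mul_basis5 (c : Fin 5 → ℂ) (i : Fin 5) :
    ∫ v, basisComb c v * (basis5 i v : ℂ) ∂maxwellian = c i := by
  have e : ∀ v, basisComb c v * (basis5 i v : ℂ) =
      ∑ j, c j * ((basis5 j v : ℂ) * (basis5 i v : ℂ)) := by
    intro v
    simp only [basisComb, sum_mul, mul_assoc]
  simp_rw [e]
  rw [integral_finsetSum _ fun j _ => (integrable_basis5_mul j i).const_mul _]
  simp_rw [integral_const_mul, basis5_orthonormal]
  simp

lemma integral_basisComb_div {φ : E3 → ℂ} (hm : AEStronglyMeasurable φ maxwellian) {C : ℝ}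
    (hb : ∀ v, ‖φ v‖ ≤ C) (c : Fin 5 → ℂ) (i : Fin 5) :
    ∫ v, φ v * basisComb c v * (basis5 i v : ℂ) ∂maxwellian = ((mulMatrix φ).mulVec c) i := by
  have e : ∀ v, φ v * basisComb c v * (basis5 i v : ℂ) =
      ∑ j, (φ v * ((basis5 i v : ℂ) * (basis5 j v : ℂ))) * c j := by
    intro v
    simp only [basisComb, mul_sum, sum_mul]
    exact sum_congr rfl fun j _ => by ring
  simp_rw [e]
  rw [integral_finsetSum _ fun j _ => (integrable_mulMatrix hm hb i j).mul_const _]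
  simp_rw [integral_mul_const]
  rfl

lemma memLp_mul_basisComb {φ : E3 → ℂ} (hm : AEStronglyMeasurable φ maxwellian) {C : ℝ}
    (hb : ∀ v, ‖φ v‖ ≤ C) (c : Fin 5 → ℂ) :
    MemLp (fun v => φ v * basisComb c v) 2 maxwellian :=
  (memLp_basisComb c).of_le_mul (c := C) (hm.mul (memLp_basisComb c).1)
    (.of_forall fun v => by
      rw [norm_mul]; exact mul_le_mul_of_nonneg_right (hb v) (norm_nonneg _))

lemma exists_vec_of_fibreDet_eq_zero {τ : ℝ} (hτ : 0 < τ) {z : ℂ} {q : E3}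
    (h : fibreDet τ z q = 0) : ∃ c ≠ 0, (momentMatrix z q).mulVec c = (τ : ℂ) • c := by
  have ht0 : (τ : ℂ) ≠ 0 := by exact_mod_cast hτ.ne'
  obtain ⟨c, hc0, hc⟩ := Matrix.exists_mulVec_eq_zero_iff.2 h
  refine ⟨c, hc0, ?_⟩
  rw [Matrix.sub_mulVec, Matrix.one_mulVec, Matrix.smul_mulVec, sub_eq_zero] at hc
  conv_rhs => rw [hc]
  rw [smul_smul, mul_one_div_cancel ht0, one_smul]

/-- An eigenvalue off the line `Re z = 0` lies in the strip `0 < Re z ≤ 1 / τ`. -/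
lemma re_of_fibreDet_eq_zero {τ : ℝ} (hτ : 0 < τ) {z : ℂ} (hz : z.re ≠ 0) {q : E3}
    (h : fibreDet τ z q = 0) : 0 < z.re ∧ z.re ≤ 1 / τ := by
  obtain ⟨c, hc0, hc⟩ := exists_vec_of_fibreDet_eq_zero hτ h
  set φ : E3 → ℂ := fun v => (velSymbol z q v)⁻¹ with hφ
  have hm : AEStronglyMeasurable φ maxwellian := (measurable_velSymbol z q).inv.aestronglyMeasurable
  have hb := norm_inv_velSymbol_le hz q
  set F := basisComb c with hF
  set G : E3 → ℂ := fun v => φ v * basisComb c v with hG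
  have hF2 : MemLp F 2 maxwellian := memLp_basisComb c
  have hG2 : MemLp G 2 maxwellian := memLp_mul_basisComb hm hb c
  set S : ℝ := ∑ j, normSq (c j) with hS
  have hSpos : 0 < S := by
    obtain ⟨j, hj⟩ := Function.ne_iff.1 hc0
    exact Finset.sum_pos' (fun _ _ => normSq_nonneg _) ⟨j, Finset.mem_univ _, normSq_pos.2 hj⟩
  have iFF : ∫ v, conj (F v) * F v ∂maxwellian = (S : ℂ) := by
    rw [hF, integral_conj_basisComb_mul c (memLp_basisComb c)]
    simp_rw [integral_basisComb_mul_basis5, hS]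
    push_cast
    exact sum_congr rfl fun j _ => by rw [normSq_eq_conj_mul_self]
  have iFG : ∫ v, conj (F v) * G v ∂maxwellian = (τ * S : ℝ) := by
    rw [hF, integral_conj_basisComb_mul c hG2]
    have : ∀ j, ∫ v, G v * (basis5 j v : ℂ) ∂maxwellian = τ * c j := by
      intro j
      rw [hG, integral_basisComb_div hm hb]
      exact congrFun hc j
    simp_rw [this, hS]
    push_cast
    rw [mul_sum]
    exact sum_congr rfl fun j _ => by rw [normSq_eq_conj_mul_self]; ring
  have hsF : Integrable (fun v => normSq (F v)) maxwellian := by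
    refine (hF2.integrable_norm_pow (by norm_num)).congr (.of_forall fun v => ?_)
    simp [normSq_eq_norm_sq]
  have hsG : Integrable (fun v => normSq (G v)) maxwellian := by
    refine (hG2.integrable_norm_pow (by norm_num)).congr (.of_forall fun v => ?_)
    simp [normSq_eq_norm_sq]
  have hFG : Integrable (fun v => conj (F v) * G v) maxwellian :=
    hF2.star.integrable_mul hG2
  set N : ℝ := ∫ v, normSq (G v) ∂maxwellian with hN
  have rFF : ∫ v, normSq (F v) ∂maxwellian = S := by
    have : ∫ v, ((normSq (F v) : ℝ) : ℂ) ∂maxwellian = (S : ℂ) := by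
      rw [← iFF]
      exact integral_congr_ae (.of_forall fun v => normSq_eq_conj_mul_self)
    rw [integral_complex_ofReal] at this
    exact_mod_cast this
  have rFG : ∫ v, (conj (F v) * G v).re ∂maxwellian = τ * S := by
    have := integral_re hFG
    simp only [RCLike.re_eq_complex_re] at this
    rw [this, iFG, ofReal_re]
  have k1 : z.re * N = τ * S := by
    rw [← rFG, hN, ← integral_const_mul]
    refine integral_congr_ae (.of_forall fun v => ?_)
    have ha := velSymbol_ne_zero hz q v
    have hFv : F v = velSymbol z q v * G v := by
      simp only [hG, hφ]; rw [mul_inv_cancel_left₀ ha]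
    change z.re * normSq (G v) = (conj (F v) * G v).re
    have e : conj (F v) * G v =
        conj (velSymbol z q v) * (normSq (G v) : ℂ) := by
      rw [hFv, map_mul, mul_assoc, ← normSq_eq_conj_mul_self]
    rw [e, re_mul_ofReal, conj_re, velSymbol_re]
  have k2 : 0 ≤ N - 2 * τ * (τ * S) + τ ^ 2 * S := by
    have : ∫ v, normSq (G v - τ * F v) ∂maxwellian = N - 2 * τ * (τ * S) + τ ^ 2 * S := by
      have e : ∀ v, normSq (G v - τ * F v) = normSq (G v)
          - 2 * τ * (conj (F v) * G v).re + τ ^ 2 * normSq (F v) := by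
        intro v
        simp only [normSq_apply, sub_re, sub_im, mul_re,
          mul_im, ofReal_re, ofReal_im, conj_re, conj_im]
        ring
      simp_rw [e]
      have hre : Integrable (fun v => (conj (F v) * G v).re) maxwellian := hFG.re
      have i1 : Integrable (fun v => normSq (G v) - 2 * τ * (conj (F v) * G v).re)
          maxwellian := hsG.sub (hre.const_mul _)
      rw [integral_add i1 (hsF.const_mul _),
        integral_sub hsG (hre.const_mul _), integral_const_mul, integral_const_mul, rFG, rFF]
    rw [← this]
    exact integral_nonneg fun v => normSq_nonneg _
  have hNpos : 0 < N := by nlinarith [mul_pos (pow_pos hτ 2) hSpos]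
  have hzpos : 0 < z.re := by
    by_contra hneg
    push Not at hneg
    nlinarith [mul_pos hτ hSpos]
  refine ⟨hzpos, ?_⟩
  rw [le_div_iff₀ hτ]
  have : z.re * τ * (τ * S) ≤ 1 * (τ * S) := by
    nlinarith
  exact le_of_mul_le_mul_right this (mul_pos hτ hSpos)

lemma isUnit_det_momentMatrix {z : ℂ} (hz : z.re ≠ 0) (q : E3) : (momentMatrix z q).det ≠ 0 := by
  intro h
  obtain ⟨c, hc0, hc⟩ := Matrix.exists_mulVec_eq_zero_iff.2 h
  set φ : E3 → ℂ := fun v => (velSymbol z q v)⁻¹ with hφ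
  have hm : AEStronglyMeasurable φ maxwellian := (measurable_velSymbol z q).inv.aestronglyMeasurable
  have hb := norm_inv_velSymbol_le hz q
  set G : E3 → ℂ := fun v => φ v * basisComb c v with hG
  have hG2 : MemLp G 2 maxwellian := memLp_mul_basisComb hm hb c
  have iFG : ∫ v, conj (basisComb c v) * G v ∂maxwellian = 0 := by
    rw [integral_conj_basisComb_mul c hG2]
    refine Finset.sum_eq_zero fun j _ => ?_
    have e : ∫ v, G v * (basis5 j v : ℂ) ∂maxwellian = 0 := by
      rw [hG, integral_basisComb_div hm hb]
      exact congrFun hc j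
    rw [e, mul_zero]
  have hFG : Integrable (fun v => conj (basisComb c v) * G v) maxwellian :=
    (memLp_basisComb c).star.integrable_mul hG2
  have rFG : ∫ v, (conj (basisComb c v) * G v).re ∂maxwellian = 0 := by
    have := integral_re hFG
    simp only [RCLike.re_eq_complex_re] at this
    rw [this, iFG, zero_re]
  have hFv : ∀ v, basisComb c v = velSymbol z q v * G v := by
    intro v
    simp only [hG, hφ]; rw [mul_inv_cancel_left₀ (velSymbol_ne_zero hz q v)]
  have e : ∀ v, (conj (basisComb c v) * G v).re = z.re * normSq (G v) := by
    intro v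
    have e : conj (basisComb c v) * G v =
        conj (velSymbol z q v) * (normSq (G v) : ℂ) := by
      rw [hFv, map_mul, mul_assoc, ← normSq_eq_conj_mul_self]
    rw [e, re_mul_ofReal, conj_re, velSymbol_re]
  simp_rw [e] at rFG
  rw [integral_const_mul] at rFG
  have hN := (mul_eq_zero.1 rFG).resolve_left hz
  have hsG : Integrable (fun v => normSq (G v)) maxwellian := by
    refine (hG2.integrable_norm_pow (by norm_num)).congr (.of_forall fun v => ?_)
    simp [normSq_eq_norm_sq]
  rw [integral_eq_zero_iff_of_nonneg (fun v => normSq_nonneg _) hsG] at hN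
  apply hc0
  funext i
  rw [← integral_basisComb_mul_basis5 c i]
  refine integral_eq_zero_of_ae ?_
  filter_upwards [hN] with v hv
  rw [hFv, Complex.normSq_eq_zero.1 hv]
  simp

lemma dispersion_zero_ne_zero {s : ℂ} (hs : 0 ≤ s.re) : dispersion s 0 ≠ 0 := by
  rcases hs.lt_or_eq with h | h
  · intro h0
    have := isUnit_det_momentMatrix h.ne' ((1 : ℝ) • axis0)
    have e := det_smul_one_sub_momentMatrix one_pos h 0
    simp only [zero_smul, zero_sub, Matrix.det_neg, mul_zero, ofReal_one, div_one, h0,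
      zero_div] at e
    apply this
    simpa using e
  · have hs : s = I * (s.im : ℂ) := by
      apply Complex.ext <;> simp [← h]
    have hpos : ∀ y : ℝ, 0 < y → dispersion (I * y) 0 ≠ 0 := by
      intro y hy
      have := dispersion_imag_ne_zero hy le_rfl (fun hb => by
        have := hb.2.1; norm_num at this)
      simpa using this
    rcases lt_trichotomy s.im 0 with hn | h0 | hp
    · have e := dispersion_conj (I * (-s.im : ℝ)) 0
      have e2 : conj (I * ((-s.im : ℝ) : ℂ)) = s := by
        conv_rhs => rw [hs]
        simp
      rw [e2] at e
      simp only [ofReal_zero] at e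
      rw [e]
      simpa using hpos (-s.im) (by linarith)
    · have : s = ((0 : ℝ) : ℂ) := by rw [hs, h0]; simp
      have e := dispersion_ofReal 0 0
      rw [this, show (0 : ℂ) = ((0 : ℝ) : ℂ) by simp, e]
      have := millsR_pos 0
      simp only [dispersionPoly]
      norm_num
      exact this.ne'
    · rw [hs]; exact hpos _ hp

/-! ### Positive zeros of a strictly increasing family -/

open Classical in
/-- The positive zero of `F κ`, if there is one. -/
def realRoot (F : ℝ → ℝ → ℝ) (κ : ℝ) : ℝ :=
  if h : ∃ s, 0 < s ∧ F κ s = 0 then h.choose else 0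

/-- A family of functions of `s ≥ 0`, strictly increasing and eventually positive, negative at `0`
exactly for `κ < κc`. -/
structure IncreasingFamily (F : ℝ → ℝ → ℝ) (κc : ℝ) : Prop where
  mono : ∀ κ, StrictMonoOn (F κ) (Set.Ici 0)
  cont : Continuous fun p : ℝ × ℝ => F p.1 p.2
  large : ∀ κ, 0 < κ → ∃ s, 0 < s ∧ 0 < F κ s
  neg_iff : ∀ κ, 0 < κ → (F κ 0 < 0 ↔ κ < κc)

namespace IncreasingFamily

variable {F : ℝ → ℝ → ℝ} {κc : ℝ} (h : IncreasingFamily F κc)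
include h

lemma root_spec {κ : ℝ} (h0 : 0 < κ) (h1 : κ < κc) :
    0 < realRoot F κ ∧ F κ (realRoot F κ) = 0 := by
  have hex : ∃ s, 0 < s ∧ F κ s = 0 := by
    obtain ⟨b, hb, hFb⟩ := h.large κ h0
    have hc : ContinuousOn (F κ) (Icc 0 b) :=
      (h.cont.comp (Continuous.prodMk_right κ)).continuousOn
    obtain ⟨s, hs, hs0⟩ := intermediate_value_Ioo hb.le hc ⟨(h.neg_iff κ h0).2 h1, hFb⟩
    exact ⟨s, hs.1, hs0⟩
  rw [realRoot, dif_pos hex]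
  exact hex.choose_spec

lemma zero_iff {κ s : ℝ} (h0 : 0 < κ) : 0 < s ∧ F κ s = 0 ↔ κ < κc ∧ s = realRoot F κ := by
  constructor
  · rintro ⟨hs, hz⟩
    have h1 : κ < κc := by
      have := h.mono κ (Set.mem_Ici.2 le_rfl) (Set.mem_Ici.2 hs.le) hs
      rwa [hz, h.neg_iff κ h0] at this
    obtain ⟨a, b⟩ := h.root_spec h0 h1
    exact ⟨h1, (h.mono κ).injOn (Set.mem_Ici.2 hs.le) (Set.mem_Ici.2 a.le) (hz.trans b.symm)⟩
  · rintro ⟨h1, rfl⟩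
    exact h.root_spec h0 h1

lemma continuousAt_root {κ : ℝ} (h0 : 0 < κ) (h1 : κ < κc) : ContinuousAt (realRoot F) κ := by
  obtain ⟨a, b⟩ := h.root_spec h0 h1
  have hc : ∀ s, Continuous fun κ => F κ s := fun s => h.cont.comp (Continuous.prodMk_left s)
  rw [Metric.continuousAt_iff']
  intro ε hε
  set r := realRoot F κ with hr
  set δ := min ε r / 2 with hδ
  have hδ0 : 0 < δ := by have := lt_min hε a; positivity
  have hδ1 : δ < ε := by have := min_le_left ε r; have := lt_min hε a; rw [hδ]; linarith
  have hδ2 : δ < r := by have := min_le_right ε r; have := lt_min hε a; rw [hδ]; linarith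
  have hlo : F κ (r - δ) < 0 := by
    rw [← b]
    exact h.mono κ (Set.mem_Ici.2 (by linarith)) (Set.mem_Ici.2 a.le) (by linarith)
  have hhi : 0 < F κ (r + δ) := by
    rw [← b]
    exact h.mono κ (Set.mem_Ici.2 a.le) (Set.mem_Ici.2 (by linarith)) (by linarith)
  filter_upwards [(hc (r - δ)).continuousAt.eventually_lt_const hlo,
    (hc (r + δ)).continuousAt.eventually_const_lt hhi, Ioo_mem_nhds h0 h1] with x hx1 hx2 hx
  obtain ⟨a', b'⟩ := h.root_spec hx.1 hx.2
  rw [← b', (h.mono x).lt_iff_lt (Set.mem_Ici.2 (by linarith)) (Set.mem_Ici.2 a'.le)] at hx1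
  rw [← b', (h.mono x).lt_iff_lt (Set.mem_Ici.2 a'.le) (Set.mem_Ici.2 (by linarith))] at hx2
  rw [Real.dist_eq, abs_lt]
  constructor <;> linarith

end IncreasingFamily

/-! ### The shear and diffusion branches -/

/-- The function `κ - W(s)` whose zero is the shear mode. -/
def shearFun (κ s : ℝ) : ℝ := κ - millsR s

lemma exists_millsR_lt {κ : ℝ} (hκ : 0 < κ) : ∃ s, 0 < s ∧ millsR s < κ := by
  refine ⟨κ⁻¹, by positivity, ?_⟩
  have := mul_millsR_lt_one κ⁻¹
  rwa [inv_mul_lt_iff₀ hκ, mul_one] at this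

lemma shear_family : IncreasingFamily shearFun (millsR 0) where
  mono κ := fun s _ t _ hst => sub_lt_sub_left (millsR_strictAnti hst) κ
  cont := by have := continuous_millsR; unfold shearFun; fun_prop
  large κ hκ := by
    obtain ⟨s, hs, h⟩ := exists_millsR_lt hκ
    exact ⟨s, hs, sub_pos.2 h⟩
  neg_iff κ _ := sub_neg

lemma millsR_lower (s : ℝ) : s * (1 - s * millsR s) ≤ millsR s := by
  have h := millsMoment_ofReal_pos 2 s
  have h2 := millsMoment_add_two 0 s
  have h4 : millsMoment 2 (s : ℂ) = mills s - s * (1 - s * mills s) := by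
    simp only [zero_add] at h2
    rw [h2, millsMoment_one, ← mills]
    simp
  rw [millsMoment_ofReal, mills_ofReal] at h4
  norm_cast at h4
  linarith

lemma shear_eventually {δ : ℝ} (hδ : 0 < δ) : ∀ᶠ κ in 𝓝 (0 : ℝ), ∀ s, 0 < κ → 0 < s →
    shearFun κ s = 0 → |κ * s - 1| < δ := by
  filter_upwards [Iio_mem_nhds (show (0 : ℝ) < min (millsR 1) δ from lt_min (millsR_pos 1) hδ)]
    with κ hκ s h0 hs hz
  obtain ⟨h1, h2⟩ := lt_min_iff.1 (Set.mem_Iio.1 hκ)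
  have hW : κ = millsR s := sub_eq_zero.1 hz
  have hs1 : 1 < s := by rwa [hW, millsR_strictAnti.lt_iff_gt] at h1
  have a := mul_millsR_lt_one s
  have b := millsR_lower s
  rw [← hW] at a b
  rw [abs_lt]
  constructor <;> nlinarith

/-- The value `D(0, κ)`. -/
def diffPoly (κ : ℝ) : ℝ := dispersionPoly 0 κ (millsR 0)

lemma diffPoly_eq (κ : ℝ) :
    diffPoly κ = 6 * κ ^ 3 - 11 * millsR 0 * κ ^ 2 + (4 * millsR 0 ^ 2 + 6) * κ - 5 * millsR 0 := by
  unfold diffPoly dispersionPoly; ring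

lemma millsR_zero_sq : millsR 0 ^ 2 = Real.pi / 2 := by
  rw [millsR_zero, Real.sq_sqrt (by positivity)]

lemma strictMono_diffPoly : StrictMono diffPoly := by
  intro x y hxy
  rw [diffPoly_eq, diffPoly_eq, ← sub_pos]
  have hW := millsR_zero_sq
  have hpi := Real.pi_lt_d2
  set W := millsR 0
  have e : 6 * y ^ 3 - 11 * W * y ^ 2 + (4 * W ^ 2 + 6) * y - 5 * W -
      (6 * x ^ 3 - 11 * W * x ^ 2 + (4 * W ^ 2 + 6) * x - 5 * W) =
      (y - x) * (6 * (x ^ 2 + x * y + y ^ 2) - 11 * W * (x + y) + (4 * W ^ 2 + 6)) := by ring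
  rw [e]
  refine mul_pos (sub_pos.2 hxy) ?_
  have h1 : 3 / 4 * (x + y) ^ 2 ≤ x ^ 2 + x * y + y ^ 2 := by nlinarith [sq_nonneg (x - y)]
  have h2 : 0 ≤ (x + y - 11 / 9 * W) ^ 2 := sq_nonneg _
  nlinarith

lemma exists_diffPoly_zero : ∃ κ, 0 < κ ∧ diffPoly κ = 0 := by
  have h0 : diffPoly 0 < 0 := by
    rw [diffPoly_eq]; have := millsR_pos 0; nlinarith
  have h2 : 0 < diffPoly 2 := by
    rw [diffPoly_eq]
    have hW := millsR_zero_sq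
    nlinarith [Real.pi_lt_d2, Real.pi_gt_three, sq_nonneg (millsR 0 - 1.25)]
  have hc : ContinuousOn diffPoly (Icc 0 2) := by
    have : diffPoly = fun κ => _ := funext diffPoly_eq
    rw [this]; fun_prop
  obtain ⟨κ, h, hκ⟩ := intermediate_value_Ioo (by norm_num) hc ⟨h0, h2⟩
  exact ⟨κ, h.1, hκ⟩

/-- The critical wave number of the diffusion mode. -/
def diffKappa : ℝ := exists_diffPoly_zero.choose

lemma diffKappa_pos : 0 < diffKappa := exists_diffPoly_zero.choose_spec.1

lemma diffPoly_diffKappa : diffPoly diffKappa = 0 := exists_diffPoly_zero.choose_spec.2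

/-- The restriction of the dispersion function to real `s`. -/
def diffFun (κ s : ℝ) : ℝ := dispersionPoly s κ (millsR s)

lemma diffFun_ofReal (κ s : ℝ) : dispersion s κ = (diffFun κ s : ℂ) := dispersion_ofReal s κ

lemma exists_diffFun_pos {κ : ℝ} (hκ : 0 < κ) : ∃ s, 0 < s ∧ 0 < diffFun κ s := by
  obtain ⟨C, hC, h⟩ := exists_dispersion_asymptotic
  set s : ℝ := 1 + 3 / κ + C / 3 with hs
  have h3 : 0 < 3 / κ := by positivity
  have hs0 : 0 < s := by rw [hs]; positivity
  have hs1 : 1 ≤ s := by rw [hs]; linarith [div_pos hC (by norm_num : (0 : ℝ) < 3)]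
  have hm : 3 ≤ κ * s := by
    have : κ * (3 / κ) = 3 := by field_simp
    rw [hs]; nlinarith [mul_pos hκ hC]
  have hsC : C / s < 3 := by
    rw [div_lt_iff₀ hs0, hs]; nlinarith
  refine ⟨s, hs0, ?_⟩
  have k := h (s : ℂ) (by simpa using hs0.le) (by simpa [abs_of_pos hs0] using hs1) ((κ * s : ℝ) : ℂ)
  rw [show (((κ * s : ℝ) : ℂ)) / s = κ by
    push_cast; rw [mul_div_cancel_right₀]; exact_mod_cast hs0.ne', diffFun_ofReal] at k
  have e : (s : ℂ) ^ 3 * (diffFun κ s : ℂ) - 6 * ((κ * s : ℝ) - 1) ^ 3 =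
      ((s ^ 3 * diffFun κ s - 6 * (κ * s - 1) ^ 3 : ℝ) : ℂ) := by push_cast; ring
  rw [e, norm_real, norm_real, norm_real, Real.norm_eq_abs,
    norm_of_nonneg hs0.le, norm_of_nonneg (by positivity)] at k
  have k2 := (abs_le.1 k).1
  set m := κ * s
  have k3 : C / s * (1 + m) ^ 2 < 6 * (m - 1) ^ 3 := by
    have : (1 + m) ^ 2 ≤ 4 * (m - 1) ^ 2 := by nlinarith
    calc C / s * (1 + m) ^ 2 < 3 * (1 + m) ^ 2 := by gcongr
      _ ≤ 3 * (4 * (m - 1) ^ 2) := by gcongr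
      _ ≤ 6 * (m - 1) ^ 3 := by nlinarith [sq_nonneg (m - 1)]
  have : 0 < s ^ 3 * diffFun κ s := by linarith
  exact (mul_pos_iff_of_pos_left (by positivity)).1 this

lemma diff_family : IncreasingFamily diffFun diffKappa where
  mono κ := strictMonoOn_dispersion κ
  cont := by
    have := continuous_millsR
    unfold diffFun dispersionPoly; fun_prop
  large κ hκ := exists_diffFun_pos hκ
  neg_iff κ _ := by
    change diffPoly κ < 0 ↔ _
    rw [← diffPoly_diffKappa, strictMono_diffPoly.lt_iff_lt]

/-! ### The imaginary part of the Mills function -/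

lemma mills_im_neg {s : ℂ} (hs : 0 < s.re) (hi : 0 < s.im) : (mills s).im < 0 := by
  set a := s.re
  set b := s.im
  set h : ℝ → ℝ := fun u => u / (a ^ 2 + u ^ 2) with hh
  have hden : ∀ u : ℝ, 0 < a ^ 2 + u ^ 2 := fun u => by positivity
  have hhc : Continuous h := by
    rw [hh]
    exact continuous_id.div (by fun_prop) fun u => (hden u).ne'
  have hhb : ∀ u, |h u| ≤ a⁻¹ := by
    intro u
    rw [hh]
    simp only
    rw [abs_div, abs_of_pos (hden u), div_le_iff₀ (hden u), inv_mul_eq_div, le_div_iff₀ hs]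
    have := sq_abs u
    nlinarith [sq_nonneg (|u| - a), abs_nonneg u]
  have e1 : (mills s).im = ∫ t, -h (t + b) ∂gauss1 := by
    rw [← resMoment_zero hs]
    unfold resMoment wMoment
    have := integral_im (integrable_resMoment hs.ne' 0)
    simp only [RCLike.im_eq_complex_im] at this
    rw [← this]
    refine integral_congr_ae (.of_forall fun t => ?_)
    simp only [pow_zero, mul_one, inv_im, hh, normSq_apply]
    simp
    change (-t + -b) / (a * a + (b + t) * (b + t)) = _
    rw [← neg_div]
    congr 1 <;> ring
  set g := gaussianPDFReal 0 1 with hg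
  have hgc : Continuous g := by
    have : g = fun t => (√(2 * Real.pi))⁻¹ * Real.exp (-t ^ 2 / 2) := funext gaussianPDFReal_std
    rw [this]; fun_prop
  have hgi : Integrable g := integrable_gaussianPDFReal 0 1
  have hi1 : Integrable fun u => h u * g (u - b) :=
    (hgi.comp_sub_right b).bdd_mul (c := a⁻¹) hhc.aestronglyMeasurable
      (.of_forall hhb)
  have hi2 : Integrable fun u => h u * g (u + b) :=
    (hgi.comp_add_right b).bdd_mul (c := a⁻¹) hhc.aestronglyMeasurable
      (.of_forall hhb)
  have e2 : ∫ t, h (t + b) ∂gauss1 = ∫ u, h u * g (u - b) := by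
    rw [integral_gauss1_eq, ← integral_add_right_eq_self (fun u => h u * g (u - b)) b]
    simp [hg]
  have e3 : ∫ u, h u * g (u - b) = -∫ u, h u * g (u + b) := by
    rw [← integral_neg_eq_self, ← integral_neg]
    refine integral_congr_ae (.of_forall fun u => ?_)
    have : g (-u - b) = g (u + b) := by
      rw [hg, gaussianPDFReal_std, gaussianPDFReal_std]; congr 2; ring
    simp only [this, hh]
    ring
  have e4 : 0 < ∫ u, h u * g (u - b) - h u * g (u + b) := by
    have hpos : ∀ u, u ≠ 0 → 0 < h u * g (u - b) - h u * g (u + b) := by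
      intro u hu
      rw [← mul_sub, hh, hg, gaussianPDFReal_std, gaussianPDFReal_std, ← mul_sub]
      have hc : 0 < (√(2 * Real.pi))⁻¹ := by positivity
      rcases lt_or_gt_of_ne hu with h' | h'
      · refine mul_pos_of_neg_of_neg (div_neg_of_neg_of_pos h' (hden u))
          (mul_neg_of_pos_of_neg hc (sub_neg.2 (Real.exp_lt_exp.2 ?_)))
        nlinarith
      · refine mul_pos (div_pos h' (hden u)) (mul_pos hc (sub_pos.2 (Real.exp_lt_exp.2 ?_)))
        nlinarith
    have hnn : ∀ u, 0 ≤ h u * g (u - b) - h u * g (u + b) := by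
      intro u
      rcases eq_or_ne u 0 with rfl | hu
      · simp [hh]
      · exact (hpos u hu).le
    rw [integral_pos_iff_support_of_nonneg hnn (hi1.sub hi2)]
    have : Ioi (0 : ℝ) ⊆ Function.support fun u => h u * g (u - b) - h u * g (u + b) :=
      fun u hu => (hpos u (ne_of_gt hu)).ne'
    exact lt_of_lt_of_le (by simp) (measure_mono this)
  rw [integral_sub hi1 hi2] at e4
  rw [e1, integral_neg, e2]
  linarith

/-! ### The plasma dispersion function and the modes -/

lemma zetaOf_eq (κ : ℝ) (Λ : ℂ) : zetaOf κ Λ = I * ((Λ + 1) / κ) := by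
  unfold zetaOf
  rw [div_mul_eq_div_div, div_I]
  ring

lemma plasmaZ_I_mul {s : ℂ} (hs : 0 < s.re) : plasmaZ (I * s) = I * mills s := by
  rw [← resMoment_zero hs]
  unfold resMoment wMoment plasmaZ
  rw [gauss1, integral_gaussianReal_eq_integral_smul (by norm_num), ← integral_const_mul,
    ← integral_const_mul]
  refine integral_congr_ae (.of_forall fun v => ?_)
  have h := add_I_mul_ne_zero hs.ne' v
  have h2 : (v : ℂ) - I * s = -I * (s + I * v) := by linear_combination (v : ℂ) * I_sq
  simp only [pow_zero, mul_one]
  rw [gaussianPDFReal_std, h2, Complex.real_smul, ← div_div, div_neg, div_I]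
  push_cast
  rw [one_div]
  ring

lemma det_three_aux {r : ℂ} (hr : r ^ 2 = 6) (X₁ X₂ X₃ b Y₁ Y₂ κ : ℂ) :
    (!![I * X₁, b, I * Y₁ / r; b, I * X₂, Y₂ / r; I * Y₁ / r, Y₂ / r, I * X₃ / 6] -
      (I * κ) • (1 : Matrix (Fin 3) (Fin 3) ℂ)).det =
    I * (-(X₁ - κ) * (X₂ - κ) * (X₃ / 6 - κ) + b * Y₁ * Y₂ / 3 + Y₁ ^ 2 / 6 * (X₂ - κ)
      - Y₂ ^ 2 / 6 * (X₁ - κ) - b ^ 2 * (X₃ / 6 - κ)) := by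
  have h : (r⁻¹) ^ 2 = 1 / 6 := by rw [inv_pow, hr]; norm_num
  have hI3 : I ^ 3 = -I := by rw [pow_succ, I_sq]; ring
  rw [Matrix.det_fin_three]
  simp [div_eq_mul_inv]
  generalize r⁻¹ = ρ at *
  linear_combination (2 * b * I * Y₁ * Y₂ - I ^ 3 * Y₁ ^ 2 * (X₂ - κ) - I * Y₂ ^ 2 * (X₁ - κ)) * h
    + ((X₁ - κ) * (X₂ - κ) * (X₃ / 6 - κ) - Y₁ ^ 2 / 6 * (X₂ - κ)) * hI3

lemma spectralGamma_I_mul {s : ℂ} (hs : 0 < s.re) (κ : ℝ) :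
    spectralGamma κ (I * s) = I / 6 * dispersion s κ := by
  have ss : ((√6 : ℝ) : ℂ) ^ 2 = 6 := by rw [sq]; exact sqrt_six_mul
  unfold spectralGamma plasmaMatrix
  rw [plasmaZ_I_mul hs]
  unfold dispersion dispersionPoly
  generalize mills s = W
  have hI2 : I ^ 2 = -1 := I_sq
  have hI3 : I ^ 3 = -I := by rw [pow_succ, hI2]; ring
  have hI4 : I ^ 4 = 1 := by rw [pow_succ, hI3]; linear_combination -hI2
  have hI5 : I ^ 5 = I := by rw [pow_succ, hI4]; ring
  have hZ1 : 1 + I * s * (I * W) = 1 - s * W := by linear_combination s * W * hI2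
  have hZ2 : I * s + ((I * s) ^ 2 - 1) * (I * W) = I * (s - (s ^ 2 + 1) * W) := by
    linear_combination s ^ 2 * W * hI3
  have hZ3 : I * s + (I * s) ^ 2 * (I * W) = I * (s - s ^ 2 * W) := by
    linear_combination s ^ 2 * W * hI3
  have hZ4 : (I * s) ^ 2 + ((I * s) ^ 3 - I * s) * (I * W) = -s ^ 2 + (s ^ 3 + s) * W := by
    linear_combination (s ^ 2 - s * W) * hI2 + s ^ 3 * W * hI4
  have hZ5 : (I * s) ^ 3 - I * s + ((I * s) ^ 4 - 2 * (I * s) ^ 2 + 5) * (I * W) =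
      I * (-s ^ 3 - s + (s ^ 4 + 2 * s ^ 2 + 5) * W) := by
    linear_combination (s ^ 3 - 2 * s ^ 2 * W) * hI3 + s ^ 4 * W * hI5
  simp only
  rw [hZ1, hZ2, hZ3, hZ4, hZ5, det_three_aux ss]
  ring

/-- `Λ = κ s - 1` along a branch `s(κ)` of zeros. -/
def branch (r : ℝ → ℂ) (κ : ℝ) : ℂ := if κ = 0 then 0 else κ * r κ - 1

lemma branch_of_ne {r : ℝ → ℂ} {κ : ℝ} (h : κ ≠ 0) : branch r κ = κ * r κ - 1 := if_neg h

lemma branch_zero (r : ℝ → ℂ) : branch r 0 = 0 := if_pos rfl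

lemma eq_branch_iff {r : ℝ → ℂ} {κ : ℝ} (h : 0 < κ) (z : ℂ) :
    z = branch r κ ↔ (z + 1) / κ = r κ := by
  have hk : (κ : ℂ) ≠ 0 := by exact_mod_cast h.ne'
  rw [branch_of_ne h.ne', div_eq_iff hk, mul_comm (r κ), eq_sub_iff_add_eq]

lemma continuousOn_branch {r : ℝ → ℂ} {κc : ℝ}
    (hc : ∀ κ, 0 < κ → κ < κc → ContinuousAt r κ)
    (h0 : ∀ δ > 0, ∀ᶠ κ : ℝ in 𝓝 0, 0 < κ → κ < κc → ‖κ * r κ - 1‖ < δ) :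
    ContinuousOn (branch r) (Set.Ico 0 κc) := by
  rintro κ ⟨hk0, hk1⟩
  rcases hk0.eq_or_lt with rfl | hk
  · rw [Metric.continuousWithinAt_iff']
    intro ε hε
    filter_upwards [nhdsWithin_le_nhds (h0 ε hε), self_mem_nhdsWithin] with x hx hxm
    rw [branch_zero, dist_zero_right]
    rcases hxm.1.eq_or_lt with rfl | hx0
    · rw [branch_zero, norm_zero]; exact hε
    · rw [branch_of_ne hx0.ne']; exact hx hx0 hxm.2
  · refine ContinuousAt.continuousWithinAt ?_
    have h1 : ContinuousAt (fun x : ℝ => (x : ℂ) * r x - 1) κ :=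
      (Complex.continuous_ofReal.continuousAt.mul (hc κ hk hk1)).sub continuousAt_const
    refine h1.congr ?_
    filter_upwards [eventually_ne_nhds hk.ne'] with x hx
    rw [branch_of_ne hx]

/-- The four branches of zeros. -/
def modeRoot : Mode → ℝ → ℂ
  | .shear => fun κ => (realRoot shearFun κ : ℂ)
  | .diff => fun κ => (realRoot diffFun κ : ℂ)
  | .ac => acousticRoot
  | .acConj => fun κ => conj (acousticRoot κ)

/-- The rescaled eigenvalues. -/
def modeValue (N : Mode) : ℝ → ℂ := branch (modeRoot N)

/-- The rescaled critical wave numbers. -/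
def modeCrit : Mode → ℝ
  | .shear => millsR 0
  | .diff => diffKappa
  | .ac => crossKappa
  | .acConj => crossKappa

lemma add_one_div_re {κ : ℝ} (hκ : 0 < κ) (z : ℂ) : 0 < ((z + 1) / κ).re ↔ -1 < z.re := by
  rw [div_ofReal_re, div_pos_iff_of_pos_right hκ]
  simp only [add_re, one_re]
  constructor <;> intro h <;> linarith

lemma add_one_div_im (κ : ℝ) (z : ℂ) : ((z + 1) / κ).im = z.im / κ := by
  rw [div_ofReal_im]; simp

lemma eq_ofReal_iff {s : ℂ} {r : ℝ} : s = r ↔ s.im = 0 ∧ s.re = r := by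
  rw [Complex.ext_iff]; simp [and_comm]

lemma mills_eq_ofReal_iff {s : ℂ} {κ : ℝ} (hκ : 0 < κ) :
    0 < s.re ∧ mills s = κ ↔ κ < millsR 0 ∧ s = modeRoot .shear κ := by
  change _ ↔ κ < millsR 0 ∧ s = ((realRoot shearFun κ : ℝ) : ℂ)
  rw [eq_ofReal_iff (s := s)]
  constructor
  · rintro ⟨hs, h⟩
    have him : s.im = 0 := by
      rcases lt_trichotomy s.im 0 with hn | h0 | hp
      · have e := mills_im_neg (s := conj s) (by simpa using hs) (by simpa using hn)
        rw [mills_conj, h] at e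
        simp at e
      · exact h0
      · have e := mills_im_neg hs hp
        rw [h] at e
        simp at e
    have hsr : s = (s.re : ℂ) := by apply Complex.ext <;> simp [him]
    rw [hsr, mills_ofReal] at h
    have h' : millsR s.re = κ := by exact_mod_cast h
    obtain ⟨a, b⟩ := (shear_family.zero_iff hκ).1 ⟨hs, by rw [shearFun, h', sub_self]⟩
    exact ⟨a, him, b⟩
  · rintro ⟨h1, h2, h3⟩
    obtain ⟨a, b⟩ := (shear_family.zero_iff hκ).2 ⟨h1, h3⟩
    have hsr : s = (s.re : ℂ) := by apply Complex.ext <;> simp [h2]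
    refine ⟨a, ?_⟩
    rw [hsr, mills_ofReal]
    exact_mod_cast (sub_eq_zero.1 b).symm

lemma dispersion_real_zero_iff {s : ℂ} {κ : ℝ} (hκ : 0 < κ) :
    0 < s.re ∧ s.im = 0 ∧ dispersion s κ = 0 ↔ κ < diffKappa ∧ s = modeRoot .diff κ := by
  change _ ↔ κ < diffKappa ∧ s = ((realRoot diffFun κ : ℝ) : ℂ)
  rw [eq_ofReal_iff (s := s)]
  have key : s.im = 0 → (dispersion s κ = 0 ↔ diffFun κ s.re = 0) := by
    intro him
    have hsr : s = (s.re : ℂ) := by apply Complex.ext <;> simp [him]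
    conv_lhs => rw [hsr, diffFun_ofReal]
    exact_mod_cast Iff.rfl
  constructor
  · rintro ⟨hs, him, h⟩
    obtain ⟨a, b⟩ := (diff_family.zero_iff hκ).1 ⟨hs, (key him).1 h⟩
    exact ⟨a, him, b⟩
  · rintro ⟨h1, h2, h3⟩
    obtain ⟨a, b⟩ := (diff_family.zero_iff hκ).2 ⟨h1, h3⟩
    exact ⟨a, h2, (key h2).2 b⟩

/-- The zeros in the right half-plane are those of the four branches. -/
lemma mills_or_dispersion_iff {s : ℂ} {κ : ℝ} (hκ : 0 < κ) :
    0 < s.re ∧ (mills s = κ ∨ dispersion s κ = 0) ↔ ∃ N, κ < modeCrit N ∧ s = modeRoot N κ := by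
  have hconj : conj s ∈ quadrant ∧ dispersion (conj s) κ = 0 ↔
      κ < crossKappa ∧ s = modeRoot .acConj κ := by
    rw [quadrant_zero_iff hκ]
    refine and_congr_right fun _ => ?_
    change _ ↔ s = conj (acousticRoot κ)
    constructor
    · intro h; rw [← h, Complex.conj_conj]
    · intro h; rw [h, Complex.conj_conj]
  constructor
  · rintro ⟨hs, h | h⟩
    · exact ⟨.shear, (mills_eq_ofReal_iff hκ).1 ⟨hs, h⟩⟩
    · rcases lt_trichotomy s.im 0 with hn | h0 | hp
      · refine ⟨.acConj, hconj.1 ⟨⟨by simpa using hs, by simpa using hn⟩, ?_⟩⟩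
        rw [dispersion_conj, h, map_zero]
      · exact ⟨.diff, (dispersion_real_zero_iff hκ).1 ⟨hs, h0, h⟩⟩
      · exact ⟨.ac, (quadrant_zero_iff hκ s).1 ⟨⟨hs, hp⟩, h⟩⟩
  · rintro ⟨N, hN⟩
    cases N
    · obtain ⟨a, b⟩ := (mills_eq_ofReal_iff hκ).2 hN
      exact ⟨a, Or.inl b⟩
    · obtain ⟨a, -, b⟩ := (dispersion_real_zero_iff hκ).2 hN
      exact ⟨a, Or.inr b⟩
    · obtain ⟨a, b⟩ := (quadrant_zero_iff hκ s).2 hN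
      exact ⟨a.1, Or.inr b⟩
    · obtain ⟨a, b⟩ := hconj.2 hN
      refine ⟨by simpa using a.1, Or.inr ?_⟩
      rwa [dispersion_conj, map_eq_zero] at b

/-- The zeros of `det (1 - B / τ)` off the imaginary axis are the modes. -/
lemma fibreDet_eq_zero_iff {τ : ℝ} (hτ : 0 < τ) {l : ℂ} (hz : (l + 1 / τ).re ≠ 0) (q : E3) :
    fibreDet τ (l + 1 / τ) q = 0 ↔ l ∈ modesAt modeValue modeCrit τ ‖q‖ := by
  have ht0 : (τ : ℂ) ≠ 0 := by exact_mod_cast hτ.ne'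
  have hmem : l ∈ modesAt modeValue modeCrit τ ‖q‖ ↔
      ∃ N, τ * ‖q‖ < modeCrit N ∧ τ * l = modeValue N (τ * ‖q‖) := by
    unfold modesAt
    refine exists_congr fun N => ?_
    rw [lt_div_iff₀ hτ, mul_comm, eq_div_iff ht0, mul_comm l]
  rw [hmem]
  rcases eq_or_ne q 0 with rfl | hq
  · rw [fibreDet_zero, norm_zero, mul_zero, pow_eq_zero_iff (by norm_num)]
    have hz0 : l + 1 / τ ≠ 0 := fun h => hz (by rw [h]; simp)
    have hcrit : ∀ N, 0 < modeCrit N := by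
      intro N
      cases N
      exacts [millsR_pos 0, diffKappa_pos, crossKappa_pos, crossKappa_pos]
    have e1 : 1 - (1 / τ : ℂ) * (l + 1 / τ)⁻¹ = 0 ↔ l = 0 := by
      rw [sub_eq_zero, eq_mul_inv_iff_mul_eq₀ hz0, one_mul]
      simp
    rw [e1]
    constructor
    · rintro rfl
      exact ⟨.shear, hcrit _, by rw [modeValue, branch_zero, mul_zero]⟩
    · rintro ⟨N, -, h⟩
      rw [modeValue, branch_zero] at h
      exact (mul_eq_zero.1 h).resolve_left ht0
  · have hk : 0 < ‖q‖ := norm_pos_iff.2 hq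
    have hκ : 0 < τ * ‖q‖ := mul_pos hτ hk
    have hκ0 : ((τ * ‖q‖ : ℝ) : ℂ) ≠ 0 := by exact_mod_cast hκ.ne'
    have hk0 : ((‖q‖ : ℝ) : ℂ) ≠ 0 := by exact_mod_cast hk.ne'
    have hs : (l + 1 / τ) / (‖q‖ : ℝ) = (τ * l + 1) / (τ * ‖q‖ : ℝ) := by
      push_cast
      field_simp
    have e2 : (∃ N, τ * ‖q‖ < modeCrit N ∧ τ * l = modeValue N (τ * ‖q‖)) ↔
        0 < ((τ * l + 1) / ((τ * ‖q‖ : ℝ) : ℂ)).re ∧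
          (mills ((τ * l + 1) / ((τ * ‖q‖ : ℝ) : ℂ)) = ((τ * ‖q‖ : ℝ) : ℂ) ∨
          dispersion ((τ * l + 1) / ((τ * ‖q‖ : ℝ) : ℂ)) ((τ * ‖q‖ : ℝ) : ℂ) = 0) := by
      rw [mills_or_dispersion_iff hκ]
      refine exists_congr fun N => ?_
      rw [modeValue, eq_branch_iff hκ]
    rw [e2, ← hs, fibreDet_eq_axis τ hz]
    have hre : 0 < ((l + 1 / τ) / ((‖q‖ : ℝ) : ℂ)).re ↔ 0 < (l + 1 / τ).re := by
      rw [div_ofReal_re, div_pos_iff_of_pos_right hk]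
    rw [hre]
    have e3 : 0 < (l + 1 / τ).re → (fibreDet τ (l + 1 / τ) (‖q‖ • axis0) = 0 ↔
        mills ((l + 1 / τ) / (‖q‖ : ℝ)) = ((τ * ‖q‖ : ℝ) : ℂ) ∨
        dispersion ((l + 1 / τ) / (‖q‖ : ℝ)) ((τ * ‖q‖ : ℝ) : ℂ) = 0) := by
      intro hp
      rw [fibreDet_axis hτ hk hp, mul_eq_zero, pow_eq_zero_iff (by norm_num), sub_eq_zero,
        eq_div_iff hκ0, one_mul, div_eq_zero_iff, or_iff_left (b := 6 * _ = (0 : ℂ))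
        (by simp only [mul_eq_zero, not_or]; exact ⟨by norm_num, pow_ne_zero _ hκ0⟩)]
      rw [eq_comm]
    constructor
    · intro h
      have hp := (re_of_fibreDet_eq_zero hτ hz h).1
      exact ⟨hp, (e3 hp).1 h⟩
    · rintro ⟨hp, h⟩
      exact (e3 hp).2 h

lemma modeValue_re {N : Mode} {κ : ℝ} (h0 : 0 ≤ κ) (h1 : κ < modeCrit N) :
    -1 < (modeValue N κ).re ∧ (modeValue N κ).re ≤ 0 := by
  rcases h0.eq_or_lt with rfl | hκ
  · rw [modeValue, branch_zero]; simp
  · have hs := ((mills_or_dispersion_iff (s := (modeValue N κ + 1) / κ) hκ).2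
      ⟨N, h1, (eq_branch_iff hκ _).1 rfl⟩).1
    have h := (add_one_div_re hκ _).1 hs
    refine ⟨h, ?_⟩
    have hz : (modeValue N κ + 1 / (1 : ℝ)).re ≠ 0 := by
      simp only [ofReal_one, div_one, add_re, one_re]
      linarith
    have hd := (fibreDet_eq_zero_iff one_pos hz (κ • axis0)).2
      ⟨N, by simpa [norm_smul, axis0, abs_of_pos hκ] using h1,
        by simp [norm_smul, axis0, abs_of_pos hκ]⟩
    have := (re_of_fibreDet_eq_zero one_pos hz hd).2
    simp only [ofReal_one, div_one, add_re, one_re] at this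
    linarith

lemma isModeFamily : IsModeFamily modeValue modeCrit where
  crit_pos N := by
    cases N
    exacts [millsR_pos 0, diffKappa_pos, crossKappa_pos, crossKappa_pos]
  at_zero N := branch_zero _
  continuousOn N := by
    have hac : ∀ δ > 0, ∀ᶠ κ : ℝ in 𝓝 0, 0 < κ → κ < crossKappa → ‖κ * acousticRoot κ - 1‖ < δ := by
      intro δ hδ
      filter_upwards [eventually_zero_near_one (fun s => dispersion_zero_ne_zero) hδ] with κ h h0 h1
      obtain ⟨a, b, -⟩ := acousticRoot_spec h0 h1
      exact h _ a.1.le b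
    cases N
    · refine continuousOn_branch (fun κ h0 h1 => Complex.continuous_ofReal.continuousAt.comp
        (shear_family.continuousAt_root h0 h1)) fun δ hδ => ?_
      filter_upwards [shear_eventually hδ] with κ h h0 h1
      obtain ⟨a, b⟩ := shear_family.root_spec h0 h1
      have := h _ h0 a b
      rw [← Real.norm_eq_abs, ← norm_real] at this
      simpa [modeRoot] using this
    · refine continuousOn_branch (fun κ h0 h1 => Complex.continuous_ofReal.continuousAt.comp
        (diff_family.continuousAt_root h0 h1)) fun δ hδ => ?_
      filter_upwards [eventually_zero_near_one (fun s => dispersion_zero_ne_zero) hδ] with κ h h0 h1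
      obtain ⟨a, b⟩ := diff_family.root_spec h0 h1
      exact h (realRoot diffFun κ : ℂ) (by rw [ofReal_re]; exact a.le)
        (by rw [diffFun_ofReal, b, ofReal_zero])
    · exact continuousOn_branch (fun κ h0 h1 => continuousAt_acousticRoot h0 h1) hac
    · refine continuousOn_branch (fun κ h0 h1 => Complex.continuous_conj.continuousAt.comp
        (continuousAt_acousticRoot h0 h1)) fun δ hδ => ?_
      filter_upwards [hac δ hδ] with κ h h0 h1
      have e : (κ : ℂ) * conj (acousticRoot κ) - 1 =
          conj (κ * acousticRoot κ - 1) := by simp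
      change ‖(κ : ℂ) * conj (acousticRoot κ) - 1‖ < δ
      rw [e, Complex.norm_conj]
      exact h h0 h1
  above N κ h0 h1 := modeValue_re h0 h1
  shear_real κ h0 _ := by
    rcases h0.eq_or_lt with rfl | h
    · rw [modeValue, branch_zero]; rfl
    · rw [modeValue, branch_of_ne h.ne']; simp [modeRoot]
  shear_iff κ z hκ := by
    rw [modeValue, eq_branch_iff hκ]
    change _ ↔ κ < millsR 0 ∧ _
    rw [← mills_eq_ofReal_iff hκ, add_one_div_re hκ, zetaOf_eq]
    refine and_congr_right fun h => ?_
    rw [plasmaZ_I_mul ((add_one_div_re hκ z).2 h), mul_right_inj' I_ne_zero]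
  diff_iff κ z hκ := by
    rw [modeValue, eq_branch_iff hκ]
    change _ ↔ κ < diffKappa ∧ _
    rw [← dispersion_real_zero_iff hκ, add_one_div_re hκ, zetaOf_eq, add_one_div_im,
      div_eq_zero_iff, or_iff_left hκ.ne']
    refine and_congr_right fun h => and_congr_right fun _ => ?_
    rw [spectralGamma_I_mul ((add_one_div_re hκ z).2 h)]
    simp
  ac_iff κ z hκ := by
    rw [modeValue, eq_branch_iff hκ]
    change _ ↔ κ < crossKappa ∧ _ = acousticRoot κ
    rw [← quadrant_zero_iff hκ, quadrant, mem_ofPred_eq, add_one_div_re hκ, zetaOf_eq,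
      add_one_div_im, div_pos_iff_of_pos_right hκ, and_assoc]
    refine and_congr_right fun h => and_congr_right fun _ => ?_
    rw [spectralGamma_I_mul ((add_one_div_re hκ z).2 h)]
    simp
  acConj_crit := rfl
  acConj_eq κ h0 _ := by
    rcases h0.eq_or_lt with rfl | h
    · rw [modeValue, modeValue, branch_zero, branch_zero, map_zero]
    · rw [modeValue, modeValue, branch_of_ne h.ne', branch_of_ne h.ne']
      simp [modeRoot]

/-! ### Multiplication operators on `L²` -/

section MulOp

variable {α : Type*} [MeasurableSpace α] {μ : Measure α}

/-- Measurable and bounded functions. -/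
def BddMeas (φ : α → ℂ) : Prop := Measurable φ ∧ ∃ C, ∀ x, ‖φ x‖ ≤ C

lemma BddMeas.memLp {φ : α → ℂ} (hφ : BddMeas φ) {f : α → ℂ} (hf : MemLp f 2 μ) :
    MemLp (fun x => φ x * f x) 2 μ := by
  obtain ⟨hm, C, hC⟩ := hφ
  exact hf.of_le_mul (c := C) (hm.aestronglyMeasurable.mul hf.1)
    (.of_forall fun x => by
      rw [norm_mul]; exact mul_le_mul_of_nonneg_right (hC x) (norm_nonneg _))

lemma BddMeas.norm_le {φ : α → ℂ} (hφ : BddMeas φ) : ∃ C, 0 ≤ C ∧ ∀ x, ‖φ x‖ ≤ C := by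
  obtain ⟨hm, C, hC⟩ := hφ
  exact ⟨max C 0, le_max_right _ _, fun x => (hC x).trans (le_max_left _ _)⟩

lemma BddMeas.mul {φ ψ : α → ℂ} (hφ : BddMeas φ) (hψ : BddMeas ψ) :
    BddMeas fun x => φ x * ψ x := by
  obtain ⟨C, hC0, hC⟩ := hφ.norm_le
  obtain ⟨D, hD0, hD⟩ := hψ.norm_le
  exact ⟨hφ.1.mul hψ.1, C * D, fun x => by
    rw [norm_mul]; exact mul_le_mul (hC x) (hD x) (norm_nonneg _) hC0⟩

lemma bddMeas_const (c : ℂ) : BddMeas fun _ : α => c := ⟨measurable_const, ‖c‖, fun _ => le_rfl⟩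

lemma bddMeas_indicator {s : Set α} (hs : MeasurableSet s) (c : ℂ) :
    BddMeas (s.indicator fun _ => c) :=
  ⟨measurable_const.indicator hs, ‖c‖, fun x => by
    by_cases h : x ∈ s <;> simp [h]⟩

lemma BddMeas.comp {β : Type*} [MeasurableSpace β] {φ : α → ℂ} (hφ : BddMeas φ) {g : β → α}
    (hg : Measurable g) : BddMeas fun x => φ (g x) :=
  ⟨hφ.1.comp hg, hφ.2.choose, fun _ => hφ.2.choose_spec _⟩

variable (μ) in
open Classical in
/-- Multiplication by a bounded measurable function, as an operator on `L²`. -/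
def mulOp (φ : α → ℂ) : Lp ℂ 2 μ →L[ℂ] Lp ℂ 2 μ :=
  if hφ : BddMeas φ then
    LinearMap.mkContinuous
      { toFun := fun f => (hφ.memLp (Lp.memLp f)).toLp _
        map_add' := fun f g => by
          apply Lp.ext
          filter_upwards [(hφ.memLp (Lp.memLp (f + g))).coeFn_toLp, Lp.coeFn_add f g,
            (hφ.memLp (Lp.memLp f)).coeFn_toLp, (hφ.memLp (Lp.memLp g)).coeFn_toLp,
            Lp.coeFn_add ((hφ.memLp (Lp.memLp f)).toLp _) ((hφ.memLp (Lp.memLp g)).toLp _)]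
            with x h1 h2 h3 h4 h5
          rw [h1, h2, h5, Pi.add_apply, Pi.add_apply, h3, h4]
          ring
        map_smul' := fun c f => by
          apply Lp.ext
          filter_upwards [(hφ.memLp (Lp.memLp (c • f))).coeFn_toLp, Lp.coeFn_smul c f,
            (hφ.memLp (Lp.memLp f)).coeFn_toLp,
            Lp.coeFn_smul c ((hφ.memLp (Lp.memLp f)).toLp _)] with x h1 h2 h3 h4
          rw [h1, h2, RingHom.id_apply, h4, Pi.smul_apply, Pi.smul_apply, h3, smul_eq_mul,
            smul_eq_mul]
          ring }
      hφ.norm_le.choose (fun f => by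
        refine Lp.norm_le_mul_norm_of_ae_le_mul ?_
        filter_upwards [(hφ.memLp (Lp.memLp f)).coeFn_toLp] with x h1
        simp only [LinearMap.coe_mk, AddHom.coe_mk]
        rw [h1, norm_mul]
        exact mul_le_mul_of_nonneg_right (hφ.norm_le.choose_spec.2 x) (norm_nonneg _))
  else 0

lemma mulOp_coe {φ : α → ℂ} (hφ : BddMeas φ) (f : Lp ℂ 2 μ) :
    mulOp μ φ f =ᵐ[μ] fun x => φ x * f x := by
  rw [mulOp, dif_pos hφ]
  exact (hφ.memLp (Lp.memLp f)).coeFn_toLp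

end MulOp

/-! ### Elementary tensors -/

section Tensor

variable {K V : Type*} [MeasurableSpace K] [MeasurableSpace V]

lemma memLp_tensor {ν : Measure K} {μ : Measure V} [SFinite ν] [SFinite μ] {u : K → ℂ} {g : V → ℂ}
    (hu : MemLp u 2 ν) (hg : MemLp g 2 μ) : MemLp (fun p : K × V => u p.1 * g p.2) 2 (ν.prod μ) := by
  have hm : AEStronglyMeasurable (fun p : K × V => u p.1 * g p.2) (ν.prod μ) :=
    hu.1.comp_fst.mul hg.1.comp_snd
  rw [memLp_two_iff_integrable_sq_norm hm]
  have h := ((memLp_two_iff_integrable_sq_norm hu.1).1 hu).mul_prod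
    ((memLp_two_iff_integrable_sq_norm hg.1).1 hg)
  refine h.congr (.of_forall fun p => ?_)
  simp [mul_pow]

lemma inner_Lp_eq {α : Type*} [MeasurableSpace α] {μ : Measure α} (f g : Lp ℂ 2 μ) :
    ⟪f, g⟫_ℂ = ∫ x, conj (f x) * g x ∂μ := by
  rw [L2.inner_def]
  refine integral_congr_ae (.of_forall fun x => ?_)
  simp only [RCLike.inner_apply]
  ring

lemma integrable_conj_mul {α : Type*} [MeasurableSpace α] {μ : Measure α} (f g : Lp ℂ 2 μ) :
    Integrable (fun x => conj (f x) * g x) μ :=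
  (Lp.memLp f).star.integrable_mul (Lp.memLp g)

lemma ae_fst {ν : Measure K} {μ : Measure V} {p : K → Prop} (h : ∀ᵐ x ∂ν, p x) : ∀ᵐ x ∂(ν.prod μ), p x.1 :=
  Measure.quasiMeasurePreserving_fst.ae h

lemma ae_snd {ν : Measure K} {μ : Measure V} [SFinite ν] {p : V → Prop} (h : ∀ᵐ x ∂μ, p x) : ∀ᵐ x ∂(ν.prod μ), p x.2 :=
  Measure.quasiMeasurePreserving_snd.ae h

variable {ν : Measure K} {μ : Measure V} [SigmaFinite ν] [SigmaFinite μ]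

/-- The elementary tensor `u ⊗ g`. -/
def tens (u : Lp ℂ 2 ν) (g : Lp ℂ 2 μ) : Lp ℂ 2 (ν.prod μ) :=
  (memLp_tensor (Lp.memLp u) (Lp.memLp g)).toLp _

lemma tens_coe (u : Lp ℂ 2 ν) (g : Lp ℂ 2 μ) :
    tens u g =ᵐ[ν.prod μ] fun p => u p.1 * g p.2 :=
  (memLp_tensor (Lp.memLp u) (Lp.memLp g)).coeFn_toLp

lemma inner_tens (u u' : Lp ℂ 2 ν) (g g' : Lp ℂ 2 μ) :
    ⟪tens u g, tens u' g'⟫_ℂ = ⟪u, u'⟫_ℂ * ⟪g, g'⟫_ℂ := by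
  rw [inner_Lp_eq, inner_Lp_eq, inner_Lp_eq, ← integral_prod_mul]
  refine integral_congr_ae ?_
  filter_upwards [tens_coe u g, tens_coe u' g'] with p h1 h2
  rw [h1, h2, map_mul]
  ring

lemma norm_tens (u : Lp ℂ 2 ν) (g : Lp ℂ 2 μ) : ‖tens u g‖ = ‖u‖ * ‖g‖ := by
  have h := inner_tens u u g g
  rw [inner_self_eq_norm_sq_to_K, inner_self_eq_norm_sq_to_K, inner_self_eq_norm_sq_to_K,
    ← mul_pow] at h
  have h2 : ‖tens u g‖ ^ 2 = (‖u‖ * ‖g‖) ^ 2 := by exact_mod_cast h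
  exact (sq_eq_sq₀ (norm_nonneg _) (by positivity)).1 h2

lemma tens_add_left (u u' : Lp ℂ 2 ν) (g : Lp ℂ 2 μ) : tens (u + u') g = tens u g + tens u' g := by
  apply Lp.ext
  filter_upwards [tens_coe (u + u') g, tens_coe u g, tens_coe u' g,
    Lp.coeFn_add (tens u g) (tens u' g), ae_fst (μ := μ) (Lp.coeFn_add u u')] with p h1 h2 h3 h4 h5
  rw [h1, h4, Pi.add_apply, h2, h3, h5, Pi.add_apply, add_mul]

lemma tens_smul_left (c : ℂ) (u : Lp ℂ 2 ν) (g : Lp ℂ 2 μ) : tens (c • u) g = c • tens u g := by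
  apply Lp.ext
  filter_upwards [tens_coe (c • u) g, tens_coe u g, Lp.coeFn_smul c (tens u g),
    ae_fst (μ := μ) (Lp.coeFn_smul c u)] with p h1 h2 h4 h5
  rw [h1, h4, Pi.smul_apply, h2, h5, Pi.smul_apply, smul_eq_mul, smul_eq_mul, mul_assoc]

lemma tens_add_right (u : Lp ℂ 2 ν) (g g' : Lp ℂ 2 μ) : tens u (g + g') = tens u g + tens u g' := by
  apply Lp.ext
  filter_upwards [tens_coe u (g + g'), tens_coe u g, tens_coe u g',
    Lp.coeFn_add (tens u g) (tens u g'), ae_snd (ν := ν) (Lp.coeFn_add g g')] with p h1 h2 h3 h4 h5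
  rw [h1, h4, Pi.add_apply, h2, h3, h5, Pi.add_apply, mul_add]

lemma tens_smul_right (c : ℂ) (u : Lp ℂ 2 ν) (g : Lp ℂ 2 μ) : tens u (c • g) = c • tens u g := by
  apply Lp.ext
  filter_upwards [tens_coe u (c • g), tens_coe u g, Lp.coeFn_smul c (tens u g),
    ae_snd (ν := ν) (Lp.coeFn_smul c g)] with p h1 h2 h4 h5
  rw [h1, h4, Pi.smul_apply, h2, h5, Pi.smul_apply, smul_eq_mul, smul_eq_mul]
  ring

/-- `u ↦ u ⊗ g` as an operator. -/
def tensL (ν : Measure K) [SigmaFinite ν] (g : Lp ℂ 2 μ) : Lp ℂ 2 ν →L[ℂ] Lp ℂ 2 (ν.prod μ) :=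
  LinearMap.mkContinuous
    { toFun := fun u => tens u g
      map_add' := fun u u' => tens_add_left u u' g
      map_smul' := fun c u => tens_smul_left c u g } ‖g‖
    fun u => by simp [norm_tens, mul_comm]

lemma tensL_apply (g : Lp ℂ 2 μ) (u : Lp ℂ 2 ν) : tensL ν g u = tens u g := rfl

/-- `g ↦ u ⊗ g` as an operator. -/
def tensR (μ : Measure V) [SigmaFinite μ] (u : Lp ℂ 2 ν) : Lp ℂ 2 μ →L[ℂ] Lp ℂ 2 (ν.prod μ) :=
  LinearMap.mkContinuous
    { toFun := fun g => tens u g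
      map_add' := fun g g' => tens_add_right u g g'
      map_smul' := fun c g => tens_smul_right c u g } ‖u‖
    fun g => by simp [norm_tens]

lemma tensR_apply (g : Lp ℂ 2 μ) (u : Lp ℂ 2 ν) : tensR μ u g = tens u g := rfl

/-- The adjoint of `u ↦ u ⊗ g` integrates against `g` in the second variable. -/
lemma adjoint_tensL_coe (g : Lp ℂ 2 μ) (f : Lp ℂ 2 (ν.prod μ)) :
    (tensL ν g).adjoint f =ᵐ[ν] fun k => ∫ v, f (k, v) * conj (g v) ∂μ := by
  have hint : ∀ s : Set K, MeasurableSet s → ν s < ⊤ →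
      Integrable (fun p : K × V => s.indicator 1 p.1 * (f p * conj (g p.2)))
        (ν.prod μ) := by
    intro s hs hs'
    have h := integrable_conj_mul (tens (indicatorConstLp 2 hs hs'.ne (1 : ℂ)) g) f
    refine h.congr ?_
    filter_upwards [tens_coe (indicatorConstLp 2 hs hs'.ne (1 : ℂ)) g,
      ae_fst (μ := μ) (indicatorConstLp_coeFn (μ := ν) (hs := hs) (hμs := hs'.ne) (c := (1 : ℂ)))]
      with p h1 h2
    rw [h1, h2, map_mul]
    by_cases hp : p.1 ∈ s <;> simp [hp]
    ring
  have hae : ∀ s : Set K, MeasurableSet s → ν s < ⊤ →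
      IntegrableOn (fun k => ∫ v, f (k, v) * conj (g v) ∂μ) s ν := by
    intro s hs hs'
    rw [← integrable_indicator_iff hs]
    refine (hint s hs hs').integral_prod_left.congr (.of_forall fun k => ?_)
    by_cases hk : k ∈ s <;> simp [hk]
  refine ae_eq_of_forall_setIntegral_eq_of_sigmaFinite ?_ hae ?_
  · intro s hs hs'
    exact integrableOn_Lp_of_measure_ne_top _ (by norm_num) hs'.ne
  · intro s hs hs'
    have e1 : ⟪indicatorConstLp 2 hs hs'.ne (1 : ℂ), (tensL ν g).adjoint f⟫_ℂ =
        ∫ k in s, (tensL ν g).adjoint f k ∂ν := L2.inner_indicatorConstLp_one hs hs'.ne _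
    rw [← e1, adjoint_inner_right, tensL_apply, inner_Lp_eq,
      ← integral_indicator hs]
    have e2 : ∫ p, conj (tens (indicatorConstLp 2 hs hs'.ne (1 : ℂ)) g p) * f p ∂(ν.prod μ)
        = ∫ p, s.indicator 1 p.1 * (f p * conj (g p.2)) ∂(ν.prod μ) := by
      refine integral_congr_ae ?_
      filter_upwards [tens_coe (indicatorConstLp 2 hs hs'.ne (1 : ℂ)) g,
        ae_fst (μ := μ) (indicatorConstLp_coeFn (μ := ν) (hs := hs) (hμs := hs'.ne) (c := (1 : ℂ)))]
        with p h1 h2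
      rw [h1, h2, map_mul]
      by_cases hp : p.1 ∈ s <;> simp [hp]
      ring
    rw [e2, integral_prod _ (hint s hs hs')]
    refine integral_congr_ae (.of_forall fun k => ?_)
    by_cases hk : k ∈ s <;> simp [hk]

end Tensor

/-! ### The kinetic relation -/

section Kinetic

variable {K : Type*} [MeasurableSpace K] {ν : Measure K} [SigmaFinite ν]

/-- The square integrable functions of a wave parameter and the velocity. -/
abbrev KinL2 (ν : Measure K) : Type _ := Lp ℂ 2 (ν.prod maxwellian)

/-- The collision invariants as elements of `L²`. -/
def basisL (j : Fin 5) : VelocityL2 := (memLp_basis5 j).toLp _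

lemma basisL_coe (j : Fin 5) : basisL j =ᵐ[maxwellian] fun v => (basis5 j v : ℂ) :=
  (memLp_basis5 j).coeFn_toLp

variable (ν) in
/-- `u ↦ u ⊗ e_j`. -/
def emb (j : Fin 5) : Lp ℂ 2 ν →L[ℂ] KinL2 ν := tensL ν (basisL j)

variable (ν) in
/-- The `j`-th moment `f ↦ ∫ f e_j dμ`. -/
def mom (j : Fin 5) : KinL2 ν →L[ℂ] Lp ℂ 2 ν := (emb ν j).adjoint

lemma emb_coe (j : Fin 5) (u : Lp ℂ 2 ν) :
    emb ν j u =ᵐ[ν.prod maxwellian] fun p => u p.1 * (basis5 j p.2 : ℂ) := by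
  filter_upwards [tens_coe u (basisL j), ae_snd (ν := ν) (basisL_coe j)] with p h1 h2
  rw [emb, tensL_apply, h1, h2]

lemma mom_coe (j : Fin 5) (f : KinL2 ν) :
    mom ν j f =ᵐ[ν] fun k => ∫ v, f (k, v) * (basis5 j v : ℂ) ∂maxwellian := by
  filter_upwards [adjoint_tensL_coe (ν := ν) (basisL j) f] with k hk
  rw [mom, emb, hk]
  refine integral_congr_ae ?_
  filter_upwards [basisL_coe j] with v hv
  rw [hv, conj_ofReal]

variable (ν) in
/-- The projection onto the collision invariants in the second variable. -/
def projOp : KinL2 ν →L[ℂ] KinL2 ν :=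
  ∑ j, (emb ν j).comp (mom ν j)

lemma sum_coeFn {α : Type*} [MeasurableSpace α] {μ : Measure α} {ι : Type*} (s : Finset ι)
    (f : ι → Lp ℂ 2 μ) : (∑ i ∈ s, f i : Lp ℂ 2 μ) =ᵐ[μ] fun x => ∑ i ∈ s, f i x := by
  classical
  induction s using Finset.induction_on with
  | empty =>
    rw [Finset.sum_empty]
    filter_upwards [Lp.coeFn_zero ℂ 2 μ] with x hx
    rw [hx]; rfl
  | insert i s hi ih =>
    rw [Finset.sum_insert hi]
    filter_upwards [Lp.coeFn_add (f i) (∑ i ∈ s, f i), ih] with x h1 h2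
    rw [h1, Pi.add_apply, h2, Finset.sum_insert hi]

lemma sum_emb_coe (u : Fin 5 → Lp ℂ 2 ν) : (∑ j, emb ν j (u j) : KinL2 ν)
    =ᵐ[ν.prod maxwellian] fun p => ∑ j, u j p.1 * (basis5 j p.2 : ℂ) := by
  filter_upwards [sum_coeFn Finset.univ fun j => emb ν j (u j),
    ae_all_iff.2 fun j => emb_coe j (u j)] with p h1 h2
  rw [h1]
  exact sum_congr rfl fun j _ => h2 j

lemma projOp_coe (f : KinL2 ν) :
    projOp ν f =ᵐ[ν.prod maxwellian] fun p => ∑ j, mom ν j f p.1 * (basis5 j p.2 : ℂ) := by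
  have : projOp ν f = ∑ j, emb ν j (mom ν j f) := by simp [projOp]
  rw [this]
  exact sum_emb_coe _

lemma mom_mulOp_emb {s : K × E3 → ℂ} (hs : BddMeas s) (l i : Fin 5) (u : Lp ℂ 2 ν) :
    mom ν l (mulOp _ s (emb ν i u)) =ᵐ[ν] fun k => mulMatrix (fun v => s (k, v)) l i * u k := by
  have h1 : mulOp _ s (emb ν i u) =ᵐ[ν.prod maxwellian]
      fun p => s p * (u p.1 * (basis5 i p.2 : ℂ)) := by
    filter_upwards [mulOp_coe hs (emb ν i u), emb_coe i u] with p h1 h2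
    rw [h1, h2]
  filter_upwards [mom_coe l (mulOp _ s (emb ν i u)), Measure.ae_ae_of_ae_prod h1] with k hk h2
  rw [hk, mulMatrix, ← integral_mul_const]
  refine integral_congr_ae ?_
  filter_upwards [h2] with v hv
  rw [hv]
  ring

/-- The relation `g = -a f + w ℙ₅ f`. -/
def KinRel (a : K × E3 → ℂ) (w : K → ℂ) (f g : KinL2 ν) : Prop :=
  g =ᵐ[ν.prod maxwellian] fun p => -a p * f p + w p.1 * projOp ν f p

lemma KinRel.add {a : K × E3 → ℂ} {w : K → ℂ} {f g f' g' : KinL2 ν}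
    (h : KinRel a w f g) (h' : KinRel a w f' g') : KinRel a w (f + f') (g + g') := by
  unfold KinRel at *
  rw [map_add]
  filter_upwards [h, h', Lp.coeFn_add f f', Lp.coeFn_add g g',
    Lp.coeFn_add (projOp ν f) (projOp ν f')] with p h1 h2 h3 h4 h5
  rw [h3, h4, h5]
  simp only [Pi.add_apply, h1, h2]
  ring

lemma KinRel.smul {a : K × E3 → ℂ} {w : K → ℂ} {f g : KinL2 ν} (c : ℂ)
    (h : KinRel a w f g) : KinRel a w (c • f) (c • g) := by
  unfold KinRel at *
  rw [map_smul]
  filter_upwards [h, Lp.coeFn_smul c f, Lp.coeFn_smul c g, Lp.coeFn_smul c (projOp ν f)]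
    with p h1 h3 h4 h5
  rw [h3, h4, h5]
  simp only [Pi.smul_apply, h1, smul_eq_mul]
  ring

lemma KinRel.zero (a : K × E3 → ℂ) (w : K → ℂ) :
    KinRel a w (0 : KinL2 ν) 0 := by
  unfold KinRel
  rw [map_zero]
  filter_upwards [Lp.coeFn_zero ℂ 2 (ν.prod maxwellian)] with p h1
  rw [h1]
  simp

lemma KinRel.sub {a : K × E3 → ℂ} {w : K → ℂ} {f g f' g' : KinL2 ν}
    (h : KinRel a w f g) (h' : KinRel a w f' g') : KinRel a w (f - f') (g - g') := by
  have := h.add (h'.smul (-1))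
  simpa [sub_eq_add_neg] using this

/-- The matrix `∫ e_i e_j / a(k, ·) dμ`. -/
def symMat (a : K × E3 → ℂ) (k : K) : Matrix (Fin 5) (Fin 5) ℂ := mulMatrix fun v => (a (k, v))⁻¹

lemma bddMeas_inv {a : K × E3 → ℂ} (ha : Measurable a) {δ : ℝ} (hδ : 0 < δ)
    (hb : ∀ p, δ ≤ ‖a p‖) : BddMeas fun p => (a p)⁻¹ :=
  ⟨ha.inv, δ⁻¹, fun p => by rw [norm_inv]; exact inv_anti₀ hδ (hb p)⟩

/-- If `1 - w B` has a bounded inverse, so has the kinetic relation. -/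
theorem exists_kin_resolvent {a : K × E3 → ℂ} {w : K → ℂ} (ha : Measurable a) {δ : ℝ} (hδ : 0 < δ)
    (hb : ∀ p, δ ≤ ‖a p‖) (hw : BddMeas w) (G : K → Matrix (Fin 5) (Fin 5) ℂ)
    (hG : ∀ i j, BddMeas fun k => G k i j) (hG1 : ∀ k, (1 - w k • symMat a k) * G k = 1) :
    ∃ R : KinL2 ν →L[ℂ] KinL2 ν,
      ∀ h, KinRel a w (R h) h ∧ ∀ f, KinRel a w f h → R h = f := by
  have ha0 : ∀ p, a p ≠ 0 := fun p h0 => by have := hb p; rw [h0, norm_zero] at this; linarith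
  have hS := bddMeas_inv ha hδ hb
  have hG2 : ∀ k, G k * (1 - w k • symMat a k) = 1 := fun k => mul_eq_one_comm.1 (hG1 k)
  set S : KinL2 ν →L[ℂ] KinL2 ν :=
    mulOp _ fun p => (a p)⁻¹ with hSdef
  have hwG : ∀ i j, BddMeas fun k => w k * G k i j := fun i j => hw.mul (hG i j)
  have uniq : ∀ f, KinRel a w f (0 : KinL2 ν) → f = 0 := by
    intro f hf
    have e1 : f = S (∑ i, emb ν i (mulOp ν w (mom ν i f))) := by
      apply Lp.ext
      filter_upwards [hf, Lp.coeFn_zero ℂ 2 (ν.prod maxwellian), projOp_coe f,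
        mulOp_coe hS (∑ i, emb ν i (mulOp ν w (mom ν i f))),
        sum_emb_coe fun i => mulOp ν w (mom ν i f),
        ae_fst (μ := maxwellian) (ae_all_iff.2 fun i => mulOp_coe hw (mom ν i f))]
        with p h1 h2 h3 h4 h5 h6
      rw [h2, h3] at h1
      rw [h4, h5, eq_inv_mul_iff_mul_eq₀ (ha0 p)]
      simp only [h6]
      simp only [Pi.zero_apply] at h1
      rw [mul_sum] at h1
      simp_rw [← mul_assoc] at h1
      linear_combination h1
    have e2 : ∀ᵐ k ∂ν, ∀ l, mom ν l f k = ∑ i, symMat a k l i * (w k * mom ν i f k) := by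
      rw [ae_all_iff]
      intro l
      have e3 : mom ν l f = ∑ i, mom ν l (S (emb ν i (mulOp ν w (mom ν i f)))) := by
        conv_lhs => rw [e1]
        rw [map_sum, map_sum]
      rw [e3]
      filter_upwards [sum_coeFn Finset.univ fun i => mom ν l (S (emb ν i (mulOp ν w (mom ν i f)))),
        ae_all_iff.2 fun i => mom_mulOp_emb hS l i (mulOp ν w (mom ν i f)),
        ae_all_iff.2 fun i => mulOp_coe hw (mom ν i f)] with k h1 h2 h3
      rw [h1]
      refine sum_congr rfl fun i _ => ?_
      rw [h2 i, h3 i]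
      rfl
    have e4 : ∀ᵐ k ∂ν, ∀ l, mom ν l f k = 0 := by
      filter_upwards [e2] with k hk
      set d : Fin 5 → ℂ := fun l => mom ν l f k with hd
      have : (1 - w k • symMat a k).mulVec d = 0 := by
        rw [Matrix.sub_mulVec, Matrix.one_mulVec, Matrix.smul_mulVec, sub_eq_zero]
        funext l
        change mom ν l f k = _
        rw [hk l, Pi.smul_apply, Matrix.mulVec, dotProduct, smul_eq_mul, mul_sum]
        exact sum_congr rfl fun i _ => by rw [hd]; ring
      have h0 : d = 0 := by
        rw [← Matrix.one_mulVec d, ← hG2 k, ← Matrix.mulVec_mulVec, this, Matrix.mulVec_zero]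
      exact fun l => congrFun h0 l
    apply Lp.ext
    filter_upwards [hf, Lp.coeFn_zero ℂ 2 (ν.prod maxwellian), projOp_coe f,
      ae_fst (μ := maxwellian) e4] with p h1 h2 h3 h4
    rw [h2] at h1 ⊢
    rw [h3] at h1
    simp only [h4, zero_mul, Finset.sum_const_zero, mul_zero, add_zero, Pi.zero_apply] at h1
    have := mul_eq_zero.1 h1.symm
    exact this.resolve_left (neg_ne_zero.2 (ha0 p))
  set R : KinL2 ν →L[ℂ] KinL2 ν :=
    -S - ∑ i, ∑ j, S.comp ((emb ν i).comp ((mulOp ν fun k => w k * G k i j).comp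
      ((mom ν j).comp S))) with hR
  have hRe : ∀ h, R h = -S h - S (∑ i, emb ν i (∑ j, mulOp ν (fun k => w k * G k i j)
      (mom ν j (S h)))) := by
    intro h
    simp [hR, map_sum]
  have sol : ∀ h, KinRel a w (R h) h := by
    intro h
    set c : Fin 5 → Lp ℂ 2 ν := fun i => ∑ j, mulOp ν (fun k => w k * G k i j) (mom ν j (S h))
      with hc
    have hcv : ∀ᵐ k ∂ν, ∀ i, c i k = ∑ j, w k * G k i j * mom ν j (S h) k := by
      rw [ae_all_iff]
      intro i
      filter_upwards [sum_coeFn Finset.univ fun j => mulOp ν (fun k => w k * G k i j)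
        (mom ν j (S h)), ae_all_iff.2 fun j => mulOp_coe (hwG i j) (mom ν j (S h))] with k h1 h2
      rw [hc]
      simp only
      rw [h1]
      exact sum_congr rfl fun j _ => h2 j
    have hm : ∀ᵐ k ∂ν, ∀ l, mom ν l (R h) k = -∑ j, G k l j * mom ν j (S h) k := by
      have hm1 : ∀ᵐ k ∂ν, ∀ l, mom ν l (R h) k =
          -mom ν l (S h) k - ∑ i, symMat a k l i * c i k := by
        rw [ae_all_iff]
        intro l
        have e : mom ν l (R h) = -mom ν l (S h) - ∑ i, mom ν l (S (emb ν i (c i))) := by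
          rw [hRe, map_sub, map_neg, map_sum, map_sum]
        rw [e]
        filter_upwards [Lp.coeFn_sub (-mom ν l (S h)) (∑ i, mom ν l (S (emb ν i (c i)))),
          Lp.coeFn_neg (mom ν l (S h)), sum_coeFn Finset.univ fun i => mom ν l (S (emb ν i (c i))),
          ae_all_iff.2 fun i => mom_mulOp_emb hS l i (c i)] with k h1 h2 h3 h4
        rw [h1, Pi.sub_apply, h2, Pi.neg_apply, h3]
        congr 1
        exact sum_congr rfl fun i _ => h4 i
      filter_upwards [hm1, hcv] with k h1 h2 l
      rw [h1 l]
      set b : Fin 5 → ℂ := fun j => mom ν j (S h) k with hb'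
      have e5 : (1 - w k • symMat a k).mulVec ((G k).mulVec b) = b := by
        rw [Matrix.mulVec_mulVec, hG1, Matrix.one_mulVec]
      rw [Matrix.sub_mulVec, Matrix.one_mulVec, Matrix.smul_mulVec] at e5
      have e6 := congrFun e5 l
      simp only [Pi.sub_apply, Pi.smul_apply, Matrix.mulVec, dotProduct, smul_eq_mul] at e6
      have e7 : ∑ i, symMat a k l i * c i k = w k * ∑ i, symMat a k l i * ∑ j, G k i j * b j := by
        rw [mul_sum]
        refine sum_congr rfl fun i _ => ?_
        rw [h2 i]
        simp_rw [mul_assoc]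
        rw [← mul_sum, mul_left_comm]
      rw [e7]
      change -b l - _ = -∑ j, G k l j * b j
      linear_combination e6
    unfold KinRel
    have hRv : R h =ᵐ[ν.prod maxwellian] fun p =>
        -((a p)⁻¹ * h p) - (a p)⁻¹ * ∑ i, c i p.1 * (basis5 i p.2 : ℂ) := by
      rw [hRe]
      filter_upwards [Lp.coeFn_sub (-S h) (S (∑ i, emb ν i (c i))), Lp.coeFn_neg (S h),
        mulOp_coe hS h, mulOp_coe hS (∑ i, emb ν i (c i)), sum_emb_coe c] with p h1 h2 h3 h4 h5
      rw [h1, Pi.sub_apply, h2, Pi.neg_apply, h3, h4, h5]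
    filter_upwards [hRv, projOp_coe (R h), ae_fst (μ := maxwellian) hm,
      ae_fst (μ := maxwellian) hcv] with p h1 h2 h3 h4
    rw [h1, h2]
    simp only [h3, h4]
    have hap := ha0 p
    have e8 : w p.1 * ∑ j, -(∑ l, G p.1 j l * mom ν l (S h) p.1) * (basis5 j p.2 : ℂ) =
        -∑ i, (∑ j, w p.1 * G p.1 i j * mom ν j (S h) p.1) * (basis5 i p.2 : ℂ) := by
      rw [mul_sum, ← Finset.sum_neg_distrib]
      refine sum_congr rfl fun i _ => ?_
      simp_rw [mul_assoc, ← mul_sum]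
      ring
    rw [e8]
    field_simp
    ring
  refine ⟨R, fun h => ⟨sol h, fun f hf => ?_⟩⟩
  have := (sol h).sub hf
  rw [sub_self] at this
  exact sub_eq_zero.1 (uniq _ this)

end Kinetic

section Kinetic

lemma one_sub_smul_mulVec (B : Matrix (Fin 5) (Fin 5) ℂ) (w : ℂ) (c : Fin 5 → ℂ) (l : Fin 5) :
    ((1 - w • B).mulVec c) l = c l - w * ∑ i, B l i * c i := by
  rw [Matrix.sub_mulVec, Matrix.one_mulVec, Matrix.smul_mulVec]
  rfl

variable {K : Type*} [MeasurableSpace K] {ν : Measure K} [SigmaFinite ν]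

lemma norm_basisL (j : Fin 5) : ‖basisL j‖ = 1 := by
  have h : ⟪basisL j, basisL j⟫_ℂ = 1 := by
    rw [inner_Lp_eq, ← (basis5_orthonormal j j).trans (if_pos rfl)]
    refine integral_congr_ae ?_
    filter_upwards [basisL_coe j] with v hv
    rw [hv, conj_ofReal]
  rw [inner_self_eq_norm_sq_to_K] at h
  have h2 : ‖basisL j‖ ^ 2 = 1 := by
    have h3 : ((‖basisL j‖ ^ 2 : ℝ) : ℂ) = 1 := by rw [← h]; norm_cast
    exact_mod_cast h3
  exact (pow_eq_one_iff_of_nonneg (norm_nonneg _) (by norm_num)).1 h2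

lemma norm_emb (j : Fin 5) (u : Lp ℂ 2 ν) : ‖emb ν j u‖ = ‖u‖ := by
  rw [emb, tensL_apply, norm_tens, norm_basisL, mul_one]

lemma norm_mom_le (j : Fin 5) (f : KinL2 ν) : ‖mom ν j f‖ ≤ ‖f‖ := by
  have h1 : ‖mom ν j‖ ≤ 1 := by
    rw [mom, LinearIsometryEquiv.norm_map]
    exact ContinuousLinearMap.opNorm_le_bound _ zero_le_one fun u => by rw [norm_emb, one_mul]
  simpa using (mom ν j).le_of_opNorm_le h1 f

lemma norm_mulOp_le {α : Type*} [MeasurableSpace α] {μ : Measure α} {φ : α → ℂ} (hφ : BddMeas φ)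
    {C : ℝ} {f : Lp ℂ 2 μ} (h : ∀ᵐ x ∂μ, ‖φ x * f x‖ ≤ C * ‖f x‖) : ‖mulOp μ φ f‖ ≤ C * ‖f‖ := by
  refine Lp.norm_le_mul_norm_of_ae_le_mul ?_
  filter_upwards [mulOp_coe hφ f, h] with x h1 h2
  rw [h1]; exact h2

/-- The indicator of a set of finite measure. -/
def indL (s : Set K) (hs : MeasurableSet s) (hs' : ν s ≠ ⊤) : Lp ℂ 2 ν :=
  indicatorConstLp 2 hs hs' (1 : ℂ)

omit [SigmaFinite ν] in
lemma indL_coe {s : Set K} (hs : MeasurableSet s) (hs' : ν s ≠ ⊤) :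
    indL s hs hs' =ᵐ[ν] s.indicator fun _ => (1 : ℂ) := indicatorConstLp_coeFn

omit [SigmaFinite ν] in
lemma norm_indL_pos {s : Set K} (hs : MeasurableSet s) (hs' : ν s ≠ ⊤) (h0 : ν s ≠ 0) :
    0 < ‖indL s hs hs'‖ := by
  rw [indL, norm_indicatorConstLp (by norm_num) (by norm_num)]
  have : 0 < (ν s).toReal := ENNReal.toReal_pos h0 hs'
  rw [Measure.real, norm_one, one_mul]
  exact Real.rpow_pos_of_pos this _

/-- Approximate solutions near a zero of `det (1 - w B)`. -/
lemma exists_approx_mode {a : K × E3 → ℂ} (ha : Measurable a) {δ : ℝ} (hδ : 0 < δ)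
    (hb : ∀ p, δ ≤ ‖a p‖) (hB : ∀ l i, Measurable fun k => symMat a k l i) (w : ℂ) (c : Fin 5 → ℂ)
    {s : Set K} (hs : MeasurableSet s) (hs' : ν s ≠ ⊤) {ε : ℝ} (hε : 0 ≤ ε)
    (h : ∀ k ∈ s, ∀ l, ‖((1 - w • symMat a k).mulVec c) l‖ ≤ ε) :
    ∃ f g : KinL2 ν, KinRel a (fun _ => w) f g ∧
      ‖g‖ ≤ 5 * ‖w‖ * ε * ‖indL s hs hs'‖ ∧ ∀ l, (‖c l‖ - ε) * ‖indL s hs hs'‖ ≤ ‖f‖ := by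
  have ha0 : ∀ p, a p ≠ 0 := fun p h0 => by have := hb p; rw [h0, norm_zero] at this; linarith
  have hS := bddMeas_inv ha hδ hb
  set u : Lp ℂ 2 ν := indL s hs hs' with hu
  set r : Fin 5 → K → ℂ := fun l => s.indicator fun k => ((1 - w • symMat a k).mulVec c) l with hr
  have hrb : ∀ l k, ‖r l k‖ ≤ ε := by
    intro l k
    by_cases hk : k ∈ s
    · simpa [hr, hk] using h k hk l
    · simpa [hr, hk] using hε
  have hrm : ∀ l, BddMeas (r l) := by
    intro l
    refine ⟨Measurable.indicator ?_ hs, ε, hrb l⟩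
    simp only [one_sub_smul_mulVec]
    exact measurable_const.sub (measurable_const.mul (Finset.measurable_sum _ fun i _ =>
      (hB l i).mul_const _))
  set f : KinL2 ν :=
    w • mulOp _ (fun p => (a p)⁻¹) (∑ i, emb ν i (c i • u)) with hf
  set g : KinL2 ν := -(w • ∑ l, emb ν l (mulOp ν (r l) u)) with hg
  have hfv : f =ᵐ[ν.prod maxwellian]
      fun p => w * ((a p)⁻¹ * ∑ i, c i * u p.1 * (basis5 i p.2 : ℂ)) := by
    filter_upwards [Lp.coeFn_smul w (mulOp _ (fun p => (a p)⁻¹) (∑ i, emb ν i (c i • u))),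
      mulOp_coe hS (∑ i, emb ν i (c i • u)), sum_emb_coe fun i => c i • u,
      ae_fst (μ := maxwellian) (ae_all_iff.2 fun i => Lp.coeFn_smul (c i) u)] with p h1 h2 h3 h4
    rw [hf, h1, Pi.smul_apply, h2, h3, smul_eq_mul]
    simp [h4]
  have hmom : ∀ᵐ k ∂ν, ∀ l, mom ν l f k = c l * u k - r l k * u k := by
    rw [ae_all_iff]
    intro l
    have e : mom ν l f = w • ∑ i, mom ν l (mulOp _ (fun p => (a p)⁻¹) (emb ν i (c i • u))) := by
      rw [hf, map_smul, map_sum, map_sum]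
    rw [e]
    filter_upwards [Lp.coeFn_smul w (∑ i, mom ν l (mulOp _ (fun p => (a p)⁻¹) (emb ν i (c i • u)))),
      sum_coeFn Finset.univ fun i => mom ν l (mulOp _ (fun p => (a p)⁻¹) (emb ν i (c i • u))),
      ae_all_iff.2 fun i => mom_mulOp_emb hS l i (c i • u), indL_coe hs hs',
      ae_all_iff.2 fun i => Lp.coeFn_smul (c i) u] with k h1 h2 h3 h4 h5
    rw [h1, Pi.smul_apply, h2, smul_eq_mul]
    simp only [h3, h5, Pi.smul_apply, smul_eq_mul]
    rw [← hu] at h4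
    rw [h4]
    by_cases hk : k ∈ s
    · simp only [hr, indicator_of_mem hk, one_sub_smul_mulVec, mul_one]
      rw [sub_sub_cancel]
      rfl
    · simp [hk]
  refine ⟨f, g, ?_, ?_, fun l => ?_⟩
  · unfold KinRel
    filter_upwards [hfv, projOp_coe f, ae_fst (μ := maxwellian) hmom,
      Lp.coeFn_neg (w • ∑ l, emb ν l (mulOp ν (r l) u)),
      Lp.coeFn_smul w (∑ l, emb ν l (mulOp ν (r l) u)), sum_emb_coe fun l => mulOp ν (r l) u,
      ae_fst (μ := maxwellian) (ae_all_iff.2 fun l => mulOp_coe (hrm l) u)] with p h1 h2 h3 h4 h5 h6 h7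
    rw [hg, h4, Pi.neg_apply, h5, Pi.smul_apply, h6, h1, h2, smul_eq_mul]
    simp only [h3, h7]
    have hap := ha0 p
    simp_rw [sub_mul, Finset.sum_sub_distrib]
    field_simp
    simp_rw [mul_comm (u p.1)]
    ring
  · rw [hg, norm_neg, norm_smul]
    have h1 : ‖∑ l, emb ν l (mulOp ν (r l) u)‖ ≤ ∑ l : Fin 5, ε * ‖u‖ := by
      refine norm_sum_le_of_le _ fun l _ => ?_
      rw [norm_emb]
      refine norm_mulOp_le (hrm l) (.of_forall fun k => ?_)
      rw [norm_mul]
      exact mul_le_mul_of_nonneg_right (hrb l k) (norm_nonneg _)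
    rw [Finset.sum_const, Finset.card_univ, Fintype.card_fin, nsmul_eq_mul] at h1
    calc ‖w‖ * _ ≤ ‖w‖ * ((5 : ℕ) * (ε * ‖u‖)) := by gcongr
      _ = _ := by push_cast; ring
  · refine le_trans ?_ (norm_mom_le l f)
    have e : mom ν l f = c l • u - mulOp ν (r l) u := by
      apply Lp.ext
      filter_upwards [hmom, Lp.coeFn_sub (c l • u) (mulOp ν (r l) u), Lp.coeFn_smul (c l) u,
        mulOp_coe (hrm l) u] with k h1 h2 h3 h4
      rw [h1 l, h2, Pi.sub_apply, h3, h4, Pi.smul_apply, smul_eq_mul]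
    rw [e]
    have h1 : ‖mulOp ν (r l) u‖ ≤ ε * ‖u‖ := by
      refine norm_mulOp_le (hrm l) (.of_forall fun k => ?_)
      rw [norm_mul]
      exact mul_le_mul_of_nonneg_right (hrb l k) (norm_nonneg _)
    have h2 := norm_sub_norm_le (c l • u) (mulOp ν (r l) u)
    rw [norm_smul] at h2
    linarith

/-- Approximate solutions near a zero of the symbol. -/
lemma exists_approx_line {a : K × E3 → ℂ} (ha : Measurable a) (w : K → ℂ) {s : Set K}
    (hs : MeasurableSet s) (hs' : ν s ≠ ⊤) {V₀ : Set E3} {g : VelocityL2}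
    (hg : ∀ j, ⟪basisL j, g⟫_ℂ = 0) (hgs : ∀ᵐ v ∂maxwellian, v ∉ V₀ → g v = 0) {ε : ℝ} (hε : 0 ≤ ε)
    (h : ∀ k ∈ s, ∀ v ∈ V₀, ‖a (k, v)‖ ≤ ε) :
    ∃ y : KinL2 ν, KinRel a w (tens (indL s hs hs') g) y ∧
      ‖y‖ ≤ ε * ‖tens (indL s hs hs') g‖ := by
  set f := tens (indL s hs hs') g with hf
  have hset : MeasurableSet {p | ‖a p‖ ≤ ε} := measurableSet_le ha.norm measurable_const
  set φ : K × E3 → ℂ := {p | ‖a p‖ ≤ ε}.indicator fun p => -a p with hφ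
  have hφb : ∀ p, ‖φ p‖ ≤ ε := by
    intro p
    by_cases hp : ‖a p‖ ≤ ε
    · rw [hφ, indicator_of_mem (by exact hp), norm_neg]; exact hp
    · rw [hφ, indicator_of_notMem (by exact hp), norm_zero]; exact hε
  have hφm : BddMeas φ := ⟨ha.neg.indicator hset, ε, hφb⟩
  have hP : projOp ν f = 0 := by
    have : ∀ j, mom ν j f = 0 := by
      intro j
      refine ext_inner_left ℂ fun x => ?_
      rw [mom, adjoint_inner_right, emb, tensL_apply, hf, inner_tens, hg,
        mul_zero, inner_zero_right]
    simp [projOp, this]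
  refine ⟨mulOp _ φ f, ?_, norm_mulOp_le hφm (.of_forall fun p => ?_)⟩
  · unfold KinRel
    rw [hP]
    filter_upwards [mulOp_coe hφm f, Lp.coeFn_zero ℂ 2 (ν.prod maxwellian),
      tens_coe (indL s hs hs') g, ae_fst (μ := maxwellian) (indL_coe hs hs'),
      ae_snd (ν := ν) hgs] with p h1 h2 h3 h4 h5
    rw [h1, h2, Pi.zero_apply, mul_zero, add_zero, hf, h3, h4]
    by_cases hp1 : p.1 ∈ s
    · by_cases hp2 : p.2 ∈ V₀
      · rw [hφ, indicator_of_mem (show p ∈ {p | ‖a p‖ ≤ ε} from h p.1 hp1 p.2 hp2)]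
      · rw [h5 hp2]; simp
    · simp [hp1]
  · rw [norm_mul]
    exact mul_le_mul_of_nonneg_right (hφb p) (norm_nonneg _)

/-! ### Kernel and range -/

/-- The kernel of the kinetic relation. -/
def relKer (ν : Measure K) [SigmaFinite ν] (a : K × E3 → ℂ) (w : K → ℂ) :
    Submodule ℂ (KinL2 ν) where
  carrier := {f | KinRel a w f 0}
  zero_mem' := KinRel.zero a w
  add_mem' h h' := by simpa using KinRel.add h h'
  smul_mem' c f h := by simpa using KinRel.smul c h

/-- The range of the kinetic relation. -/
def relRange (ν : Measure K) [SigmaFinite ν] (a : K × E3 → ℂ) (w : K → ℂ) :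
    Submodule ℂ (KinL2 ν) where
  carrier := {g | ∃ f, KinRel a w f g}
  zero_mem' := ⟨0, KinRel.zero a w⟩
  add_mem' := fun ⟨f, h⟩ ⟨f', h'⟩ => ⟨f + f', h.add h'⟩
  smul_mem' c _ := fun ⟨f, h⟩ => ⟨c • f, h.smul c⟩

/-- The graph of the kinetic relation. -/
def relGraph (ν : Measure K) [SigmaFinite ν] (a : K × E3 → ℂ) (w : K → ℂ) :
    Submodule ℂ (KinL2 ν × KinL2 ν) where
  carrier := {p | KinRel a w p.1 p.2}
  zero_mem' := KinRel.zero a w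
  add_mem' h h' := KinRel.add h h'
  smul_mem' c _ h := KinRel.smul c h

lemma isClosed_relGraph {a : K × E3 → ℂ} (ha : Measurable a) {w : K → ℂ} (hw : BddMeas w) :
    IsClosed (relGraph ν a w : Set (KinL2 ν × KinL2 ν)) := by
  set b : K × E3 → ℂ := fun p => ((1 + ‖a p‖)⁻¹ : ℝ) with hb
  have hpos : ∀ p, 0 < 1 + ‖a p‖ := fun p => by positivity
  have hbm : BddMeas b := ⟨by fun_prop, 1, fun p => by
    rw [hb, norm_real, norm_of_nonneg (by have := hpos p; positivity)]
    exact inv_le_one_of_one_le₀ (by linarith [norm_nonneg (a p)])⟩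
  have hab : BddMeas fun p => a p * b p := ⟨by fun_prop, 1, fun p => by
    rw [hb, norm_mul, norm_real, norm_of_nonneg (by have := hpos p; positivity),
      ← div_eq_mul_inv, div_le_one (hpos p)]
    linarith⟩
  have hwb : BddMeas fun p : K × E3 => w p.1 * b p := (hw.comp measurable_fst).mul hbm
  have hb0 : ∀ p, b p ≠ 0 := fun p => by
    rw [hb]; simp only [ne_eq, ofReal_eq_zero]; exact (inv_pos.2 (hpos p)).ne'
  set L : KinL2 ν × KinL2 ν →L[ℂ] KinL2 ν :=
    (mulOp _ b).comp (ContinuousLinearMap.snd ℂ _ _) +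
    (mulOp _ fun p => a p * b p).comp (ContinuousLinearMap.fst ℂ _ _) -
    ((mulOp _ fun p => w p.1 * b p).comp (projOp ν)).comp (ContinuousLinearMap.fst ℂ _ _) with hL
  have : (relGraph ν a w : Set (KinL2 ν × KinL2 ν)) =
      L ⁻¹' {0} := by
    ext ⟨f, g⟩
    rw [Set.mem_preimage, Set.mem_singleton_iff]
    change KinRel a w f g ↔ mulOp _ b g + mulOp _ (fun p => a p * b p) f -
      mulOp _ (fun p => w p.1 * b p) (projOp ν f) = 0
    rw [sub_eq_zero]
    have hae : (∀ᵐ p ∂(ν.prod maxwellian), g p = -a p * f p + w p.1 * projOp ν f p) ↔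
        ∀ᵐ p ∂(ν.prod maxwellian), (mulOp _ b g + mulOp _ (fun p => a p * b p) f) p =
          mulOp _ (fun p => w p.1 * b p) (projOp ν f) p := by
      refine Filter.eventually_congr ?_
      filter_upwards [Lp.coeFn_add (mulOp _ b g) (mulOp _ (fun p => a p * b p) f), mulOp_coe hbm g,
        mulOp_coe hab f, mulOp_coe hwb (projOp ν f)] with p h1 h2 h3 h4
      rw [h1, Pi.add_apply, h2, h3, h4, ← mul_right_inj' (hb0 p)]
      constructor <;> intro h <;> linear_combination h
    exact hae.trans Lp.ext_iff.symm
  rw [this]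
  exact isClosed_singleton.preimage L.continuous

/-- The range is not closed if there are approximate solutions away from the kernel. -/
lemma not_isClosed_relRange {a : K × E3 → ℂ} (ha : Measurable a) {w : K → ℂ} (hw : BddMeas w)
    (M : KinL2 ν →L[ℂ] KinL2 ν) (hM : ∀ f, ‖M f‖ ≤ ‖f‖)
    (hker : ∀ f, KinRel a w f (0 : KinL2 ν) → M f = 0)
    (happ : ∀ ε > 0, ∃ f g : KinL2 ν,
      f ≠ 0 ∧ M f = f ∧ KinRel a w f g ∧ ‖g‖ ≤ ε * ‖f‖) :
    ¬ IsClosed (relRange ν a w : Set (KinL2 ν)) := by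
  intro hcl
  have : CompleteSpace (relRange ν a w) := hcl.completeSpace_coe
  have : CompleteSpace (relGraph ν a w) := (isClosed_relGraph ha hw).completeSpace_coe
  set L : relGraph ν a w →L[ℂ] relRange ν a w :=
    ((ContinuousLinearMap.snd ℂ _ _).comp (relGraph ν a w).subtypeL).codRestrict _
      (fun p => ⟨p.1.1, p.2⟩) with hL
  have hsurj : Function.Surjective L := by
    rintro ⟨g, f, h⟩
    exact ⟨⟨(f, g), h⟩, rfl⟩
  obtain ⟨C, hC, h⟩ := L.exists_preimage_norm_le hsurj
  obtain ⟨f, g, hf0, hMf, hfg, hε⟩ := happ (1 / (2 * C)) (by positivity)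
  obtain ⟨⟨⟨f', g'⟩, hp⟩, hx1, hx2⟩ := h ⟨g, f, hfg⟩
  have hg' : g' = g := congrArg Subtype.val hx1
  subst hg'
  have hf' : ‖f'‖ ≤ C * ‖g'‖ := le_trans (le_max_left _ _) hx2
  have hk := hker (f - f') (by
    have := hfg.sub (show KinRel a w f' g' from hp)
    rwa [sub_self] at this)
  rw [map_sub, hMf, sub_eq_zero] at hk
  have h1 : ‖f‖ ≤ ‖f'‖ := by rw [hk]; exact hM f'
  have h2 : C * ‖g'‖ ≤ ‖f‖ / 2 := by
    calc C * ‖g'‖ ≤ C * (1 / (2 * C) * ‖f‖) := by gcongr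
      _ = _ := by field_simp
  have h3 := norm_pos_iff.2 hf0
  linarith

/-- If the symbol is purely imaginary, the kernel vanishes where the symbol does not. -/
lemma relKer_ae_zero {a : K × E3 → ℂ} (hre : ∀ p, (a p).re = 0) {w : ℝ} (hw : 0 < w)
    {f : KinL2 ν} (hf : KinRel a (fun _ => (w : ℂ)) f 0) :
    ∀ᵐ p ∂(ν.prod maxwellian), a p * f p = 0 := by
  have h1 : ∀ᵐ p ∂(ν.prod maxwellian), a p * f p = w * projOp ν f p := by
    filter_upwards [hf, Lp.coeFn_zero ℂ 2 (ν.prod maxwellian)] with p h1 h2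
    rw [h2, Pi.zero_apply] at h1
    linear_combination h1
  have hP : projOp ν f = 0 := by
    have e1 : ⟪f, projOp ν f⟫_ℂ = ∑ j, (‖mom ν j f‖ ^ 2 : ℝ) := by
      simp only [projOp, sum_apply, ContinuousLinearMap.comp_apply, inner_sum,
        ofReal_sum]
      refine sum_congr rfl fun j _ => ?_
      rw [← adjoint_inner_left, ← mom, inner_self_eq_norm_sq_to_K]
      norm_cast
    have e2 : (w * ⟪f, projOp ν f⟫_ℂ).re = 0 := by
      rw [inner_Lp_eq, ← integral_const_mul]
      have hint := (integrable_conj_mul f (projOp ν f)).const_mul (w : ℂ)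
      have := integral_re hint
      simp only [RCLike.re_eq_complex_re] at this
      rw [← this]
      refine integral_eq_zero_of_ae ?_
      filter_upwards [h1] with p hp
      have e : (w : ℂ) * (conj (f p) * projOp ν f p) = a p * (normSq (f p) : ℂ) := by
        rw [normSq_eq_conj_mul_self]; linear_combination -conj (f p) * hp
      rw [e, re_mul_ofReal, hre, zero_mul, Pi.zero_apply]
    rw [e1, re_ofReal_mul, ofReal_re] at e2
    have e3 := (mul_eq_zero.1 e2).resolve_left hw.ne'
    rw [Finset.sum_eq_zero_iff_of_nonneg fun _ _ => by positivity] at e3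
    have e4 : ∀ j, mom ν j f = 0 := fun j => by
      have := e3 j (Finset.mem_univ j)
      simpa using this
    simp [projOp, e4]
  filter_upwards [h1, Lp.coeFn_zero ℂ 2 (ν.prod maxwellian)] with p hp h0
  rw [hp, hP, h0, Pi.zero_apply, mul_zero]

/-! ### Finite rank perturbations -/

lemma fredholm_of_ker_le {H : Type*} [NormedAddCommGroup H] [NormedSpace ℂ H] (L : H →L[ℂ] H)
    (hL : FiniteDimensional ℂ (LinearMap.range L.toLinearMap)) {S : Submodule ℂ H}
    (h : LinearMap.ker L.toLinearMap ≤ S) : IsClosed (S : Set H) ∧ FiniteDimensional ℂ (H ⧸ S) := by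
  constructor
  · have hfd : FiniteDimensional ℂ (S.map L.toLinearMap) :=
      Submodule.finiteDimensional_of_le (LinearMap.map_le_range)
    have hc := Submodule.closed_of_finiteDimensional (S.map L.toLinearMap)
    rw [← Submodule.comap_map_eq_self h]
    exact hc.preimage L.continuous
  · have : FiniteDimensional ℂ (H ⧸ LinearMap.ker L.toLinearMap) :=
      L.toLinearMap.quotKerEquivRange.symm.finiteDimensional
    exact Module.Finite.of_surjective _ (Submodule.factor_surjective h)

lemma kinRel_add_iff (a : K × E3 → ℂ) (w₁ : K → ℂ) {w₂ : K → ℂ} (hw : BddMeas w₂)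
    (f g : KinL2 ν) :
    KinRel a (fun k => w₁ k + w₂ k) f g ↔
      KinRel a w₁ f (g - mulOp _ (fun p => w₂ p.1) (projOp ν f)) := by
  refine Filter.eventually_congr ?_
  filter_upwards [Lp.coeFn_sub g (mulOp _ (fun p => w₂ p.1) (projOp ν f)),
    mulOp_coe (hw.comp measurable_fst) (projOp ν f)] with p h1 h2
  rw [h1, Pi.sub_apply]
  erw [h2]
  constructor <;> intro h <;> linear_combination h

/-- A finite rank perturbation of a boundedly invertible relation is Fredholm. -/
lemma fredholm_kinRel {a : K × E3 → ℂ} {w₁ w₂ : K → ℂ} (hw : BddMeas w₂)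
    {R : KinL2 ν →L[ℂ] KinL2 ν}
    (hR : ∀ h, KinRel a w₁ (R h) h ∧ ∀ f, KinRel a w₁ f h → R h = f)
    (hN : FiniteDimensional ℂ (LinearMap.range
      ((mulOp (ν.prod maxwellian) fun p => w₂ p.1).comp (projOp ν)).toLinearMap)) :
    IsClosed (relRange ν a fun k => w₁ k + w₂ k : Set (KinL2 ν)) ∧
      FiniteDimensional ℂ (KinL2 ν ⧸ relRange ν a fun k => w₁ k + w₂ k) ∧
      FiniteDimensional ℂ (relKer ν a fun k => w₁ k + w₂ k) := by
  set N := (mulOp (ν.prod maxwellian) fun p => w₂ p.1).comp (projOp ν) with hNdef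
  have hrange : FiniteDimensional ℂ (LinearMap.range (N.comp R).toLinearMap) :=
    Submodule.finiteDimensional_of_le (S₂ := LinearMap.range N.toLinearMap) (by
      rintro _ ⟨x, rfl⟩; exact ⟨R x, rfl⟩)
  obtain ⟨h1, h2⟩ := fredholm_of_ker_le (N.comp R) hrange
    (S := relRange ν a fun k => w₁ k + w₂ k) (by
      intro h hh
      refine ⟨R h, (kinRel_add_iff a w₁ hw _ _).2 ?_⟩
      have : mulOp (ν.prod maxwellian) (fun p => w₂ p.1) (projOp ν (R h)) = 0 := hh
      rw [this, sub_zero]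
      exact (hR h).1)
  refine ⟨h1, h2, ?_⟩
  have : FiniteDimensional ℂ ((LinearMap.range N.toLinearMap).map R.toLinearMap) := inferInstance
  refine Submodule.finiteDimensional_of_le (S₂ := (LinearMap.range N.toLinearMap).map R.toLinearMap) ?_
  intro f hf
  have h3 := (kinRel_add_iff a w₁ hw _ _).1 (show KinRel a (fun k => w₁ k + w₂ k) f 0 from hf)
  refine ⟨0 - N f, ⟨-f, by simp⟩, (hR _).2 f h3⟩

/-- Multiplication by a finitely supported function has finite rank. -/
lemma finiteDimensional_range_mulOp [MeasurableSingletonClass K] {F : Finset K}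
    (hν : ∀ k, ν {k} ≠ ⊤) {w : K → ℂ} (hw : BddMeas w) (hF : ∀ k ∉ F, w k = 0) :
    FiniteDimensional ℂ (LinearMap.range
      ((mulOp (ν.prod maxwellian) fun p => w p.1).comp (projOp ν)).toLinearMap) := by
  classical
  set x : K × Fin 5 → KinL2 ν := fun kj =>
    emb ν kj.2 (indL {kj.1} (measurableSet_singleton _) (hν _)) with hx
  have : FiniteDimensional ℂ (Submodule.span ℂ (x '' ((F ×ˢ Finset.univ : Finset (K × Fin 5)) : Set (K × Fin 5)))) :=
    FiniteDimensional.span_of_finite _ ((F ×ˢ Finset.univ).finite_toSet.image x)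
  refine Submodule.finiteDimensional_of_le (S₂ := Submodule.span ℂ (x '' ((F ×ˢ Finset.univ : Finset (K × Fin 5)) : Set (K × Fin 5)))) ?_
  rintro _ ⟨f, rfl⟩
  have key : mulOp (ν.prod maxwellian) (fun p => w p.1) (projOp ν f) =
      ∑ kj ∈ F ×ˢ Finset.univ, (w kj.1 * mom ν kj.2 f kj.1) • x kj := by
    apply Lp.ext
    filter_upwards [mulOp_coe (hw.comp measurable_fst) (projOp ν f), projOp_coe f,
      sum_coeFn (F ×ˢ Finset.univ) fun kj => (w kj.1 * mom ν kj.2 f kj.1) • x kj,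
      (ae_ball_iff (F ×ˢ (Finset.univ : Finset (Fin 5))).countable_toSet).2 fun kj _ =>
        Lp.coeFn_smul (w kj.1 * mom ν kj.2 f kj.1) (x kj),
      (ae_ball_iff (F ×ˢ (Finset.univ : Finset (Fin 5))).countable_toSet).2 fun kj _ =>
        emb_coe kj.2 (indL {kj.1} (measurableSet_singleton _) (hν _)),
      (ae_ball_iff (F ×ˢ (Finset.univ : Finset (Fin 5))).countable_toSet).2 fun kj _ =>
        ae_fst (μ := maxwellian) (indL_coe (measurableSet_singleton kj.1) (hν kj.1))]
      with p h1 h2 h3 h4 h5 h6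
    erw [h1]
    rw [h2, h3, mul_sum]
    have e : ∀ kj ∈ F ×ˢ (Finset.univ : Finset (Fin 5)),
        ((w kj.1 * mom ν kj.2 f kj.1) • x kj : KinL2 ν) p =
        if kj.1 = p.1 then w p.1 * (mom ν kj.2 f p.1 * (basis5 kj.2 p.2 : ℂ)) else 0 := by
      intro kj hkj
      rw [h4 kj hkj, Pi.smul_apply, h5 kj hkj, h6 kj hkj, smul_eq_mul]
      split_ifs with hk
      · rw [← hk]; simp; ring
      · have : p.1 ∉ ({kj.1} : Set K) := fun h => hk h.symm
        rw [indicator_of_notMem this]; simp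
    rw [sum_congr rfl e, Finset.sum_product_right]
    refine sum_congr rfl fun j _ => ?_
    rw [Finset.sum_ite_eq' F p.1]
    split_ifs with hp
    · rfl
    · rw [hF _ hp, zero_mul]
  change mulOp (ν.prod maxwellian) (fun p => w p.1) (projOp ν f) ∈ _
  rw [key]
  exact Submodule.sum_mem _ fun kj hkj => Submodule.smul_mem _ _
    (Submodule.subset_span ⟨kj, hkj, rfl⟩)

end Kinetic

section Velocity

instance isOpenPosMeasure_maxwellian : maxwellian.IsOpenPosMeasure := by
  have h1 : (gaussianReal 0 1).IsOpenPosMeasure :=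
    (gaussianReal_absolutelyContinuous' 0 one_ne_zero).isOpenPosMeasure
  rw [maxwellian, ← map_pi_eq_stdGaussian]
  exact (PiLp.continuous_toLp 2 _).isOpenPosMeasure_map (WithLp.toLp_surjective 2)

lemma maxwellian_slab (c : ℝ) {q : E3} (hq : q ≠ 0) : ∀ᵐ v ∂maxwellian, ⟪v, q⟫_ℝ ≠ c := by
  have h := IsGaussian.map_eq_gaussianReal (μ := maxwellian) (innerSL ℝ q)
  have hv : Var[innerSL ℝ q; maxwellian] = ‖q‖ ^ 2 := by
    rw [variance_dual_stdGaussian, innerSL_apply_norm]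
  have hne : (Var[innerSL ℝ q; maxwellian]).toNNReal ≠ 0 := by
    rw [hv, ne_eq, Real.toNNReal_eq_zero, not_le]; have := norm_pos_iff.2 hq; positivity
  have := nullSingletonClass_gaussianReal (μ := maxwellian[innerSL ℝ q]) hne
  have h0 : (maxwellian.map (innerSL ℝ q)) {c} = 0 := by rw [h]; exact measure_singleton c
  rw [Measure.map_apply (by fun_prop) (measurableSet_singleton c)] at h0
  rw [ae_iff]
  convert h0 using 2
  ext v
  simp [real_inner_comm]

lemma velSymbol_ae_ne_zero (z : ℂ) {q : E3} (hq : q ≠ 0) :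
    ∀ᵐ v ∂maxwellian, velSymbol z q v ≠ 0 := by
  filter_upwards [maxwellian_slab (-z.im) hq] with v hv h
  have := congrArg Complex.im h
  simp [velSymbol] at this
  exact hv (by linarith)

lemma exists_velocity_function {V₀ : Set E3} (hV : IsOpen V₀) (hne : V₀.Nonempty) {E : Type*}
    [AddCommGroup E] [Module ℂ E] [FiniteDimensional ℂ E] (Φ : VelocityL2 →ₗ[ℂ] E) :
    ∃ g : VelocityL2, g ≠ 0 ∧ (∀ᵐ v ∂maxwellian, v ∉ V₀ → g v = 0) ∧ Φ g = 0 := by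
  obtain ⟨v₀, hv₀⟩ := hne
  have : Infinite V₀ := (infinite_of_mem_nhds v₀ (hV.mem_nhds hv₀)).to_subtype
  obtain ⟨U, hUi, hUo, hUd⟩ := exists_seq_infinite_isOpen_pairwise_disjoint V₀
  set B : ℕ → Set E3 := fun n => Subtype.val '' U n with hB
  have hBo : ∀ n, IsOpen (B n) := fun n => hV.isOpenMap_subtype_val _ (hUo n)
  have hBd : ∀ m n, m ≠ n → Disjoint (B m) (B n) := fun m n h =>
    (Set.disjoint_image_iff Subtype.val_injective).2 (hUd h)
  set x : ℕ → VelocityL2 := fun n => indL (B n) (hBo n).measurableSet (measure_ne_top _ _) with hx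
  have hlin : LinearIndependent ℂ x := by
    refine linearIndependent_of_ne_zero_of_inner_eq_zero (fun n => ?_) fun m n hmn => ?_
    · exact norm_pos_iff.1 (norm_indL_pos _ _
        ((hBo n).measure_pos _ ((hUi n).nonempty.image _)).ne')
    · change ⟪x m, x n⟫_ℂ = 0
      rw [inner_Lp_eq]
      refine integral_eq_zero_of_ae ?_
      filter_upwards [indL_coe (hBo m).measurableSet (measure_ne_top maxwellian _),
        indL_coe (hBo n).measurableSet (measure_ne_top maxwellian _)] with v h1 h2
      change conj (indL (B m) _ _ v) * indL (B n) _ _ v = 0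
      rw [h1, h2]
      by_cases hm : v ∈ B m
      · rw [indicator_of_notMem (Set.disjoint_left.1 (hBd m n hmn) hm), mul_zero]
      · rw [indicator_of_notMem hm, map_zero, zero_mul]
  have hsupp : ∀ g ∈ Submodule.span ℂ (Set.range x), ∀ᵐ v ∂maxwellian, v ∉ V₀ → g v = 0 := by
    intro g hg
    induction hg using Submodule.span_induction with
    | mem g hg =>
      obtain ⟨n, rfl⟩ := hg
      filter_upwards [indL_coe (hBo n).measurableSet (measure_ne_top maxwellian _)] with v h1 hv
      change indL (B n) _ _ v = 0
      rw [h1, indicator_of_notMem]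
      rintro ⟨y, -, rfl⟩
      exact hv y.2
    | zero => filter_upwards [Lp.coeFn_zero ℂ 2 maxwellian] with v hv _; rw [hv, Pi.zero_apply]
    | add f g _ _ hf hg =>
      filter_upwards [hf, hg, Lp.coeFn_add f g] with v h1 h2 h3 hv
      rw [h3, Pi.add_apply, h1 hv, h2 hv, add_zero]
    | smul c f _ hf =>
      filter_upwards [hf, Lp.coeFn_smul c f] with v h1 h3 hv
      rw [h3, Pi.smul_apply, h1 hv, smul_zero]
  by_contra! hcon
  have hinj : Function.Injective (Φ.domRestrict (Submodule.span ℂ (Set.range x))) := by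
    rw [← LinearMap.ker_eq_bot, LinearMap.ker_eq_bot']
    rintro ⟨g, hg⟩ h
    by_contra h0
    exact hcon g (fun e => h0 (Subtype.ext e)) (hsupp g hg) h
  have hfd := FiniteDimensional.of_injective _ hinj
  have h2 := linearIndependent_span hlin
  have := h2.finite
  exact not_finite ℕ

lemma not_finiteDimensional_velocityL2 : ¬ FiniteDimensional ℂ VelocityL2 := by
  intro h
  obtain ⟨g, h1, -, h2⟩ := exists_velocity_function isOpen_univ Set.univ_nonempty
    (LinearMap.id : VelocityL2 →ₗ[ℂ] VelocityL2)
  exact h1 h2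

lemma exists_velocity_orthogonal {V₀ : Set E3} (hV : IsOpen V₀) (hne : V₀.Nonempty) :
    ∃ g : VelocityL2, g ≠ 0 ∧ (∀ᵐ v ∂maxwellian, v ∉ V₀ → g v = 0) ∧ ∀ j, ⟪basisL j, g⟫_ℂ = 0 := by
  obtain ⟨g, h1, h2, h3⟩ := exists_velocity_function hV hne
    (LinearMap.pi fun j => (innerSL ℂ (basisL j)).toLinearMap)
  exact ⟨g, h1, h2, fun j => congrFun h3 j⟩

/-! ### Regularity of the moment matrix -/

lemma norm_momentMatrix_integrand_le {z : ℂ} (hz : z.re ≠ 0) (q v : E3) (i j : Fin 5) :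
    ‖(velSymbol z q v)⁻¹ * ((basis5 i v : ℂ) * (basis5 j v : ℂ))‖ ≤
      |z.re|⁻¹ * ‖(basis5 i v : ℂ) * (basis5 j v : ℂ)‖ := by
  rw [norm_mul]
  exact mul_le_mul_of_nonneg_right (norm_inv_velSymbol_le hz q v) (norm_nonneg _)

lemma integrable_bound_momentMatrix (z : ℂ) (i j : Fin 5) :
    Integrable (fun v => |z.re|⁻¹ * ‖(basis5 i v : ℂ) * (basis5 j v : ℂ)‖) maxwellian :=
  (((memLp_basis5 i).integrable_mul (memLp_basis5 j)).norm).const_mul _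

lemma continuous_momentMatrix {z : ℂ} (hz : z.re ≠ 0) : Continuous (momentMatrix z) := by
  refine continuous_matrix fun i j => ?_
  refine continuous_of_dominated (fun q => ?_)
    (fun q => .of_forall fun v => norm_momentMatrix_integrand_le hz q v i j)
    (integrable_bound_momentMatrix z i j) (.of_forall fun v => ?_)
  · have := measurable_velSymbol z q
    have h1 := measurable_basis5 i
    have h2 := measurable_basis5 j
    fun_prop
  · have h := (continuous_velSymbol z).comp (Continuous.prodMk_left v)
    exact (h.inv₀ fun q => velSymbol_ne_zero hz q v).mul continuous_const

lemma continuous_det_one_sub (c : ℂ) :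
    Continuous fun B : Matrix (Fin 5) (Fin 5) ℂ => (1 - c • B).det := by
  have h : Continuous fun B : Matrix (Fin 5) (Fin 5) ℂ => 1 - c • B :=
    continuous_const.sub (continuous_id.const_smul c)
  exact h.matrix_det

lemma continuous_fibreDet (τ : ℝ) {z : ℂ} (hz : z.re ≠ 0) : Continuous (fibreDet τ z) :=
  (continuous_det_one_sub (1 / τ)).comp (continuous_momentMatrix hz)

lemma norm_momentMatrix_le {z : ℂ} (hz : z.re ≠ 0) (q : E3) (i j : Fin 5) :
    ‖momentMatrix z q i j‖ ≤ ∫ v, |z.re|⁻¹ * ‖(basis5 i v : ℂ) * (basis5 j v : ℂ)‖ ∂maxwellian :=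
  norm_integral_le_of_norm_le (integrable_bound_momentMatrix z i j)
    (.of_forall fun v => norm_momentMatrix_integrand_le hz q v i j)

lemma tendsto_momentMatrix {z : ℂ} (hz : z.re ≠ 0) :
    Tendsto (fun r : ℝ => momentMatrix z (r • axis0)) atTop (𝓝 0) := by
  refine tendsto_pi_nhds.2 fun i => tendsto_pi_nhds.2 fun j => ?_
  have h0 : (0 : Matrix (Fin 5) (Fin 5) ℂ) i j = ∫ v, (0 : ℂ) ∂maxwellian := by simp
  rw [h0]
  refine tendsto_integral_filter_of_dominated_convergence _ (.of_forall fun r => ?_)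
    (.of_forall fun r => .of_forall fun v =>
      norm_momentMatrix_integrand_le hz (r • axis0) v i j) (integrable_bound_momentMatrix z i j) ?_
  · have := measurable_velSymbol z (r • axis0)
    have h1 := measurable_basis5 i
    have h2 := measurable_basis5 j
    fun_prop
  · have hax : axis0 ≠ 0 := by
      intro h
      have := congrArg (fun x : E3 => x 0) h
      simp [axis0] at this
    filter_upwards [maxwellian_slab 0 hax] with v hv
    rw [← zero_mul ((basis5 i v : ℂ) * (basis5 j v : ℂ))]
    refine Tendsto.mul_const _ ?_
    refine Filter.tendsto_inv₀_cobounded.comp (tendsto_norm_atTop_iff_cobounded.1 ?_)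
    have h1 : Tendsto (fun r : ℝ => r * |⟪v, axis0⟫_ℝ| - |z.im|) atTop atTop :=
      Filter.tendsto_atTop_add_const_right _ _
        (Filter.tendsto_id.atTop_mul_const (abs_pos.2 hv))
    refine Filter.tendsto_atTop_mono (fun r => ?_) h1
    refine le_trans ?_ (abs_im_le_norm _)
    have e : (velSymbol z (r • axis0) v).im = r * ⟪v, axis0⟫_ℝ + z.im := by
      simp [velSymbol, inner_smul_right, add_comm]
    rw [e]
    have h2 := abs_sub_abs_le_abs_sub (r * ⟪v, axis0⟫_ℝ) (-z.im)
    rw [abs_neg, sub_neg_eq_add, abs_mul] at h2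
    have h3 := mul_le_mul_of_nonneg_right (le_abs_self r) (abs_nonneg ⟪v, axis0⟫_ℝ)
    linarith

lemma exists_fibreDet_ge (τ : ℝ) {z : ℂ} (hz : z.re ≠ 0) :
    ∃ R : ℝ, ∀ q : E3, R ≤ ‖q‖ → 1 / 2 ≤ ‖fibreDet τ z q‖ := by
  have h : Tendsto (fun r : ℝ => ‖fibreDet τ z (r • axis0)‖) atTop (𝓝 1) := by
    have h2 := ((continuous_det_one_sub (1 / τ)).norm.tendsto 0).comp (tendsto_momentMatrix hz)
    rw [smul_zero, sub_zero, Matrix.det_one, norm_one] at h2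
    exact h2
  obtain ⟨R, hR⟩ := Filter.eventually_atTop.1 (h.eventually (eventually_ge_nhds (b := 1 / 2) (by norm_num)))
  exact ⟨R, fun q hq => by rw [fibreDet_eq_axis τ hz]; exact hR _ hq⟩

end Velocity

section Kinetic

variable {K : Type*} [MeasurableSpace K] {ν : Measure K} [SigmaFinite ν]

/-- The symbol `z + i ⟪v, ξ k⟫`. -/
def kinSymbol (z : ℂ) (ξ : K → E3) (p : K × E3) : ℂ := velSymbol z (ξ p.1) p.2

lemma measurable_kinSymbol (z : ℂ) {ξ : K → E3} (hξ : Measurable ξ) : Measurable (kinSymbol z ξ) := by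
  have h : Measurable fun p : K × E3 => ⟪p.2, ξ p.1⟫_ℝ :=
    measurable_snd.inner (hξ.comp measurable_fst)
  exact measurable_const.add (measurable_const.mul (Complex.measurable_ofReal.comp h))

lemma bddMeas_continuous_comp {φ : Matrix (Fin 5) (Fin 5) ℂ → ℂ} (hφ : Continuous φ)
    {M : K → Matrix (Fin 5) (Fin 5) ℂ} (hM : ∀ i j, BddMeas fun k => M k i j) :
    BddMeas fun k => φ (M k) := by
  choose hm C hC using hM
  have hB : BorelSpace (Fin 5 → ℂ) := Pi.borelSpace
  have hB2 : BorelSpace (Fin 5 → Fin 5 → ℂ) := Pi.borelSpace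
  have hφ' : Continuous fun x : Fin 5 → Fin 5 → ℂ => φ x := hφ
  refine ⟨hφ'.measurable.comp
    (measurable_pi_lambda _ fun i => measurable_pi_lambda _ fun j => hm i j), ?_⟩
  have hc : IsCompact (Set.univ.pi fun i => Set.univ.pi fun j => Metric.closedBall (0 : ℂ) (C i j)) :=
    isCompact_univ_pi fun i => isCompact_univ_pi fun j => isCompact_closedBall _ _
  obtain ⟨D, hD⟩ := hc.exists_bound_of_continuousOn (f := φ) hφ.continuousOn
  exact ⟨D, fun k => hD _ fun i _ j _ => by simpa using hC i j k⟩

/-- Off the line, the relation is boundedly invertible where the determinant is bounded below. -/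
theorem exists_resolvent_of_fibreDet (τ : ℝ) {z : ℂ} (hz : z.re ≠ 0) {ξ : K → E3} (hξ : Measurable ξ)
    {s : Set K} (hs : MeasurableSet s)
    (h : ∀ r, ∃ δ > 0, ∀ k ∈ s, ‖ξ k‖ ≤ r → δ ≤ ‖fibreDet τ z (ξ k)‖) :
    ∃ R : KinL2 ν →L[ℂ] KinL2 ν,
      ∀ h, KinRel (kinSymbol z ξ) (s.indicator fun _ => (1 / τ : ℂ)) (R h) h ∧
        ∀ f, KinRel (kinSymbol z ξ) (s.indicator fun _ => (1 / τ : ℂ)) f h → R h = f := by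
  set w : K → ℂ := s.indicator fun _ => (1 / τ : ℂ) with hw
  have hwb : BddMeas w := bddMeas_indicator hs _
  set M : K → Matrix (Fin 5) (Fin 5) ℂ := fun k => 1 - w k • momentMatrix z (ξ k) with hM
  have hB : ∀ i j, BddMeas fun k => momentMatrix z (ξ k) i j := fun i j =>
    ⟨(((continuous_momentMatrix hz).matrix_elem i j).measurable).comp hξ, _,
      fun k => norm_momentMatrix_le hz (ξ k) i j⟩
  have hMb : ∀ i j, BddMeas fun k => M k i j := by
    intro i j
    obtain ⟨h1, C, hC⟩ := hwb.mul (hB i j)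
    refine ⟨measurable_const.sub h1, ‖(1 : Matrix (Fin 5) (Fin 5) ℂ) i j‖ + C, fun k => ?_⟩
    exact (norm_sub_le _ _).trans (add_le_add le_rfl (hC k))
  have hdet : ∃ δ > 0, ∀ k, δ ≤ ‖(M k).det‖ := by
    obtain ⟨r, hr⟩ := exists_fibreDet_ge τ hz
    obtain ⟨δ, hδ, hd⟩ := h r
    refine ⟨min δ (1 / 2), by positivity, fun k => ?_⟩
    by_cases hk : k ∈ s
    · have e : (M k).det = fibreDet τ z (ξ k) := by
        simp only [hM, hw, indicator_of_mem hk]; rfl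
      rw [e]
      rcases le_total ‖ξ k‖ r with hle | hle
      · exact (min_le_left _ _).trans (hd k hk hle)
      · exact (min_le_right _ _).trans (hr _ hle)
    · have e : M k = 1 := by simp [hM, hw, hk]
      rw [e, Matrix.det_one, norm_one]
      exact (min_le_right _ _).trans (by norm_num)
  obtain ⟨δ, hδ, hd⟩ := hdet
  have hd0 : ∀ k, (M k).det ≠ 0 := fun k h0 => by
    have := hd k; rw [h0, norm_zero] at this; linarith
  refine exists_kin_resolvent (measurable_kinSymbol z hξ) (abs_pos.2 hz)
    (fun p => norm_velSymbol_ge z _ _) hwb (fun k => (M k).det⁻¹ • (M k).adjugate) (fun i j => ?_)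
    fun k => ?_
  · have h1 : BddMeas fun k => (M k).det :=
      bddMeas_continuous_comp (continuous_id.matrix_det) hMb
    have h2 : BddMeas fun k => (M k).adjugate i j :=
      bddMeas_continuous_comp (continuous_id.matrix_adjugate.matrix_elem i j) hMb
    have h3 : BddMeas fun k => (M k).det⁻¹ := ⟨h1.1.inv, δ⁻¹, fun k => by
      rw [norm_inv]; exact inv_anti₀ hδ (hd k)⟩
    exact h3.mul h2
  · change M k * _ = 1
    rw [Matrix.mul_smul, Matrix.mul_adjugate, smul_smul, inv_mul_cancel₀ (hd0 k), one_smul]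

end Kinetic

section Kinetic

variable {K : Type*} [MeasurableSpace K] {ν : Measure K} [SigmaFinite ν]

/-- `q` lies in the support of the law of `ξ`. -/
def InSupport (ν : Measure K) (ξ : K → E3) (q : E3) : Prop :=
  ∀ N : Set E3, IsOpen N → q ∈ N → ∃ s : Set K, MeasurableSet s ∧ (∀ k ∈ s, ξ k ∈ N) ∧
    ν s ≠ 0 ∧ ν s ≠ ⊤

lemma exists_line_approx {z : ℂ} (hz : z.re = 0) {ξ : K → E3} (hξ : Measurable ξ) {q : E3}
    (hq : q ≠ 0) (hs : InSupport ν ξ q) (w : K → ℂ) {ε : ℝ} (hε : 0 < ε) :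
    ∃ f g : KinL2 ν, f ≠ 0 ∧
      mulOp _ ({p : K × E3 | ξ p.1 ≠ 0}.indicator fun _ => 1) f = f ∧
      KinRel (kinSymbol z ξ) w f g ∧ ‖g‖ ≤ ε * ‖f‖ := by
  have hopen : IsOpen {p : E3 × E3 | ‖velSymbol z p.1 p.2‖ < ε ∧ p.1 ≠ 0} :=
    (isOpen_lt (continuous_velSymbol z).norm continuous_const).inter
      (isOpen_ne_fun continuous_fst continuous_const)
  have hmem : (q, (-z.im / ‖q‖ ^ 2) • q) ∈ {p : E3 × E3 | ‖velSymbol z p.1 p.2‖ < ε ∧ p.1 ≠ 0} := by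
    refine ⟨?_, hq⟩
    have e : velSymbol z q ((-z.im / ‖q‖ ^ 2) • q) = 0 := by
      have hn : ‖q‖ ≠ 0 := norm_ne_zero_iff.2 hq
      rw [velSymbol, real_inner_smul_left, real_inner_self_eq_norm_sq,
        div_mul_cancel₀ _ (pow_ne_zero 2 hn)]
      apply Complex.ext <;> simp [hz]
    simpa [e] using hε
  obtain ⟨N, V, hN, hV, hqN, hvV, hNV⟩ := isOpen_prod_iff.1 hopen _ _ hmem
  obtain ⟨s, hsm, hsN, hs0, hst⟩ := hs N hN hqN
  obtain ⟨g, hg0, hgs, hg⟩ := exists_velocity_orthogonal hV ⟨_, hvV⟩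
  obtain ⟨y, hy, hyn⟩ := exists_approx_line (measurable_kinSymbol z hξ) w hsm hst hg hgs hε.le
    (fun k hk v hv => (hNV (Set.mk_mem_prod (hsN k hk) hv)).1.le)
  refine ⟨_, y, ?_, ?_, hy, hyn⟩
  · rw [← norm_ne_zero_iff, norm_tens]
    exact mul_ne_zero (norm_indL_pos _ _ hs0).ne' (norm_ne_zero_iff.2 hg0)
  · have hm : MeasurableSet {p : K × E3 | ξ p.1 ≠ 0} :=
      (hξ.comp measurable_fst) (measurableSet_singleton 0).compl
    apply Lp.ext
    filter_upwards [mulOp_coe (bddMeas_indicator hm 1) (tens (indL s hsm hst) g),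
      tens_coe (indL s hsm hst) g, ae_fst (μ := maxwellian) (indL_coe hsm hst)] with p h1 h2 h3
    rw [h1, h2, h3]
    by_cases hp : p.1 ∈ s
    · have : p ∈ {p : K × E3 | ξ p.1 ≠ 0} := (hNV (Set.mk_mem_prod (hsN _ hp) hvV)).2
      rw [indicator_of_mem this, one_mul]
    · simp [hp]

/-- On the line the range is not closed. -/
theorem not_isClosed_relRange_line {τ : ℝ} (hτ : 0 < τ) {z : ℂ} (hz : z.re = 0) {ξ : K → E3}
    (hξ : Measurable ξ) {q : E3} (hq : q ≠ 0) (hs : InSupport ν ξ q) :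
    ¬ IsClosed (relRange ν (kinSymbol z ξ) fun _ => (1 / τ : ℂ) :
      Set (KinL2 ν)) := by
  have hm : MeasurableSet {p : K × E3 | ξ p.1 ≠ 0} :=
    (hξ.comp measurable_fst) (measurableSet_singleton 0).compl
  have hb := bddMeas_indicator hm 1
  refine not_isClosed_relRange (measurable_kinSymbol z hξ) (bddMeas_const _)
    (mulOp _ ({p : K × E3 | ξ p.1 ≠ 0}.indicator fun _ => 1)) (fun f => ?_) (fun f hf => ?_)
    fun ε hε => exists_line_approx hz hξ hq hs _ hε
  · rw [← one_mul ‖f‖]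
    refine norm_mulOp_le hb (.of_forall fun p => ?_)
    rw [norm_mul]
    refine mul_le_mul_of_nonneg_right ?_ (norm_nonneg _)
    by_cases hp : p ∈ {p : K × E3 | ξ p.1 ≠ 0}
    · rw [indicator_of_mem hp, norm_one]
    · rw [indicator_of_notMem hp, norm_zero]; exact zero_le_one
  · have h1 := relKer_ae_zero (a := kinSymbol z ξ)
      (fun p => by rw [kinSymbol, velSymbol_re, hz]) (w := 1 / τ) (by positivity)
      (by simpa using hf)
    have hae : ∀ᵐ p ∂(ν.prod maxwellian), ξ p.1 ≠ 0 → kinSymbol z ξ p ≠ 0 := by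
      have hms : MeasurableSet {p : K × E3 | ξ p.1 ≠ 0 → kinSymbol z ξ p ≠ 0} := by
        have h2 : MeasurableSet {p : K × E3 | kinSymbol z ξ p ≠ 0} :=
          (measurable_kinSymbol z hξ) (measurableSet_singleton 0).compl
        exact hm.imp h2
      rw [Measure.ae_prod_iff_ae_ae hms]
      refine .of_forall fun k => ?_
      by_cases hk : ξ k = 0
      · exact .of_forall fun v h => absurd hk h
      · filter_upwards [velSymbol_ae_ne_zero z hk] with v hv _; exact hv
    apply Lp.ext
    filter_upwards [h1, hae, mulOp_coe hb f, Lp.coeFn_zero ℂ 2 (ν.prod maxwellian)]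
      with p h1 h2 h3 h4
    rw [h3, h4, Pi.zero_apply]
    by_cases hp : p ∈ {p : K × E3 | ξ p.1 ≠ 0}
    · rw [(mul_eq_zero.1 h1).resolve_left (h2 hp), mul_zero]
    · rw [indicator_of_notMem hp, zero_mul]

lemma exists_null_vec {τ : ℝ} {z : ℂ} {q : E3} (h : fibreDet τ z q = 0) :
    ∃ c : Fin 5 → ℂ, (∃ l, c l ≠ 0) ∧ (1 - (1 / τ : ℂ) • momentMatrix z q).mulVec c = 0 := by
  obtain ⟨c, hc, hv⟩ := Matrix.exists_mulVec_eq_zero_iff.2 h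
  exact ⟨c, Function.ne_iff.1 hc, hv⟩

lemma exists_mode_approx {τ : ℝ} (hτ : 0 < τ) {z : ℂ} (hz : z.re ≠ 0) {ξ : K → E3}
    (hξ : Measurable ξ) {q : E3} (h : fibreDet τ z q = 0) (hs : InSupport ν ξ q) {ε : ℝ}
    (hε : 0 < ε) : ∃ f g : KinL2 ν, f ≠ 0 ∧
      KinRel (kinSymbol z ξ) (fun _ => (1 / τ : ℂ)) f g ∧ ‖g‖ ≤ ε * ‖f‖ := by
  obtain ⟨c, ⟨l, hl⟩, hc⟩ := exists_null_vec h
  have hcl := norm_pos_iff.2 hl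
  set w : ℂ := 1 / τ with hw
  have hw0 : 0 < ‖w‖ := by rw [hw, norm_pos_iff]; simp [hτ.ne']
  set η : ℝ := min (‖c l‖ / 2) (ε * ‖c l‖ / (10 * ‖w‖)) with hη
  have hη0 : 0 < η := by positivity
  have hcont : ∀ i, Continuous fun q => ‖((1 - w • momentMatrix z q).mulVec c) i‖ := by
    intro i
    simp only [one_sub_smul_mulVec]
    have h1 : ∀ j, Continuous fun q => momentMatrix z q i j := fun j =>
      (continuous_momentMatrix hz).matrix_elem i j
    fun_prop
  have hN : IsOpen {q | ∀ i, ‖((1 - w • momentMatrix z q).mulVec c) i‖ < η} := by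
    simp only [Set.ofPred_forall]
    exact isOpen_iInter_of_finite fun i => isOpen_lt (hcont i) continuous_const
  obtain ⟨s, hsm, hsN, hs0, hst⟩ := hs _ hN (by
    intro i
    rw [hc]
    simpa using hη0)
  obtain ⟨f, g, hfg, hgn, hfn⟩ := exists_approx_mode (ν := ν) (measurable_kinSymbol z hξ)
    (abs_pos.2 hz) (fun p => norm_velSymbol_ge z _ _)
    (fun i j => (((continuous_momentMatrix hz).matrix_elem i j).measurable).comp hξ) w c hsm hst
    hη0.le (fun k hk i => (hsN k hk i).le)
  have hi := norm_indL_pos hsm hst hs0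
  have h1 := hfn l
  have h2 : ‖c l‖ / 2 ≤ ‖c l‖ - η := by linarith [min_le_left (‖c l‖ / 2) (ε * ‖c l‖ / (10 * ‖w‖))]
  have h3 : ‖c l‖ / 2 * ‖indL s hsm hst‖ ≤ ‖f‖ :=
    (mul_le_mul_of_nonneg_right h2 hi.le).trans h1
  have h4 : 5 * ‖w‖ * η ≤ ε * (‖c l‖ / 2) := by
    calc 5 * ‖w‖ * η ≤ 5 * ‖w‖ * (ε * ‖c l‖ / (10 * ‖w‖)) := by
          gcongr; exact min_le_right _ _
      _ = _ := by field_simp; ring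
  refine ⟨f, g, norm_pos_iff.1 (lt_of_lt_of_le (by positivity) h3), hfg, hgn.trans ?_⟩
  calc 5 * ‖w‖ * η * ‖indL s hsm hst‖ ≤ ε * (‖c l‖ / 2) * ‖indL s hsm hst‖ := by gcongr
    _ = ε * (‖c l‖ / 2 * ‖indL s hsm hst‖) := by ring
    _ ≤ _ := by gcongr

lemma relKer_ne_bot {τ : ℝ} {z : ℂ} (hz : z.re ≠ 0) {ξ : K → E3}
    (hξ : Measurable ξ) [MeasurableSingletonClass K] {k : K} (h : fibreDet τ z (ξ k) = 0)
    (hk : ν {k} ≠ 0) (hk' : ν {k} ≠ ⊤) :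
    relKer ν (kinSymbol z ξ) (fun _ => (1 / τ : ℂ)) ≠ ⊥ := by
  obtain ⟨c, ⟨l, hl⟩, hc⟩ := exists_null_vec h
  obtain ⟨f, g, hfg, hgn, hfn⟩ := exists_approx_mode (ν := ν) (measurable_kinSymbol z hξ)
    (abs_pos.2 hz) (fun p => norm_velSymbol_ge z _ _)
    (fun i j => (((continuous_momentMatrix hz).matrix_elem i j).measurable).comp hξ) (1 / τ) c
    (measurableSet_singleton k) hk' le_rfl (fun k' hk' i => by
      rw [Set.mem_singleton_iff.1 hk']
      change ‖((1 - (1 / τ : ℂ) • momentMatrix z (ξ k)).mulVec c) i‖ ≤ 0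
      rw [hc]; simp)
  have hg : g = 0 := by simpa using hgn
  subst hg
  have hf := hfn l
  rw [sub_zero] at hf
  rw [Submodule.ne_bot_iff]
  exact ⟨f, hfg, norm_pos_iff.1 (lt_of_lt_of_le (mul_pos (norm_pos_iff.2 hl)
    (norm_indL_pos _ _ hk)) hf)⟩

end Kinetic

/-! ### Transport to an unbounded operator -/

section Transport

variable {H : Type*} [NormedAddCommGroup H] [InnerProductSpace ℂ H]

lemma isSemiFredholmAt_of_isResolventPoint {T : H →ₗ.[ℂ] H} {l : ℂ} (h : IsResolventPoint T l) :
    IsSemiFredholmAt T l := by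
  obtain ⟨R, h1, -⟩ := h
  have htop : LinearMap.range (shifted T l) = ⊤ := by
    rw [LinearMap.range_eq_top]
    intro x
    obtain ⟨hd, hx⟩ := h1 x
    exact ⟨⟨R x, hd⟩, hx⟩
  refine ⟨by rw [htop]; exact isClosed_univ, Or.inr ?_⟩
  rw [htop]
  infer_instance

lemma essSpectrum_subset (T : H →ₗ.[ℂ] H) : essSpectrum T ⊆ opSpectrum T :=
  fun _ h h' => h (isSemiFredholmAt_of_isResolventPoint h')

lemma ker_shifted_eq_bot {T : H →ₗ.[ℂ] H} {l : ℂ} (h : IsResolventPoint T l) :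
    LinearMap.ker (shifted T l) = ⊥ := by
  obtain ⟨R, -, h2⟩ := h
  rw [LinearMap.ker_eq_bot']
  intro f hf
  have := h2 f
  have e : T f - l • (f : H) = 0 := hf
  rw [e, map_zero] at this
  exact Subtype.ext this.symm

lemma discSpectrum_subset (T : H →ₗ.[ℂ] H) : discSpectrum T ⊆ opSpectrum T :=
  fun _ h h' => h.1 (ker_shifted_eq_bot h')

variable {K : Type*} [MeasurableSpace K] {ν : Measure K} [SigmaFinite ν]

/-- `T` is unitarily equivalent, by `U`, to the kinetic relation with wave vectors `ξ`. -/
def IsKinetic (T : H →ₗ.[ℂ] H) (τ : ℝ) (ξ : K → E3)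
    (U : H ≃ₗᵢ[ℂ] KinL2 ν) : Prop :=
  ∀ f g, (f, g) ∈ T.graph ↔ KinRel (kinSymbol (1 / τ) ξ) (fun _ => (1 / τ : ℂ)) (U f) (U g)

variable {T : H →ₗ.[ℂ] H} {τ : ℝ} {ξ : K → E3} {U : H ≃ₗᵢ[ℂ] KinL2 ν}

lemma IsKinetic.shifted_iff (hT : IsKinetic T τ ξ U) (l : ℂ) (f h : H) :
    (∃ hd : f ∈ T.domain, T ⟨f, hd⟩ - l • f = h) ↔
      KinRel (kinSymbol (l + 1 / τ) ξ) (fun _ => (1 / τ : ℂ)) (U f) (U h) := by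
  have h1 : (∃ hd : f ∈ T.domain, T ⟨f, hd⟩ - l • f = h) ↔ (f, h + l • f) ∈ T.graph := by
    rw [LinearPMap.mem_graph_iff]
    constructor
    · rintro ⟨hd, rfl⟩; exact ⟨⟨f, hd⟩, rfl, by simp⟩
    · rintro ⟨⟨y, hy⟩, rfl, e⟩
      exact ⟨hy, by simp only at e; rw [e, add_sub_cancel_right]⟩
  rw [h1, hT]
  refine Filter.eventually_congr ?_
  rw [map_add, map_smul]
  filter_upwards [Lp.coeFn_add (U h) (l • U f), Lp.coeFn_smul l (U f)] with p h2 h3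
  rw [h2, Pi.add_apply, h3, Pi.smul_apply, smul_eq_mul]
  simp only [kinSymbol, velSymbol]
  constructor <;> intro h <;> linear_combination h

lemma IsKinetic.isResolventPoint (hT : IsKinetic T τ ξ U) {l : ℂ}
    (hR : ∃ R : KinL2 ν →L[ℂ] KinL2 ν,
      ∀ h, KinRel (kinSymbol (l + 1 / τ) ξ) (fun _ => (1 / τ : ℂ)) (R h) h ∧
        ∀ f, KinRel (kinSymbol (l + 1 / τ) ξ) (fun _ => (1 / τ : ℂ)) f h → R h = f) :
    IsResolventPoint T l := by
  obtain ⟨R, hR⟩ := hR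
  refine ⟨(U.symm.toContinuousLinearEquiv : _ →L[ℂ] H).comp
    (R.comp (U.toContinuousLinearEquiv : H →L[ℂ] _)), fun h => ?_, fun f => ?_⟩
  · have h1 := (hR (U h)).1
    refine (hT.shifted_iff l (U.symm (R (U h))) h).2 ?_
    rw [U.apply_symm_apply]
    exact h1
  · have h1 := (hT.shifted_iff l f (T f - l • (f : H))).1 ⟨f.2, rfl⟩
    have h2 := (hR _).2 _ h1
    change U.symm (R (U _)) = _
    rw [h2, U.symm_apply_apply]

lemma IsKinetic.not_isResolventPoint (hT : IsKinetic T τ ξ U) {l : ℂ}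
    (happ : ∀ ε > 0, ∃ f g : KinL2 ν, f ≠ 0 ∧
      KinRel (kinSymbol (l + 1 / τ) ξ) (fun _ => (1 / τ : ℂ)) f g ∧ ‖g‖ ≤ ε * ‖f‖) :
    ¬ IsResolventPoint T l := by
  rintro ⟨R, -, h2⟩
  obtain ⟨f, g, hf, hfg, hε⟩ := happ (1 / (2 * (‖R‖ + 1))) (by positivity)
  have h3 := hT.shifted_iff l (U.symm f) (U.symm g)
  rw [U.apply_symm_apply, U.apply_symm_apply] at h3
  obtain ⟨hd, e⟩ := h3.2 hfg
  have h4 := h2 ⟨_, hd⟩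
  rw [e] at h4
  have h5 := R.le_opNorm (U.symm g)
  rw [h4, U.symm.norm_map, U.symm.norm_map] at h5
  have hf0 := norm_pos_iff.2 hf
  have h6 : ‖R‖ * ‖g‖ ≤ ‖f‖ / 2 := by
    calc ‖R‖ * ‖g‖ ≤ (‖R‖ + 1) * (1 / (2 * (‖R‖ + 1)) * ‖f‖) := by
          gcongr; linarith
      _ = _ := by field_simp
  linarith

lemma IsKinetic.range_shifted (hT : IsKinetic T τ ξ U) (l : ℂ) :
    LinearMap.range (shifted T l) =
      (relRange ν (kinSymbol (l + 1 / τ) ξ) fun _ => (1 / τ : ℂ)).comap U.toLinearEquiv.toLinearMap := by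
  ext h
  constructor
  · rintro ⟨f, rfl⟩
    exact ⟨U f, (hT.shifted_iff l f _).1 ⟨f.2, rfl⟩⟩
  · rintro ⟨f, hf⟩
    have h3 := hT.shifted_iff l (U.symm f) h
    rw [U.apply_symm_apply] at h3
    obtain ⟨hd, e⟩ := h3.2 hf
    exact ⟨⟨_, hd⟩, e⟩

lemma IsKinetic.isClosed_range_iff (hT : IsKinetic T τ ξ U) (l : ℂ) :
    IsClosed (LinearMap.range (shifted T l) : Set H) ↔
      IsClosed (relRange ν (kinSymbol (l + 1 / τ) ξ) fun _ => (1 / τ : ℂ) :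
        Set (KinL2 ν)) := by
  rw [hT.range_shifted]
  exact U.toHomeomorph.isClosed_preimage
    (s := (relRange ν (kinSymbol (l + 1 / τ) ξ) fun _ => (1 / τ : ℂ) : Set _))

lemma IsKinetic.finite_quotient_iff (hT : IsKinetic T τ ξ U) (l : ℂ) :
    FiniteDimensional ℂ (H ⧸ LinearMap.range (shifted T l)) ↔
      FiniteDimensional ℂ (KinL2 ν ⧸
        relRange ν (kinSymbol (l + 1 / τ) ξ) fun _ => (1 / τ : ℂ)) := by
  refine Module.Finite.equiv_iff (Submodule.Quotient.equiv _ _ U.toLinearEquiv ?_)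
  rw [hT.range_shifted]
  exact Submodule.map_comap_eq_of_surjective U.surjective _

lemma IsKinetic.exists_ker_equiv (hT : IsKinetic T τ ξ U) (l : ℂ) :
    Nonempty (LinearMap.ker (shifted T l) ≃ₗ[ℂ]
      relKer ν (kinSymbol (l + 1 / τ) ξ) fun _ => (1 / τ : ℂ)) := by
  have h0 : ∀ f : T.domain, f ∈ LinearMap.ker (shifted T l) →
      U f ∈ relKer ν (kinSymbol (l + 1 / τ) ξ) fun _ => (1 / τ : ℂ) := by
    intro f hf
    have := (hT.shifted_iff l f 0).1 ⟨f.2, hf⟩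
    rwa [map_zero] at this
  refine ⟨LinearEquiv.ofBijective
    ((U.toLinearEquiv.toLinearMap ∘ₗ T.domain.subtype).restrict h0) ⟨?_, ?_⟩⟩
  · intro f g hfg
    have := congrArg Subtype.val hfg
    exact Subtype.ext (Subtype.ext (U.injective this))
  · rintro ⟨f, hf⟩
    have h3 := hT.shifted_iff l (U.symm f) 0
    rw [U.apply_symm_apply, map_zero] at h3
    obtain ⟨hd, e⟩ := h3.2 hf
    exact ⟨⟨⟨_, hd⟩, e⟩, Subtype.ext (U.apply_symm_apply f)⟩

lemma IsKinetic.finite_ker_iff (hT : IsKinetic T τ ξ U) (l : ℂ) :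
    FiniteDimensional ℂ (LinearMap.ker (shifted T l)) ↔
      FiniteDimensional ℂ (relKer ν (kinSymbol (l + 1 / τ) ξ) fun _ => (1 / τ : ℂ)) := by
  obtain ⟨e⟩ := hT.exists_ker_equiv l
  exact Module.Finite.equiv_iff e

lemma IsKinetic.ker_ne_bot (hT : IsKinetic T τ ξ U) {l : ℂ}
    (h : relKer ν (kinSymbol (l + 1 / τ) ξ) (fun _ => (1 / τ : ℂ)) ≠ ⊥) :
    LinearMap.ker (shifted T l) ≠ ⊥ := by
  obtain ⟨e⟩ := hT.exists_ker_equiv l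
  intro h0
  rw [Submodule.ne_bot_iff] at h
  obtain ⟨f, hf, hne⟩ := h
  have h1 : (e.symm ⟨f, hf⟩ : T.domain) ∈ LinearMap.ker (shifted T l) := (e.symm ⟨f, hf⟩).2
  have h2 : e.symm ⟨f, hf⟩ = 0 := Subtype.ext ((Submodule.eq_bot_iff _).1 h0 _ h1)
  rw [LinearEquiv.map_eq_zero_iff] at h2
  exact hne (congrArg Subtype.val h2)

lemma mem_essLine_iff (τ : ℝ) (l : ℂ) : l ∈ essLine τ ↔ (l + 1 / τ).re = 0 := by
  have : ((1 : ℂ) / τ).re = 1 / τ := by rw [← ofReal_one, ← ofReal_div, ofReal_re]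
  rw [essLine, mem_ofPred_eq, add_re, this]
  constructor <;> intro h <;> linarith

lemma IsKinetic.essLine_subset (hT : IsKinetic T τ ξ U) (hτ : 0 < τ) (hξ : Measurable ξ) {q : E3}
    (hq : q ≠ 0) (hs : InSupport ν ξ q) : essLine τ ⊆ essSpectrum T := fun l hl hF =>
  not_isClosed_relRange_line hτ ((mem_essLine_iff τ l).1 hl) hξ hq hs
    ((hT.isClosed_range_iff l).1 hF.1)

/-- The spectrum off the line. -/
lemma IsKinetic.opSpectrum_subset (hT : IsKinetic T τ ξ U) (hτ : 0 < τ) (hξ : Measurable ξ)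
    (h : ∀ z : ℂ, z.re ≠ 0 → (∀ k, fibreDet τ z (ξ k) ≠ 0) →
      ∀ r, ∃ δ > 0, ∀ k, ‖ξ k‖ ≤ r → δ ≤ ‖fibreDet τ z (ξ k)‖) :
    opSpectrum T ⊆ essLine τ ∪ ⋃ k, modesAt modeValue modeCrit τ ‖ξ k‖ := by
  intro l hl
  by_contra hcon
  rw [Set.mem_union, not_or, mem_essLine_iff, Set.mem_iUnion] at hcon
  obtain ⟨h1, h2⟩ := hcon
  push Not at h2
  have h3 : ∀ k, fibreDet τ (l + 1 / τ) (ξ k) ≠ 0 := fun k h0 =>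
    h2 k ((fibreDet_eq_zero_iff hτ h1 _).1 h0)
  refine hl (hT.isResolventPoint ?_)
  have := exists_resolvent_of_fibreDet (ν := ν) τ h1 hξ MeasurableSet.univ
    (fun r => by simpa using h _ h1 h3 r)
  simpa using this

lemma re_of_mem_modesAt (hτ : 0 < τ) {k : ℝ} (hk : 0 ≤ k) {l : ℂ}
    (hl : l ∈ modesAt modeValue modeCrit τ k) : -(1 / τ) < l.re := by
  obtain ⟨N, hN, rfl⟩ := hl
  have h1 : τ * k < modeCrit N := by rw [lt_div_iff₀ hτ] at hN; linarith
  have h2 := (modeValue_re (N := N) (mul_nonneg hτ.le hk) h1).1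
  rw [div_ofReal_re, lt_div_iff₀ hτ]
  have : -(1 / τ) * τ = -1 := by field_simp
  linarith

lemma IsKinetic.modes_subset (hT : IsKinetic T τ ξ U) (hτ : 0 < τ) (hξ : Measurable ξ)
    (hs : ∀ k, InSupport ν ξ (ξ k)) :
    (⋃ k, modesAt modeValue modeCrit τ ‖ξ k‖) ⊆ opSpectrum T := by
  intro l hl
  obtain ⟨k, hk⟩ := Set.mem_iUnion.1 hl
  have h1 := re_of_mem_modesAt hτ (norm_nonneg _) hk
  have h2 : (l + 1 / τ).re ≠ 0 := fun h => by
    rw [← mem_essLine_iff, essLine, mem_ofPred_eq] at h; linarith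
  exact hT.not_isResolventPoint fun ε hε =>
    exists_mode_approx hτ h2 hξ ((fibreDet_eq_zero_iff hτ h2 _).2 hk) (hs k) hε

end Transport

section Discrete

variable {H : Type*} [NormedAddCommGroup H] [InnerProductSpace ℂ H]
variable {K : Type*} [MeasurableSpace K] [MeasurableSingletonClass K] [Countable K]
variable {T : H →ₗ.[ℂ] H} {τ : ℝ} {ξ : K → E3}
  {U : H ≃ₗᵢ[ℂ] Lp ℂ 2 ((Measure.count : Measure K).prod maxwellian)}

omit [Countable K] in
lemma inSupport_count (ξ : K → E3) (k : K) : InSupport Measure.count ξ (ξ k) := fun N _ hN =>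
  ⟨{k}, measurableSet_singleton k, by rintro _ rfl; exact hN, by simp, by simp⟩

omit [MeasurableSpace K] [MeasurableSingletonClass K] [Countable K] in
lemma exists_det_bound (hfin : ∀ r, {k | ‖ξ k‖ ≤ r}.Finite) (z : ℂ) {s : Set K}
    (h : ∀ k ∈ s, fibreDet τ z (ξ k) ≠ 0) (r : ℝ) :
    ∃ δ > 0, ∀ k ∈ s, ‖ξ k‖ ≤ r → δ ≤ ‖fibreDet τ z (ξ k)‖ := by
  have hf : (s ∩ {k | ‖ξ k‖ ≤ r}).Finite := (hfin r).inter_of_right _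
  rcases (s ∩ {k | ‖ξ k‖ ≤ r}).eq_empty_or_nonempty with he | hne
  · refine ⟨1, one_pos, fun k hk hr => ?_⟩
    have : k ∈ s ∩ {k | ‖ξ k‖ ≤ r} := ⟨hk, hr⟩
    rw [he] at this
    exact this.elim
  · obtain ⟨k₀, hk₀, hm⟩ := Set.exists_min_image _ (fun k => ‖fibreDet τ z (ξ k)‖) hf hne
    exact ⟨_, norm_pos_iff.2 (h k₀ hk₀.1), fun k hk hr => hm k ⟨hk, hr⟩⟩

lemma IsKinetic.opSpectrum_subset_of_discrete (hT : IsKinetic T τ ξ U) (hτ : 0 < τ)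
    (hfin : ∀ r, {k | ‖ξ k‖ ≤ r}.Finite) :
    opSpectrum T ⊆ essLine τ ∪ ⋃ k, modesAt modeValue modeCrit τ ‖ξ k‖ :=
  hT.opSpectrum_subset hτ (measurable_of_countable ξ) fun z _ h r => by
    simpa using exists_det_bound hfin z (s := Set.univ) (fun k _ => h k) r

/-- Off the line the operator is Fredholm. -/
lemma IsKinetic.fredholm_off_line (hT : IsKinetic T τ ξ U) (hfin : ∀ r, {k | ‖ξ k‖ ≤ r}.Finite)
    {l : ℂ} (hl : l ∉ essLine τ) :
    IsSemiFredholmAt T l ∧ FiniteDimensional ℂ (LinearMap.ker (shifted T l)) := by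
  rw [mem_essLine_iff] at hl
  obtain ⟨r, hr⟩ := exists_fibreDet_ge τ hl
  have hξ := measurable_of_countable ξ
  have hF : {k | fibreDet τ (l + 1 / τ) (ξ k) = 0}.Finite := by
    refine (hfin r).subset fun k hk => ?_
    rw [mem_ofPred_eq] at hk ⊢
    by_contra hcon
    have := hr (ξ k) (not_le.1 hcon).le
    rw [hk, norm_zero] at this
    norm_num at this
  set F := hF.toFinset with hFdef
  have hFm : MeasurableSet (F : Set K) := F.measurableSet
  have hw := bddMeas_indicator hFm (1 / τ : ℂ)
  have hR := exists_resolvent_of_fibreDet (ν := (Measure.count : Measure K)) τ hl hξ hFm.compl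
    (exists_det_bound hfin (l + 1 / τ) fun k hk => by simpa [hFdef] using hk)
  obtain ⟨R, hR⟩ := hR
  have key := fredholm_kinRel hw hR (finiteDimensional_range_mulOp (F := F) (by simp) hw
    fun k hk => indicator_of_notMem (by simpa using hk) _)
  have e : (fun k => (F : Set K)ᶜ.indicator (fun _ => (1 / τ : ℂ)) k +
      (F : Set K).indicator (fun _ => (1 / τ : ℂ)) k) = fun _ => (1 / τ : ℂ) := by
    funext k
    exact congrFun ((F : Set K).indicator_compl_add_self fun _ => (1 / τ : ℂ)) k
  rw [e] at key
  exact ⟨⟨(hT.isClosed_range_iff l).2 key.1, Or.inr ((hT.finite_quotient_iff l).2 key.2.1)⟩,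
    (hT.finite_ker_iff l).2 key.2.2⟩

lemma finite_mode : Finite Mode :=
  Finite.of_surjective (![.shear, .diff, .ac, .acConj] : Fin 4 → Mode) fun N => by
    cases N
    exacts [⟨0, rfl⟩, ⟨1, rfl⟩, ⟨2, rfl⟩, ⟨3, rfl⟩]

omit [MeasurableSpace K] [MeasurableSingletonClass K] [Countable K] in
lemma finite_modes (hfin : ∀ r, {k | ‖ξ k‖ ≤ r}.Finite) (τ : ℝ) :
    (⋃ k, modesAt modeValue modeCrit τ ‖ξ k‖).Finite := by
  have := finite_mode
  refine (Set.finite_iUnion fun N => (hfin (modeCrit N / τ)).image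
    fun k => modeValue N (τ * ‖ξ k‖) / (τ : ℂ)).subset fun l hl => ?_
  obtain ⟨k, N, hk, rfl⟩ := Set.mem_iUnion.1 hl
  exact Set.mem_iUnion.2 ⟨N, k, hk.le, rfl⟩

omit [MeasurableSpace K] [MeasurableSingletonClass K] [Countable K] in
lemma notMem_essLine_of_mem_modes (hτ : 0 < τ) {l : ℂ}
    (hl : l ∈ ⋃ k, modesAt modeValue modeCrit τ ‖ξ k‖) : -(1 / τ) < l.re := by
  obtain ⟨k, hk⟩ := Set.mem_iUnion.1 hl
  exact re_of_mem_modesAt hτ (norm_nonneg _) hk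

lemma IsKinetic.modes_subset_discSpectrum (hT : IsKinetic T τ ξ U) (hτ : 0 < τ)
    (hfin : ∀ r, {k | ‖ξ k‖ ≤ r}.Finite) :
    (⋃ k, modesAt modeValue modeCrit τ ‖ξ k‖) ⊆ discSpectrum T := by
  intro l hl
  have hξ := measurable_of_countable ξ
  have h1 := notMem_essLine_of_mem_modes hτ hl
  have hnl : l ∉ essLine τ := fun h => by rw [essLine, mem_ofPred_eq] at h; linarith
  have h2 : (l + 1 / τ).re ≠ 0 := fun h => hnl ((mem_essLine_iff τ l).2 h)
  obtain ⟨k, hk⟩ := Set.mem_iUnion.1 hl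
  refine ⟨hT.ker_ne_bot (relKer_ne_bot h2 hξ ((fibreDet_eq_zero_iff hτ h2 _).2 hk) (by simp)
    (by simp)), (hT.fredholm_off_line hfin hnl).2,
    {x : ℂ | -(1 / τ) < x.re} ∩ ((⋃ k, modesAt modeValue modeCrit τ ‖ξ k‖) \ {l})ᶜ,
    Filter.inter_mem ((isOpen_lt continuous_const continuous_re).mem_nhds h1)
      (((finite_modes hfin τ).subset Set.sdiff_subset).isClosed.isOpen_compl.mem_nhds (by simp)), ?_⟩
  ext x
  rw [Set.mem_singleton_iff]
  constructor
  · rintro ⟨⟨hx1, hx2⟩, hx3⟩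
    rcases hT.opSpectrum_subset_of_discrete hτ hfin hx3 with h | h
    · rw [essLine, mem_ofPred_eq] at h
      rw [mem_ofPred_eq] at hx1
      linarith
    · by_contra hne
      exact hx2 ⟨h, hne⟩
  · rintro rfl
    exact ⟨⟨h1, by simp⟩, hT.modes_subset hτ hξ (inSupport_count ξ) hl⟩

/-- The spectrum for a discrete set of wave vectors, not all zero. -/
theorem IsKinetic.spectrum_of_discrete (hT : IsKinetic T τ ξ U) (hτ : 0 < τ)
    (hfin : ∀ r, {k | ‖ξ k‖ ≤ r}.Finite) {k₀ : K} (hk₀ : ξ k₀ ≠ 0) :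
    opSpectrum T = essLine τ ∪ ⋃ k, modesAt modeValue modeCrit τ ‖ξ k‖ ∧
      essSpectrum T = essLine τ ∧ discSpectrum T = ⋃ k, modesAt modeValue modeCrit τ ‖ξ k‖ := by
  have hline := hT.essLine_subset hτ (measurable_of_countable ξ) hk₀ (inSupport_count ξ k₀)
  refine ⟨Set.Subset.antisymm (hT.opSpectrum_subset_of_discrete hτ hfin) (Set.union_subset
      (hline.trans (essSpectrum_subset T))
      (hT.modes_subset hτ (measurable_of_countable ξ) (inSupport_count ξ))),
    Set.Subset.antisymm (fun l hl => ?_) hline,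
    Set.Subset.antisymm (fun l hl => ?_) (hT.modes_subset_discSpectrum hτ hfin)⟩
  · by_contra h
    exact hl (hT.fredholm_off_line hfin h).1
  · refine (hT.opSpectrum_subset_of_discrete hτ hfin (discSpectrum_subset T hl)).resolve_left ?_
    intro hlin
    obtain ⟨-, -, V, hV, hVl⟩ := hl
    obtain ⟨ε, hε, hball⟩ := Metric.mem_nhds_iff.1 hV
    have h1 : l + (ε / 2 : ℝ) * I ∈ V ∩ opSpectrum T := by
      refine ⟨hball ?_, essSpectrum_subset T (hline ?_)⟩
      · rw [Metric.mem_ball, dist_eq_norm, add_sub_cancel_left, norm_mul, norm_I, mul_one,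
          norm_real, norm_of_nonneg (by positivity)]
        linarith
      · rw [essLine, mem_ofPred_eq] at hlin ⊢
        simpa using hlin
    rw [hVl, Set.mem_singleton_iff, add_eq_left, mul_eq_zero, ofReal_eq_zero] at h1
    rcases h1 with h1 | h1
    · linarith
    · exact I_ne_zero h1

end Discrete

/-! ### The operator at a fixed wave vector -/

section Fibre

lemma projOp_ae_eq_proj5 {K : Type*} [MeasurableSpace K] {ν : Measure K} [SigmaFinite ν]
    (f : KinL2 ν) :
    projOp ν f =ᵐ[ν.prod maxwellian] fun p => proj5 (fun w => f (p.1, w)) p.2 := by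
  filter_upwards [projOp_coe f, ae_fst (μ := maxwellian) (ae_all_iff.2 fun j => mom_coe j f)]
    with p h1 h2
  rw [h1]
  simp only [h2]
  rfl

variable {H : Type*} [NormedAddCommGroup H] [InnerProductSpace ℂ H] {τ : ℝ}

lemma isKinetic_toLinearPMap {K : Type*} [MeasurableSpace K] {ν : Measure K} [SigmaFinite ν]
    {ξ : K → E3} {U : H ≃ₗᵢ[ℂ] KinL2 ν} {G : Submodule ℂ (H × H)}
    (hG : ∀ f g, (f, g) ∈ G ↔ KinRel (kinSymbol (1 / τ) ξ) (fun _ => (1 / τ : ℂ)) (U f) (U g)) :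
    IsKinetic G.toLinearPMap τ ξ U := by
  have hfun : ∀ x ∈ G, x.1 = 0 → x.2 = 0 := by
    rintro ⟨f, g⟩ hx rfl
    have h1 := (hG _ _).1 hx
    rw [map_zero] at h1
    rw [← map_eq_zero_iff U U.injective]
    unfold KinRel at h1
    rw [map_zero] at h1
    apply Lp.ext
    filter_upwards [h1, Lp.coeFn_zero ℂ 2 (ν.prod maxwellian)] with p h2 h3
    rw [h2, h3, Pi.zero_apply, mul_zero, mul_zero, add_zero]
  intro f g
  rw [G.toLinearPMap_graph_eq hfun]
  exact hG f g

lemma measurePreserving_snd_unit :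
    MeasurePreserving Prod.snd ((Measure.count : Measure Unit).prod maxwellian) maxwellian := by
  have : IsProbabilityMeasure (Measure.count : Measure Unit) :=
    ⟨by rw [Unique.count_eq_dirac]; exact measure_univ⟩
  exact measurePreserving_snd

lemma measurePreserving_mk_unit :
    MeasurePreserving (Prod.mk ()) maxwellian ((Measure.count : Measure Unit).prod maxwellian) :=
  ⟨measurable_prodMk_left, by rw [Unique.count_eq_dirac, Measure.dirac_prod]⟩

/-- `L²(maxwellian)` as an `L²` space over a one-point set of wave vectors. -/
def unitL2 : VelocityL2 ≃ₗᵢ[ℂ] KinL2 (Measure.count : Measure Unit) :=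
  LinearIsometryEquiv.ofSurjective
    (Lp.compMeasurePreservingₗᵢ ℂ Prod.snd measurePreserving_snd_unit) fun f => by
      refine ⟨Lp.compMeasurePreserving (Prod.mk ()) measurePreserving_mk_unit f, ?_⟩
      apply Lp.ext
      refine (Lp.coeFn_compMeasurePreserving _ measurePreserving_snd_unit).trans ?_
      exact measurePreserving_snd_unit.quasiMeasurePreserving.ae
        (Lp.coeFn_compMeasurePreserving f measurePreserving_mk_unit)

lemma unitL2_coe (f : VelocityL2) :
    unitL2 f =ᵐ[(Measure.count : Measure Unit).prod maxwellian] fun p => f p.2 :=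
  Lp.coeFn_compMeasurePreserving _ measurePreserving_snd_unit

lemma isKinetic_fibreOperator (τ : ℝ) (k : E3) :
    IsKinetic (fibreOperator τ k) τ (fun _ : Unit => k) unitL2 := by
  refine isKinetic_toLinearPMap fun f g => ?_
  have e1 : (∀ᵐ v ∂maxwellian, g v = -I * ((⟪v, k⟫_ℝ : ℝ) : ℂ) * f v - (1 / τ : ℂ) * f v +
      (1 / τ : ℂ) * proj5 f v) ↔ ∀ᵐ p ∂(Measure.count : Measure Unit).prod maxwellian,
      g p.2 = -I * ((⟪p.2, k⟫_ℝ : ℝ) : ℂ) * f p.2 - (1 / τ : ℂ) * f p.2 +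
      (1 / τ : ℂ) * proj5 f p.2 :=
    ⟨fun h => ae_snd h, fun h => measurePreserving_mk_unit.quasiMeasurePreserving.ae h⟩
  refine e1.trans (Filter.eventually_congr ?_)
  have e2 : ∀ᵐ v ∂maxwellian, unitL2 f ((), v) = f v :=
    measurePreserving_mk_unit.quasiMeasurePreserving.ae (unitL2_coe f)
  filter_upwards [unitL2_coe f, unitL2_coe g, projOp_ae_eq_proj5 (unitL2 f)] with p h1 h2 h3
  rw [h1, h2, h3, proj5_congr e2]
  simp only [kinSymbol, velSymbol]
  constructor <;> intro h <;> linear_combination h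

lemma not_finiteDimensional_unit :
    ¬ FiniteDimensional ℂ (KinL2 (Measure.count : Measure Unit)) := fun _ =>
  not_finiteDimensional_velocityL2 unitL2.symm.toLinearEquiv.finiteDimensional

lemma infinite_of_finite_range {V : Type*} [AddCommGroup V] [Module ℂ V]
    (hV : ¬ FiniteDimensional ℂ V) (L : V →ₗ[ℂ] V) (hL : FiniteDimensional ℂ (LinearMap.range L)) :
    ¬ FiniteDimensional ℂ (LinearMap.ker L) ∧
      ∀ S ≤ LinearMap.range L, ¬ FiniteDimensional ℂ (V ⧸ S) := by
  constructor
  · intro h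
    have : FiniteDimensional ℂ (V ⧸ LinearMap.ker L) := L.quotKerEquivRange.symm.finiteDimensional
    exact hV (Module.Finite.of_submodule_quotient (LinearMap.ker L))
  · intro S hS h
    have : FiniteDimensional ℂ S := Submodule.finiteDimensional_of_le hS
    exact hV (Module.Finite.of_submodule_quotient S)

lemma kinRel_zero_iff (f g : KinL2 (Measure.count : Measure Unit)) :
    KinRel (kinSymbol (-(1 / τ : ℂ) + 1 / τ) fun _ : Unit => (0 : E3)) (fun _ => (1 / τ : ℂ)) f g ↔
      g = mulOp _ (fun _ => (1 / τ : ℂ)) (projOp Measure.count f) := by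
  rw [Lp.ext_iff]
  refine Filter.eventually_congr ?_
  filter_upwards [mulOp_coe (bddMeas_const (1 / τ : ℂ)) (projOp Measure.count f)] with p hp
  rw [hp, neg_add_cancel]
  simp [kinSymbol, velSymbol]

lemma finite_range_zero (τ : ℝ) : FiniteDimensional ℂ (LinearMap.range
    ((mulOp ((Measure.count : Measure Unit).prod maxwellian) fun _ => (1 / τ : ℂ)).comp
      (projOp Measure.count)).toLinearMap) := by
  have h := finiteDimensional_range_mulOp (K := Unit) (ν := Measure.count) (F := Finset.univ)
    (w := fun _ => (1 / τ : ℂ)) (by simp) (bddMeas_const (1 / τ : ℂ)) (by simp)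
  exact h

lemma infinite_relKer_zero (τ : ℝ) : ¬ FiniteDimensional ℂ (relKer (Measure.count : Measure Unit)
    (kinSymbol (-(1 / τ : ℂ) + 1 / τ) fun _ : Unit => (0 : E3)) (fun _ => (1 / τ : ℂ))) := by
  intro h
  refine (infinite_of_finite_range not_finiteDimensional_unit _ (finite_range_zero τ)).1
    (Submodule.finiteDimensional_of_le (S₂ := relKer (Measure.count : Measure Unit)
    (kinSymbol (-(1 / τ : ℂ) + 1 / τ) fun _ : Unit => (0 : E3)) (fun _ => (1 / τ : ℂ))) ?_)
  intro f hf
  exact (kinRel_zero_iff f 0).2 (LinearMap.mem_ker.1 hf).symm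

lemma infinite_relRange_zero (τ : ℝ) :
    ¬ FiniteDimensional ℂ (_ ⧸ relRange (Measure.count : Measure Unit)
      (kinSymbol (-(1 / τ : ℂ) + 1 / τ) fun _ : Unit => (0 : E3)) (fun _ => (1 / τ : ℂ))) := by
  refine (infinite_of_finite_range not_finiteDimensional_unit _ (finite_range_zero τ)).2 _ ?_
  rintro g ⟨f, hf⟩
  exact LinearMap.mem_range.2 ⟨f, ((kinRel_zero_iff f g).1 hf).symm⟩

lemma not_fredholm_zero (τ : ℝ) :
    ¬ IsSemiFredholmAt (fibreOperator τ 0) (-(1 / τ : ℂ)) ∧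
      ¬ FiniteDimensional ℂ (LinearMap.ker (shifted (fibreOperator τ 0) (-(1 / τ : ℂ)))) := by
  have hker := mt ((isKinetic_fibreOperator τ 0).finite_ker_iff _).1 (infinite_relKer_zero τ)
  exact ⟨fun h => mt ((isKinetic_fibreOperator τ 0).finite_quotient_iff _).1
    (infinite_relRange_zero τ) (h.2.resolve_left hker), hker⟩

lemma isResolventPoint_zero (hτ : 0 < τ) {l : ℂ} (hl : l ∈ essLine τ) (hne : l ≠ -(1 / τ : ℂ)) :
    IsResolventPoint (fibreOperator τ 0) l := by
  rw [mem_essLine_iff] at hl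
  set z := l + 1 / τ with hz
  have hz0 : z ≠ 0 := fun h => hne (eq_neg_of_add_eq_zero_left h)
  have hsym : ∀ k, symMat (kinSymbol z fun _ : Unit => (0 : E3)) k = z⁻¹ • 1 := by
    intro k
    rw [← mulMatrix_const, symMat]
    congr 1
    funext v
    simp [kinSymbol, velSymbol]
  have h1 : 1 - (1 / τ : ℂ) * z⁻¹ ≠ 0 := by
    intro h
    have h2 : (τ : ℂ) ≠ 0 := by exact_mod_cast hτ.ne'
    have h3 : z = 1 / τ := by field_simp at h ⊢; linear_combination h
    rw [h3, ← ofReal_one, ← ofReal_div, ofReal_re] at hl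
    exact (one_div_pos.2 hτ).ne' hl
  refine (isKinetic_fibreOperator τ 0).isResolventPoint
    (exists_kin_resolvent (measurable_kinSymbol z measurable_const) (norm_pos_iff.2 hz0)
      (fun p => by
        simp only [kinSymbol, velSymbol, inner_zero_right, ofReal_zero, mul_zero, add_zero]
        exact le_rfl) (bddMeas_const _)
      (fun _ => (1 - (1 / τ : ℂ) * z⁻¹)⁻¹ • 1) (fun i j => bddMeas_const _) fun k => ?_)
  rw [hsym, smul_smul]
  have : (1 : Matrix (Fin 5) (Fin 5) ℂ) - ((1 / τ : ℂ) * z⁻¹) • 1 = (1 - (1 / τ : ℂ) * z⁻¹) • 1 := by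
    rw [sub_smul, one_smul]
  rw [this, smul_mul_smul_comm, mul_inv_cancel₀ h1, one_smul, one_mul]

/-- The spectrum at a fixed wave vector. -/
theorem spectrum_fibreOperator (hτ : 0 < τ) (k : E3) :
    opSpectrum (fibreOperator τ k) =
        essSpectrum (fibreOperator τ k) ∪ discSpectrum (fibreOperator τ k) ∧
      (k ≠ 0 → essSpectrum (fibreOperator τ k) = essLine τ) ∧
      (k = 0 → essSpectrum (fibreOperator τ k) = {-(1 / τ : ℂ)}) ∧
      discSpectrum (fibreOperator τ k) = modesAt modeValue modeCrit τ ‖k‖ ∧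
      (discSpectrum (fibreOperator τ k)).Finite := by
  have hT := isKinetic_fibreOperator τ k
  have hfin : ∀ r, {u : Unit | ‖(fun _ : Unit => k) u‖ ≤ r}.Finite := fun r => Set.toFinite _
  have hmodes : (⋃ u : Unit, modesAt modeValue modeCrit τ ‖(fun _ : Unit => k) u‖) =
      modesAt modeValue modeCrit τ ‖k‖ := Set.iUnion_const _
  have hfm := finite_modes hfin τ
  rw [hmodes] at hfm
  rcases eq_or_ne k 0 with rfl | hk
  · have hsub := hT.opSpectrum_subset_of_discrete hτ hfin
    have hdisc := hT.modes_subset_discSpectrum hτ hfin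
    rw [hmodes] at hsub hdisc
    obtain ⟨hnf, hnk⟩ := not_fredholm_zero τ
    have hess : essSpectrum (fibreOperator τ 0) = {-(1 / τ : ℂ)} := by
      refine Set.Subset.antisymm (fun l hl => ?_) (by rintro _ rfl; exact hnf)
      by_contra hne
      by_cases hlin : l ∈ essLine τ
      · exact essSpectrum_subset _ hl (isResolventPoint_zero hτ hlin hne)
      · exact hl (hT.fredholm_off_line hfin hlin).1
    have hop : opSpectrum (fibreOperator τ 0) ⊆ {-(1 / τ : ℂ)} ∪ modesAt modeValue modeCrit τ ‖(0 : E3)‖ := by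
      intro l hl
      rcases hsub hl with h | h
      · left
        by_contra hne
        exact hl (isResolventPoint_zero hτ h hne)
      · exact Or.inr h
    have hd : discSpectrum (fibreOperator τ 0) = modesAt modeValue modeCrit τ ‖(0 : E3)‖ := by
      refine Set.Subset.antisymm (fun l hl => ?_) hdisc
      refine (hop (discSpectrum_subset _ hl)).resolve_left ?_
      rintro rfl
      exact hnk hl.2.1
    refine ⟨?_, fun h => absurd rfl h, fun _ => hess, hd, hd ▸ hfm⟩
    rw [hd, hess]
    refine Set.Subset.antisymm hop (Set.union_subset ?_ ?_)
    · rw [← hess]; exact essSpectrum_subset _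
    · rw [← hd]; exact discSpectrum_subset _
  · obtain ⟨h1, h2, h3⟩ := hT.spectrum_of_discrete hτ hfin (k₀ := ()) hk
    rw [hmodes] at h1 h3
    exact ⟨by rw [h1, h2, h3], fun _ => h2, fun h => absurd h hk, h3, h3 ▸ hfm⟩

end Fibre

section TensorBasis

variable {K V : Type*} [MeasurableSpace K] [MeasurableSpace V] {ν : Measure K} {μ : Measure V}
  [SigmaFinite ν] [SigmaFinite μ]

lemma ae_memLp_section (f : Lp ℂ 2 (ν.prod μ)) : ∀ᵐ k ∂ν, MemLp (fun v => f (k, v)) 2 μ := by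
  have hm := Lp.memLp f
  filter_upwards [hm.1.prodMk_left, (hm.integrable_norm_pow (by norm_num)).prod_right_ae]
    with x h1 h2
  rw [memLp_two_iff_integrable_sq_norm h1]
  simpa using h2

/-- The elementary tensors are total. -/
lemma eq_zero_of_tens [TopologicalSpace.SeparableSpace (Lp ℂ 2 μ)] {f : Lp ℂ 2 (ν.prod μ)}
    (h : ∀ u g, ⟪tens u g, f⟫_ℂ = 0) : f = 0 := by
  have h1 : ∀ g : Lp ℂ 2 μ, ∀ᵐ k ∂ν, ∫ v, f (k, v) * conj (g v) ∂μ = 0 := by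
    intro g
    have h2 : (tensL ν g).adjoint f = 0 := ext_inner_left ℂ fun u => by
      rw [adjoint_inner_right, tensL_apply, h, inner_zero_right]
    have h3 := adjoint_tensL_coe g f
    rw [h2] at h3
    filter_upwards [h3, Lp.coeFn_zero ℂ 2 ν] with k h4 h5
    rw [← h4, h5, Pi.zero_apply]
  have h2 : ∀ᵐ k ∂ν, ∀ᵐ v ∂μ, f (k, v) = 0 := by
    filter_upwards [ae_memLp_section f,
      ae_all_iff.2 fun n => h1 (TopologicalSpace.denseSeq (Lp ℂ 2 μ) n)] with k hk hn
    have h3 : hk.toLp _ = 0 := by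
      refine (TopologicalSpace.denseRange_denseSeq (Lp ℂ 2 μ)).eq_zero_of_inner_right ℂ fun n => ?_
      rw [inner_Lp_eq, ← hn n]
      refine integral_congr_ae ?_
      filter_upwards [hk.coeFn_toLp] with v hv
      rw [hv, mul_comm]
    have h4 := hk.coeFn_toLp
    rw [h3] at h4
    filter_upwards [h4, Lp.coeFn_zero ℂ 2 μ] with v h5 h6
    rw [← h5, h6, Pi.zero_apply]
  apply Lp.ext
  have hms : MeasurableSet {p | f p = 0} :=
    (Lp.stronglyMeasurable f).measurable (measurableSet_singleton 0)
  have h3 := (Measure.ae_prod_iff_ae_ae hms).2 h2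
  filter_upwards [h3, Lp.coeFn_zero ℂ 2 (ν.prod μ)] with p h4 h5
  rw [h4, h5, Pi.zero_apply]

lemma eq_zero_of_total [TopologicalSpace.SeparableSpace (Lp ℂ 2 μ)] {f : Lp ℂ 2 (ν.prod μ)}
    {S : Set (Lp ℂ 2 ν)} {S' : Set (Lp ℂ 2 μ)} (hS : ∀ x, (∀ s ∈ S, ⟪s, x⟫_ℂ = 0) → x = 0)
    (hS' : ∀ x, (∀ s ∈ S', ⟪s, x⟫_ℂ = 0) → x = 0) (h : ∀ s ∈ S, ∀ t ∈ S', ⟪tens s t, f⟫_ℂ = 0) :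
    f = 0 := by
  refine eq_zero_of_tens fun u g => ?_
  have h1 : ∀ t ∈ S', ∀ u, ⟪tens u t, f⟫_ℂ = 0 := by
    intro t ht u
    rw [← tensL_apply, ← adjoint_inner_right, hS ((tensL ν t).adjoint f),
      inner_zero_right]
    intro s hs
    rw [adjoint_inner_right, tensL_apply, h s hs t ht]
  rw [← tensR_apply, ← adjoint_inner_right, hS' ((tensR μ u).adjoint f),
    inner_zero_right]
  intro t ht
  rw [adjoint_inner_right, tensR_apply, h1 t ht]

lemma HilbertBasis.eq_zero_of_inner {ι E : Type*} [NormedAddCommGroup E] [InnerProductSpace ℂ E]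
    (b : HilbertBasis ι ℂ E) {x : E} (h : ∀ s ∈ Set.range b, ⟪s, x⟫_ℂ = 0) : x = 0 := by
  rw [← b.repr.map_eq_zero_iff]
  ext i
  rw [b.repr_apply_apply, h _ ⟨i, rfl⟩]
  rfl

/-- The tensor product of two Hilbert bases. -/
def tensBasis [TopologicalSpace.SeparableSpace (Lp ℂ 2 μ)] {ι κ : Type*}
    (b : HilbertBasis ι ℂ (Lp ℂ 2 ν)) (c : HilbertBasis κ ℂ (Lp ℂ 2 μ)) :
    HilbertBasis (ι × κ) ℂ (Lp ℂ 2 (ν.prod μ)) :=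
  HilbertBasis.mkOfOrthogonalEqBot (v := fun i => tens (b i.1) (c i.2)) (by
    classical
    rw [orthonormal_iff_ite]
    intro i j
    rw [inner_tens, orthonormal_iff_ite.1 b.orthonormal, orthonormal_iff_ite.1 c.orthonormal]
    by_cases h1 : i.1 = j.1 <;> by_cases h2 : i.2 = j.2 <;> simp [h1, h2, Prod.ext_iff]) (by
    rw [Submodule.eq_bot_iff]
    intro f hf
    rw [Submodule.mem_orthogonal] at hf
    refine eq_zero_of_total (fun x => HilbertBasis.eq_zero_of_inner b)
      (fun x => HilbertBasis.eq_zero_of_inner c) ?_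
    rintro _ ⟨i, rfl⟩ _ ⟨j, rfl⟩
    exact hf _ (Submodule.subset_span ⟨(i, j), rfl⟩))

lemma tensBasis_apply [TopologicalSpace.SeparableSpace (Lp ℂ 2 μ)] {ι κ : Type*}
    (b : HilbertBasis ι ℂ (Lp ℂ 2 ν)) (c : HilbertBasis κ ℂ (Lp ℂ 2 μ)) (i : ι × κ) :
    tensBasis b c i = tens (b i.1) (c i.2) := by
  rw [tensBasis, HilbertBasis.coe_mkOfOrthogonalEqBot]

variable {K' : Type*} [MeasurableSpace K'] {ν' : Measure K'} [SigmaFinite ν']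

/-- A unitary map between `L²` spaces, acting on the first variable. -/
theorem exists_tensor_unitary [TopologicalSpace.SeparableSpace (Lp ℂ 2 μ)]
    (U₀ : Lp ℂ 2 ν' ≃ₗᵢ[ℂ] Lp ℂ 2 ν) :
    ∃ U : Lp ℂ 2 (ν'.prod μ) ≃ₗᵢ[ℂ] Lp ℂ 2 (ν.prod μ), ∀ u g, U (tens u g) = tens (U₀ u) g := by
  classical
  obtain ⟨w, b, -⟩ := exists_hilbertBasis ℂ (Lp ℂ 2 ν')
  obtain ⟨w', c, -⟩ := exists_hilbertBasis ℂ (Lp ℂ 2 μ)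
  set b' : HilbertBasis w ℂ (Lp ℂ 2 ν) := HilbertBasis.ofRepr (U₀.symm.trans b.repr) with hb'
  have hb : ∀ i, b' i = U₀ (b i) := fun i => by
    rw [← HilbertBasis.repr_symm_single, ← HilbertBasis.repr_symm_single]; rfl
  set U := (tensBasis b c).repr.trans (tensBasis b' c).repr.symm with hU
  have h0 : ∀ i j, U (tens (b i) (c j)) = tens (U₀ (b i)) (c j) := by
    intro i j
    have e1 := tensBasis_apply b c (i, j)
    have e2 := tensBasis_apply b' c (i, j)
    simp only at e1 e2
    rw [← e1, ← hb, ← e2, hU, LinearIsometryEquiv.trans_apply, HilbertBasis.repr_self,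
      HilbertBasis.repr_symm_single]
  have hdb := Submodule.dense_iff_topologicalClosure_eq_top.2 b.dense_span
  have hdc := Submodule.dense_iff_topologicalClosure_eq_top.2 c.dense_span
  have h1 : ∀ j u, U (tens u (c j)) = tens (U₀ u) (c j) := by
    intro j u
    have : (U.toContinuousLinearEquiv : _ →L[ℂ] Lp ℂ 2 (ν.prod μ)).comp (tensL ν' (c j)) =
        (tensL ν (c j)).comp (U₀.toContinuousLinearEquiv : _ →L[ℂ] Lp ℂ 2 ν) :=
      ContinuousLinearMap.ext_on hdb (by rintro _ ⟨i, rfl⟩; exact h0 i j)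
    exact congrArg (fun L => L u) this
  refine ⟨U, fun u g => ?_⟩
  have : (U.toContinuousLinearEquiv : _ →L[ℂ] Lp ℂ 2 (ν.prod μ)).comp (tensR μ u) =
      tensR μ (U₀ u) :=
    ContinuousLinearMap.ext_on hdc (by rintro _ ⟨j, rfl⟩; exact h1 j u)
  exact congrArg (fun L => L g) this

end TensorBasis

section Intertwining

variable {K X : Type*} [MeasurableSpace K] [MeasurableSpace X] {ν : Measure K} {ρ : Measure X}
  [SigmaFinite ν] [SigmaFinite ρ]

lemma projOp_unitary (U₀ : Lp ℂ 2 ρ ≃ₗᵢ[ℂ] Lp ℂ 2 ν)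
    (U : Lp ℂ 2 (ρ.prod maxwellian) ≃ₗᵢ[ℂ] KinL2 ν)
    (hU : ∀ u g, U (tens u g) = tens (U₀ u) g) (f : Lp ℂ 2 (ρ.prod maxwellian)) :
    U (projOp ρ f) = projOp ν (U f) := by
  have h1 : ∀ j u, U (emb ρ j u) = emb ν j (U₀ u) := fun j u => hU u _
  have h2 : ∀ j, mom ν j (U f) = U₀ (mom ρ j f) := by
    intro j
    refine ext_inner_left ℂ fun x => ?_
    obtain ⟨y, rfl⟩ := U₀.surjective x
    rw [mom, adjoint_inner_right, ← h1, U.inner_map_map, U₀.inner_map_map, mom,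
      adjoint_inner_right]
  simp only [projOp, sum_apply, ContinuousLinearMap.comp_apply, map_sum, h1, h2]

instance separableSpace_velocityL2 : TopologicalSpace.SeparableSpace VelocityL2 := by
  have : Fact ((2 : ℝ≥0∞) ≠ ⊤) := ⟨by norm_num⟩
  infer_instance

end Intertwining

section TestFunctions

variable {X : Type*} [AddCommGroup X] [TopologicalSpace X] {q : E3 →+ X} {φ ψ : X × E3 → ℂ}

lemma IsTestFunction.continuous (hq : IsOpenQuotientMap q) (hφ : IsTestFunction q φ) :
    Continuous φ :=
  (hq.prodMap IsOpenQuotientMap.id).isQuotientMap.continuous_iff.2 hφ.1.continuous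

lemma IsTestFunction.conj (hφ : IsTestFunction q φ) :
    IsTestFunction q fun p => conj (φ p) :=
  ⟨conjCLE.contDiff.comp hφ.1, hφ.2.comp_left (map_zero _)⟩

lemma IsTestFunction.mul (hφ : IsTestFunction q φ) (hψ : IsTestFunction q ψ) :
    IsTestFunction q fun p => φ p * ψ p :=
  ⟨hφ.1.mul hψ.1, hφ.2.mul_right⟩

lemma IsTestFunction.hasDerivAt_lift (hφ : IsTestFunction q φ) (y v : E3) (t : ℝ) :
    HasDerivAt (fun t : ℝ => φ (q y + q (t • v), v))
      (fderiv ℝ (fun p : E3 × E3 => φ (q p.1, p.2)) (y + t • v, v) (v, 0)) t := by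
  have h1 : HasFDerivAt (fun p : E3 × E3 => φ (q p.1, p.2))
      (fderiv ℝ (fun p : E3 × E3 => φ (q p.1, p.2)) (y + t • v, v)) (y + t • v, v) :=
    (hφ.1.differentiable (by norm_num) _).hasFDerivAt
  have h2 : HasDerivAt (fun t : ℝ => (y + t • v, v)) (v, (0 : E3)) t := by
    have h3 := ((hasDerivAt_id t).smul_const v).const_add y
    rw [one_smul] at h3
    exact h3.prodMk (hasDerivAt_const t v)
  have h3 := h1.comp_hasDerivAt t h2
  simpa only [Function.comp_def, map_add] using h3

lemma IsTestFunction.streamDeriv_lift (hφ : IsTestFunction q φ) (y v : E3) :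
    streamDeriv q φ (q y, v) = fderiv ℝ (fun p : E3 × E3 => φ (q p.1, p.2)) (y, v) (v, 0) := by
  have h := (hφ.hasDerivAt_lift y v 0).deriv
  rw [zero_smul, add_zero] at h
  exact h

lemma IsTestFunction.hasDerivAt (hq : IsOpenQuotientMap q) (hφ : IsTestFunction q φ) (x : X) (v : E3)
    (t : ℝ) :
    HasDerivAt (fun t : ℝ => φ (x + q (t • v), v)) (streamDeriv q φ (x + q (t • v), v)) t := by
  obtain ⟨y, rfl⟩ := hq.surjective x
  rw [← map_add, hφ.streamDeriv_lift]
  exact hφ.hasDerivAt_lift y v t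

lemma IsTestFunction.hasDerivAt_zero (hq : IsOpenQuotientMap q) (hφ : IsTestFunction q φ)
    (p : X × E3) :
    HasDerivAt (fun t : ℝ => φ (p.1 + q (t • p.2), p.2)) (streamDeriv q φ p) 0 := by
  have h := hφ.hasDerivAt hq p.1 p.2 0
  rwa [zero_smul, map_zero, add_zero] at h

lemma streamDeriv_mul (hq : IsOpenQuotientMap q) (hφ : IsTestFunction q φ) (hψ : IsTestFunction q ψ)
    (p : X × E3) : streamDeriv q (fun p => φ p * ψ p) p =
      streamDeriv q φ p * ψ p + φ p * streamDeriv q ψ p := by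
  have h := ((hφ.hasDerivAt_zero hq p).mul (hψ.hasDerivAt_zero hq p)).deriv
  simp only [zero_smul, map_zero, add_zero] at h
  exact h

lemma streamDeriv_conj (hq : IsOpenQuotientMap q) (hφ : IsTestFunction q φ) (p : X × E3) :
    streamDeriv q (fun p => conj (φ p)) p = conj (streamDeriv q φ p) :=
  ((conjCLE : ℂ →L[ℝ] ℂ).hasFDerivAt.comp_hasDerivAt 0 (hφ.hasDerivAt_zero hq p)).deriv.trans (by simp)

variable [IsTopologicalAddGroup X]

lemma IsTestFunction.stream (hq : IsOpenQuotientMap q) (hφ : IsTestFunction q φ) :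
    IsTestFunction q (streamDeriv q φ) := by
  refine ⟨?_, hφ.2.mono' ?_⟩
  · simp only [hφ.streamDeriv_lift]
    exact (hφ.1.fderiv_right (m := ∞) (by norm_num)).clm_apply (contDiff_snd.prodMk contDiff_const)
  · intro p hp
    by_contra hcon
    apply hp
    have h1 : φ =ᶠ[𝓝 p] 0 := notMem_tsupport_iff_eventuallyEq.1 hcon
    have hc : Tendsto (fun t : ℝ => (p.1 + q (t • p.2), p.2)) (𝓝 0) (𝓝 p) := by
      have : Continuous fun t : ℝ => (p.1 + q (t • p.2), p.2) := by
        have := hq.continuous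
        fun_prop
      have h2 := this.tendsto 0
      simpa using h2
    have h2 : (fun t : ℝ => φ (p.1 + q (t • p.2), p.2)) =ᶠ[𝓝 0] fun _ => 0 := hc.eventually h1
    rw [streamDeriv, h2.deriv_eq, deriv_const]

variable [T2Space X] [MeasureSpace X] [BorelSpace X]
  [SigmaFinite (volume : Measure X)] [IsFiniteMeasureOnCompacts (volume : Measure X)]

omit [IsTopologicalAddGroup X] [T2Space X] [SigmaFinite (volume : Measure X)] in
lemma IsTestFunction.memLp (hq : IsOpenQuotientMap q) (hφ : IsTestFunction q φ) (r : ℝ≥0∞) :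
    MemLp φ r (phaseMeasure X) :=
  (hφ.continuous hq).memLp_of_hasCompactSupport hφ.2

variable [(volume : Measure X).IsAddLeftInvariant]

/-- The stream derivative of a test function integrates to zero. -/
lemma integral_streamDeriv (hq : IsOpenQuotientMap q) (hφ : IsTestFunction q φ) :
    ∫ p, streamDeriv q φ p ∂(phaseMeasure X) = 0 := by
  have hs := hφ.stream hq
  rw [phaseMeasure, integral_prod_symm _ (memLp_one_iff_integrable.1 (hs.memLp hq 1))]
  refine integral_eq_zero_of_ae (.of_forall fun v => ?_)
  change ∫ x, streamDeriv q φ (x, v) = 0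
  have hsc := hs.continuous hq
  have hφc := hφ.continuous hq
  have hqc := hq.continuous
  obtain ⟨C, hC⟩ := hs.2.exists_bound_of_continuous hsc
  have hC0 : 0 ≤ C := (norm_nonneg _).trans (hC 0)
  set Q : Set X := (fun y : X × ℝ => y.1 - q (y.2 • v)) ''
    ((Prod.fst '' tsupport (streamDeriv q φ)) ×ˢ Icc (-1) 1) with hQ
  have hQc : IsCompact Q :=
    ((hs.2.isCompact.image continuous_fst).prod isCompact_Icc).image (by fun_prop)
  have hmaps : ∀ ψ : X × E3 → ℂ, Continuous ψ → HasCompactSupport ψ →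
      HasCompactSupport fun x => ψ (x, v) := fun ψ h1 h2 =>
    HasCompactSupport.intro (h2.isCompact.image continuous_fst) fun x hx => by
      by_contra h0
      exact hx ⟨(x, v), subset_tsupport _ h0, rfl⟩
  have key := hasDerivAt_integral_of_dominated_loc_of_deriv_le (μ := (volume : Measure X))
    (F := fun t x => φ (x + q (t • v), v)) (F' := fun t x => streamDeriv q φ (x + q (t • v), v))
    (x₀ := (0 : ℝ)) (s := Metric.ball 0 1) (bound := Q.indicator fun _ => C)
    (Metric.ball_mem_nhds 0 one_pos)
    (.of_forall fun t => Continuous.aestronglyMeasurable (by fun_prop))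
    (by
      simp only [zero_smul, map_zero, add_zero]
      have hc : Continuous fun x => φ (x, v) := by fun_prop
      exact hc.integrable_of_hasCompactSupport (hmaps φ hφc hφ.2))
    (Continuous.aestronglyMeasurable (by fun_prop))
    (.of_forall fun x t ht => by
      by_cases hx : x ∈ Q
      · rw [indicator_of_mem hx]; exact hC _
      · rw [indicator_of_notMem hx, norm_le_zero_iff]
        by_contra h0
        refine hx ⟨(x + q (t • v), t), ⟨⟨_, subset_tsupport _ h0, rfl⟩, ?_⟩, by simp⟩
        rw [Metric.mem_ball, dist_zero_right, Real.norm_eq_abs, abs_lt] at ht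
        exact ⟨ht.1.le, ht.2.le⟩)
    ((integrable_indicator_iff hQc.measurableSet).2 (integrableOn_const hQc.measure_lt_top.ne))
    (.of_forall fun x t _ => hφ.hasDerivAt hq x v t)
  have hconst : (fun t : ℝ => ∫ x, φ (x + q (t • v), v)) = fun _ => ∫ x, φ (x, v) := by
    funext t
    simp_rw [add_comm _ (q (t • v))]
    exact integral_add_left_eq_self (fun x => φ (x, v)) (q (t • v))
  have h1 := key.2
  rw [hconst] at h1
  have h2 := h1.unique (hasDerivAt_const (0 : ℝ) _)
  simpa using h2

/-- A test function as an element of `L²`. -/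
def testL (hq : IsOpenQuotientMap q) (hφ : IsTestFunction q φ) : PhaseL2 X :=
  (hφ.memLp hq 2).toLp φ

omit [IsTopologicalAddGroup X] [T2Space X] [SigmaFinite (volume : Measure X)]
  [(volume : Measure X).IsAddLeftInvariant] in
lemma testL_coe (hq : IsOpenQuotientMap q) (hφ : IsTestFunction q φ) :
    testL hq hφ =ᵐ[phaseMeasure X] φ := (hφ.memLp hq 2).coeFn_toLp

omit [IsTopologicalAddGroup X] [T2Space X] [SigmaFinite (volume : Measure X)]
  [(volume : Measure X).IsAddLeftInvariant] in
lemma integrable_mul_test (hq : IsOpenQuotientMap q) (hφ : IsTestFunction q φ) (f : PhaseL2 X) :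
    Integrable (fun p => f p * φ p) (phaseMeasure X) :=
  (Lp.memLp f).integrable_mul (hφ.memLp hq 2)

/-- Classical stream derivatives are weak ones. -/
lemma isWeakStream_testL (hq : IsOpenQuotientMap q) (hφ : IsTestFunction q φ) :
    IsWeakStream q (testL hq hφ) (testL hq (hφ.stream hq)) := by
  intro ψ hψ
  have i1 := integrable_mul_test hq (hψ.stream hq) (testL hq hφ)
  have i2 := integrable_mul_test hq hψ (testL hq (hφ.stream hq))
  refine ⟨i1, i2, ?_⟩
  rw [eq_neg_iff_add_eq_zero, ← integral_add i1 i2, ← integral_streamDeriv hq (hφ.mul hψ)]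
  refine integral_congr_ae ?_
  filter_upwards [testL_coe hq hφ, testL_coe hq (hφ.stream hq)] with p h1 h2
  rw [h1, h2, streamDeriv_mul hq hφ hψ]
  ring

omit [IsTopologicalAddGroup X] [T2Space X] [SigmaFinite (volume : Measure X)]
  [(volume : Measure X).IsAddLeftInvariant] in
lemma integral_mul_test_eq_inner (hq : IsOpenQuotientMap q) (hφ : IsTestFunction q φ)
    (f : PhaseL2 X) : ∫ p, f p * φ p ∂(phaseMeasure X) = ⟪testL hq hφ.conj, f⟫_ℂ := by
  rw [inner_Lp_eq]
  refine integral_congr_ae ?_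
  filter_upwards [testL_coe hq hφ.conj] with p h1
  rw [h1, Complex.conj_conj, mul_comm]

variable {K : Type*} [MeasurableSpace K] {ν : Measure K} [SigmaFinite ν] {ξ : K → E3}

omit [SigmaFinite ν] in
/-- The weak stream derivative is a multiplication operator as soon as this holds one way. -/
theorem isWeakStream_iff (hq : IsOpenQuotientMap q)
    (U : PhaseL2 X ≃ₗᵢ[ℂ] KinL2 ν)
    (hW : ∀ f g, IsWeakStream q f g →
      U g =ᵐ[ν.prod maxwellian] fun p => I * ((⟪p.2, ξ p.1⟫_ℝ : ℝ) : ℂ) * U f p)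
    (f g : PhaseL2 X) : IsWeakStream q f g ↔
      U g =ᵐ[ν.prod maxwellian] fun p => I * ((⟪p.2, ξ p.1⟫_ℝ : ℝ) : ℂ) * U f p := by
  refine ⟨hW f g, fun h φ hφ => ⟨integrable_mul_test hq (hφ.stream hq) f,
    integrable_mul_test hq hφ g, ?_⟩⟩
  rw [integral_mul_test_eq_inner hq hφ, integral_mul_test_eq_inner hq (hφ.stream hq)]
  have e : testL hq (hφ.stream hq).conj = testL hq (hφ.conj.stream hq) := by
    apply Lp.ext
    filter_upwards [testL_coe hq (hφ.stream hq).conj, testL_coe hq (hφ.conj.stream hq)] with p h1 h2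
    rw [h1, h2, streamDeriv_conj hq hφ]
  rw [e, ← U.inner_map_map, ← U.inner_map_map, inner_Lp_eq, inner_Lp_eq, ← integral_neg]
  refine integral_congr_ae ?_
  filter_upwards [h, hW _ _ (isWeakStream_testL hq hφ.conj)] with p h1 h2
  rw [h1, h2, map_mul, map_mul, conj_I, conj_ofReal]
  ring

theorem isKinetic_bgkOperator (hq : IsOpenQuotientMap q)
    (U₀ : Lp ℂ 2 (volume : Measure X) ≃ₗᵢ[ℂ] Lp ℂ 2 ν)
    (U : PhaseL2 X ≃ₗᵢ[ℂ] KinL2 ν) (hU : ∀ u g, U (tens u g) = tens (U₀ u) g)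
    (hW : ∀ f g, IsWeakStream q f g →
      U g =ᵐ[ν.prod maxwellian] fun p => I * ((⟪p.2, ξ p.1⟫_ℝ : ℝ) : ℂ) * U f p) (τ : ℝ) :
    IsKinetic (bgkOperator q τ) τ ξ U := by
  refine isKinetic_toLinearPMap fun f h => ?_
  set G : PhaseL2 X := -h - (1 / τ : ℂ) • f + (1 / τ : ℂ) • projOp volume f with hG
  have hGv : G =ᵐ[phaseMeasure X]
      fun y => -h y - (1 / τ : ℂ) * f y + (1 / τ : ℂ) * phaseProj5 f y := by
    filter_upwards [Lp.coeFn_add (-h - (1 / τ : ℂ) • f) ((1 / τ : ℂ) • projOp volume f),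
      Lp.coeFn_sub (-h) ((1 / τ : ℂ) • f), Lp.coeFn_neg h, Lp.coeFn_smul (1 / τ : ℂ) f,
      Lp.coeFn_smul (1 / τ : ℂ) (projOp volume f), projOp_ae_eq_proj5 f] with y h1 h2 h3 h4 h5 h6
    rw [hG, h1, Pi.add_apply, h2, Pi.sub_apply, h3, Pi.neg_apply, h4, Pi.smul_apply, h5,
      Pi.smul_apply, h6]
    rfl
  have e1 : (f, h) ∈ bgkGraph q τ ↔ IsWeakStream q f G := by
    constructor
    · rintro ⟨g, hg, hh⟩
      have : g = G := by
        apply Lp.ext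
        filter_upwards [hh, hGv] with y h1 h2
        rw [h2, h1]
        ring
      rwa [← this]
    · intro hg
      refine ⟨G, hg, ?_⟩
      filter_upwards [hGv] with y h2
      rw [h2]
      ring
  rw [e1, isWeakStream_iff hq U hW]
  have e2 : U G = -U h - (1 / τ : ℂ) • U f + (1 / τ : ℂ) • projOp ν (U f) := by
    rw [hG, map_add, map_sub, map_neg, map_smul, map_smul, projOp_unitary U₀ U hU]
  rw [e2]
  refine Filter.eventually_congr ?_
  filter_upwards [Lp.coeFn_add (-U h - (1 / τ : ℂ) • U f) ((1 / τ : ℂ) • projOp ν (U f)),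
      Lp.coeFn_sub (-U h) ((1 / τ : ℂ) • U f), Lp.coeFn_neg (U h), Lp.coeFn_smul (1 / τ : ℂ) (U f),
      Lp.coeFn_smul (1 / τ : ℂ) (projOp ν (U f))] with p h1 h2 h3 h4 h5
  rw [h1, Pi.add_apply, h2, Pi.sub_apply, h3, Pi.neg_apply, h4, Pi.smul_apply, h5, Pi.smul_apply]
  simp only [kinSymbol, velSymbol, smul_eq_mul]
  constructor <;> intro h <;> linear_combination -h

end TestFunctions

section Bumps

/-- Smooth compactly supported functions of the velocity. -/
def IsBump (ψ : E3 → ℝ) : Prop := ContDiff ℝ ∞ ψ ∧ HasCompactSupport ψ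

lemma IsBump.memLp {ψ : E3 → ℝ} (h : IsBump ψ) (μ : Measure E3) [IsFiniteMeasureOnCompacts μ] :
    MemLp (fun v => (ψ v : ℂ)) 2 μ :=
  (Complex.continuous_ofReal.comp h.1.continuous).memLp_of_hasCompactSupport
    (h.2.comp_left ofReal_zero)

lemma IsBump.mul {ψ ρ : E3 → ℝ} (hρ : ContDiff ℝ ∞ ρ) (h : IsBump ψ) : IsBump fun v => ρ v * ψ v :=
  ⟨hρ.mul h.1, h.2.mul_left⟩

lemma eq_zero_of_bumps {μ : Measure E3} [IsFiniteMeasureOnCompacts μ] {x : Lp ℂ 2 μ}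
    (h : ∀ ψ, IsBump ψ → ∫ v, (ψ v : ℂ) * x v ∂μ = 0) : x = 0 := by
  have h1 := ae_eq_zero_of_integral_contDiff_smul_eq_zero
    ((Lp.memLp x).locallyIntegrable (by norm_num)) fun ψ h1 h2 => by
      simpa only [real_smul] using h ψ ⟨h1, h2⟩
  apply Lp.ext
  filter_upwards [h1, Lp.coeFn_zero ℂ 2 μ] with v h2 h3
  rw [h2, h3, Pi.zero_apply]

lemma contDiff_weight : ContDiff ℝ ∞ fun v : E3 => (1 + ‖v‖ ^ 2)⁻¹ :=
  (contDiff_const.add (contDiff_norm_sq ℝ)).inv fun v => by positivity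

variable {K : Type*} [MeasurableSpace K] {ν : Measure K} [SigmaFinite ν] {ξ : K → E3}

/-- Two functions related by the symbol of the transport operator when tested on products are so
related almost everywhere. -/
lemma eq_symbol_mul_of_pairing (hξ : Measurable ξ) (S : Set (K → ℂ)) (hS : ∀ u ∈ S, MemLp u 2 ν)
    (hw : ∀ u ∈ S, (fun k => (((1 + ‖ξ k‖ ^ 2)⁻¹ : ℝ) : ℂ) * u k) ∈ S)
    (htot : ∀ x : Lp ℂ 2 ν, (∀ u ∈ S, ∫ k, conj (u k) * x k ∂ν = 0) → x = 0)
    (F G : KinL2 ν)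
    (h : ∀ u ∈ S, ∀ ψ, IsBump ψ → ∫ p, conj (u p.1) * (ψ p.2 : ℂ) * G p ∂ν.prod maxwellian =
      ∫ p, conj (u p.1) * (ψ p.2 : ℂ) * (I * ((⟪p.2, ξ p.1⟫_ℝ : ℝ) : ℂ) * F p)
        ∂ν.prod maxwellian) :
    G =ᵐ[ν.prod maxwellian] fun p => I * ((⟪p.2, ξ p.1⟫_ℝ : ℝ) : ℂ) * F p := by
  set r : K × E3 → ℝ := fun p => (1 + ‖ξ p.1‖ ^ 2)⁻¹ * (1 + ‖p.2‖ ^ 2)⁻¹ with hr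
  have hin : Measurable fun p : K × E3 => ⟪p.2, ξ p.1⟫_ℝ :=
    measurable_snd.inner (hξ.comp measurable_fst)
  have hrm : Measurable r := by fun_prop
  have hr0 : ∀ p, 0 < r p := fun p => by positivity
  have hle : ∀ x : ℝ, 0 ≤ x → x * (1 + x ^ 2)⁻¹ ≤ 1 := fun x hx => by
    rw [← div_eq_mul_inv, div_le_one (by positivity)]; nlinarith [sq_nonneg (x - 1)]
  have hb1 : BddMeas fun p => (r p : ℂ) := ⟨by fun_prop, 1, fun p => by
    rw [norm_real, norm_of_nonneg (hr0 p).le]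
    exact mul_le_one₀ (inv_le_one_of_one_le₀ (by nlinarith [sq_nonneg ‖ξ p.1‖])) (by positivity)
      (inv_le_one_of_one_le₀ (by nlinarith [sq_nonneg ‖p.2‖]))⟩
  have hb2 : BddMeas fun p => (r p : ℂ) * (I * ((⟪p.2, ξ p.1⟫_ℝ : ℝ) : ℂ)) :=
    ⟨by fun_prop, 1, fun p => by
      rw [norm_mul, norm_mul, norm_I, one_mul, norm_real, norm_real,
        norm_of_nonneg (hr0 p).le]
      calc r p * ‖⟪p.2, ξ p.1⟫_ℝ‖ ≤ r p * (‖p.2‖ * ‖ξ p.1‖) := by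
            gcongr
            exact norm_inner_le_norm _ _
        _ = (‖ξ p.1‖ * (1 + ‖ξ p.1‖ ^ 2)⁻¹) * (‖p.2‖ * (1 + ‖p.2‖ ^ 2)⁻¹) := by rw [hr]; ring
        _ ≤ 1 := mul_le_one₀ (hle _ (norm_nonneg _)) (by positivity) (hle _ (norm_nonneg _))⟩
  have hzero : mulOp _ (fun p => (r p : ℂ)) G -
      mulOp _ (fun p => (r p : ℂ) * (I * ((⟪p.2, ξ p.1⟫_ℝ : ℝ) : ℂ))) F = 0 := by
    refine eq_zero_of_total (S := {x | ∃ u ∈ S, x =ᵐ[ν] u})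
      (S' := {y | ∃ ψ, IsBump ψ ∧ y =ᵐ[maxwellian] fun v => (ψ v : ℂ)})
      (fun x hx => htot x fun u hu => ?_) (fun y hy => eq_zero_of_bumps fun ψ hψ => ?_) ?_
    · rw [← hx ((hS u hu).toLp u) ⟨u, hu, (hS u hu).coeFn_toLp⟩, inner_Lp_eq]
      refine integral_congr_ae ?_
      filter_upwards [(hS u hu).coeFn_toLp] with k hk
      rw [hk]
    · rw [← hy ((hψ.memLp maxwellian).toLp _) ⟨ψ, hψ, (hψ.memLp maxwellian).coeFn_toLp⟩, inner_Lp_eq]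
      refine integral_congr_ae ?_
      filter_upwards [(hψ.memLp maxwellian).coeFn_toLp] with v hv
      rw [hv, conj_ofReal]
    · rintro s ⟨u, hu, hsu⟩ t ⟨ψ, hψ, htψ⟩
      have key := h _ (hw u hu) _ (IsBump.mul contDiff_weight hψ)
      rw [inner_sub_right, sub_eq_zero, inner_Lp_eq, inner_Lp_eq]
      refine Eq.trans ?_ (key.trans ?_) <;> refine integral_congr_ae ?_
      · filter_upwards [mulOp_coe hb1 G, tens_coe s t, ae_fst (μ := maxwellian) hsu,
          ae_snd (ν := ν) htψ] with p h1 h2 h3 h4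
        rw [h1, h2, h3, h4, map_mul, map_mul, conj_ofReal, conj_ofReal, hr]
        push_cast
        ring
      · filter_upwards [mulOp_coe hb2 F, tens_coe s t, ae_fst (μ := maxwellian) hsu,
          ae_snd (ν := ν) htψ] with p h1 h2 h3 h4
        rw [h1, h2, h3, h4, map_mul, map_mul, conj_ofReal, conj_ofReal, hr]
        push_cast
        ring
  have h2 := Lp.ext_iff.1 (sub_eq_zero.1 hzero)
  filter_upwards [h2, mulOp_coe hb1 G,
    mulOp_coe hb2 F] with p h3 h4 h5
  rw [h4, h5, mul_assoc] at h3
  exact mul_left_cancel₀ (Complex.ofReal_ne_zero.2 (hr0 p).ne') h3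

end Bumps

section Count

lemma integral_count_indicator {K : Type*} [MeasurableSpace K] [MeasurableSingletonClass K] (n : K)
    (d : ℂ) (x : K → ℂ) :
    ∫ k, conj (({n} : Set K).indicator (fun _ => d) k) * x k ∂Measure.count =
      conj d * x n := by
  have e : (fun k => conj (({n} : Set K).indicator (fun _ => d) k) * x k) =
      ({n} : Set K).indicator fun k => conj d * x k := by
    funext k
    by_cases hk : k ∈ ({n} : Set K)
    · rw [indicator_of_mem hk, indicator_of_mem hk]
    · rw [indicator_of_notMem hk, indicator_of_notMem hk, map_zero, zero_mul]
  rw [e, integral_indicator (measurableSet_singleton n), Measure.restrict_singleton,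
    Measure.count_singleton, one_smul, integral_dirac]

variable {K : Type*} [MeasurableSpace K] [MeasurableSingletonClass K] [Countable K]

/-- The indicator of a point. -/
def deltaL (n : K) : Lp ℂ 2 (Measure.count : Measure K) :=
  indL {n} (measurableSet_singleton n) (by simp)

omit [Countable K] in
lemma deltaL_coe (n : K) : deltaL n =ᵐ[Measure.count] ({n} : Set K).indicator fun _ => (1 : ℂ) :=
  indL_coe _ _

omit [Countable K] in
lemma inner_deltaL (n : K) (x : Lp ℂ 2 (Measure.count : Measure K)) : ⟪deltaL n, x⟫_ℂ = x n := by
  have h := integral_count_indicator n 1 x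
  rw [map_one, one_mul] at h
  rw [inner_Lp_eq, ← h]
  refine integral_congr_ae ?_
  filter_upwards [deltaL_coe n] with k hk
  rw [hk]

omit [MeasurableSingletonClass K] [Countable K] in
lemma eq_zero_of_count {x : Lp ℂ 2 (Measure.count : Measure K)} (h : ∀ n, x n = 0) : x = 0 := by
  apply Lp.ext
  filter_upwards [Lp.coeFn_zero ℂ 2 (Measure.count : Measure K)] with k hk
  rw [hk, h, Pi.zero_apply]

/-- The point indicators as a Hilbert basis. -/
def deltaBasis : HilbertBasis K ℂ (Lp ℂ 2 (Measure.count : Measure K)) :=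
  HilbertBasis.mkOfOrthogonalEqBot (v := deltaL) (by
    classical
    rw [orthonormal_iff_ite]
    intro m n
    rw [inner_deltaL, Measure.ae_count_iff.1 (deltaL_coe n) m]
    by_cases h : m = n <;> simp [h]) (by
    rw [Submodule.eq_bot_iff]
    intro x hx
    rw [Submodule.mem_orthogonal] at hx
    exact eq_zero_of_count fun n => by
      rw [← inner_deltaL]; exact hx _ (Submodule.subset_span ⟨n, rfl⟩))

end Count

section Torus

variable {ℓ : ℝ} [hℓ : Fact (0 < ℓ)]

omit hℓ in
lemma isOpenQuotientMap_torusMk : IsOpenQuotientMap (torusMk ℓ) :=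
  (IsOpenQuotientMap.piMap fun _ : Fin 3 => QuotientAddGroup.isOpenQuotientMap_mk).comp
    (PiLp.homeomorph 2 fun _ : Fin 3 => ℝ).isOpenQuotientMap

/-- The characters of the torus. -/
def torusChar (n : Fin 3 → ℤ) : C(Torus3 ℓ, ℂ) := ⟨fun x => ∏ i, fourier (n i) (x i), by fun_prop⟩

omit hℓ in
lemma torusChar_mk (n : Fin 3 → ℤ) (y : E3) : torusChar n (torusMk ℓ y) =
    cexp (I * ((⟪y, torusWaveVector ℓ n⟫_ℝ : ℝ) : ℂ)) := by
  change ∏ i, fourier (n i) ((y i : ℝ) : AddCircle ℓ) = _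
  simp only [fourier_coe_apply, Fin.prod_univ_three, ← Complex.exp_add, PiLp.inner_apply,
    Fin.sum_univ_three, torusWaveVector]
  congr 1
  simp
  ring

omit hℓ in
lemma torusChar_add_mk (n : Fin 3 → ℤ) (x : Torus3 ℓ) (y : E3) : torusChar n (x + torusMk ℓ y) =
    torusChar n x * cexp (I * ((⟪y, torusWaveVector ℓ n⟫_ℝ : ℝ) : ℂ)) := by
  obtain ⟨x, rfl⟩ := isOpenQuotientMap_torusMk.surjective x
  rw [← map_add, torusChar_mk, torusChar_mk, inner_add_left, ← Complex.exp_add]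
  push_cast
  ring_nf

omit hℓ in
lemma torusChar_neg (n : Fin 3 → ℤ) (x : Torus3 ℓ) :
    torusChar (-n) x = conj (torusChar n x) := by
  simp only [torusChar, ContinuousMap.coe_mk, map_prod, Pi.neg_apply, fourier_neg]

omit hℓ in
lemma torusChar_add (m n : Fin 3 → ℤ) (x : Torus3 ℓ) :
    torusChar (m + n) x = torusChar m x * torusChar n x := by
  simp only [torusChar, ContinuousMap.coe_mk, Pi.add_apply, fourier_add, Finset.prod_mul_distrib]

omit hℓ in
lemma torusChar_zero (x : Torus3 ℓ) : torusChar 0 x = 1 := by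
  simp [torusChar]

lemma torusWaveVector_ne_zero {n : Fin 3 → ℤ} (hn : n ≠ 0) : torusWaveVector ℓ n ≠ 0 := by
  intro h
  apply hn
  funext i
  have h1 : 2 * Real.pi / ℓ * (n i : ℝ) = 0 := congrArg (fun x : E3 => x i) h
  have h2 := hℓ.out
  simpa [Real.pi_ne_zero, h2.ne'] using h1

lemma integral_torusChar {n : Fin 3 → ℤ} (hn : n ≠ 0) : ∫ x : Torus3 ℓ, torusChar n x = 0 := by
  set ξ := torusWaveVector ℓ n with hξ
  have h0 : ‖ξ‖ ≠ 0 := norm_ne_zero_iff.2 (torusWaveVector_ne_zero hn)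
  have h1 := integral_add_right_eq_self (μ := (volume : Measure (Torus3 ℓ))) (torusChar n)
    (torusMk ℓ ((Real.pi / ‖ξ‖ ^ 2) • ξ))
  simp only [torusChar_add_mk, ← hξ, real_inner_smul_left, real_inner_self_eq_norm_sq,
    div_mul_cancel₀ _ (pow_ne_zero 2 h0)] at h1
  rw [integral_mul_const, mul_comm I, Complex.exp_pi_mul_I] at h1
  linear_combination (-1 / 2 : ℂ) * h1

lemma span_torusChar_closure : (Submodule.span ℂ (Set.range fun n : Fin 3 → ℤ =>
    (torusChar n : C(Torus3 ℓ, ℂ)))).topologicalClosure = ⊤ := by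
  classical
  set A : StarSubalgebra ℂ C(Torus3 ℓ, ℂ) :=
    { toSubalgebra := Algebra.adjoin ℂ (Set.range fun n : Fin 3 → ℤ => (torusChar n : C(Torus3 ℓ, ℂ)))
      star_mem' := by
        change Algebra.adjoin ℂ _ ≤ star (Algebra.adjoin ℂ _)
        refine Algebra.adjoin_le ?_
        rintro _ ⟨n, rfl⟩
        refine Algebra.subset_adjoin ⟨-n, ?_⟩
        ext1 x
        exact torusChar_neg n x } with hA
  have hspan : A.toSubalgebra.toSubmodule =
      Submodule.span ℂ (Set.range fun n : Fin 3 → ℤ => (torusChar n : C(Torus3 ℓ, ℂ))) := by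
    apply Algebra.adjoin_eq_span_of_subset
    refine .trans (fun x ↦ Submonoid.closure_induction (fun _ ↦ id) ⟨0, ?_⟩ ?_) Submodule.subset_span
    · ext x; exact torusChar_zero x
    · rintro _ _ _ _ ⟨m, rfl⟩ ⟨n, rfl⟩
      exact ⟨m + n, ContinuousMap.ext (torusChar_add m n)⟩
  have hsep : A.SeparatesPoints := by
    intro x y hxy
    obtain ⟨i, hi⟩ := Function.ne_iff.1 hxy
    refine ⟨_, ⟨torusChar (Pi.single i 1), Algebra.subset_adjoin ⟨Pi.single i 1, rfl⟩, rfl⟩, ?_⟩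
    have e : ∀ x : Torus3 ℓ, torusChar (Pi.single i 1) x = fourier 1 (x i) := by
      intro x
      change ∏ j, fourier ((Pi.single i 1 : Fin 3 → ℤ) j) (x j) = _
      rw [Finset.prod_eq_single i (fun j _ hj => by rw [Pi.single_eq_of_ne hj, fourier_zero])
        (by simp), Pi.single_eq_same]
    change torusChar (Pi.single i 1) x ≠ torusChar (Pi.single i 1) y
    rw [e, e, fourier_one, fourier_one]
    exact fun h => hi (AddCircle.injective_toCircle hℓ.out.ne' (Circle.ext h))
  rw [← hspan]
  exact congr_arg (Subalgebra.toSubmodule <| StarSubalgebra.toSubalgebra ·)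
    (ContinuousMap.starSubalgebra_topologicalClosure_eq_top_of_separatesPoints A hsep)

/-- The characters in `L²`. -/
def torusCharL (n : Fin 3 → ℤ) : Lp ℂ 2 (volume : Measure (Torus3 ℓ)) :=
  ContinuousMap.toLp (E := ℂ) 2 volume ℂ (torusChar n)

lemma torusCharL_coe (n : Fin 3 → ℤ) :
    torusCharL n =ᵐ[(volume : Measure (Torus3 ℓ))] torusChar n := ContinuousMap.coeFn_toLp _ _

lemma inner_torusCharL (m n : Fin 3 → ℤ) : ⟪(torusCharL m : Lp ℂ 2 (volume : Measure (Torus3 ℓ))),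
    torusCharL n⟫_ℂ = if m = n then ((volume : Measure (Torus3 ℓ)).real Set.univ : ℂ) else 0 := by
  rw [torusCharL, torusCharL, ContinuousMap.inner_toLp]
  simp_rw [← torusChar_neg, ← torusChar_add]
  split_ifs with h
  · simp [h, torusChar_zero]
  · exact integral_torusChar fun h' => h (by rw [add_neg_eq_zero] at h'; exact h'.symm)

variable (ℓ) in
/-- The inverse of the norm of the characters. -/
def torusNorm : ℝ := (√((volume : Measure (Torus3 ℓ)).real Set.univ))⁻¹

lemma torusNorm_sq : torusNorm ℓ ^ 2 * (volume : Measure (Torus3 ℓ)).real Set.univ = 1 ∧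
    torusNorm ℓ ≠ 0 := by
  have h : 0 < (volume : Measure (Torus3 ℓ)).real Set.univ :=
    ENNReal.toReal_pos (isOpen_univ.measure_pos _ Set.univ_nonempty).ne' (measure_ne_top _ _)
  rw [torusNorm, inv_pow, Real.sq_sqrt h.le, inv_mul_cancel₀ h.ne']
  exact ⟨rfl, inv_ne_zero (Real.sqrt_pos.2 h).ne'⟩

variable (ℓ) in
/-- The normalized characters as a Hilbert basis. -/
def torusBasis : HilbertBasis (Fin 3 → ℤ) ℂ (Lp ℂ 2 (volume : Measure (Torus3 ℓ))) :=
  HilbertBasis.mkOfOrthogonalEqBot (v := fun n => (torusNorm ℓ : ℂ) • torusCharL n) (by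
    rw [orthonormal_iff_ite]
    intro m n
    rw [inner_smul_left, inner_smul_right, inner_torusCharL, conj_ofReal]
    split_ifs with h
    · rw [← mul_assoc, ← sq]
      exact_mod_cast (torusNorm_sq (ℓ := ℓ)).1
    · simp) (by
    have h1 : (Submodule.span ℂ (Set.range fun n : Fin 3 → ℤ =>
        (torusCharL n : Lp ℂ 2 (volume : Measure (Torus3 ℓ))))).topologicalClosure = ⊤ := by
      have := (ContinuousMap.toLp_denseRange (p := 2) ℂ (volume : Measure (Torus3 ℓ)) ℂ
        (by norm_num)).topologicalClosure_map_submodule (span_torusChar_closure (ℓ := ℓ))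
      simp only [Submodule.map_span, ContinuousLinearMap.coe_coe, ← Set.range_comp,
        Function.comp_def] at this
      exact this
    rw [Submodule.topologicalClosure_eq_top_iff] at h1
    rw [← le_bot_iff, ← h1]
    refine Submodule.orthogonal_le (Submodule.span_le.2 ?_)
    rintro _ ⟨n, rfl⟩
    have h2 := Submodule.smul_mem _ (torusNorm ℓ : ℂ)⁻¹
      (Submodule.subset_span (R := ℂ) (Set.mem_range_self (f := fun n : Fin 3 → ℤ =>
        (torusNorm ℓ : ℂ) • (torusCharL n : Lp ℂ 2 (volume : Measure (Torus3 ℓ)))) n))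
    rwa [inv_smul_smul₀ (Complex.ofReal_ne_zero.2 (torusNorm_sq (ℓ := ℓ)).2)] at h2)

lemma torusBasis_apply (n : Fin 3 → ℤ) : torusBasis ℓ n = (torusNorm ℓ : ℂ) • torusCharL n := by
  rw [torusBasis, HilbertBasis.coe_mkOfOrthogonalEqBot]

variable (ℓ) in
/-- Fourier series. -/
def torusFourier : Lp ℂ 2 (volume : Measure (Torus3 ℓ)) ≃ₗᵢ[ℂ]
    Lp ℂ 2 (Measure.count : Measure (Fin 3 → ℤ)) :=
  (torusBasis ℓ).repr.trans deltaBasis.repr.symm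

lemma torusFourier_char (n : Fin 3 → ℤ) :
    (torusNorm ℓ : ℂ) • torusFourier ℓ (torusCharL n) = deltaL n := by
  classical
  rw [← map_smul, ← torusBasis_apply, torusFourier, LinearIsometryEquiv.trans_apply,
    HilbertBasis.repr_self, HilbertBasis.repr_symm_single, deltaBasis,
    HilbertBasis.coe_mkOfOrthogonalEqBot]

lemma isTestFunction_torus (n : Fin 3 → ℤ) {ψ : E3 → ℝ} (hψ : IsBump ψ) :
    IsTestFunction (torusMk ℓ) fun p => torusChar n p.1 * (ψ p.2 : ℂ) := by
  constructor
  · simp only [torusChar_mk]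
    have h1 : ContDiff ℝ ∞ fun p : E3 × E3 => ((⟪p.1, torusWaveVector ℓ n⟫_ℝ : ℝ) : ℂ) :=
      ofRealCLM.contDiff.comp (contDiff_fst.inner ℝ contDiff_const)
    have h2 : ContDiff ℝ ∞ fun p : E3 × E3 => (ψ p.2 : ℂ) :=
      ofRealCLM.contDiff.comp (hψ.1.comp contDiff_snd)
    exact (contDiff_const.mul h1).cexp.mul h2
  · refine HasCompactSupport.intro (isCompact_univ.prod hψ.2.isCompact) fun p hp => ?_
    have : p.2 ∉ tsupport ψ := fun h => hp ⟨Set.mem_univ _, h⟩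
    rw [image_eq_zero_of_notMem_tsupport this, ofReal_zero, mul_zero]

omit hℓ in
lemma streamDeriv_torus (n : Fin 3 → ℤ) (ψ : E3 → ℝ) (p : Torus3 ℓ × E3) :
    streamDeriv (torusMk ℓ) (fun p => torusChar n p.1 * (ψ p.2 : ℂ)) p =
      I * ((⟪p.2, torusWaveVector ℓ n⟫_ℝ : ℝ) : ℂ) * (torusChar n p.1 * (ψ p.2 : ℂ)) := by
  set c : ℂ := I * ((⟪p.2, torusWaveVector ℓ n⟫_ℝ : ℝ) : ℂ) with hc
  have h1 : HasDerivAt (fun t : ℝ => cexp ((t : ℂ) * c)) c 0 := by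
    have h2 : HasDerivAt (fun t : ℝ => (t : ℂ) * c) c 0 := by
      simpa using (Complex.ofRealCLM.hasDerivAt (x := (0 : ℝ))).mul_const c
    simpa using h2.cexp
  have h3 := ((h1.const_mul (torusChar n p.1)).mul_const (ψ p.2 : ℂ)).deriv
  rw [streamDeriv]
  simp only [torusChar_add_mk, real_inner_smul_left, ofReal_mul]
  simp only [hc] at h3
  simp only [mul_left_comm I, h3]
  ring

/-- A bump as an element of `L²(maxwellian)`. -/
def bumpL {ψ : E3 → ℝ} (hψ : IsBump ψ) : VelocityL2 := (hψ.memLp maxwellian).toLp _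

lemma bumpL_coe {ψ : E3 → ℝ} (hψ : IsBump ψ) : bumpL hψ =ᵐ[maxwellian] fun v => (ψ v : ℂ) :=
  (hψ.memLp maxwellian).coeFn_toLp

lemma isBump_inner {ψ : E3 → ℝ} (hψ : IsBump ψ) (q : E3) : IsBump fun v => ⟪v, q⟫_ℝ * ψ v :=
  hψ.mul (contDiff_id.inner ℝ contDiff_const)

lemma inner_torus_tens (n : Fin 3 → ℤ) {ψ : E3 → ℝ} (hψ : IsBump ψ) (f : PhaseL2 (Torus3 ℓ)) :
    ⟪tens (torusCharL n) (bumpL hψ), f⟫_ℂ =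
      ∫ p, f p * (torusChar (-n) p.1 * (ψ p.2 : ℂ)) ∂phaseMeasure (Torus3 ℓ) := by
  rw [inner_Lp_eq]
  refine integral_congr_ae ?_
  filter_upwards [tens_coe (torusCharL n) (bumpL hψ), ae_fst (μ := maxwellian) (torusCharL_coe n),
    ae_snd (ν := (volume : Measure (Torus3 ℓ))) (bumpL_coe hψ)] with p h1 h2 h3
  rw [h1, h2, h3, map_mul, conj_ofReal, torusChar_neg, mul_comm]

lemma inner_stream_torus {f g : PhaseL2 (Torus3 ℓ)} (h : IsWeakStream (torusMk ℓ) f g)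
    (n : Fin 3 → ℤ) {ψ : E3 → ℝ} (hψ : IsBump ψ) : ⟪tens (torusCharL n) (bumpL hψ), g⟫_ℂ =
      I * ⟪tens (torusCharL n) (bumpL (isBump_inner hψ (torusWaveVector ℓ n))), f⟫_ℂ := by
  rw [inner_torus_tens, inner_torus_tens, ← integral_const_mul, ← neg_inj,
    ← (h _ (isTestFunction_torus (-n) hψ)).2.2, ← integral_neg]
  refine integral_congr_ae (.of_forall fun p => ?_)
  have e : torusWaveVector ℓ (-n) = -torusWaveVector ℓ n := by
    ext i; simp [torusWaveVector]
  simp only [streamDeriv_torus, e, inner_neg_right]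
  push_cast
  ring

lemma integral_delta_tens (n : Fin 3 → ℤ) (d : ℂ) {ψ : E3 → ℝ} (hψ : IsBump ψ)
    (F : Lp ℂ 2 ((Measure.count : Measure (Fin 3 → ℤ)).prod maxwellian)) :
    ∫ p, conj (({n} : Set (Fin 3 → ℤ)).indicator (fun _ => d) p.1) * (ψ p.2 : ℂ) * F p
      ∂(Measure.count : Measure (Fin 3 → ℤ)).prod maxwellian =
    conj d * ⟪tens (deltaL n) (bumpL hψ), F⟫_ℂ := by
  rw [inner_Lp_eq, ← integral_const_mul]
  refine integral_congr_ae ?_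
  filter_upwards [tens_coe (deltaL n) (bumpL hψ), ae_fst (μ := maxwellian) (deltaL_coe n),
    ae_snd (ν := (Measure.count : Measure (Fin 3 → ℤ))) (bumpL_coe hψ)] with p h1 h2 h3
  rw [h1, h2, h3, map_mul, conj_ofReal]
  by_cases hp : p.1 ∈ ({n} : Set (Fin 3 → ℤ)) <;> simp [hp, mul_assoc]

theorem spectrum_bgkTorus {τ : ℝ} (hτ : 0 < τ) :
    opSpectrum (bgkTorus ℓ τ) =
        essLine τ ∪ ⋃ n, modesAt modeValue modeCrit τ ‖torusWaveVector ℓ n‖ ∧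
      essSpectrum (bgkTorus ℓ τ) = essLine τ ∧
      discSpectrum (bgkTorus ℓ τ) = ⋃ n, modesAt modeValue modeCrit τ ‖torusWaveVector ℓ n‖ := by
  obtain ⟨U, hU⟩ := exists_tensor_unitary (μ := maxwellian) (torusFourier ℓ)
  have hc := Complex.ofReal_ne_zero.2 (torusNorm_sq (ℓ := ℓ)).2
  have htr : ∀ n, ∀ ψ (hψ : IsBump ψ) (f : PhaseL2 (Torus3 ℓ)),
      ⟪tens (deltaL n) (bumpL hψ), U f⟫_ℂ =
        (torusNorm ℓ : ℂ) * ⟪tens (torusCharL n) (bumpL hψ), f⟫_ℂ := by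
    intro n ψ hψ f
    rw [← torusFourier_char (ℓ := ℓ), tens_smul_left, inner_smul_left, conj_ofReal, ← hU,
      U.inner_map_map]
  have hW : ∀ f g, IsWeakStream (torusMk ℓ) f g →
      U g =ᵐ[(Measure.count : Measure (Fin 3 → ℤ)).prod maxwellian] fun p =>
        I * ((⟪p.2, torusWaveVector ℓ p.1⟫_ℝ : ℝ) : ℂ) * U f p := by
    intro f g hfg
    refine eq_symbol_mul_of_pairing (measurable_of_countable _)
      {u | ∃ n d, u = ({n} : Set (Fin 3 → ℤ)).indicator fun _ => d} ?_ ?_ ?_ _ _ ?_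
    · rintro _ ⟨n, d, rfl⟩
      exact memLp_indicator_const 2 (measurableSet_singleton n) d (Or.inr (by simp))
    · rintro _ ⟨n, d, rfl⟩
      refine ⟨n, ((1 + ‖torusWaveVector ℓ n‖ ^ 2)⁻¹ : ℝ) * d, ?_⟩
      funext k
      by_cases hk : k = n
      · subst hk; simp
      · simp [hk]
    · intro x hx
      refine eq_zero_of_count fun n => ?_
      have := hx _ ⟨n, 1, rfl⟩
      rwa [integral_count_indicator, map_one, one_mul] at this
    · rintro _ ⟨n, d, rfl⟩ ψ hψ
      rw [integral_delta_tens n d hψ, htr, inner_stream_torus hfg, mul_left_comm _ I, ← htr,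
        mul_left_comm _ I, ← integral_delta_tens, ← integral_const_mul]
      refine integral_congr_ae (.of_forall fun p => ?_)
      by_cases hp : p.1 = n
      · subst hp; simp; ring
      · simp [hp]
  have hT := isKinetic_bgkOperator isOpenQuotientMap_torusMk (torusFourier ℓ) U hU hW τ
  refine hT.spectrum_of_discrete hτ (fun r => ?_) (k₀ := fun _ => 1)
    (torusWaveVector_ne_zero fun h => one_ne_zero (congrFun h 0))
  have hp : 0 < 2 * Real.pi / ℓ := div_pos (by positivity) hℓ.out
  refine (Set.Finite.pi' fun _ : Fin 3 =>
    Set.finite_Icc (-⌈r / (2 * Real.pi / ℓ)⌉) ⌈r / (2 * Real.pi / ℓ)⌉).subset fun n hn i => ?_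
  have h1 : ‖2 * Real.pi / ℓ * (n i : ℝ)‖ ≤ r :=
    (PiLp.norm_apply_le (torusWaveVector ℓ n) i).trans hn
  rw [norm_mul, norm_of_nonneg hp.le, Real.norm_eq_abs, ← le_div_iff₀' hp, abs_le] at h1
  have h2 := Int.le_ceil (r / (2 * Real.pi / ℓ))
  constructor
  · have : (-(⌈r / (2 * Real.pi / ℓ)⌉ : ℤ) : ℝ) ≤ n i := by linarith [h1.1]
    exact_mod_cast this
  · exact_mod_cast h1.2.trans h2

end Torus

section Space

open scoped SchwartzMap FourierTransform LineDeriv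

lemma isOpenQuotientMap_id : IsOpenQuotientMap (AddMonoidHom.id E3) := IsOpenQuotientMap.id

/-- The standard basis. -/
abbrev stdB : OrthonormalBasis (Fin 3) ℝ E3 := EuclideanSpace.basisFun (Fin 3) ℝ

/-- `u(x) · v ψ(v)` for a vector field `u`. -/
def dotL (u : Fin 3 → 𝓢(E3, ℂ)) {ψ : E3 → ℝ} (hψ : IsBump ψ) : PhaseL2 E3 :=
  ∑ j, tens ((u j).toLp 2) (bumpL (isBump_inner hψ (stdB j)))

lemma tens_bumpL_coe (u : 𝓢(E3, ℂ)) {ψ : E3 → ℝ} (hψ : IsBump ψ) :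
    tens (u.toLp 2) (bumpL hψ) =ᵐ[phaseMeasure E3] fun p => u p.1 * (ψ p.2 : ℂ) := by
  filter_upwards [tens_coe (u.toLp 2) (bumpL hψ), ae_fst (μ := maxwellian)
    (p := fun x => u.toLp 2 volume x = u x) (u.coeFn_toLp 2 volume),
    ae_snd (ν := (volume : Measure E3)) (bumpL_coe hψ)] with p h1 h2 h3
  rw [h1, h2, h3]

lemma dotL_coe (u : Fin 3 → 𝓢(E3, ℂ)) {ψ : E3 → ℝ} (hψ : IsBump ψ) :
    dotL u hψ =ᵐ[phaseMeasure E3] fun p => (∑ j, u j p.1 * (⟪p.2, stdB j⟫_ℝ : ℂ)) * (ψ p.2 : ℂ) := by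
  have h := fun j => tens_bumpL_coe (u j) (isBump_inner hψ (stdB j))
  rw [dotL, Fin.sum_univ_three]
  have h' : ∀ a b c : PhaseL2 E3, a + b + c =ᵐ[phaseMeasure E3] fun p => a p + b p + c p := by
    intro a b c
    filter_upwards [Lp.coeFn_add (a + b) c, Lp.coeFn_add a b] with p h1 h2
    rw [h1, Pi.add_apply, h2, Pi.add_apply]
  filter_upwards [h' _ _ _, h 0, h 1, h 2] with p h1 h3 h4 h5
  rw [h1, h3, h4, h5, Fin.sum_univ_three]
  push_cast
  ring

lemma grad_dot (χ : 𝓢(E3, ℂ)) (x v : E3) :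
    ∑ j, (∂_{stdB j} χ : 𝓢(E3, ℂ)) x * (⟪v, stdB j⟫_ℝ : ℂ) = fderiv ℝ χ x v := by
  conv_rhs => rw [← stdB.sum_repr' v, map_sum]
  refine sum_congr rfl fun j _ => ?_
  rw [SchwartzMap.lineDerivOp_apply_eq_fderiv, map_smul, real_smul, real_inner_comm, mul_comm]

lemma hasDerivAt_line {F : E3 → ℂ} (hF : Differentiable ℝ F) (x v : E3) :
    HasDerivAt (fun t : ℝ => F (x + t • v)) (fderiv ℝ F x v) 0 :=
  (hF x).hasFDerivAt.hasLineDerivAt v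

/-- The weak stream derivative may be tested on Schwartz functions of the position. -/
lemma inner_stream_space {f g : PhaseL2 E3} (h : IsWeakStream (AddMonoidHom.id E3) f g)
    (χ : 𝓢(E3, ℂ)) {ψ : E3 → ℝ} (hψ : IsBump ψ) :
    ⟪tens (χ.toLp 2) (bumpL hψ), g⟫_ℂ = -⟪dotL (fun j => ∂_{stdB j} χ) hψ, f⟫_ℂ := by
  obtain ⟨η, hη1, hη2, hη3, hη4⟩ : ∃ η : E3 → ℂ, ContDiff ℝ ∞ η ∧ HasCompactSupport η ∧ η 0 = 1 ∧
      ∀ x, ‖η x‖ ≤ 1 := by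
    let b : ContDiffBump (0 : E3) := ⟨1, 2, one_pos, one_lt_two⟩
    refine ⟨fun x => (b x : ℂ), ofRealCLM.contDiff.comp b.contDiff,
      b.hasCompactSupport.comp_left ofReal_zero, by
        simp [b.one_of_mem_closedBall (Metric.mem_closedBall_self zero_le_one)], fun x => ?_⟩
    rw [norm_real, norm_of_nonneg b.nonneg]
    exact b.le_one
  obtain ⟨C, hC⟩ := (hη2.fderiv ℝ).exists_bound_of_continuous (hη1.continuous_fderiv (by norm_num))
  have hχd : Differentiable ℝ χ := χ.differentiable
  set s : ℕ → ℝ := fun n => ((n : ℝ) + 1)⁻¹ with hs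
  have hs0 : ∀ n, 0 < s n := fun n => by positivity
  have hs1 : ∀ n, s n ≤ 1 := fun n => inv_le_one_of_one_le₀ (by simp)
  have hst : Tendsto s atTop (𝓝 0) := by
    simpa [hs] using tendsto_one_div_add_atTop_nhds_zero_nat (𝕜 := ℝ)
  set φ : ℕ → E3 × E3 → ℂ := fun n p => η (s n • p.1) * conj (χ p.1) * (ψ p.2 : ℂ) with hφ
  have hsc : ∀ n, ContDiff ℝ ∞ fun x : E3 => η (s n • x) := fun n =>
    hη1.comp (contDiff_const_smul (s n))
  have hχc : ContDiff ℝ ∞ fun x => conj (χ x) := conjCLE.contDiff.comp (χ.smooth ⊤)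
  have htest : ∀ n, IsTestFunction (AddMonoidHom.id E3) (φ n) := by
    intro n
    constructor
    · exact (((hsc n).comp contDiff_fst).mul (hχc.comp contDiff_fst)).mul
        (ofRealCLM.contDiff.comp (hψ.1.comp contDiff_snd))
    · refine HasCompactSupport.intro ((hη2.isCompact.image (continuous_const_smul (s n)⁻¹)).prod
        hψ.2.isCompact) fun p hp => ?_
      by_contra h0
      simp only [hφ, mul_ne_zero_iff] at h0
      exact hp ⟨⟨_, subset_tsupport _ h0.1.1, inv_smul_smul₀ (hs0 n).ne' _⟩,
        subset_tsupport _ fun h => h0.2 (by rw [h, ofReal_zero])⟩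
  have hderiv : ∀ n p, streamDeriv (AddMonoidHom.id E3) (φ n) p =
      η (s n • p.1) * (conj (fderiv ℝ χ p.1 p.2) * (ψ p.2 : ℂ)) +
        s n • (fderiv ℝ η (s n • p.1) p.2 * (conj (χ p.1) * (ψ p.2 : ℂ))) := by
    intro n p
    have d1 := hasDerivAt_line (hη1.differentiable (by norm_num)) (s n • p.1) (s n • p.2)
    have d2 := (conjCLE : ℂ →L[ℝ] ℂ).hasFDerivAt.comp_hasDerivAt 0 (hasDerivAt_line hχd p.1 p.2)
    have d3 := ((d1.mul d2).mul_const (ψ p.2 : ℂ)).deriv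
    simp only [zero_smul, add_zero, map_smul, smul_comm _ (s n), ← smul_add, Function.comp_def] at d3
    refine Eq.trans d3 ?_
    simp only [real_smul]
    change ((s n : ℂ) * fderiv ℝ η (s n • p.1) p.2 * conj (χ p.1) + η (s n • p.1) *
      conj (fderiv ℝ χ p.1 p.2)) * (ψ p.2 : ℂ) = _
    ring
  have hηt : ∀ x, Tendsto (fun n => η (s n • x)) atTop (𝓝 1) := fun x => by
    have := (hη1.continuous.tendsto 0).comp (by simpa using hst.smul_const x :
      Tendsto (fun n => s n • x) atTop (𝓝 0))
    rwa [hη3] at this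
  set T := tens (χ.toLp 2) (bumpL hψ) with hT
  set W := dotL (fun j => ∂_{stdB j} χ) hψ with hW
  have hψ' : IsBump fun v => (1 + ‖v‖ ^ 2) * ψ v :=
    hψ.mul (contDiff_const.add (contDiff_norm_sq ℝ))
  set T' := tens (χ.toLp 2) (bumpL hψ') with hT'
  have hWc : W =ᵐ[phaseMeasure E3] fun p => fderiv ℝ χ p.1 p.2 * (ψ p.2 : ℂ) := by
    filter_upwards [dotL_coe (fun j => ∂_{stdB j} χ) hψ] with p hp
    rw [hp, grad_dot]
  have l1 : Tendsto (fun n => ∫ p, g p * φ n p ∂phaseMeasure E3) atTop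
      (𝓝 ⟪T, g⟫_ℂ) := by
    rw [inner_Lp_eq]
    refine tendsto_integral_of_dominated_convergence (fun p => ‖g p‖ * ‖T p‖)
      (fun n => (integrable_mul_test isOpenQuotientMap_id (htest n) g).1)
      ((Lp.memLp g).norm.integrable_mul (Lp.memLp T).norm) (fun n => ?_) ?_
    · filter_upwards [tens_bumpL_coe χ hψ] with p hp
      rw [hT, hp, norm_mul, norm_mul, norm_mul, norm_mul, RCLike.norm_conj]
      gcongr
      exact mul_le_of_le_one_left (norm_nonneg _) (hη4 _)
    · filter_upwards [tens_bumpL_coe χ hψ] with p hp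
      have := ((hηt p.1).mul_const (conj (χ p.1) * (ψ p.2 : ℂ))).const_mul (g p)
      rw [hT, hp, map_mul, conj_ofReal, mul_comm _ (g p)]
      simpa only [hφ, one_mul, mul_assoc] using this
  have l2 : Tendsto (fun n => ∫ p, f p * streamDeriv (AddMonoidHom.id E3) (φ n) p
      ∂phaseMeasure E3) atTop (𝓝 ⟪W, f⟫_ℂ) := by
    rw [inner_Lp_eq]
    refine tendsto_integral_of_dominated_convergence (fun p => ‖f p‖ * ‖W p‖ + C * (‖f p‖ * ‖T' p‖))
      (fun n => (integrable_mul_test isOpenQuotientMap_id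
        ((htest n).stream isOpenQuotientMap_id) f).1)
      (((Lp.memLp f).norm.integrable_mul (Lp.memLp W).norm).add
        (((Lp.memLp f).norm.integrable_mul (Lp.memLp T').norm).const_mul C)) (fun n => ?_) ?_
    · filter_upwards [hWc, tens_bumpL_coe χ hψ'] with p hp hp'
      rw [hp, hT', hp', hderiv, mul_add]
      refine (norm_add_le _ _).trans (add_le_add ?_ ?_)
      · rw [norm_mul, norm_mul, norm_mul, norm_mul, RCLike.norm_conj]
        exact mul_le_mul_of_nonneg_left (mul_le_of_le_one_left
          (mul_nonneg (norm_nonneg _) (norm_nonneg _)) (hη4 _)) (norm_nonneg _)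
      · have hv : ‖p.2‖ ≤ 1 + ‖p.2‖ ^ 2 := by nlinarith [sq_nonneg (‖p.2‖ - 1)]
        have hD : ‖fderiv ℝ η (s n • p.1) p.2‖ ≤ C * (1 + ‖p.2‖ ^ 2) :=
          ((fderiv ℝ η (s n • p.1)).le_opNorm p.2).trans
            (mul_le_mul (hC _) hv (norm_nonneg _) ((norm_nonneg _).trans (hC 0)))
        rw [norm_mul, norm_smul, norm_mul, norm_mul, norm_mul, RCLike.norm_conj, norm_real,
          norm_real, norm_mul, norm_of_nonneg (hs0 n).le,
          norm_of_nonneg (by positivity : 0 ≤ 1 + ‖p.2‖ ^ 2)]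
        calc _ ≤ ‖f p‖ * (1 * (C * (1 + ‖p.2‖ ^ 2) * (‖χ p.1‖ * ‖ψ p.2‖))) := by
              gcongr
              exact hs1 n
          _ = _ := by ring
    · filter_upwards [hWc] with p hp
      have t1 := (hηt p.1).mul_const (conj (fderiv ℝ χ p.1 p.2) * (ψ p.2 : ℂ))
      have t2 : Tendsto (fun n => s n • (fderiv ℝ η (s n • p.1) p.2 *
          (conj (χ p.1) * (ψ p.2 : ℂ)))) atTop (𝓝 0) := by
        have hc : Continuous fun x => fderiv ℝ η x p.2 :=
          (hη1.continuous_fderiv (by norm_num)).clm_apply continuous_const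
        have := hst.smul (((hc.tendsto 0).comp (by simpa using hst.smul_const p.1 :
          Tendsto (fun n => s n • p.1) atTop (𝓝 0))).mul_const
            (conj (χ p.1) * (ψ p.2 : ℂ)))
        simpa using this
      have := (t1.add t2).const_mul (f p)
      rw [hp, map_mul, conj_ofReal, mul_comm _ (f p)]
      simpa only [hderiv, one_mul, add_zero] using this
  refine tendsto_nhds_unique l1 ?_
  refine l2.neg.congr fun n => ?_
  rw [(h _ (htest n)).2.2, neg_neg]

lemma fourierL_toLp (χ : 𝓢(E3, ℂ)) :
    Lp.fourierTransformₗᵢ E3 ℂ (χ.toLp 2) = (𝓕 χ : 𝓢(E3, ℂ)).toLp 2 := SchwartzMap.toLp_fourier_eq χ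

lemma fourier_lineDeriv_apply (χ : 𝓢(E3, ℂ)) (m k : E3) :
    (𝓕 (∂_{m} χ : 𝓢(E3, ℂ)) : 𝓢(E3, ℂ)) k =
      2 * Real.pi * I * ((⟪k, m⟫_ℝ : ℂ) * (𝓕 χ : 𝓢(E3, ℂ)) k) := by
  have hm : (fun x : E3 => ⟪x, m⟫_ℝ).HasTemperateGrowth := ((innerSL ℝ).flip m).hasTemperateGrowth
  rw [SchwartzMap.fourier_lineDerivOp_eq, smul_apply,
    SchwartzMap.smulLeftCLM_apply_apply hm, real_smul, smul_eq_mul]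

lemma ball_inSupport (k : E3) :
    InSupport (volume : Measure E3) (fun k => (2 * Real.pi) • k) ((2 * Real.pi) • k) := by
  intro N hN hk
  have hc : Continuous fun k : E3 => (2 * Real.pi) • k := continuous_const_smul _
  have ho := (hN.preimage hc).inter (Metric.isOpen_ball (x := k) (ε := 1))
  exact ⟨_, ho.measurableSet, fun x hx => hx.1, (ho.measure_pos _ ⟨k, hk, by simp⟩).ne',
    ((measure_mono Set.inter_subset_right).trans_lt measure_ball_lt_top).ne⟩

theorem spectrum_bgkSpace {τ : ℝ} (hτ : 0 < τ) :
    opSpectrum (bgkSpace τ) = essLine τ ∪ ⋃ k : E3, modesAt modeValue modeCrit τ ‖k‖ := by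
  obtain ⟨U, hU⟩ := exists_tensor_unitary (μ := maxwellian) (Lp.fourierTransformₗᵢ E3 ℂ)
  have hξ : Measurable fun k : E3 => (2 * Real.pi) • k := measurable_const_smul _
  have hpi : (2 * Real.pi) ≠ 0 := by positivity
  have hW : ∀ f g, IsWeakStream (AddMonoidHom.id E3) f g →
      U g =ᵐ[phaseMeasure E3] fun p => I * ((⟪p.2, (2 * Real.pi) • p.1⟫_ℝ : ℝ) : ℂ) * U f p := by
    intro f g hfg
    refine eq_symbol_mul_of_pairing (ξ := fun k : E3 => (2 * Real.pi) • k) hξ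
      {u | ∃ θ, IsBump θ ∧ u = fun k => (θ k : ℂ)} ?_ ?_ ?_ _ _ ?_
    · rintro _ ⟨θ, hθ, rfl⟩
      exact hθ.memLp _
    · rintro _ ⟨θ, hθ, rfl⟩
      refine ⟨_, hθ.mul (contDiff_weight.comp (contDiff_const_smul (2 * Real.pi))), ?_⟩
      funext k
      simp
    · intro x hx
      exact eq_zero_of_bumps fun θ hθ => by simpa using hx _ ⟨θ, hθ, rfl⟩
    · rintro _ ⟨θ, hθ, rfl⟩ ψ hψ
      set Θ : 𝓢(E3, ℂ) := (hθ.2.comp_left ofReal_zero : HasCompactSupport fun k =>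
        (θ k : ℂ)).toSchwartzMap (ofRealCLM.contDiff.comp hθ.1) with hΘ
      set χ : 𝓢(E3, ℂ) := 𝓕⁻ Θ with hχ
      have hFχ : (𝓕 χ : 𝓢(E3, ℂ)) = Θ := by rw [hχ, FourierTransform.fourier_fourierInv_eq]
      have e1 : U (tens (χ.toLp 2) (bumpL hψ)) = tens (Θ.toLp 2) (bumpL hψ) := by
        rw [hU, fourierL_toLp, hFχ]
      have e2 : U (dotL (fun j => ∂_{stdB j} χ) hψ) =
          dotL (fun j => 𝓕 (∂_{stdB j} χ : 𝓢(E3, ℂ))) hψ := by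
        rw [dotL, map_sum, dotL]
        exact sum_congr rfl fun j _ => by rw [hU, fourierL_toLp]
      have e3 := inner_stream_space hfg χ hψ
      rw [← U.inner_map_map _ g, e1, ← U.inner_map_map _ f, e2, inner_Lp_eq, inner_Lp_eq,
        ← integral_neg] at e3
      refine Eq.trans ?_ (e3.trans ?_) <;> refine integral_congr_ae ?_
      · filter_upwards [tens_bumpL_coe Θ hψ] with p hp
        rw [hp, map_mul, conj_ofReal (ψ p.2)]
        rfl
      · filter_upwards [dotL_coe (fun j => 𝓕 (∂_{stdB j} χ : 𝓢(E3, ℂ))) hψ] with p hp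
        have h1 : ∑ j, ⟪p.1, stdB j⟫_ℝ * ⟪p.2, stdB j⟫_ℝ = ⟪p.2, p.1⟫_ℝ := by
          rw [← stdB.sum_inner_mul_inner p.2 p.1]
          exact sum_congr rfl fun j _ => by rw [mul_comm, real_inner_comm p.1]
        have h2 : ∑ j, (𝓕 (∂_{stdB j} χ : 𝓢(E3, ℂ)) : 𝓢(E3, ℂ)) p.1 * (⟪p.2, stdB j⟫_ℝ : ℂ) =
            2 * Real.pi * I * (⟪p.2, p.1⟫_ℝ : ℂ) * (θ p.1 : ℂ) := by
          rw [← h1]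
          push_cast
          rw [mul_sum, sum_mul]
          refine sum_congr rfl fun j _ => ?_
          rw [fourier_lineDeriv_apply, hFχ]
          change _ * (_ * (θ p.1 : ℂ)) * _ = _
          ring
        rw [hp, h2, inner_smul_right]
        simp only [map_mul, conj_ofReal, conj_I, map_ofNat]
        push_cast
        ring
  have hT := isKinetic_bgkOperator isOpenQuotientMap_id (Lp.fourierTransformₗᵢ E3 ℂ) U hU
    (ξ := fun k : E3 => (2 * Real.pi) • k) hW τ
  have hre : (⋃ k : E3, modesAt modeValue modeCrit τ ‖(2 * Real.pi) • k‖) =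
      ⋃ k : E3, modesAt modeValue modeCrit τ ‖k‖ :=
    (MulAction.surjective₀ hpi).iUnion_comp fun k : E3 => modesAt modeValue modeCrit τ ‖k‖
  rw [← hre]
  refine Set.Subset.antisymm (hT.opSpectrum_subset hτ hξ fun z hz h0 r => ?_)
    (Set.union_subset ?_ (hT.modes_subset hτ hξ ball_inSupport))
  · rcases (Metric.closedBall (0 : E3) r).eq_empty_or_nonempty with he | hne
    · exact ⟨1, one_pos, fun k hk =>
        absurd (mem_closedBall_zero_iff.2 hk) (by rw [he]; exact Set.notMem_empty _)⟩
    obtain ⟨q, -, hq⟩ := (isCompact_closedBall (0 : E3) r).exists_isMinOn hne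
      (continuous_fibreDet τ hz).norm.continuousOn
    obtain ⟨k, rfl⟩ := MulAction.surjective₀ hpi q
    exact ⟨_, norm_pos_iff.2 (h0 k), fun k hk => hq (mem_closedBall_zero_iff.2 hk)⟩
  · have h1 : (stdB 0 : E3) ≠ 0 := stdB.orthonormal.ne_zero 0
    exact (hT.essLine_subset hτ hξ (smul_ne_zero hpi h1) (ball_inSupport _)).trans
      (essSpectrum_subset _)

end Space

end
end BGK

theorem mainTheorem1 :
    ∃ (Λ : BGK.Mode → ℝ → ℂ) (κc : BGK.Mode → ℝ), BGK.IsModeFamily Λ κc ∧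
      ∀ τ : ℝ, 0 < τ →
        -- the operator at each wave vector
        (∀ k : BGK.E3,
          BGK.opSpectrum (BGK.fibreOperator τ k) =
            BGK.essSpectrum (BGK.fibreOperator τ k) ∪ BGK.discSpectrum (BGK.fibreOperator τ k) ∧
          (k ≠ 0 → BGK.essSpectrum (BGK.fibreOperator τ k) = BGK.essLine τ) ∧
          (k = 0 → BGK.essSpectrum (BGK.fibreOperator τ k) = {-(1 / τ : ℂ)}) ∧
          BGK.discSpectrum (BGK.fibreOperator τ k) = BGK.modesAt Λ κc τ ‖k‖ ∧
          (BGK.discSpectrum (BGK.fibreOperator τ k)).Finite) ∧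
        -- the full operator on the torus
        (∀ (ℓ : ℝ) [Fact (0 < ℓ)],
          BGK.opSpectrum (BGK.bgkTorus ℓ τ) =
            BGK.essLine τ ∪ ⋃ n : Fin 3 → ℤ, BGK.modesAt Λ κc τ ‖BGK.torusWaveVector ℓ n‖ ∧
          BGK.essSpectrum (BGK.bgkTorus ℓ τ) = BGK.essLine τ ∧
          BGK.discSpectrum (BGK.bgkTorus ℓ τ) =
            ⋃ n : Fin 3 → ℤ, BGK.modesAt Λ κc τ ‖BGK.torusWaveVector ℓ n‖) ∧
        -- the full operator on the whole space
        BGK.opSpectrum (BGK.bgkSpace τ) =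
          BGK.essLine τ ∪ ⋃ k : BGK.E3, BGK.modesAt Λ κc τ ‖k‖ :=
  ⟨BGK.modeValue, BGK.modeCrit, BGK.isModeFamily, fun _ hτ =>
    ⟨BGK.spectrum_fibreOperator hτ, fun _ _ => BGK.spectrum_bgkTorus hτ, BGK.spectrum_bgkSpace hτ⟩⟩
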